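/- **Setting.** A latent MDP (LMDP) with $M\ge 1$ contexts, finite state space $\mathcal S$, finite action space $\mathcal A$ and horizon $H$ is given by a model $\theta=(w_m,\mu_m,T_m,R_m)_{m=1}^M$: mixing weights $w$, initial state distributions $\mu_m$, transition kernels $T_m(\cdot\mid s,a)$ and reward kernels $R_m(\cdot\mid s,a)$ supported on a finite set $\mathcal R\subset[-1,1]$. In every episode a context $m\sim w$ is drawn (unobserved), and the learner interacts with the $m$-th MDP for $H$ steps, generating $\mathcal T=(s_t,a_t,r_t)_{t=1}^H$; $\mathbb P_\theta^\pi(\mathcal T)$ is the probability of $\mathcal T$ under the policy $\pi$. $\Pi$ is the class of all history-dependent randomized policies (which may also use a random seed drawn before the episode), $\Pi_{\rm mls}$ the class of memoryless policies $\mathcal S\times[H]\to\Delta(\mathcal A)$, $V_\theta^\pi=\mathbb E_\theta^\pi[\sum_t r_t]$, and $\pi$ is $\varepsilon$-optimal in $\theta$ if $V_\theta^\pi\ge V_\theta^{\pi'}-\varepsilon$ for all $\pi'\in\Pi$. Let $S=|\mathcal S|$, $A=|\mathcal A|$, and $\mathrm{TV}(\mathbb P,\mathbb Q)=\sum_{\mathcal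 T}|\mathbb P(\mathcal T)-\mathbb Q(\mathcal T)|$. **Segmented policies.** For $\psi=(\psi_0,\dots,\psi_d)$, checkpoints $\tau=(\tau_1<\dots<\tau_q)$ in $[H]$ with $1\le q\le d$, and $z\in\{0,1\}^q$, the policy $\nu(\psi;\tau,z)$ executes $\psi_i$ at the times $\tau_i<t\le\tau_{i+1}$ (with $\tau_0=0$, $\tau_{q+1}=H$), except that at the times $\tau_i$ with $z_i=1$ it plays a uniformly random action. **Algorithm LMDP-OMLE.** Inputs: a finite model class $\Theta$, $K,d,n_{\rm test}\in\mathbb N$, $\varepsilon_{\rm test},\eta>0$; $\beta=\log(K|\Theta|/\eta)$. For a dataset $D$ of pairs (episode, executed policy) let $\mathcal C(D)$ be the set of $\theta\in\Theta$ with $\sum_{(\mathcal T,\pi)\in D}\log\mathbb P_\theta^\pi(\mathcal T)\ge\max_{\theta'\in\Theta}\sum_{(\mathcal T,\pi)\in D}\log\mathbb P_{\theta'}^\pi(\mathcal T)-\beta$. Start with $\Psi^0=\{\mathrm{Unif}(\mathcal A)\}$ and $D^0$ consisting of $n_{\rm test}$ episodes of $\mathrm{Unif}(\mathcal A)$. In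 iteration $k=1,2,\dots$: if there are $\pi\in\Pi_{\rm mls}$ and $\theta_1,\theta_2\in\mathcal C(D^{k-1})$ with $\mathrm{TV}(\mathbb P_{\theta_1}^\pi,\mathbb P_{\theta_2}^\pi)>4\varepsilon_{\rm test}$, pick any such $\pi=\pi^k$, set $\Psi^k=\Psi^{k-1}\cup\{\pi^k\}$, and obtain $D^k$ by adding to $D^{k-1}$, for every $\psi\in(\Psi^k)^d\times\{\mathrm{Unif}(\mathcal A)\}$ with $\psi_i=\pi^k$ for some $i<d$, every $\tau$ with $1\le|\tau|\le d$ and every $z\in\{0,1\}^{|\tau|}$, $n_{\rm test}$ fresh episodes of $\nu(\psi;\tau,z)$. Otherwise terminate and return an optimal policy (in $\Pi$) of any model in the current confidence set. **Theorem.** Let $M\ge1$ and $d=2M-1$. There is a constant $C>0$ depending only on $M$ such that the following holds for all $S,A\ge1$, $H>2M$, $n\ge1$, $\varepsilon\in(0,1]$, $\eta\in(0,1)$. There are inputs $K\ge1$, $n_{\rm test}$, $\varepsilon_{\rm test}>0$, depending only on $M,S,A,H,n,\varepsilon,\eta$, with $$K\le C\,MS^2H\,\log(MSAH/\varepsilon),$$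 such that for every LMDP setting as above with these $S,A,M,H$, every class $\Theta$ of $n$ models, every true model $\theta^*\in\Theta$, and every rule for picking the test policies $\pi^k$ and the output, with probability at least $1-\eta$ LMDP-OMLE, run in $\theta^*$, terminates after at most $K$ iterations, having generated in total at most $$N=C\,\bigl(M^4S^6A^4H^7\log(MSAH/\varepsilon)\bigr)^{d}\cdot M^4H^2\cdot\frac{\log(K|\Theta|/\eta)}{\varepsilon^2}$$ episodes, and returns a policy that is $\varepsilon$-optimal in $\theta^*$. -/

import Mathlib

namespace LMDP

noncomputable section

/-- Probability distributions on a finite set, as real-valued functions (`p a` is the mass of `a`). -/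
abbrev Dist (α : Type*) [Fintype α] := stdSimplex ℝ α

/-- One time step of an episode: state, action, reward. The reward space is a finite set of reals. -/
abbrev Step (𝒮 𝒜 : Type*) (ℛ : Finset ℝ) := 𝒮 × 𝒜 × ℛ

/-- A full episode `(s, a, r)_{1:H}`; the time step `t` is the index `t - 1`. -/
abbrev Traj (H : ℕ) (𝒮 𝒜 : Type*) (ℛ : Finset ℝ) := Fin H → Step 𝒮 𝒜 ℛ

/-- The part of an episode that strictly precedes step `t`. -/
def pre {H : ℕ} {X : Type*} (T : Fin H → X) (t : Fin H) : Fin t → X :=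
  fun i => T (Fin.castLE t.isLt.le i)

/-- Parameters of a latent MDP with `M` contexts: mixing weights and, for every context, an
initial state distribution (the transition out of the null state), a transition kernel and
a reward kernel. -/
structure Model (M : ℕ) (𝒮 𝒜 : Type*) [Fintype 𝒮] (ℛ : Finset ℝ) where
  w : Dist (Fin M)
  init : Fin M → Dist 𝒮
  trans : Fin M → 𝒮 → 𝒜 → Dist 𝒮
  reward : Fin M → 𝒮 → 𝒜 → Dist ℛ

/-- History-dependent behaviour: at step `t`, given the past steps and the current state, a
distribution over actions. -/
abbrev HistPolicy (H : ℕ) (𝒮 𝒜 : Type*) [Fintype 𝒜] (ℛ : Finset ℝ) :=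
  (t : Fin H) → (Fin t → Step 𝒮 𝒜 ℛ) → 𝒮 → Dist 𝒜

/-- Memoryless policies: the action depends on the current state and the time step only. -/
abbrev MlsPolicy (H : ℕ) (𝒮 𝒜 : Type*) [Fintype 𝒜] := Fin H → 𝒮 → Dist 𝒜

/-- General policies: history-dependent behaviour that may also use a random seed `ξ ∈ Ξ`
drawn once, independently of everything else, before the episode starts. -/
structure Policy (H : ℕ) (𝒮 𝒜 : Type*) [Fintype 𝒜] (ℛ : Finset ℝ) where
  Ξ : Type
  [mΞ : MeasurableSpace Ξ]
  law : MeasureTheory.Measure Ξ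
  [isProb : MeasureTheory.IsProbabilityMeasure law]
  act : Ξ → HistPolicy H 𝒮 𝒜 ℛ
  measurable_act : ∀ t h s a, Measurable fun ξ => act ξ t h s a

section Laws

variable {M H : ℕ} {𝒮 𝒜 : Type*} [Fintype 𝒮] [Fintype 𝒜] {ℛ : Finset ℝ}

/-- A memoryless policy as a history-dependent one. -/
def MlsPolicy.toHist (π : MlsPolicy H 𝒮 𝒜) : HistPolicy H 𝒮 𝒜 ℛ := fun t _ s => π t s

/-- In context `m`, the distribution of the next state after a history of `t` steps. -/
def Model.nextState (θ : Model M 𝒮 𝒜 ℛ) (m : Fin M) : (t : ℕ) → (Fin t → Step 𝒮 𝒜 ℛ) → Dist 𝒮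
  | 0, _ => θ.init m
  | (t + 1), h => θ.trans m (h (Fin.last t)).1 (h (Fin.last t)).2.1

/-- In context `m` under `π`, the probability that step `t` equals `x`, given the past `h`. -/
def Model.stepProb (θ : Model M 𝒮 𝒜 ℛ) (m : Fin M) (π : HistPolicy H 𝒮 𝒜 ℛ)
    (t : Fin H) (h : Fin t → Step 𝒮 𝒜 ℛ) (x : Step 𝒮 𝒜 ℛ) : ℝ :=
  θ.nextState m t h x.1 * π t h x.1 x.2.1 * θ.reward m x.1 x.2.1 x.2.2

/-- `ℙ_θ^π(T)`, the probability of the episode `T` when `π` is executed in the model `θ`. -/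
def Model.prob (θ : Model M 𝒮 𝒜 ℛ) (π : HistPolicy H 𝒮 𝒜 ℛ) (T : Traj H 𝒮 𝒜 ℛ) : ℝ :=
  ∑ m, θ.w m * ∏ t, θ.stepProb m π t (pre T t) (T t)

/-- Total variation distance between the episode distributions of two models under `π`, in the
normalisation `∑ |p - q|`. -/
def tv (θ₁ θ₂ : Model M 𝒮 𝒜 ℛ) (π : HistPolicy H 𝒮 𝒜 ℛ) : ℝ :=
  ∑ T, |θ₁.prob π T - θ₂.prob π T|

/-- Expected total reward of a history-dependent behaviour. -/
def Model.histValue (θ : Model M 𝒮 𝒜 ℛ) (π : HistPolicy H 𝒮 𝒜 ℛ) : ℝ :=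
  ∑ T, θ.prob π T * ∑ t, ((T t).2.2 : ℝ)

/-- Expected total reward of a policy, the seed included. -/
def Model.value (θ : Model M 𝒮 𝒜 ℛ) (π : Policy H 𝒮 𝒜 ℛ) : ℝ :=
  letI := π.mΞ
  ∫ ξ, θ.histValue (π.act ξ) ∂π.law

/-- `π` is optimal up to `ε` in the model `θ`, among all policies. -/
def Model.IsEpsOptimal (θ : Model M 𝒮 𝒜 ℛ) (ε : ℝ) (π : Policy H 𝒮 𝒜 ℛ) : Prop :=
  ∀ π' : Policy H 𝒮 𝒜 ℛ, θ.value π' - ε ≤ θ.value π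

/-- `π` is an optimal policy of the model `θ`. -/
def Model.IsOptimal (θ : Model M 𝒮 𝒜 ℛ) (π : Policy H 𝒮 𝒜 ℛ) : Prop := θ.IsEpsOptimal 0 π

theorem sum_prod_pre {X : Type*} [Fintype X] (n : ℕ)
    (f : (t : Fin n) → (Fin t → X) → X → ℝ) (hf : ∀ t h, ∑ x, f t h x = 1) :
    ∑ T : Fin n → X, ∏ t, f t (pre T t) (T t) = 1 := by
  induction n with
  | zero => simp
  | succ n ih =>
    rw [← (Fin.snocEquiv (fun _ : Fin (n + 1) => X)).sum_comp, Fintype.sum_prod_type_right]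
    rw [← ih (fun t => f t.castSucc) (fun t h => hf t.castSucc h)]
    refine Finset.sum_congr rfl fun T _ => ?_
    have key : ∀ x : X, ∏ t, f t (pre (Fin.snocEquiv (fun _ : Fin (n + 1) => X) (x, T)) t)
          (Fin.snocEquiv (fun _ : Fin (n + 1) => X) (x, T) t)
        = (∏ t, f t.castSucc (pre T t) (T t)) * f (Fin.last n) T x := by
      intro x
      rw [Fin.prod_univ_castSucc]
      congr 1
      · refine Finset.prod_congr rfl fun t _ => ?_
        congr 1
        · funext i
          exact Fin.snoc_castSucc (α := fun _ => X) x T (Fin.castLE t.isLt.le i)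
        · exact Fin.snoc_castSucc (α := fun _ => X) x T t
      · congr 1
        · funext i
          exact Fin.snoc_castSucc (α := fun _ => X) x T i
        · exact Fin.snoc_last (α := fun _ => X) x T
    simp_rw [key, ← Finset.mul_sum, hf, mul_one]

theorem Model.stepProb_nonneg (θ : Model M 𝒮 𝒜 ℛ) (m : Fin M) (π : HistPolicy H 𝒮 𝒜 ℛ)
    (t : Fin H) (h : Fin t → Step 𝒮 𝒜 ℛ) (x : Step 𝒮 𝒜 ℛ) : 0 ≤ θ.stepProb m π t h x :=
  mul_nonneg (mul_nonneg ((θ.nextState m t h).2.1 _) ((π t h x.1).2.1 _))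
    ((θ.reward m x.1 x.2.1).2.1 _)

theorem Model.sum_stepProb (θ : Model M 𝒮 𝒜 ℛ) (m : Fin M) (π : HistPolicy H 𝒮 𝒜 ℛ)
    (t : Fin H) (h : Fin t → Step 𝒮 𝒜 ℛ) : ∑ x, θ.stepProb m π t h x = 1 := by
  have e1 : ∀ s a, ∑ r, θ.reward m s a r = 1 := fun s a => (θ.reward m s a).2.2
  have e2 : ∀ s, ∑ a, π t h s a = 1 := fun s => (π t h s).2.2
  have e3 : ∑ s, θ.nextState m t h s = 1 := (θ.nextState m t h).2.2
  simp_rw [Model.stepProb, Fintype.sum_prod_type, ← Finset.mul_sum, e1, mul_one,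
    ← Finset.mul_sum, e2, mul_one, e3]

theorem Model.prob_nonneg (θ : Model M 𝒮 𝒜 ℛ) (π : HistPolicy H 𝒮 𝒜 ℛ)
    (T : Traj H 𝒮 𝒜 ℛ) : 0 ≤ θ.prob π T :=
  Finset.sum_nonneg fun m _ => mul_nonneg (θ.w.2.1 m)
    (Finset.prod_nonneg fun t _ => θ.stepProb_nonneg m π t _ _)

theorem Model.sum_prob (θ : Model M 𝒮 𝒜 ℛ) (π : HistPolicy H 𝒮 𝒜 ℛ) :
    ∑ T, θ.prob π T = 1 := by
  have e : ∑ m, θ.w m = 1 := θ.w.2.2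
  simp_rw [Model.prob]
  rw [Finset.sum_comm]
  simp_rw [← Finset.mul_sum]
  rw [← e]
  refine Finset.sum_congr rfl fun m _ => ?_
  rw [sum_prod_pre H (θ.stepProb m π) (θ.sum_stepProb m π), mul_one]

/-- The distribution of one episode when `π` is executed in the model `θ`. -/
def Model.episode (θ : Model M 𝒮 𝒜 ℛ) (π : HistPolicy H 𝒮 𝒜 ℛ) : PMF (Traj H 𝒮 𝒜 ℛ) :=
  PMF.ofFintype (fun T => ENNReal.ofReal (θ.prob π T)) (by
    rw [← ENNReal.ofReal_sum_of_nonneg (fun T _ => θ.prob_nonneg π T), θ.sum_prob π,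
      ENNReal.ofReal_one])

end Laws

section Algorithm

variable {M H : ℕ} {𝒮 𝒜 : Type*} [Fintype 𝒮] [Fintype 𝒜] [Nonempty 𝒜] {ℛ : Finset ℝ}

/-- The policy that always plays a uniformly random action. -/
def unif : MlsPolicy H 𝒮 𝒜 := fun _ _ => stdSimplex.barycenter

/-- The segmented policy `ν((ψ₀, …, ψ_{d-1}, Unif); τ, z)`. The checkpoints form the set `τ`, and
`Z ⊆ τ` is the set of those checkpoints with `z = 1`. At a time in `Z` a uniformly random action
is taken; at every other time `t` the policy `ψ_i` is executed, `i` being the number of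
checkpoints strictly before `t`. As all `ψ_i` are memoryless, so is the result. -/
def segmented {d : ℕ} (ψ : Fin d → MlsPolicy H 𝒮 𝒜) (τ Z : Finset (Fin H)) : MlsPolicy H 𝒮 𝒜 :=
  fun t s =>
    if t ∈ Z then unif t s
    else if hi : (τ.filter (· < t)).card < d then ψ ⟨(τ.filter (· < t)).card, hi⟩ t s
    else unif t s

open Classical in
/-- All data collection policies of an iteration whose set of test policies is `Ψ` and whose new
test policy is `π`: all tuples `(ψ₀, …, ψ_{d-1})` over `Ψ` that contain `π`, all sets of between
`1` and `d` checkpoints, and all choices of interventions. -/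
def designs (H d : ℕ) (Ψ : Finset (MlsPolicy H 𝒮 𝒜)) (π : MlsPolicy H 𝒮 𝒜) :
    Finset ((Fin d → MlsPolicy H 𝒮 𝒜) × Finset (Fin H) × Finset (Fin H)) :=
  ((Fintype.piFinset fun _ : Fin d => Ψ).filter fun ψ => ∃ i, ψ i = π) ×ˢ
    (Finset.univ.filter fun τZ : Finset (Fin H) × Finset (Fin H) =>
      τZ.1.Nonempty ∧ τZ.1.card ≤ d ∧ τZ.2 ⊆ τZ.1)

/-- Data: the executed policies with the episodes they generated. -/
abbrev Dataset (H : ℕ) (𝒮 𝒜 : Type*) [Fintype 𝒜] (ℛ : Finset ℝ) :=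
  List (MlsPolicy H 𝒮 𝒜 × Traj H 𝒮 𝒜 ℛ)

/-- Execute a list of policies one after the other in the model `θ`, each for one fresh episode. -/
def execute (θ : Model M 𝒮 𝒜 ℛ) : List (MlsPolicy H 𝒮 𝒜) → PMF (Dataset H 𝒮 𝒜 ℛ)
  | [] => PMF.pure []
  | π :: l => (θ.episode π.toHist).bind fun T => (execute θ l).map fun D => (π, T) :: D

/-- Likelihood of a dataset, the exponential of its log-likelihood. -/
def Model.likelihood (θ : Model M 𝒮 𝒜 ℛ) (D : Dataset H 𝒮 𝒜 ℛ) : ℝ :=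
  (D.map fun e => θ.prob e.1.toHist e.2).prod

/-- The confidence set: all models whose log-likelihood is within `β` of the maximum (written
multiplicatively, so that likelihood `0` means log-likelihood `-∞`). -/
def confidenceSet (Θ : Finset (Model M 𝒮 𝒜 ℛ)) (β : ℝ) (D : Dataset H 𝒮 𝒜 ℛ) :
    Set (Model M 𝒮 𝒜 ℛ) :=
  {θ | θ ∈ Θ ∧ ∀ θ' ∈ Θ, Real.exp (-β) * θ'.likelihood D ≤ θ.likelihood D}

/-- Inputs of the algorithm LMDP-OMLE, apart from the model class. -/
structure Params where
  K : ℕ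
  d : ℕ
  nTest : ℕ
  εTest : ℝ
  η : ℝ

/-- What the algorithm knows at the start of an iteration: test policies and data. -/
structure State (H : ℕ) (𝒮 𝒜 : Type*) [Fintype 𝒜] (ℛ : Finset ℝ) where
  Ψ : Finset (MlsPolicy H 𝒮 𝒜)
  D : Dataset H 𝒮 𝒜 ℛ

/-- The confidence level `β = log (K |Θ| / η)`. -/
def Params.β (p : Params) (Θ : Finset (Model M 𝒮 𝒜 ℛ)) : ℝ := Real.log (p.K * Θ.card / p.η)

/-- The current confidence set. -/
def State.C (σ : State H 𝒮 𝒜 ℛ) (p : Params) (Θ : Finset (Model M 𝒮 𝒜 ℛ)) :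
    Set (Model M 𝒮 𝒜 ℛ) :=
  confidenceSet Θ (p.β Θ) σ.D

/-- Two models of the confidence set disagree about the memoryless policy `π`. -/
def State.Disagree (σ : State H 𝒮 𝒜 ℛ) (p : Params) (Θ : Finset (Model M 𝒮 𝒜 ℛ))
    (π : MlsPolicy H 𝒮 𝒜) : Prop :=
  ∃ θ₁ ∈ σ.C p Θ, ∃ θ₂ ∈ σ.C p Θ, 4 * p.εTest < tv θ₁ θ₂ π.toHist

/-- The condition of the while loop. -/
def State.LoopCond (σ : State H 𝒮 𝒜 ℛ) (p : Params) (Θ : Finset (Model M 𝒮 𝒜 ℛ)) : Prop :=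
  ∃ π : MlsPolicy H 𝒮 𝒜, σ.Disagree p Θ π

/-- A rule that picks the new test policy; whenever the loop condition holds, it has to return
a policy that witnesses it. Nothing else is required of it. -/
def IsSelector (p : Params) (Θ : Finset (Model M 𝒮 𝒜 ℛ))
    (pick : State H 𝒮 𝒜 ℛ → MlsPolicy H 𝒮 𝒜) : Prop :=
  ∀ σ : State H 𝒮 𝒜 ℛ, σ.LoopCond p Θ → σ.Disagree p Θ (pick σ)

open Classical in
/-- One iteration of the while loop in the true model `θs`: add the new test policy and collect
`nTest` episodes with every data collection policy. Nothing happens once the loop condition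
fails. -/
def iter (p : Params) (Θ : Finset (Model M 𝒮 𝒜 ℛ)) (pick : State H 𝒮 𝒜 ℛ → MlsPolicy H 𝒮 𝒜)
    (θs : Model M 𝒮 𝒜 ℛ) (σ : State H 𝒮 𝒜 ℛ) : PMF (State H 𝒮 𝒜 ℛ) :=
  if σ.LoopCond p Θ then
    (execute θs ((designs H p.d (insert (pick σ) σ.Ψ) (pick σ)).toList.flatMap fun c =>
        List.replicate p.nTest (segmented c.1 c.2.1 c.2.2))).map
      fun D => ⟨insert (pick σ) σ.Ψ, σ.D ++ D⟩
  else PMF.pure σ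

/-- The distribution of the state of LMDP-OMLE after (at most) `k` iterations in the true model
`θs`; the initial data are `nTest` episodes of the uniformly random policy. -/
def run (p : Params) (Θ : Finset (Model M 𝒮 𝒜 ℛ)) (pick : State H 𝒮 𝒜 ℛ → MlsPolicy H 𝒮 𝒜)
    (θs : Model M 𝒮 𝒜 ℛ) : ℕ → PMF (State H 𝒮 𝒜 ℛ)
  | 0 => (execute θs (List.replicate p.nTest unif)).map fun D => ⟨{unif}, D⟩
  | k + 1 => (run p Θ pick θs k).bind (iter p Θ pick θs)

/-- `π` may be returned in the state `σ`: it is an optimal policy of some model in the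
confidence set. -/
def State.IsOutput (σ : State H 𝒮 𝒜 ℛ) (p : Params) (Θ : Finset (Model M 𝒮 𝒜 ℛ))
    (π : Policy H 𝒮 𝒜 ℛ) : Prop :=
  ∃ θ ∈ σ.C p Θ, θ.IsOptimal π

/-- The algorithm has terminated in the state `σ` after at most `N` episodes, it has something to
return, and whatever it may return is `ε`-optimal in the true model `θs`. -/
def State.Success (σ : State H 𝒮 𝒜 ℛ) (p : Params) (Θ : Finset (Model M 𝒮 𝒜 ℛ))
    (θs : Model M 𝒮 𝒜 ℛ) (N ε : ℝ) : Prop :=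
  ¬ σ.LoopCond p Θ ∧ (σ.D.length : ℝ) ≤ N ∧
    (∃ π : Policy H 𝒮 𝒜 ℛ, σ.IsOutput p Θ π) ∧
    ∀ π : Policy H 𝒮 𝒜 ℛ, σ.IsOutput p Θ π → θs.IsEpsOptimal ε π

end Algorithm

end

end LMDP

/-! Fix the true model θ* and a candidate θ. The difference of their episode laws is a signed
mixture of 2M Markov processes, with weights that are nonnegative on the M contexts of θ and
nonpositive on those of θ*. Under a memoryless policy its total variation is a value function of the
current state and the current weights, every observation multiplying the weights by the transition
likelihoods. This is `gap`; TV is its value in the null state (`tv_eq_gap`).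

The core is a deterministic comparison. Say that a set Ψ of policies covers π if, for the contexts
of θ* alone, the gap of π at every node (time and state) is dominated by few members of Ψ, and the
flow of π between nodes is dominated by few words, that is, concatenations of at most two members of
Ψ; small multiples of the ℓ¹ norm are tolerated as errors. Nothing is assumed about θ. Then TV(θ,
θ*) under π is at most a polynomial factor times the sum of the TVs under segmented policies over Ψ,
plus an error (`exists_tests_of_covered`). The proof is an induction on the number of contexts of θ
with positive weight (`stage`, with `base` for a single one). While π is followed, the weights at a
node are replaced by a multiple of the weights that the words produce at this node. The multiple is
the largest one that keeps the remainder nonnegative on θ, so the remainder has lost a context and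
is left to the induction hypothesis, after the word and possibly a uniformly random action. The
multiples stay bounded because the run is stopped at two kinds of nodes: where θ outweighs θ*, there
is no cancellation and the gap is comparable to the absolute total weight; where the words carry
little of θ, the contribution of the node is controlled by test values. Each level uses words of at
most two segments, the first level, which starts in the null state, words of one segment. This gives
2(M - 1) + 1 = d checkpoints.

Coverage refers to the fixed model θ* only, so a potential argument applies. To each node and each
pair of nodes belongs the largest determinant of vectors dominated by the seminorms of the policies
in Ψ, or by δ times ℓ¹. If adding π does not enlarge it much, Cramer's rule expresses the seminorm
of π through at most M old ones (`spanner`); and it lies between δ^M and M!, so it can grow only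
O(log(1/δ)) times (`card_vol_growth`). Allowing two-segment words between nodes makes the number of
uncovered iterations linear in H instead of quadratic: an interval of length i that cannot be
covered even after a cut forces i intervals to grow (`one_le_sum_inv_of_split`, `exists_covered`).

The statistics are those of maximum likelihood. Square roots of likelihood ratios, suitably
normalised, have expected product at most one along the adaptive data, hence a model in the
confidence set has small squared TV to θ*, summed over the data
(`toOuterMeasure_not_concentrated_le`, `sum_tv_sq_le`). If the algorithm ran for K iterations
without terminating, one of the chosen policies would be covered; every segmented policy over the
older test policies was executed sufficiently often, so all models of the confidence set would
nearly agree about it, against the loop condition (`GoodAt.not_loopCond`).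

After termination all memoryless policies nearly agree for θ and θ*. The same removal of contexts,
now from both models and with words that maximise the probability to reach a node in one context,
shows that history dependence gains at most a polynomial factor (`hist_stage`, `tv_hist_le`). Hence
the values are close and an optimal policy of θ is ε-optimal in θ*. -/

set_option linter.unusedSectionVars false

namespace LMDP
noncomputable section
open Finset

/-! ### Operators on functionals of signed mixtures -/

/-- Kernels of a finite family of controlled processes: `p t s a o s' k` is the probability that
the process `k`, when at time `t` the action `a` is played in the state `s`, emits the
observation `o` and moves to `s'`. -/
abbrev Ker (S A O ι : Type*) := ℕ → S → A → O → S → ι → ℝ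

/-- Memoryless policies on an unbounded time axis, as real-valued functions. -/
abbrev Pol (S A : Type*) := ℕ → S → A → ℝ

/-- Functionals of a state and a vector of signed weights. -/
abbrev Fnl (S ι : Type*) := S → (ι → ℝ) → ℝ

/-- Seminorms, unbundled. -/
structure Sn {ι : Type*} (φ : (ι → ℝ) → ℝ) : Prop where
  add_le : ∀ v w, φ (v + w) ≤ φ v + φ w
  smul : ∀ (c : ℝ) v, φ (c • v) = |c| * φ v

namespace Sn
variable {ι : Type*} {φ : (ι → ℝ) → ℝ}

theorem zero (h : Sn φ) : φ 0 = 0 := by simpa using h.smul 0 0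

theorem neg (h : Sn φ) (v) : φ (-v) = φ v := by simpa using h.smul (-1) v

theorem nonneg (h : Sn φ) (v) : 0 ≤ φ v := by
  have := h.add_le v (-v)
  rw [add_neg_cancel, h.zero, h.neg] at this
  linarith

theorem sub_le (h : Sn φ) (v w) : φ (v - w) ≤ φ v + φ w := by
  rw [sub_eq_add_neg]
  exact (h.add_le _ _).trans (by rw [h.neg])

theorem smul_nonneg (h : Sn φ) {c : ℝ} (hc : 0 ≤ c) (v) : φ (c • v) = c * φ v := by
  rw [h.smul, abs_of_nonneg hc]

theorem sum_le (h : Sn φ) {κ : Type*} (s : Finset κ) (f : κ → ι → ℝ) : φ (∑ i ∈ s, f i) ≤ ∑ i ∈ s, φ (f i) := by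
  classical
  induction s using Finset.induction_on with
  | empty => simp [h.zero]
  | insert a s ha ih =>
    rw [sum_insert ha, sum_insert ha]
    exact (h.add_le _ _).trans (by gcongr)

end Sn

theorem Sn.const_mul {ι : Type*} {φ : (ι → ℝ) → ℝ} (h : Sn φ) {c : ℝ} (hc : 0 ≤ c) :
    Sn fun v => c * φ v where
  add_le v w := by rw [← mul_add]; exact mul_le_mul_of_nonneg_left (h.add_le v w) hc
  smul a v := by rw [h.smul]; ring

theorem Sn.add {ι : Type*} {φ φ' : (ι → ℝ) → ℝ} (h : Sn φ) (h' : Sn φ') :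
    Sn fun v => φ v + φ' v where
  add_le v w := by linarith [h.add_le v w, h'.add_le v w]
  smul a v := by rw [h.smul, h'.smul]; ring

theorem Sn.sum {ι κ : Type*} {φ : κ → (ι → ℝ) → ℝ} (s : Finset κ) (h : ∀ i ∈ s, Sn (φ i)) :
    Sn fun v => ∑ i ∈ s, φ i v where
  add_le v w := by rw [← sum_add_distrib]; exact sum_le_sum fun i hi => (h i hi).add_le v w
  smul a v := by rw [mul_sum]; exact sum_congr rfl fun i hi => (h i hi).smul a v

theorem Sn.mul_left {ι : Type*} {φ : (ι → ℝ) → ℝ} (h : Sn φ) (z : ι → ℝ) :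
    Sn fun v => φ (v * z) where
  add_le v w := by rw [add_mul]; exact h.add_le _ _
  smul a v := by rw [smul_mul_assoc]; exact h.smul _ _

theorem Sn.zero_fun {ι : Type*} : Sn fun _ : ι → ℝ => (0 : ℝ) where
  add_le v w := by simp
  smul a v := by simp

theorem Sn.absSum {ι : Type*} [Fintype ι] : Sn fun v : ι → ℝ => |∑ k, v k| where
  add_le v w := by simp only [Pi.add_apply, sum_add_distrib]; exact abs_add_le _ _
  smul a v := by simp only [Pi.smul_apply, smul_eq_mul, ← mul_sum, abs_mul]

/-- The `ℓ¹` norm. -/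
def l1 {ι : Type*} [Fintype ι] (v : ι → ℝ) : ℝ := ∑ k, |v k|

theorem Sn.l1 {ι : Type*} [Fintype ι] : Sn (LMDP.l1 (ι := ι)) where
  add_le v w := by
    simp only [LMDP.l1, Pi.add_apply, ← sum_add_distrib]
    exact sum_le_sum fun i _ => abs_add_le _ _
  smul a v := by simp only [LMDP.l1, Pi.smul_apply, smul_eq_mul, abs_mul, ← mul_sum]

theorem l1_nonneg {ι : Type*} [Fintype ι] (v : ι → ℝ) : 0 ≤ l1 v := Sn.l1.nonneg v

theorem absSum_le_l1 {ι : Type*} [Fintype ι] (v : ι → ℝ) : |∑ k, v k| ≤ l1 v :=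
  abs_sum_le_sum_abs _ _

theorem l1_of_nonneg {ι : Type*} [Fintype ι] {v : ι → ℝ} (h : ∀ k, 0 ≤ v k) : l1 v = ∑ k, v k :=
  sum_congr rfl fun k _ => abs_of_nonneg (h k)

/-- A nonnegative policy whose rows sum to one. -/
structure IsPol {S A : Type*} [Fintype A] (σ : Pol S A) : Prop where
  nonneg : ∀ t s a, 0 ≤ σ t s a
  sum_eq : ∀ t s, ∑ a, σ t s a = 1

/-- A nonnegative kernel whose rows sum to one. -/
structure IsKer {S A O ι : Type*} [Fintype S] [Fintype O] (p : Ker S A O ι) : Prop where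
  nonneg : ∀ t s a o s' k, 0 ≤ p t s a o s' k
  sum_eq : ∀ t s a k, ∑ o, ∑ s', p t s a o s' k = 1

section Ops

variable {S A O ι : Type*} [Fintype S] [Fintype A] [Fintype O]
variable (p : Ker S A O ι)

/-- One step of the process: the observations and next states are summed out. -/
def stepOp (α : S → A → ℝ) (t : ℕ) (φ : Fnl S ι) : Fnl S ι := fun s b =>
  ∑ a, α s a * ∑ o, ∑ s', φ s' (b * p t s a o s')

/-- `n` steps of the process from time `t` on, with the terminal functional `φ`. -/
def runOp (σ : Pol S A) : ℕ → ℕ → Fnl S ι → Fnl S ι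
  | _, 0, φ => φ
  | t, n + 1, φ => stepOp p (σ t) t (runOp σ (t + 1) n φ)

@[simp] theorem runOp_zero (σ : Pol S A) (t : ℕ) (φ : Fnl S ι) : runOp p σ t 0 φ = φ := rfl

theorem runOp_succ (σ : Pol S A) (t n : ℕ) (φ : Fnl S ι) :
    runOp p σ t (n + 1) φ = stepOp p (σ t) t (runOp p σ (t + 1) n φ) := rfl

theorem runOp_add (σ : Pol S A) (t m n : ℕ) (φ : Fnl S ι) :
    runOp p σ t (m + n) φ = runOp p σ t m (runOp p σ (t + m) n φ) := by
  induction m generalizing t with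
  | zero => simp
  | succ m ih =>
    rw [show m + 1 + n = (m + n) + 1 by omega, runOp_succ, ih, runOp_succ,
      show t + 1 + m = t + (m + 1) by omega]

theorem runOp_succ_last (σ : Pol S A) (t n : ℕ) (φ : Fnl S ι) :
    runOp p σ t (n + 1) φ = runOp p σ t n (stepOp p (σ (t + n)) (t + n) φ) := by
  rw [runOp_add]; rfl

theorem runOp_congr {σ σ' : Pol S A} {t n : ℕ} (φ : Fnl S ι)
    (h : ∀ i, t ≤ i → i < t + n → σ i = σ' i) : runOp p σ t n φ = runOp p σ' t n φ := by
  induction n generalizing t with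
  | zero => rfl
  | succ n ih =>
    rw [runOp_succ, runOp_succ, h t le_rfl (by omega),
      ih fun i h1 h2 => h i (by omega) (by omega)]

variable {p}

theorem stepOp_mono (hα : ∀ s a, (0 : ℝ) ≤ α s a) {t : ℕ} {φ φ' : Fnl S ι}
    (h : ∀ s v, φ s v ≤ φ' s v) (s : S) (b : ι → ℝ) : stepOp p α t φ s b ≤ stepOp p α t φ' s b :=
  sum_le_sum fun a _ => mul_le_mul_of_nonneg_left
    (sum_le_sum fun _ _ => sum_le_sum fun _ _ => h _ _) (hα s a)

theorem runOp_mono {σ : Pol S A} (hσ : ∀ t s a, 0 ≤ σ t s a) (t n : ℕ) {φ φ' : Fnl S ι}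
    (h : ∀ s v, φ s v ≤ φ' s v) (s : S) (b : ι → ℝ) :
    runOp p σ t n φ s b ≤ runOp p σ t n φ' s b := by
  induction n generalizing t s b with
  | zero => exact h s b
  | succ n ih => exact stepOp_mono (hσ t) (fun s v => ih (t + 1) s v) s b

theorem stepOp_add (α : S → A → ℝ) (t : ℕ) (φ φ' : Fnl S ι) :
    stepOp p α t (fun s v => φ s v + φ' s v) = fun s v => stepOp p α t φ s v + stepOp p α t φ' s v := by
  funext s v
  simp only [stepOp, sum_add_distrib, mul_add]

theorem stepOp_const_mul (α : S → A → ℝ) (t : ℕ) (c : ℝ) (φ : Fnl S ι) :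
    stepOp p α t (fun s v => c * φ s v) = fun s v => c * stepOp p α t φ s v := by
  funext s v
  simp only [stepOp, ← mul_sum]
  rw [mul_sum]
  exact sum_congr rfl fun a _ => by ring

theorem stepOp_zero (α : S → A → ℝ) (t : ℕ) :
    stepOp p α t (fun _ _ => 0 : Fnl S ι) = fun _ _ => 0 := by
  funext s v; simp [stepOp]

theorem runOp_add_fun (σ : Pol S A) (t n : ℕ) (φ φ' : Fnl S ι) :
    runOp p σ t n (fun s v => φ s v + φ' s v)
      = fun s v => runOp p σ t n φ s v + runOp p σ t n φ' s v := by
  induction n generalizing t with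
  | zero => rfl
  | succ n ih => rw [runOp_succ, ih, stepOp_add]; rfl

theorem runOp_const_mul (σ : Pol S A) (t n : ℕ) (c : ℝ) (φ : Fnl S ι) :
    runOp p σ t n (fun s v => c * φ s v) = fun s v => c * runOp p σ t n φ s v := by
  induction n generalizing t with
  | zero => rfl
  | succ n ih => rw [runOp_succ, ih, stepOp_const_mul]; rfl

theorem runOp_zero_fun (σ : Pol S A) (t n : ℕ) :
    runOp p σ t n (fun _ _ => 0 : Fnl S ι) = fun _ _ => 0 := by
  induction n generalizing t with
  | zero => rfl
  | succ n ih => rw [runOp_succ, ih, stepOp_zero]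

theorem runOp_sum_fun {κ : Type*} (I : Finset κ) (σ : Pol S A) (t n : ℕ) (φ : κ → Fnl S ι) :
    runOp p σ t n (fun s v => ∑ i ∈ I, φ i s v) = fun s v => ∑ i ∈ I, runOp p σ t n (φ i) s v := by
  classical
  induction I using Finset.induction_on with
  | empty => simpa using runOp_zero_fun σ t n
  | insert i I hi ih =>
    simp only [sum_insert hi]
    rw [runOp_add_fun, ih]

theorem stepOp_sum_fun {κ : Type*} (I : Finset κ) (σ : S → A → ℝ) (t : ℕ) (φ : κ → Fnl S ι) :
    stepOp p σ t (fun s v => ∑ i ∈ I, φ i s v) = fun s v => ∑ i ∈ I, stepOp p σ t (φ i) s v :=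
  runOp_sum_fun I (fun _ => σ) t 1 φ

theorem runOp_nonneg {σ : Pol S A} (hσ : ∀ t s a, 0 ≤ σ t s a) (t n : ℕ) {φ : Fnl S ι}
    (h : ∀ s v, 0 ≤ φ s v) (s : S) (b : ι → ℝ) : 0 ≤ runOp p σ t n φ s b := by
  have := runOp_mono (p := p) hσ t n h s b
  rwa [runOp_zero_fun] at this

theorem stepOp_sn {α : S → A → ℝ} (hα : ∀ s a, 0 ≤ α s a) (t : ℕ) {φ : Fnl S ι}
    (h : ∀ s, Sn (φ s)) (s : S) : Sn (stepOp p α t φ s) :=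
  Sn.sum _ fun a _ => (Sn.sum _ fun _ _ => Sn.sum _ fun s' _ => (h s').mul_left _).const_mul (hα s a)

theorem runOp_sn {σ : Pol S A} (hσ : ∀ t s a, 0 ≤ σ t s a) (t n : ℕ) {φ : Fnl S ι}
    (h : ∀ s, Sn (φ s)) (s : S) : Sn (runOp p σ t n φ s) := by
  induction n generalizing t s with
  | zero => exact h s
  | succ n ih => exact stepOp_sn (hσ t) t (fun s => ih (t + 1) s) s

/-- Multiplying the weights by a fixed vector commutes with running the process. -/
theorem runOp_mul (σ : Pol S A) (t n : ℕ) (φ : Fnl S ι) (z : ι → ℝ) (s : S) (b : ι → ℝ) :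
    runOp p σ t n (fun s v => φ s (v * z)) s b = runOp p σ t n φ s (b * z) := by
  induction n generalizing t s b with
  | zero => rfl
  | succ n ih =>
    simp only [runOp_succ, stepOp, ih]
    refine sum_congr rfl fun a _ => congrArg _ (sum_congr rfl fun o _ => sum_congr rfl fun s' _ => ?_)
    rw [mul_right_comm]

section Reach
variable [DecidableEq S]

variable (p) in
/-- The probability, in the process `k`, to be in the state `s` after `n` steps from `y`. -/
def rch (σ : Pol S A) (t : ℕ) : ℕ → S → S → ι → ℝ
  | 0, y, s => fun _ => if y = s then 1 else 0
  | n + 1, y, s' => fun k =>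
    ∑ s, rch σ t n y s k * ∑ a, σ (t + n) s a * ∑ o, p (t + n) s a o s' k

theorem rch_succ (σ : Pol S A) (t n : ℕ) (y s' : S) (k : ι) : rch p σ t (n + 1) y s' k =
    ∑ s, rch p σ t n y s k * ∑ a, σ (t + n) s a * ∑ o, p (t + n) s a o s' k := rfl

theorem rch_congr {σ σ' : Pol S A} {t n : ℕ} (h : ∀ i, t ≤ i → i < t + n → σ i = σ' i) (y s : S) :
    rch p σ t n y s = rch p σ' t n y s := by
  induction n generalizing s with
  | zero => rfl
  | succ n ih =>
    funext k
    rw [rch_succ, rch_succ, h (t + n) (by omega) (by omega)]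
    exact sum_congr rfl fun s _ => by rw [ih (fun i h1 h2 => h i h1 (by omega))]

theorem rch_nonneg (hp : ∀ t s a o s' k, 0 ≤ p t s a o s' k) {σ : Pol S A} (hσ : ∀ t s a, 0 ≤ σ t s a) (t n : ℕ) (y s : S)
    (k : ι) : 0 ≤ rch p σ t n y s k := by
  induction n generalizing s with
  | zero => simp only [rch]; split_ifs <;> norm_num
  | succ n ih =>
    exact sum_nonneg fun s _ => mul_nonneg (ih s) (sum_nonneg fun a _ => mul_nonneg (hσ _ _ _)
      (sum_nonneg fun o _ => hp _ _ _ _ _ _))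

/-- Merging the histories that end in the same state does not increase a seminorm. -/
theorem sum_rch_le {σ : Pol S A} (hσ : ∀ t s a, 0 ≤ σ t s a) (t n : ℕ) {φ : Fnl S ι}
    (h : ∀ s, Sn (φ s)) (y : S) (b : ι → ℝ) :
    ∑ s, φ s (b * rch p σ t n y s) ≤ runOp p σ t n φ y b := by
  induction n generalizing φ with
  | zero =>
    rw [runOp_zero, sum_eq_single y]
    · apply le_of_eq; congr 1; funext k; simp [rch]
    · intro s _ hs
      rw [show b * rch p σ t 0 y s = 0 by funext k; simp [rch, hs.symm]]
      exact (h s).zero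
    · simp
  | succ n ih =>
    rw [runOp_succ_last]
    refine le_trans ?_ (ih (stepOp_sn (hσ _) _ h))
    have e : ∀ s', b * rch p σ t (n + 1) y s' = ∑ s, ∑ a, ∑ o,
        σ (t + n) s a • (b * rch p σ t n y s * p (t + n) s a o s') := by
      intro s'
      funext k
      simp only [Pi.mul_apply, rch_succ, Finset.sum_apply, Pi.smul_apply, smul_eq_mul, mul_sum]
      refine sum_congr rfl fun s _ => sum_congr rfl fun a _ => sum_congr rfl fun o _ => by ring
    calc ∑ s', φ s' (b * rch p σ t (n + 1) y s')
        ≤ ∑ s', ∑ s, ∑ a, ∑ o, σ (t + n) s a * φ s' (b * rch p σ t n y s * p (t + n) s a o s') := by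
          refine sum_le_sum fun s' _ => ?_
          rw [e]
          refine ((h s').sum_le _ _).trans (sum_le_sum fun s _ => ?_)
          refine ((h s').sum_le _ _).trans (sum_le_sum fun a _ => ?_)
          refine ((h s').sum_le _ _).trans (sum_le_sum fun o _ => ?_)
          rw [(h s').smul_nonneg (hσ _ _ _)]
      _ = ∑ s, stepOp p (σ (t + n)) (t + n) φ s (b * rch p σ t n y s) := by
          rw [sum_comm]
          refine sum_congr rfl fun s _ => ?_
          rw [sum_comm]
          refine sum_congr rfl fun a _ => ?_
          rw [mul_sum, sum_comm]
          refine sum_congr rfl fun o _ => ?_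
          rw [mul_sum]

/-- A terminal functional that is linear in a single weight. -/
theorem runOp_coord (σ : Pol S A) (t n : ℕ) (f : S → ℝ) (k : ι) (y : S) (b : ι → ℝ) :
    runOp p σ t n (fun s v => f s * v k) y b = b k * ∑ s, f s * rch p σ t n y s k := by
  induction n generalizing f with
  | zero => simp [rch, mul_comm]
  | succ n ih =>
    rw [runOp_succ_last]
    have e : stepOp p (σ (t + n)) (t + n) (fun s v => f s * v k) = fun s v =>
        (∑ a, σ (t + n) s a * ∑ o, ∑ s', f s' * p (t + n) s a o s' k) * v k := by
      funext s v
      simp only [stepOp, Pi.mul_apply, mul_sum, sum_mul]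
      exact sum_congr rfl fun a _ => sum_congr rfl fun o _ => sum_congr rfl fun s' _ => by ring
    rw [e, ih]
    congr 1
    simp only [rch_succ, mul_sum, sum_mul]
    symm
    rw [sum_comm]
    refine sum_congr rfl fun s _ => ?_
    rw [sum_comm]
    refine sum_congr rfl fun a _ => ?_
    rw [sum_comm]
    exact sum_congr rfl fun s' _ => sum_congr rfl fun o _ => by ring

/-- A linear terminal functional. -/
theorem runOp_linear [Fintype ι] (σ : Pol S A) (t n : ℕ) (f : S → ι → ℝ) (y : S) (b : ι → ℝ) :
    runOp p σ t n (fun s v => ∑ k, f s k * v k) y b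
      = ∑ k, b k * ∑ s, f s k * rch p σ t n y s k := by
  rw [runOp_sum_fun]
  exact sum_congr rfl fun k _ => runOp_coord σ t n (fun s => f s k) k y b

/-- On nonnegative weights, functionals need to be compared on nonnegative weights only. -/
theorem runOp_congr_nonneg (hp : IsKer p) {φ φ' : Fnl S ι}
    (h : ∀ s v, (∀ k, 0 ≤ v k) → φ s v = φ' s v) (σ : Pol S A) (t n : ℕ) (s : S)
    {b : ι → ℝ} (hb : ∀ k, 0 ≤ b k) : runOp p σ t n φ s b = runOp p σ t n φ' s b := by
  induction n generalizing t s b with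
  | zero => exact h s b hb
  | succ n ih =>
    simp only [runOp_succ, stepOp]
    refine sum_congr rfl fun a _ => congrArg _ (sum_congr rfl fun o _ => sum_congr rfl fun s' _ => ?_)
    exact ih _ _ fun k => mul_nonneg (hb k) (hp.nonneg _ _ _ _ _ _)

/-- The `ℓ¹` norm is conserved. -/
theorem runOp_l1 [Fintype ι] (hp : IsKer p) {σ : Pol S A} (hσ : IsPol σ) (t n : ℕ) (s : S)
    (b : ι → ℝ) : runOp p σ t n (fun _ => l1) s b = l1 b := by
  induction n generalizing t s b with
  | zero => rfl
  | succ n ih =>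
    rw [runOp_succ, show runOp p σ (t + 1) n (fun _ => l1) = fun _ => l1 from
      funext fun s => funext fun v => ih (t + 1) s v]
    simp only [stepOp, l1, Pi.mul_apply, abs_mul, abs_of_nonneg (hp.nonneg _ _ _ _ _ _)]
    have : ∀ a, ∑ o, ∑ s', ∑ k, |b k| * p t s a o s' k = ∑ k, |b k| := by
      intro a
      simp_rw [sum_comm (s := (univ : Finset S)) (t := (univ : Finset ι)),
        sum_comm (s := (univ : Finset O)) (t := (univ : Finset ι)), ← mul_sum, hp.sum_eq, mul_one]
    simp_rw [this, ← sum_mul, hσ.sum_eq, one_mul]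

theorem stepOp_l1 [Fintype ι] (hp : IsKer p) {σ : Pol S A} (hσ : IsPol σ) (t : ℕ) (s : S)
    (b : ι → ℝ) : stepOp p (σ t) t (fun _ => l1) s b = l1 b := runOp_l1 hp hσ t 1 s b

end Reach

section Gap
variable [Fintype ι]

/-- The absolute value of the total weight. -/
def absSum : Fnl S ι := fun _ v => |∑ k, v k|

theorem absSum_sn (s : S) : Sn ((absSum : Fnl S ι) s) := Sn.absSum

variable (p) in
/-- The total variation, from time `t` to time `N`, of the signed mixture with weights `b`. -/
def gap (N : ℕ) (σ : Pol S A) (t : ℕ) : Fnl S ι := runOp p σ t (N - t) absSum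

theorem gap_congr {N : ℕ} {σ σ' : Pol S A} {t : ℕ} (h : ∀ i, t ≤ i → i < N → σ i = σ' i) :
    gap p N σ t = gap p N σ' t := runOp_congr p _ fun i h1 h2 => h i h1 (by omega)

theorem gap_end (N : ℕ) (σ : Pol S A) : gap p N σ N = absSum := by simp [gap]

theorem gap_step {N t : ℕ} (σ : Pol S A) (h : t < N) :
    gap p N σ t = stepOp p (σ t) t (gap p N σ (t + 1)) := by
  rw [gap, show N - t = (N - (t + 1)) + 1 by omega, runOp_succ, gap]

theorem runOp_gap {N t n : ℕ} (σ : Pol S A) (h : t + n ≤ N) :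
    runOp p σ t n (gap p N σ (t + n)) = gap p N σ t := by
  rw [gap, ← runOp_add, gap]; congr 1; omega

theorem gap_sn {N : ℕ} {σ : Pol S A} (hσ : ∀ t s a, 0 ≤ σ t s a) (t : ℕ) (s : S) :
    Sn (gap p N σ t s) := runOp_sn hσ _ _ absSum_sn s

theorem gap_le_l1 [DecidableEq S] (hp : IsKer p) {N : ℕ} {σ : Pol S A} (hσ : IsPol σ) (t : ℕ) (s : S)
    (b : ι → ℝ) : gap p N σ t s b ≤ l1 b := by
  rw [← runOp_l1 hp hσ t (N - t) s b]
  exact runOp_mono hσ.nonneg _ _ (fun s v => absSum_le_l1 v) s b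

theorem gap_of_nonneg [DecidableEq S] (hp : IsKer p) {N : ℕ} {σ : Pol S A} (hσ : IsPol σ) (t : ℕ) (s : S)
    {b : ι → ℝ} (hb : ∀ k, 0 ≤ b k) : gap p N σ t s b = ∑ k, b k := by
  rw [← l1_of_nonneg hb, ← runOp_l1 hp hσ t (N - t) s b]
  exact runOp_congr_nonneg hp (fun s v hv => by
    rw [l1_of_nonneg hv]; exact abs_of_nonneg (sum_nonneg fun k _ => hv k)) σ _ _ s hb

/-- Data processing: refining the observation can only increase the total variation, by the triangle
inequality and the normalisation of the kernels. -/
theorem absSum_le_runOp (hp : IsKer p) {σ : Pol S A} (hσ : IsPol σ) (t n : ℕ) (s : S)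
    (b : ι → ℝ) : |∑ k, b k| ≤ runOp p σ t n absSum s b := by
  induction n generalizing t s b with
  | zero => rfl
  | succ n ih =>
    rw [runOp_succ]
    refine le_trans ?_ (stepOp_mono (hσ.nonneg t) (fun s v => ih (t + 1) s v) s b)
    simp only [stepOp, Pi.mul_apply]
    have : ∀ a, |∑ k, b k| ≤ ∑ o, ∑ s', |∑ k, b k * p t s a o s' k| := by
      intro a
      calc |∑ k, b k| = |∑ o, ∑ s', ∑ k, b k * p t s a o s' k| := by
            congr 1
            simp_rw [sum_comm (s := (univ : Finset S)) (t := (univ : Finset ι)),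
              sum_comm (s := (univ : Finset O)) (t := (univ : Finset ι)), ← mul_sum, hp.sum_eq, mul_one]
        _ ≤ _ := (abs_sum_le_sum_abs _ _).trans (sum_le_sum fun _ _ => abs_sum_le_sum_abs _ _)
    calc |∑ k, b k| = ∑ a, σ t s a * |∑ k, b k| := by rw [← sum_mul, hσ.sum_eq, one_mul]
      _ ≤ _ := sum_le_sum fun a _ => mul_le_mul_of_nonneg_left (this a) (hσ.nonneg _ _ _)

theorem absSum_le_gap (hp : IsKer p) {N : ℕ} {σ : Pol S A} (hσ : IsPol σ) (t : ℕ) (s : S)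
    (b : ι → ℝ) : |∑ k, b k| ≤ gap p N σ t s b := absSum_le_runOp hp hσ _ _ _ _

end Gap

/-- Follow `ω` before time `l` and `σ` from then on. -/
def splice (l : ℕ) (ω σ : Pol S A) : Pol S A := fun t => if t < l then ω t else σ t

theorem splice_of_lt {l t : ℕ} (h : t < l) (ω σ : Pol S A) : splice l ω σ t = ω t := if_pos h

theorem splice_of_le {l t : ℕ} (h : l ≤ t) (ω σ : Pol S A) : splice l ω σ t = σ t :=
  if_neg (by omega)

theorem IsPol.splice {ω σ : Pol S A} (hω : IsPol ω) (hσ : IsPol σ) (l : ℕ) :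
    IsPol (splice l ω σ) where
  nonneg t s a := by unfold LMDP.splice; split_ifs; exacts [hω.nonneg _ _ _, hσ.nonneg _ _ _]
  sum_eq t s := by unfold LMDP.splice; split_ifs; exacts [hω.sum_eq _ _, hσ.sum_eq _ _]

theorem gap_splice [Fintype ι] {N u l : ℕ} (hu : u ≤ l) (hl : l ≤ N) (ω σ : Pol S A) :
    gap p N (splice l ω σ) u = runOp p ω u (l - u) (gap p N σ l) := by
  obtain ⟨n, rfl⟩ := Nat.exists_eq_add_of_le hu
  rw [← runOp_gap (n := n) _ hl, show u + n - u = n by omega,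
    gap_congr (t := u + n) (σ' := σ) fun i h1 _ => splice_of_le h1 _ _]
  exact runOp_congr p _ fun i _ h2 => splice_of_lt h2 _ _

end Ops
end
end LMDP

/-! ### Subadditive recursions: unrolling along words, and stopping -/

namespace LMDP
noncomputable section
open Finset

section Unroll
variable {S A O ι : Type*} [Fintype S] [Fintype A] [Fintype O] [DecidableEq S]
variable {p : Ker S A O ι}

/-- The mass that is transported to `s` along the partial kernel `κ`. -/
def flow (κ : ℕ → S → A → O → S → ℝ) (α : Pol S A) (u i : ℕ) (y s : S) : ℝ :=
  rch (fun t s a o s' (_ : Unit) => κ t s a o s') α u i y s ()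

theorem flow_zero (κ : ℕ → S → A → O → S → ℝ) (α : Pol S A) (u : ℕ) (y s : S) :
    flow κ α u 0 y s = if y = s then 1 else 0 := rfl

theorem flow_succ (κ : ℕ → S → A → O → S → ℝ) (α : Pol S A) (u i : ℕ) (y s' : S) :
    flow κ α u (i + 1) y s' =
      ∑ s, flow κ α u i y s * ∑ a, α (u + i) s a * ∑ o, κ (u + i) s a o s' := rfl

theorem flow_nonneg {κ : ℕ → S → A → O → S → ℝ} (hκ : ∀ t s a o s', 0 ≤ κ t s a o s') {α : Pol S A}
    (hα : ∀ t s a, 0 ≤ α t s a) (u i : ℕ) (y s : S) : 0 ≤ flow κ α u i y s :=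
  rch_nonneg (fun t s a o s' _ => hκ t s a o s') hα u i y s ()

/-- Unrolling a subadditive recursion along the words `w`: at every step the part
`κ • (b * w)` of the weights goes on, the rest is handed over to `E`. -/
theorem unroll {E : ℕ → Fnl S ι} (hE : ∀ t s, Sn (E t s)) {α : Pol S A}
    (hα : ∀ t s a, 0 ≤ α t s a) (w : ℕ → S → ι → ℝ) {κ : ℕ → S → A → O → S → ℝ}
    (hκ : ∀ t s a o s', 0 ≤ κ t s a o s') (b : ι → ℝ) (u : ℕ) (y : S) (n : ℕ)
    (hstep : ∀ i < n, ∀ s, flow κ α u i y s ≠ 0 → E (u + i) s (b * w (u + i) s)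
      ≤ stepOp p (α (u + i)) (u + i) (E (u + i + 1)) s (b * w (u + i) s)) :
    E u y (b * w u y) ≤ (∑ i ∈ range n, ∑ s, flow κ α u i y s * ∑ a, α (u + i) s a *
      ∑ o, ∑ s', E (u + i + 1) s' (b * w (u + i) s * p (u + i) s a o s'
        - κ (u + i) s a o s' • (b * w (u + i + 1) s')))
      + ∑ s, flow κ α u n y s * E (u + n) s (b * w (u + n) s) := by
  induction n with
  | zero => simp [flow_zero]
  | succ n ih =>
    refine (ih fun i hi => hstep i (by omega)).trans ?_
    rw [sum_range_succ, add_assoc]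
    refine add_le_add le_rfl ?_
    have e : ∑ s', flow κ α u (n + 1) y s' * E (u + (n + 1)) s' (b * w (u + (n + 1)) s')
        = ∑ s, flow κ α u n y s * ∑ a, α (u + n) s a * ∑ o, ∑ s',
          κ (u + n) s a o s' * E (u + n + 1) s' (b * w (u + n + 1) s') := by
      simp only [flow_succ, sum_mul, mul_sum]
      rw [sum_comm]
      refine sum_congr rfl fun s _ => ?_
      rw [sum_comm]
      refine sum_congr rfl fun a _ => ?_
      rw [sum_comm]
      exact sum_congr rfl fun o _ => sum_congr rfl fun s' _ => by rw [← add_assoc]; ring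
    rw [e, ← sum_add_distrib]
    refine sum_le_sum fun s _ => ?_
    rw [← mul_add]
    by_cases hs : flow κ α u n y s = 0
    · simp [hs]
    refine mul_le_mul_of_nonneg_left ?_ (flow_nonneg hκ hα _ _ _ _)
    refine (hstep n (by omega) s hs).trans ?_
    rw [stepOp, ← sum_add_distrib]
    refine sum_le_sum fun a _ => ?_
    rw [← mul_add, ← sum_add_distrib]
    refine mul_le_mul_of_nonneg_left (sum_le_sum fun o _ => ?_) (hα _ _ _)
    rw [← sum_add_distrib]
    refine sum_le_sum fun s' _ => ?_
    rw [← (hE _ s').smul_nonneg (hκ (u + n) s a o s')]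
    -- The new weights are the remainder plus `κ` times the weights of the word that ends in `s'`;
    -- subadditivity separates them.
    refine le_trans (le_of_eq ?_) ((hE _ s').add_le _ _)
    rw [sub_add_cancel]

/-- The price of following the words `w`. -/
theorem flow_mul_le {α : Pol S A} (hα : ∀ t s a, 0 ≤ α t s a) {w : ℕ → S → ι → ℝ}
    {κ : ℕ → S → A → O → S → ℝ} (hκ : ∀ t s a o s', 0 ≤ κ t s a o s') (hp : ∀ t s a o s' k, 0 ≤ p t s a o s' k) {u : ℕ} {y : S} {k : ι}
    (h0 : w u y k ≤ 1)
    (h : ∀ t s a o s', κ t s a o s' * w (t + 1) s' k ≤ w t s k * p t s a o s' k) (i : ℕ) (s : S) :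
    flow κ α u i y s * w (u + i) s k ≤ rch p α u i y s k := by
  induction i generalizing s with
  | zero =>
    simp only [flow_zero, rch, add_zero]
    split_ifs with hs
    · subst hs; simpa using h0
    · simp
  | succ i ih =>
    rw [flow_succ, rch_succ, sum_mul]
    refine sum_le_sum fun s₀ _ => ?_
    calc _ = flow κ α u i y s₀ * ∑ a, α (u + i) s₀ a * ∑ o, κ (u + i) s₀ a o s * w (u + i + 1) s k := by
          rw [mul_assoc, sum_mul]; simp_rw [mul_assoc, sum_mul]; rfl
      _ ≤ flow κ α u i y s₀ * ∑ a, α (u + i) s₀ a * ∑ o, w (u + i) s₀ k * p (u + i) s₀ a o s k := by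
          refine mul_le_mul_of_nonneg_left (sum_le_sum fun a _ => mul_le_mul_of_nonneg_left
            (sum_le_sum fun o _ => h _ _ _ _ _) (hα _ _ _)) (flow_nonneg hκ hα _ _ _ _)
      _ = (flow κ α u i y s₀ * w (u + i) s₀ k) * ∑ a, α (u + i) s₀ a * ∑ o, p (u + i) s₀ a o s k := by
          rw [mul_assoc, mul_sum (a := w (u + i) s₀ k)]
          congr 1
          refine sum_congr rfl fun a _ => ?_
          rw [← mul_sum]; ring
      _ ≤ _ := mul_le_mul_of_nonneg_right (ih s₀) (sum_nonneg fun a _ => mul_nonneg (hα _ _ _)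
          (sum_nonneg fun o _ => hp _ _ _ _ _ _))

variable (J : Finset ι)

open Classical in
/-- The largest multiple of `y` that lies below `x` on `J`; `0` if `y` vanishes on `J`. -/
def kil (x y : ι → ℝ) : ℝ :=
  if h : (J.filter fun k => 0 < y k).Nonempty then (J.filter fun k => 0 < y k).inf' h fun k => x k / y k
  else 0

variable {J}

theorem kil_nonneg {x y : ι → ℝ} (hx : ∀ k, 0 ≤ x k) : 0 ≤ kil J x y := by
  unfold kil
  split_ifs with h
  · refine (le_inf'_iff _ _).2 fun k hk => div_nonneg (hx k) (mem_filter.1 hk).2.le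
  · rfl

theorem kil_mul_le {x y : ι → ℝ} (hx : ∀ k, 0 ≤ x k) (hy : ∀ k, 0 ≤ y k) {k : ι} (hk : k ∈ J) :
    kil J x y * y k ≤ x k := by
  rcases (hy k).eq_or_lt with h0 | h0
  · rw [← h0, mul_zero]; exact hx k
  have hm : k ∈ J.filter fun k => 0 < y k := mem_filter.2 ⟨hk, h0⟩
  rw [kil, dif_pos ⟨k, hm⟩, ← le_div_iff₀ h0]
  exact inf'_le (fun k => x k / y k) hm

/-- The minimum of the ratios is attained, and there the remainder `x - kil J x y • y` vanishes.
This is how a context is removed. -/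
theorem exists_kil_mul_eq {x y : ι → ℝ} (h : ∃ k ∈ J, 0 < y k) :
    ∃ k ∈ J, 0 < y k ∧ kil J x y * y k = x k := by
  obtain ⟨k, hk, h0⟩ := h
  have hn : (J.filter fun k => 0 < y k).Nonempty := ⟨k, mem_filter.2 ⟨hk, h0⟩⟩
  obtain ⟨j, hj, he⟩ := exists_mem_eq_inf' hn fun k => x k / y k
  obtain ⟨hj, hj0⟩ := mem_filter.1 hj
  refine ⟨j, hj, hj0, ?_⟩
  rw [kil, dif_pos hn, he, div_mul_cancel₀ _ hj0.ne']

end Unroll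

section Stop
variable {S A O ι : Type*} [Fintype S] [Fintype A] [Fintype O]
variable {p : Ker S A O ι}

open Classical in
/-- The part of a policy that acts on the nodes in `c` only. -/
def restr (π : Pol S A) (c : ℕ → S → Prop) : Pol S A := fun t s a => if c t s then π t s a else 0

theorem restr_nonneg {π : Pol S A} (hπ : ∀ t s a, 0 ≤ π t s a) (c : ℕ → S → Prop) (t : ℕ) (s : S)
    (a : A) : 0 ≤ restr π c t s a := by
  unfold restr; split_ifs; exacts [hπ _ _ _, le_rfl]

theorem restr_le {π : Pol S A} (hπ : ∀ t s a, 0 ≤ π t s a) (c : ℕ → S → Prop) (t : ℕ) (s : S)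
    (a : A) : restr π c t s a ≤ π t s a := by
  unfold restr; split_ifs; exacts [le_rfl, hπ _ _ _]

theorem stepOp_restr_of {π : Pol S A} {c : ℕ → S → Prop} {t : ℕ} {s : S} (h : c t s) (φ : Fnl S ι)
    (b : ι → ℝ) : stepOp p (restr π c t) t φ s b = stepOp p (π t) t φ s b := by
  simp [stepOp, restr, h]

theorem stepOp_restr_of_not {π : Pol S A} {c : ℕ → S → Prop} {t : ℕ} {s : S} (h : ¬ c t s)
    (φ : Fnl S ι) (b : ι → ℝ) : stepOp p (restr π c t) t φ s b = 0 := by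
  simp [stepOp, restr, h]

theorem runOp_mono_pol {σ σ' : Pol S A} (hσ : ∀ t s a, 0 ≤ σ t s a)
    (h : ∀ t s a, σ t s a ≤ σ' t s a) (t n : ℕ) {φ : Fnl S ι} (hφ : ∀ s v, 0 ≤ φ s v) (s : S)
    (b : ι → ℝ) : runOp p σ t n φ s b ≤ runOp p σ' t n φ s b := by
  induction n generalizing t s b with
  | zero => rfl
  | succ n ih =>
    rw [runOp_succ, runOp_succ]
    refine (stepOp_mono (hσ t) (fun s v => ih (t + 1) s v) s b).trans ?_
    exact sum_le_sum fun a _ => mul_le_mul_of_nonneg_right (h t s a) (sum_nonneg fun _ _ =>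
      sum_nonneg fun _ _ => runOp_nonneg (fun t s a => (hσ t s a).trans (h t s a)) _ _ hφ _ _)

open Classical in
/-- Run `π` as long as the nodes are in `c`; at the first node outside of `c` end with `G`. -/
def stopRun (p : Ker S A O ι) (π : Pol S A) (c : ℕ → S → Prop) (G : ℕ → Fnl S ι) (φ : Fnl S ι) :
    ℕ → ℕ → Fnl S ι
  | _, 0 => φ
  | t, n + 1 => fun s v =>
    if c t s then stepOp p (π t) t (stopRun p π c G φ (t + 1) n) s v else G t s v

open Classical in
-- First-exit decomposition. It serves to compare two terminal functionals `G` term by term, under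
-- the same stopping rule.
theorem stopRun_eq (π : Pol S A) (c : ℕ → S → Prop) (G : ℕ → Fnl S ι) (φ : Fnl S ι) (t n : ℕ)
    (s : S) (b : ι → ℝ) : stopRun p π c G φ t n s b =
      (∑ i ∈ range n, runOp p (restr π c) t i (fun s v => if c (t + i) s then 0 else G (t + i) s v) s b)
        + runOp p (restr π c) t n φ s b := by
  induction n generalizing t s b with
  | zero => simp [stopRun]
  | succ n ih =>
    rw [sum_range_succ']
    simp only [stopRun, runOp_zero, add_zero, runOp_succ]
    by_cases h : c t s
    · simp only [h, if_true, add_zero, stepOp_restr_of h]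
      rw [show stopRun p π c G φ (t + 1) n = _ from funext fun s => funext fun v => ih (t + 1) s v]
      rw [stepOp_add]
      dsimp only
      rw [stepOp_sum_fun]
      dsimp only
      congr 1
      refine sum_congr rfl fun i _ => ?_
      rw [show t + 1 + i = t + (i + 1) by omega]
    · simp [h, stepOp_restr_of_not h]

/-- Stopping and collecting the gap that is still to come changes nothing. -/
theorem stopRun_gap [Fintype ι] (π : Pol S A) (c : ℕ → S → Prop) {N t n : ℕ} (h : t + n = N) :
    stopRun p π c (gap p N π) absSum t n = gap p N π t := by
  induction n generalizing t with
  | zero => rw [← h, add_zero, gap_end]; rfl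
  | succ n ih =>
    funext s v
    simp only [stopRun, ih (t := t + 1) (by omega)]
    rw [← gap_step π (by omega), ite_self]

theorem stopRun_sn {π : Pol S A} (hπ : ∀ t s a, 0 ≤ π t s a) (c : ℕ → S → Prop) {G : ℕ → Fnl S ι}
    (hG : ∀ t s, Sn (G t s)) {φ : Fnl S ι} (hφ : ∀ s, Sn (φ s)) (t n : ℕ) (s : S) :
    Sn (stopRun p π c G φ t n s) := by
  induction n generalizing t s with
  | zero => exact hφ s
  | succ n ih =>
    by_cases h : c t s
    · simpa only [stopRun, h, if_true] using stepOp_sn (hπ t) t (fun s => ih (t + 1) s) s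
    · simpa only [stopRun, h, if_false] using hG t s

/-- A self-referential choice of the nodes at which to continue. -/
theorem exists_restr [DecidableEq S] (π : Pol S A) (u : ℕ) (y : S)
    (P : ℕ → S → (ι → ℝ) → Prop) :
    ∃ c : ℕ → S → Prop, ∀ i s, c (u + i) s ↔ P i s (rch p (restr π c) u i y s) := by
  classical
  -- There is no circularity: the reach probabilities after `n` steps depend on the choices at
  -- earlier steps only, so they can be defined together with the choices by recursion on time.
  let r : ℕ → S → ι → ℝ := fun n => Nat.rec (fun s _ => if y = s then 1 else 0)
    (fun n r s' k => ∑ s, r s k * ∑ a, (if P n s (r s) then π (u + n) s a else 0) *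
      ∑ o, p (u + n) s a o s' k) n
  have hr : ∀ n s' k, r (n + 1) s' k = ∑ s, r n s k * ∑ a,
      (if P n s (r n s) then π (u + n) s a else 0) * ∑ o, p (u + n) s a o s' k := fun _ _ _ => rfl
  refine ⟨fun t s => P (t - u) s (r (t - u) s), fun i s => ?_⟩
  have : ∀ i s, rch p (restr π fun t s => P (t - u) s (r (t - u) s)) u i y s = r i s := by
    intro i
    induction i with
    | zero => intro s; rfl
    | succ i ih =>
      intro s; funext k
      rw [rch_succ, hr]
      refine sum_congr rfl fun s₀ _ => ?_
      rw [ih]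
      simp [restr]
  dsimp only
  rw [this, Nat.add_sub_cancel_left]

end Stop
end
end LMDP

/-! ### Separating the two families of contexts -/

namespace LMDP
noncomputable section
open Finset

section Ind
variable {S A O ι : Type*} [Fintype S] [Fintype A] [Fintype O] [DecidableEq S]
variable {p : Ker S A O ι}

/-- The functional that is `φ` in the state `s` and vanishes elsewhere. -/
def ind (s : S) (φ : (ι → ℝ) → ℝ) : Fnl S ι := fun s' v => if s' = s then φ v else 0

theorem ind_sn (s : S) {φ : (ι → ℝ) → ℝ} (h : Sn φ) (s' : S) : Sn (ind s φ s') := by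
  unfold ind; split_ifs; exacts [h, Sn.zero_fun]

theorem ind_mono (s : S) {φ φ' : (ι → ℝ) → ℝ} (h : ∀ v, φ v ≤ φ' v) (s' : S) (v : ι → ℝ) :
    ind s φ s' v ≤ ind s φ' s' v := by
  unfold ind; split_ifs; exacts [h v, le_rfl]

theorem ind_nonneg (s : S) {φ : (ι → ℝ) → ℝ} (h : ∀ v, 0 ≤ φ v) (s' : S) (v : ι → ℝ) :
    0 ≤ ind s φ s' v := by
  unfold ind; split_ifs; exacts [h v, le_rfl]

theorem runOp_eq_sum_ind (σ : Pol S A) (t n : ℕ) (φ : Fnl S ι) (y : S) (b : ι → ℝ) :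
    runOp p σ t n φ y b = ∑ s, runOp p σ t n (ind s (φ s)) y b := by
  have : φ = fun s' v => ∑ s, ind s (φ s) s' v := by funext s' v; simp [ind]
  conv_lhs => rw [this, runOp_sum_fun]

/-- Nonnegative weights do not cancel: a functional that equals the total mass on them may be
treated as linear. -/
theorem runOp_ind_of_nonneg [Fintype ι] (hp : IsKer p) (σ : Pol S A) (t n : ℕ)
    {φ : (ι → ℝ) → ℝ} (h : ∀ v, (∀ k, 0 ≤ v k) → φ v = ∑ k, v k) (y s : S) {b : ι → ℝ}
    (hb : ∀ k, 0 ≤ b k) : runOp p σ t n (ind s φ) y b = ∑ k, b k * rch p σ t n y s k := by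
  rw [runOp_congr_nonneg hp (φ' := fun s' v => ∑ k, (if s' = s then 1 else 0) * v k)
    (fun s' v hv => ?_) σ t n y hb, runOp_linear]
  · refine sum_congr rfl fun k _ => ?_
    simp
  · unfold ind; split_ifs <;> simp [h v hv]

/-- Summing a seminorm over the nodes along a family of words. -/
theorem sum_words_le {U : Finset (Pol S A)} {W : S → Finset (Pol S A)} (hWU : ∀ s, W s ⊆ U)
    (hU : ∀ ω ∈ U, ∀ t s a, 0 ≤ ω t s a) (u i : ℕ) (y : S) {φ : Fnl S ι}
    (hφ : ∀ s, Sn (φ s)) (b : ι → ℝ) :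
    ∑ s, φ s (b * ∑ ω ∈ W s, rch p ω u i y s) ≤ ∑ ω ∈ U, runOp p ω u i φ y b := by
  calc _ ≤ ∑ s, ∑ ω ∈ U, φ s (b * rch p ω u i y s) := by
        refine sum_le_sum fun s _ => ?_
        rw [mul_sum]
        refine ((hφ s).sum_le _ _).trans ?_
        exact sum_le_sum_of_subset_of_nonneg (hWU s) fun ω _ _ => (hφ s).nonneg _
    _ = ∑ ω ∈ U, ∑ s, φ s (b * rch p ω u i y s) := sum_comm
    _ ≤ _ := sum_le_sum fun ω hω => sum_rch_le (hU ω hω) u i hφ y b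

variable (S A) in
/-- The uniform policy. -/
def unifPol : Pol S A := fun _ _ _ => 1 / (Fintype.card A : ℝ)

theorem unifPol_isPol [Nonempty A] : IsPol (unifPol S A) where
  nonneg _ _ _ := by unfold unifPol; positivity
  sum_eq _ _ := by simp [unifPol]

theorem stepOp_le_unif [Nonempty A] {α : S → A → ℝ} (hα : ∀ s a, α s a ≤ 1) (t : ℕ)
    {φ : Fnl S ι} (hφ : ∀ s v, 0 ≤ φ s v) (s : S) (b : ι → ℝ) :
    stepOp p α t φ s b ≤ Fintype.card A * stepOp p (unifPol S A t) t φ s b := by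
  unfold stepOp
  rw [mul_sum]
  refine sum_le_sum fun a _ => ?_
  rw [unifPol, ← mul_assoc, mul_one_div_cancel (by simp)]
  exact mul_le_mul_of_nonneg_right (hα s a) (sum_nonneg fun _ _ => sum_nonneg fun _ _ => hφ _ _)

theorem IsPol.le_one {σ : Pol S A} (h : IsPol σ) (t : ℕ) (s : S) (a : A) : σ t s a ≤ 1 := by
  rw [← h.sum_eq t s]
  exact single_le_sum (f := fun a => σ t s a) (fun a _ => h.nonneg t s a) (mem_univ a)

end Ind

section Parts
variable {ι₁ ι₂ : Type*}

/-- The weights of the first family. -/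
def inlPart (b : ι₁ ⊕ ι₂ → ℝ) : ι₁ ⊕ ι₂ → ℝ := Sum.elim (fun i => b (Sum.inl i)) 0

/-- The weights of the second family. -/
def inrPart (b : ι₁ ⊕ ι₂ → ℝ) : ι₁ ⊕ ι₂ → ℝ := Sum.elim 0 fun i => b (Sum.inr i)

theorem inlPart_add_inrPart (b : ι₁ ⊕ ι₂ → ℝ) : inlPart b + inrPart b = b := by
  funext k; cases k <;> simp [inlPart, inrPart]

theorem l1_inrPart_le [Fintype ι₁] [Fintype ι₂] (b : ι₁ ⊕ ι₂ → ℝ) : l1 (inrPart b) ≤ l1 b := by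
  refine sum_le_sum fun k _ => ?_
  cases k <;> simp [inrPart]

end Parts

section Stage

variable {S A O ι₁ ι₂ : Type*} [Fintype S] [Fintype A] [Fintype O] [DecidableEq S] [Nonempty A]
  [Fintype ι₁] [Fintype ι₂]
variable {p : Ker S A O (ι₁ ⊕ ι₂)}

/-- Weights are only ever multiplied, so those of the first family stay zero along the run. -/
theorem runOp_mono_inr {φ φ' : Fnl S (ι₁ ⊕ ι₂)} {σ : Pol S A} (hσ : ∀ t s a, 0 ≤ σ t s a)
    (h : ∀ s v, (∀ i, v (Sum.inl i) = 0) → φ s v ≤ φ' s v) (t n : ℕ) (s : S) {v : ι₁ ⊕ ι₂ → ℝ}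
    (hv : ∀ i, v (Sum.inl i) = 0) : runOp p σ t n φ s v ≤ runOp p σ t n φ' s v := by
  induction n generalizing t s v with
  | zero => exact h s v hv
  | succ n ih =>
    exact sum_le_sum fun a _ => mul_le_mul_of_nonneg_left (sum_le_sum fun o _ =>
      sum_le_sum fun s' _ => ih _ _ fun i => by simp [hv i]) (hσ _ _ _)

/-- Split the weights into the two families. On the first one, gap and absolute total weight both
equal the mass; on the second one, both are bounded by `ν`. If the mass of the first family exceeds
twice the `ν`-term, the two bounds make the gap at most three times the absolute total weight;
otherwise the gap is at most three times the `ν`-term. -/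
theorem exists_light_bound {N u : ℕ} {y : S} {π : Pol S A}
    (hp : IsKer p) (hπ : IsPol π) {b : ι₁ ⊕ ι₂ → ℝ} (hb : ∀ i, 0 ≤ b (Sum.inl i)) (l i : ℕ) (s : S)
    {ν : (ι₁ ⊕ ι₂ → ℝ) → ℝ} (hν : Sn ν)
    (hgap : ∀ v, (∀ i, v (Sum.inl i) = 0) → gap p N π l s v ≤ ν v)
    {ρ : Pol S A} (hρ : ∀ t s a, 0 ≤ ρ t s a) (hρπ : ∀ t s a, ρ t s a ≤ π t s a) :
    runOp p ρ u i (ind s (gap p N π l s)) y b ≤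
        (∑ k, b (Sum.inl k) * rch p ρ u i y s (Sum.inl k)) + runOp p π u i (ind s ν) y (inrPart b) ∧
      (∑ k, b (Sum.inl k) * rch p ρ u i y s (Sum.inl k)) ≤
        runOp p ρ u i (ind s fun v => |∑ k, v k|) y b + runOp p π u i (ind s ν) y (inrPart b) := by
  have hI : ∀ k, 0 ≤ inlPart b k := by rintro (k | k) <;> simp [inlPart, hb]
  have hT : ∀ k, inrPart b (Sum.inl k) = 0 := fun k => rfl
  have hsum : ∀ φ : (ι₁ ⊕ ι₂ → ℝ) → ℝ, (∀ v, (∀ k, 0 ≤ v k) → φ v = ∑ k, v k) →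
      runOp p ρ u i (ind s φ) y (inlPart b) = ∑ k, b (Sum.inl k) * rch p ρ u i y s (Sum.inl k) := by
    intro φ hφ
    rw [runOp_ind_of_nonneg hp ρ u i hφ y s hI, Fintype.sum_sum_type]
    simp [inlPart]
  have hν' : ∀ φ : (ι₁ ⊕ ι₂ → ℝ) → ℝ, (∀ v, φ v ≤ gap p N π l s v) →
      runOp p ρ u i (ind s φ) y (inrPart b) ≤ runOp p π u i (ind s ν) y (inrPart b) := by
    intro φ hφ
    refine (runOp_mono_inr hρ (φ' := ind s ν) (fun s' v hv => ?_) u i y hT).trans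
      (runOp_mono_pol hρ hρπ u i (ind_nonneg s hν.nonneg) y _)
    unfold ind
    split_ifs
    exacts [(hφ v).trans (hgap v hv), le_rfl]
  constructor
  · conv_lhs => rw [← inlPart_add_inrPart b]
    refine ((runOp_sn hρ u i (ind_sn s (gap_sn hπ.nonneg l s)) y).add_le _ _).trans ?_
    rw [hsum _ fun v hv => gap_of_nonneg hp hπ l s hv]
    exact add_le_add le_rfl (hν' _ fun v => le_rfl)
  · rw [← hsum (fun v => |∑ k, v k|) fun v hv => abs_of_nonneg (sum_nonneg fun k _ => hv k)]
    conv_lhs => rw [show inlPart b = b - inrPart b from eq_sub_of_add_eq (inlPart_add_inrPart b)]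
    refine ((runOp_sn hρ u i (ind_sn s Sn.absSum) y).sub_le _ _).trans ?_
    exact add_le_add le_rfl (hν' _ fun v => absSum_le_gap hp hπ l s v)

/-- Splitting off the first family from the test values. -/
theorem sum_tests_inrPart_le {N u : ℕ} {y : S} (hp : IsKer p) {b : ι₁ ⊕ ι₂ → ℝ}
    (hb : ∀ i, 0 ≤ b (Sum.inl i)) (l i : ℕ) (s : S) {W D : Finset (Pol S A)}
    (hW : ∀ ω ∈ W, IsPol ω) (hD : ∀ ψ ∈ D, IsPol ψ) {m : ℕ} (hm : D.card ≤ m) :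
    ∑ ω ∈ W, ∑ ψ ∈ D, runOp p ω u i (ind s (gap p N ψ l s)) y (inrPart b) ≤
      (∑ ω ∈ W, ∑ ψ ∈ D, runOp p ω u i (ind s (gap p N ψ l s)) y b) +
        m * ∑ k, b (Sum.inl k) * (∑ ω ∈ W, rch p ω u i y s) (Sum.inl k) := by
  have hI : ∀ k, 0 ≤ inlPart b k := by rintro (k | k) <;> simp [inlPart, hb]
  have h1 : ∀ ω ∈ W, ∀ ψ ∈ D, runOp p ω u i (ind s (gap p N ψ l s)) y (inrPart b) ≤
      runOp p ω u i (ind s (gap p N ψ l s)) y b + ∑ k, b (Sum.inl k) * rch p ω u i y s (Sum.inl k) := by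
    intro ω hω ψ hψ
    conv_lhs => rw [show inrPart b = b - inlPart b from eq_sub_of_add_eq'
      (inlPart_add_inrPart b)]
    refine ((runOp_sn (hW ω hω).nonneg u i (ind_sn s (gap_sn (hD ψ hψ).nonneg l s)) y).sub_le
      _ _).trans (add_le_add le_rfl (le_of_eq ?_))
    rw [runOp_ind_of_nonneg hp ω u i (fun v hv => gap_of_nonneg hp (hD ψ hψ) l s hv) y s hI,
      Fintype.sum_sum_type]
    simp [inlPart]
  refine (sum_le_sum fun ω hω => sum_le_sum fun ψ hψ => h1 ω hω ψ hψ).trans ?_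
  simp only [sum_add_distrib, sum_const, nsmul_eq_mul]
  refine add_le_add le_rfl ?_
  rw [← mul_sum, sum_comm]
  simp only [Finset.sum_apply, mul_sum]
  refine sum_le_sum fun k _ => sum_le_sum fun ω hω => ?_
  have := mul_nonneg (hb k) (rch_nonneg hp.nonneg (hW ω hω).nonneg u i y s (Sum.inl k))
  gcongr

end Stage
end
end LMDP

/-! ### Removing one context of the candidate model -/

namespace LMDP
noncomputable section
open Finset

section Stage

variable {S A O ι₁ ι₂ : Type*} [Fintype S] [Fintype A] [Fintype O] [DecidableEq S] [Nonempty A]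
  [Fintype ι₁] [Fintype ι₂]
variable {p : Ker S A O (ι₁ ⊕ ι₂)}

/-- The weights of the first family are nonnegative, and at most `j` of them are positive. -/
def PosType (j : ℕ) (b : ι₁ ⊕ ι₂ → ℝ) : Prop :=
  (∀ i, 0 ≤ b (Sum.inl i)) ∧ (univ.filter fun i => 0 < b (Sum.inl i)).card ≤ j

/-- The common form of the upper bounds: words `ω ∈ U l` up to time `l`, followed by `Q`, either
directly or after a uniformly random action. -/
def wordBound (p : Ker S A O (ι₁ ⊕ ι₂)) (Q : ℕ → Fnl S (ι₁ ⊕ ι₂)) (U : ℕ → Finset (Pol S A))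
    (N u : ℕ) : Fnl S (ι₁ ⊕ ι₂) := fun y b =>
  ∑ i ∈ range (N - u), ∑ ω ∈ U (u + i), (Fintype.card A *
    runOp p ω u i (stepOp p (unifPol S A (u + i)) (u + i) (Q (u + i + 1))) y b
      + runOp p ω u i (Q (u + i)) y b)

/-- Stopping early with a multiple of the absolute total weight costs no more than that multiple of
the full gap, which by data processing dominates the absolute total weight at every earlier time. -/
theorem stopRun_le (hp : IsKer p) {π : Pol S A} (hπ : IsPol π) (c : ℕ → S → Prop)
    {G : ℕ → Fnl S (ι₁ ⊕ ι₂)} (hG : ∀ t s v, G t s v ≤ 3 * |∑ k, v k|) (t n : ℕ) (s : S)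
    (v : ι₁ ⊕ ι₂ → ℝ) : stopRun p π c G absSum t n s v ≤ 3 * runOp p π t n absSum s v := by
  induction n generalizing t s v with
  | zero =>
    have : (0 : ℝ) ≤ absSum s v := abs_nonneg _
    simp only [stopRun, runOp_zero]; linarith
  | succ n ih =>
    by_cases h : c t s
    · simp only [stopRun, h, if_true, runOp_succ]
      refine (stepOp_mono (hπ.nonneg t) (fun s v => ih (t + 1) s v) s v).trans ?_
      rw [stepOp_const_mul]
    · simp only [stopRun, h, if_false]
      exact (hG t s v).trans (by linarith [absSum_le_runOp hp hπ t (n + 1) s v])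

/-- The induction step on the number of positive weights in the first family. Here `W` are the
words, `D` the dominating policies at the nodes, `ν` the resulting bound for the gap of `π` on the
second family, and `Q` the bound that is already known for at most `j` positive weights. Following
`π`, the weights are exchanged at every node for those along the words. Each exchange leaves a
remainder with one positive weight fewer, bounded by `Q`, and the total multiplicity of the
exchanges stays below `2 * B * (m + 1)` because the run stops at heavy and light nodes. -/
theorem stage {N u : ℕ} {y : S} {π : Pol S A} (hp : IsKer p) (hπ : IsPol π) (huN : u < N)
    {j m : ℕ} {B D₁ : ℝ} (hB : 1 ≤ B) (hD₁ : 0 ≤ D₁)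
    {W D : ℕ → S → Finset (Pol S A)} {U : ℕ → Finset (Pol S A)}
    (hWU : ∀ l s, W l s ⊆ U l) (hU : ∀ l, ∀ ω ∈ U l, IsPol ω) (hD : ∀ l s, ∀ ψ ∈ D l s, IsPol ψ)
    (hm : ∀ l s, (D l s).card ≤ m) (hWu : (W u y).card = 1)
    {ν : ℕ → Fnl S (ι₁ ⊕ ι₂)} (hν : ∀ l s, Sn (ν l s))
    (hgap : ∀ l s v, u < l → l < N → (∀ i, v (Sum.inl i) = 0) → gap p N π l s v ≤ ν l s v)
    (hcov : ∀ i s, 0 < i → u + i < N → ∀ v, (∀ i, v (Sum.inl i) = 0) →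
      runOp p π u i (ind s (ν (u + i) s)) y v ≤
        B * (∑ ω ∈ W (u + i) s, ∑ ψ ∈ D (u + i) s, runOp p ω u i (ind s (gap p N ψ (u + i) s)) y v)
          + D₁ * l1 v)
    {Q : ℕ → Fnl S (ι₁ ⊕ ι₂)} (hQ : ∀ l s, Sn (Q l s)) (hQ0 : ∀ l s v, |∑ k, v k| ≤ Q l s v)
    (hQD : ∀ l s, ∀ ψ ∈ D l s, ∀ v, gap p N ψ l s v ≤ Q l s v)
    (hQπ : ∀ l s v, u < l → l < N → PosType j v → gap p N π l s v ≤ Q l s v)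
    {b : ι₁ ⊕ ι₂ → ℝ} (hb : PosType (j + 1) b) :
    gap p N π u y b ≤ 3 * B * (m + 1) * (m + 2) * wordBound p Q U N u y b
      + 3 * (m + 1) * D₁ * N * Fintype.card S * l1 b := by
  classical
  obtain ⟨hb0, hbj⟩ := hb
  have hW : ∀ l s, ∀ ω ∈ W l s, IsPol ω := fun l s ω hω => hU l ω (hWU l s hω)
  -- The likelihoods with which the words reach a node. In the next lines, `mass` is the mass of the
  -- first family that they transport, `τ` the values of the tests behind the words, and `𝒩` the
  -- second family's share under `π`.
  set wd : ℕ → S → ι₁ ⊕ ι₂ → ℝ := fun l s => ∑ ω ∈ W l s, rch p ω u (l - u) y s with hwd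
  set mass : ℕ → S → ℝ := fun i s => ∑ k, b (Sum.inl k) * wd (u + i) s (Sum.inl k) with hmass
  set τ : ℕ → S → ℝ := fun i s => ∑ ω ∈ W (u + i) s, ∑ ψ ∈ D (u + i) s,
    runOp p ω u i (ind s (gap p N ψ (u + i) s)) y b with hτ
  set 𝒩 : ℕ → S → ℝ := fun i s => runOp p π u i (ind s (ν (u + i) s)) y (inrPart b) with h𝒩
  -- Heavy: the first family prevails, so there is no substantial cancellation. Light: the words
  -- bring little of the first family, so the tests control all that `π` brings. Heaviness is
  -- measured with the flow `ρ` of the run that is already stopped at earlier nodes, whence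
  -- `exists_restr`.
  set heavy : ℕ → S → (ι₁ ⊕ ι₂ → ℝ) → Prop := fun i s r =>
    2 * 𝒩 i s < ∑ k, b (Sum.inl k) * r (Sum.inl k) with hheavy
  set light : ℕ → S → Prop := fun i s => B * mass i s ≤ B * τ i s + D₁ * l1 b with hlight
  obtain ⟨c, hc⟩ := exists_restr (p := p) π u y
    (fun i s r => i = 0 ∨ (¬ heavy i s r ∧ ¬ light i s))
  set ρ := restr π c with hρ
  have hρ0 : ∀ t s a, 0 ≤ ρ t s a := restr_nonneg hπ.nonneg c
  have hρπ : ∀ t s a, ρ t s a ≤ π t s a := restr_le hπ.nonneg c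
  have hwd0 : ∀ l s k, 0 ≤ wd l s k := fun l s k => by
    simp only [hwd, Finset.sum_apply]
    exact sum_nonneg fun ω hω => rch_nonneg hp.nonneg (hW l s ω hω).nonneg _ _ _ _ _
  have hmass0 : ∀ i s, 0 ≤ mass i s := fun i s =>
    sum_nonneg fun k _ => mul_nonneg (hb0 k) (hwd0 _ _ _)
  have hτ0 : ∀ i s, 0 ≤ τ i s := fun i s => sum_nonneg fun ω hω => sum_nonneg fun ψ hψ =>
    runOp_nonneg (hW _ s ω hω).nonneg _ _
      (ind_nonneg s (gap_sn (hD _ s ψ hψ).nonneg _ s).nonneg) _ _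
  have h𝒩0 : ∀ i s, 0 ≤ 𝒩 i s := fun i s =>
    runOp_nonneg hπ.nonneg _ _ (ind_nonneg s (hν _ s).nonneg) _ _
  have hl1 := l1_nonneg b
  -- Coverage is an assumption about the second family alone, while tests see both; the difference
  -- is at most the mass of the first family along the words, once for each of the at most `m`
  -- tests.
  have h𝒩le : ∀ i s, 0 < i → u + i < N → 𝒩 i s ≤ B * τ i s + D₁ * l1 b + B * m * mass i s := by
    intro i s hi hiN
    refine (hcov i s hi hiN _ fun k => rfl).trans ?_
    have h1 := sum_tests_inrPart_le (N := N) (u := u) (y := y) hp hb0 (u + i) i s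
      (hW (u + i) s) (hD (u + i) s) (hm (u + i) s)
    have h2 := mul_le_mul_of_nonneg_left h1 (zero_le_one.trans hB)
    have h3 := mul_le_mul_of_nonneg_left (l1_inrPart_le b) hD₁
    have h4 : mass i s = ∑ k, b (Sum.inl k) * (∑ ω ∈ W (u + i) s, rch p ω u i y s) (Sum.inl k) := by
      simp only [hmass, hwd, Nat.add_sub_cancel_left]
    rw [← h4] at h2
    simp only [hτ]
    linarith
  -- the stopped functional
  set E : ℕ → Fnl S (ι₁ ⊕ ι₂) := fun t => stopRun p π c
    (fun t s v => (if heavy (t - u) s (rch p ρ u (t - u) y s) then 3 else 0) * |∑ k, v k|) absSum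
      t (N - t) with hE
  have hEsn : ∀ t s, Sn (E t s) := fun t s => stopRun_sn hπ.nonneg c
    (fun t s => Sn.absSum.const_mul (by split_ifs <;> norm_num)) absSum_sn _ _ _
  have hG3 : ∀ t s (v : ι₁ ⊕ ι₂ → ℝ), (if heavy (t - u) s (rch p ρ u (t - u) y s) then (3 : ℝ) else 0)
      * |∑ k, v k| ≤ 3 * |∑ k, v k| := fun t s v => by
    have := abs_nonneg (∑ k, v k)
    split_ifs
    · exact le_rfl
    · linarith
  have hE3 : ∀ t s v, E t s v ≤ 3 * gap p N π t s v := by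
    exact fun t s v => stopRun_le hp hπ c hG3 t (N - t) s v
  have hEc : ∀ t s v, t < N → ¬ c t s → E t s v ≤ 3 * |∑ k, v k| := by
    intro t s v ht hct
    obtain ⟨n, hn⟩ : ∃ n, N - t = n + 1 := ⟨N - t - 1, by omega⟩
    simp only [hE, hn, stopRun, hct, if_false]
    exact hG3 t s v
  have hEN : ∀ s v, E N s v ≤ 3 * |∑ k, v k| := by
    intro s v
    have : (0 : ℝ) ≤ |∑ k, v k| := abs_nonneg _
    simp only [hE, Nat.sub_self, stopRun, absSum]
    linarith
  have hEstep : ∀ t s v, t < N → c t s → E t s v = stepOp p (ρ t) t (E (t + 1)) s v := by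
    intro t s v ht hct
    rw [hρ, stepOp_restr_of hct]
    simp only [hE]
    rw [show N - t = (N - (t + 1)) + 1 by omega]
    simp only [stopRun, hct, if_true]
  -- Two stopped runs are compared: the true one, ending with the gap, and `E`, ending with three
  -- times the absolute total weight at heavy nodes and with zero at light ones. The sum pays for
  -- the light nodes.
  have hdecomp : gap p N π u y b ≤ E u y b +
      ∑ i ∈ range (N - u), ∑ s, 3 * (m + 1) * (B * τ i s + D₁ * l1 b) := by
    simp only [hE]
    rw [← stopRun_gap π c (show u + (N - u) = N by omega), stopRun_eq, stopRun_eq, add_right_comm,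
      ← sum_add_distrib]
    refine add_le_add (sum_le_sum fun i hi => ?_) le_rfl
    rw [mem_range] at hi
    rw [runOp_eq_sum_ind, runOp_eq_sum_ind (p := p) (restr π c) u i _ y b, ← sum_add_distrib]
    refine sum_le_sum fun s _ => ?_
    have hpos : 0 ≤ 3 * (m + 1) * (B * τ i s + D₁ * l1 b) := by
      have := hτ0 i s
      positivity
    by_cases hcs : c (u + i) s
    · simp only [hcs, if_true]
      exact le_add_of_nonneg_right hpos
    simp only [hcs, if_false]
    rw [hc] at hcs
    push Not at hcs
    obtain ⟨hi0, hcs⟩ := hcs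
    obtain ⟨h1, h2⟩ := exists_light_bound (N := N) (u := u) (y := y) hp hπ hb0 (u + i) i s (hν (u + i) s)
      (fun v => hgap (u + i) s v (by omega) (by omega)) hρ0 hρπ
    rw [Nat.add_sub_cancel_left]
    by_cases hh : heavy i s (rch p ρ u i y s)
    · simp only [hh, if_true]
      have e : ind s (fun v : ι₁ ⊕ ι₂ → ℝ => 3 * |∑ k, v k|)
          = fun s' v => 3 * ind s (fun v : ι₁ ⊕ ι₂ → ℝ => |∑ k, v k|) s' v := by
        funext s' v; unfold ind; split_ifs <;> simp
      rw [e, runOp_const_mul]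
      simp only [hheavy, h𝒩] at hh
      dsimp only
      linarith
    · have hl := hcs hh
      simp only [hlight] at hl
      have h3 := h𝒩le i s (by omega) (by omega)
      simp only [hh, if_false, zero_mul]
      have e : ind s (fun v : ι₁ ⊕ ι₂ → ℝ => (0 : ℝ)) = fun _ _ => 0 := by
        funext s' v; unfold ind; split_ifs <;> simp
      rw [e, runOp_zero_fun]
      simp only [hheavy, not_lt] at hh
      have h4 := mul_le_mul_of_nonneg_left hl (Nat.cast_nonneg (α := ℝ) m)
      -- At a stopped node that is not heavy the gap is at most `3 * 𝒩`. Being light, the node also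
      -- has its word mass bounded by test values, hence so is `𝒩`.
      have h5 : (∑ k, b (Sum.inl k) * rch p ρ u i y s (Sum.inl k)) + 𝒩 i s ≤ 3 * 𝒩 i s := by linarith
      refine h1.trans (h5.trans ?_)
      nlinarith
  -- unrolling
  set J : Finset (ι₁ ⊕ ι₂) := (univ.filter fun i => 0 < b (Sum.inl i)).map Function.Embedding.inl with hJ
  -- Weights are handed over only to nodes at which the run continues, and never to the final time
  -- `N`.
  set κ : ℕ → S → A → O → S → ℝ := fun t s a o s' =>
    if t + 1 < N ∧ c (t + 1) s' then kil J (wd t s * p t s a o s') (wd (t + 1) s') else 0 with hκ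
  have hwp : ∀ t s a o s' k, 0 ≤ (wd t s * p t s a o s') k := fun t s a o s' k =>
    mul_nonneg (hwd0 _ _ _) (hp.nonneg _ _ _ _ _ _)
  have hκ0 : ∀ t s a o s', 0 ≤ κ t s a o s' := fun t s a o s' => by
    simp only [hκ]; split_ifs
    exacts [kil_nonneg (hwp t s a o s'), le_rfl]
  have hflow0 := flow_nonneg (u := u) (y := y) hκ0 hρ0
  have hflowc : ∀ i s, flow κ ρ u i y s ≠ 0 → c (u + i) s ∧ (0 < i → u + i < N) := by
    intro i s hne
    cases i with
    | zero => exact ⟨(hc 0 s).2 (Or.inl rfl), fun h => absurd h (by omega)⟩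
    | succ i =>
      by_contra hcon
      apply hne
      rw [flow_succ]
      refine sum_eq_zero fun s₀ _ => ?_
      have : ∀ a o, κ (u + i) s₀ a o s = 0 := by
        intro a o
        simp only [hκ]
        refine if_neg fun hh => hcon ⟨?_, fun _ => ?_⟩
        · exact hh.2
        · exact hh.1
      simp [this]
  have hwuy : wd u y = 1 := by
    obtain ⟨ω, hω⟩ := card_eq_one.1 hWu
    funext k
    simp [hwd, hω, rch]
  have hprice : ∀ i s, flow κ ρ u i y s * mass i s ≤
      ∑ k, b (Sum.inl k) * rch p ρ u i y s (Sum.inl k) := by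
    intro i s
    simp only [hmass, mul_sum]
    refine sum_le_sum fun k _ => ?_
    rcases (hb0 k).eq_or_lt with h | h
    · simp [← h]
    have hkJ : Sum.inl k ∈ J := by simp [hJ, h]
    have := flow_mul_le (p := p) (u := u) (y := y) (w := wd) (k := Sum.inl k) hρ0 hκ0 hp.nonneg
      (by rw [hwuy]; exact le_rfl) (fun t s a o s' => ?_) i s
    · calc _ = b (Sum.inl k) * (flow κ ρ u i y s * wd (u + i) s (Sum.inl k)) := by ring
        _ ≤ _ := mul_le_mul_of_nonneg_left this h.le
    · simp only [hκ]
      split_ifs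
      · exact kil_mul_le (hwp t s a o s') (hwd0 _ _) hkJ
      · rw [zero_mul]; exact hwp t s a o s' _
  -- The multiplicity times the word mass is at most the mass under `ρ`. At a continuing node the
  -- latter is at most `2 * 𝒩` (not heavy), and `𝒩` is at most `B * (m + 1)` times the word mass
  -- (not light); the positive word mass cancels.
  have hflow : ∀ i s, flow κ ρ u i y s ≤ 2 * B * (m + 1) := by
    intro i s
    have hm0 : (0 : ℝ) ≤ m := Nat.cast_nonneg m
    rcases Nat.eq_zero_or_pos i with rfl | hi
    · rw [flow_zero]
      split_ifs
      · nlinarith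
      · positivity
    by_cases hne : flow κ ρ u i y s = 0
    · rw [hne]; positivity
    obtain ⟨h1, h2⟩ := hflowc i s hne
    rcases (hc i s).1 h1 with h | ⟨hh, hl⟩
    · omega
    simp only [hlight, not_le] at hl
    simp only [hheavy, not_lt] at hh
    have h3 := h𝒩le i s hi (h2 hi)
    have h4 := hprice i s
    have h5 : 0 < mass i s := by
      have h6 := hτ0 i s
      have h7 : 0 ≤ B * τ i s + D₁ * l1 b := by positivity
      exact pos_of_mul_pos_right (h7.trans_lt hl) (by linarith)
    refine le_of_mul_le_mul_right (a := mass i s) ?_ h5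
    nlinarith
  -- The remainder: with a handover, one weight is killed and the hypothesis for `j` applies;
  -- without one, the run is over and only the absolute total weight is left.
  have hrem : ∀ i s a o s', i < N - u → E (u + i + 1) s' (b * wd (u + i) s * p (u + i) s a o s'
        - κ (u + i) s a o s' • (b * wd (u + i + 1) s')) ≤
      3 * (Q (u + i + 1) s' (b * wd (u + i) s * p (u + i) s a o s') +
        κ (u + i) s a o s' * Q (u + i + 1) s' (b * wd (u + i + 1) s')) := by
    intro i s a o s' hi
    have hQsub := fun v w => (hQ (u + i + 1) s').sub_le v w
    by_cases hk : u + i + 1 < N ∧ c (u + i + 1) s'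
    · rw [← (hQ (u + i + 1) s').smul_nonneg (hκ0 _ _ _ _ _)]
      refine (hE3 _ _ _).trans (mul_le_mul_of_nonneg_left (le_trans ?_ (hQsub _ _)) (by norm_num))
      refine hQπ _ _ _ (by omega) hk.1 ?_
      have hκe : κ (u + i) s a o s' =
          kil J (wd (u + i) s * p (u + i) s a o s') (wd (u + i + 1) s') := if_pos hk
      have hX : ∀ k, (b * wd (u + i) s * p (u + i) s a o s'
          - κ (u + i) s a o s' • (b * wd (u + i + 1) s')) k = b k *
            ((wd (u + i) s * p (u + i) s a o s') k - κ (u + i) s a o s' * wd (u + i + 1) s' k) := by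
        intro k
        simp only [Pi.sub_apply, Pi.mul_apply, Pi.smul_apply, smul_eq_mul]; ring
      have hX0 : ∀ k ∈ J, 0 ≤ (wd (u + i) s * p (u + i) s a o s') k
          - κ (u + i) s a o s' * wd (u + i + 1) s' k := fun k hk => by
        rw [hκe]; exact sub_nonneg.2 (kil_mul_le (hwp _ _ _ _ _) (hwd0 _ _) hk)
      -- the mass of a continuing node is positive
      have hmp : 0 < mass (i + 1) s' := by
        have h1 := (hc (i + 1) s').1 hk.2
        rcases h1 with h | ⟨-, hl⟩
        · omega
        simp only [hlight, not_le] at hl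
        have h6 := hτ0 (i + 1) s'
        have h7 : 0 ≤ B * τ (i + 1) s' + D₁ * l1 b := by positivity
        exact pos_of_mul_pos_right (h7.trans_lt hl) (by linarith)
      obtain ⟨k₀, -, hk₀⟩ := exists_lt_of_sum_lt (f := fun _ => (0 : ℝ)) (by simpa using hmp)
      have hk₀b : 0 < b (Sum.inl k₀) := (hb0 k₀).lt_of_ne fun h => by simp [← h] at hk₀
      obtain ⟨k, hkJ, -, hkill⟩ := exists_kil_mul_eq (J := J) (x := wd (u + i) s * p (u + i) s a o s')
        (y := wd (u + i + 1) s') ⟨Sum.inl k₀, by simp [hJ, hk₀b], by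
          exact pos_of_mul_pos_right hk₀ hk₀b.le⟩
      simp only [hJ, mem_map, mem_filter, mem_univ, true_and] at hkJ
      obtain ⟨k', hk'b, rfl⟩ := hkJ
      refine ⟨fun k => ?_, ?_⟩
      · rw [hX]
        rcases (hb0 k).eq_or_lt with h | h
        · simp [← h]
        · exact mul_nonneg h.le (hX0 _ (by simp [hJ, h]))
      · refine Nat.le_of_lt_succ (lt_of_lt_of_le (card_lt_card ?_) hbj)
        refine (ssubset_iff_of_subset fun k hk => ?_).2 ⟨k', by simpa using hk'b, ?_⟩
        · simp only [mem_filter, mem_univ, true_and, hX] at hk ⊢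
          exact (hb0 k).lt_of_ne fun h => by simp [← h] at hk
        · simp only [mem_filter, mem_univ, true_and, not_lt]
          apply le_of_eq
          rw [hX, hκe]
          rw [mul_eq_zero]
          right
          exact sub_eq_zero.2 hkill.symm
    · have hκe : κ (u + i) s a o s' = 0 := if_neg hk
      rw [hκe, zero_smul, sub_zero, zero_mul, add_zero]
      have h1 : E (u + i + 1) s' (b * wd (u + i) s * p (u + i) s a o s') ≤
          3 * |∑ k, (b * wd (u + i) s * p (u + i) s a o s') k| := by
        by_cases hN : u + i + 1 < N
        · exact hEc _ _ _ hN fun h => hk ⟨hN, h⟩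
        · rw [show u + i + 1 = N by omega]; exact hEN _ _
      exact h1.trans (mul_le_mul_of_nonneg_left (hQ0 _ _ _) (by norm_num))
  have hun := unroll (p := p) hEsn hρ0 wd hκ0 b u y (N - u) (fun i hi s hs =>
    (hEstep (u + i) s _ (by omega) (hflowc i s hs).1).le)
  have hlast : ∑ s, flow κ ρ u (N - u) y s * E (u + (N - u)) s (b * wd (u + (N - u)) s) = 0 := by
    refine sum_eq_zero fun s _ => ?_
    by_cases h : flow κ ρ u (N - u) y s = 0
    · rw [h, zero_mul]
    · have := (hflowc _ s h).2 (by omega)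
      omega
  rw [hlast, add_zero, hwuy, mul_one] at hun
  set Cw : ℝ := 2 * B * (m + 1) with hCw
  have hCw0 : 0 ≤ Cw := by positivity
  set a₁ : ℕ → ℝ := fun i => ∑ ω ∈ U (u + i), (Fintype.card A : ℝ) *
    runOp p ω u i (stepOp p (unifPol S A (u + i)) (u + i) (Q (u + i + 1))) y b with ha₁
  set a₂ : ℕ → ℝ := fun i => ∑ ω ∈ U (u + i), runOp p ω u i (Q (u + i)) y b with ha₂
  set f : ℕ → ℝ := fun i => ∑ s, flow κ ρ u i y s * Q (u + i) s (b * wd (u + i) s) with hf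
  have hf0 : ∀ i, 0 ≤ f i := fun i => sum_nonneg fun s _ =>
    mul_nonneg (hflow0 i s) ((hQ _ s).nonneg _)
  have hwdi : ∀ i s, wd (u + i) s = ∑ ω ∈ W (u + i) s, rch p ω u i y s := fun i s => by
    simp only [hwd, Nat.add_sub_cancel_left]
  have hU0 : ∀ i, ∀ ω ∈ U (u + i), ∀ t s a, 0 ≤ ω t s a := fun i ω hω => (hU _ ω hω).nonneg
  have hfa : ∀ i, f i ≤ Cw * a₂ i := by
    intro i
    calc f i ≤ ∑ s, Cw * Q (u + i) s (b * wd (u + i) s) := sum_le_sum fun s _ =>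
          mul_le_mul_of_nonneg_right (hflow i s) ((hQ _ s).nonneg _)
      _ = Cw * ∑ s, Q (u + i) s (b * ∑ ω ∈ W (u + i) s, rch p ω u i y s) := by
          rw [mul_sum]; exact sum_congr rfl fun s _ => by rw [hwdi]
      _ ≤ _ := mul_le_mul_of_nonneg_left (sum_words_le (fun s => hWU (u + i) s) (hU0 i) u i y
          (fun s => hQ (u + i) s) b) hCw0
  have hmain : ∀ i ∈ range (N - u), (∑ s, flow κ ρ u i y s * ∑ a, ρ (u + i) s a * ∑ o, ∑ s',
      E (u + i + 1) s' (b * wd (u + i) s * p (u + i) s a o s'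
        - κ (u + i) s a o s' • (b * wd (u + i + 1) s'))) ≤ 3 * Cw * a₁ i + 3 * f (i + 1) := by
    intro i hi
    have hi := mem_range.1 hi
    have e1 : 3 * f (i + 1) = ∑ s, flow κ ρ u i y s * ∑ a, ρ (u + i) s a * ∑ o, ∑ s',
        3 * (κ (u + i) s a o s' * Q (u + i + 1) s' (b * wd (u + i + 1) s')) := by
      simp only [hf, flow_succ, sum_mul, mul_sum]
      rw [sum_comm]
      refine sum_congr rfl fun s _ => ?_
      rw [sum_comm]
      refine sum_congr rfl fun a _ => ?_
      rw [sum_comm]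
      exact sum_congr rfl fun o _ => sum_congr rfl fun s' _ => by rw [← add_assoc]; ring
    have e2 : ∑ s, flow κ ρ u i y s * ∑ a, ρ (u + i) s a * ∑ o, ∑ s',
        3 * Q (u + i + 1) s' (b * wd (u + i) s * p (u + i) s a o s') ≤ 3 * Cw * a₁ i := by
      calc _ = ∑ s, 3 * (flow κ ρ u i y s *
              stepOp p (ρ (u + i)) (u + i) (Q (u + i + 1)) s (b * wd (u + i) s)) := by
            refine sum_congr rfl fun s _ => ?_
            simp only [stepOp, ← mul_sum, mul_left_comm _ (3 : ℝ)]
        _ ≤ ∑ s, 3 * (Cw * (Fintype.card A * stepOp p (unifPol S A (u + i)) (u + i)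
              (Q (u + i + 1)) s (b * wd (u + i) s))) := by
            refine sum_le_sum fun s _ => mul_le_mul_of_nonneg_left (mul_le_mul (hflow i s)
              (stepOp_le_unif (fun s a => (hρπ _ s a).trans (hπ.le_one _ s a)) _
                (fun s v => (hQ _ s).nonneg v) s _) ?_ hCw0) (by norm_num)
            exact (stepOp_sn (hρ0 _) _ (hQ _) s).nonneg _
        _ = 3 * Cw * (Fintype.card A * ∑ s, stepOp p (unifPol S A (u + i)) (u + i)
              (Q (u + i + 1)) s (b * ∑ ω ∈ W (u + i) s, rch p ω u i y s)) := by
            rw [mul_sum, mul_sum]; exact sum_congr rfl fun s _ => by rw [hwdi]; ring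
        _ ≤ _ := by
            simp only [ha₁, ← mul_sum]
            refine mul_le_mul_of_nonneg_left (mul_le_mul_of_nonneg_left (sum_words_le
              (fun s => hWU (u + i) s) (hU0 i) u i y
              (stepOp_sn (unifPol_isPol.nonneg _) _ (hQ _)) b) (by positivity)) (by positivity)
    rw [e1]
    refine le_trans ?_ (add_le_add e2 le_rfl)
    rw [← sum_add_distrib]
    refine sum_le_sum fun s _ => ?_
    rw [← mul_add, ← sum_add_distrib]
    refine mul_le_mul_of_nonneg_left (sum_le_sum fun a _ => ?_) (hflow0 i s)
    rw [← mul_add, ← sum_add_distrib]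
    refine mul_le_mul_of_nonneg_left (sum_le_sum fun o _ => ?_) (hρ0 _ _ _)
    rw [← sum_add_distrib]
    refine sum_le_sum fun s' _ => ?_
    rw [← mul_add]
    exact hrem i s a o s' hi
  have hfn : f (N - u) = 0 := by
    refine sum_eq_zero fun s _ => ?_
    by_cases h : flow κ ρ u (N - u) y s = 0
    · rw [h, zero_mul]
    · have := (hflowc _ s h).2 (by omega)
      omega
  -- Each handover is counted at its target node; the shifted sum is no larger because nothing
  -- arrives at the final time.
  have hfsum : ∑ i ∈ range (N - u), f (i + 1) ≤ ∑ i ∈ range (N - u), f i := by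
    have := sum_range_succ' f (N - u)
    rw [sum_range_succ, hfn] at this
    linarith [hf0 0]
  have hEu : E u y b ≤ 3 * Cw * ∑ i ∈ range (N - u), (a₁ i + a₂ i) := by
    refine hun.trans ((sum_le_sum hmain).trans ?_)
    rw [sum_add_distrib, ← mul_sum, ← mul_sum, sum_add_distrib, mul_add]
    refine add_le_add le_rfl ?_
    rw [mul_assoc]
    refine mul_le_mul_of_nonneg_left (hfsum.trans ?_) (by norm_num)
    rw [mul_sum]
    exact sum_le_sum fun i _ => hfa i
  have hτsum : ∀ i, ∑ s, τ i s ≤ m * a₂ i := by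
    intro i
    calc ∑ s, τ i s ≤ ∑ s, ∑ ω ∈ U (u + i), m * runOp p ω u i (ind s (Q (u + i) s)) y b := by
          refine sum_le_sum fun s _ => ?_
          have hnn : ∀ ω ∈ U (u + i), 0 ≤ runOp p ω u i (ind s (Q (u + i) s)) y b := fun ω hω =>
            runOp_nonneg (hU0 i ω hω) _ _ (ind_nonneg s (hQ _ s).nonneg) _ _
          refine (sum_le_sum fun ω hω => ?_).trans (sum_le_sum_of_subset_of_nonneg
            (hWU (u + i) s) fun ω hω _ => mul_nonneg (Nat.cast_nonneg m) (hnn ω hω))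
          have hω' := hWU (u + i) s hω
          refine (sum_le_card_nsmul _ _ (runOp p ω u i (ind s (Q (u + i) s)) y b) fun ψ hψ =>
            runOp_mono (hU0 i ω hω') _ _ (ind_mono s (hQD (u + i) s ψ hψ)) _ _).trans ?_
          rw [nsmul_eq_mul]
          exact mul_le_mul_of_nonneg_right (by exact_mod_cast hm (u + i) s) (hnn ω hω')
      _ = m * a₂ i := by
          simp only [ha₂]
          rw [sum_comm, mul_sum]
          refine sum_congr rfl fun ω _ => ?_
          rw [runOp_eq_sum_ind (p := p) ω u i (Q (u + i)) y b, mul_sum]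
  have ha₁0 : ∀ i, 0 ≤ a₁ i := fun i => sum_nonneg fun ω hω => mul_nonneg (Nat.cast_nonneg _)
    (runOp_nonneg (hU0 i ω hω) _ _ (fun s v => (stepOp_sn (unifPol_isPol.nonneg _) _ (hQ _) s).nonneg v)
      _ _)
  have hwb : wordBound p Q U N u y b = ∑ i ∈ range (N - u), (a₁ i + a₂ i) := by
    simp only [wordBound, ha₁, ha₂, sum_add_distrib]
  have hlt : ∑ i ∈ range (N - u), ∑ s, 3 * (m + 1) * (B * τ i s + D₁ * l1 b) ≤
      3 * (m + 1) * B * m * ∑ i ∈ range (N - u), (a₁ i + a₂ i)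
        + 3 * (m + 1) * D₁ * N * Fintype.card S * l1 b := by
    calc _ ≤ ∑ i ∈ range (N - u), (3 * (m + 1) * B * m * (a₁ i + a₂ i)
            + 3 * (m + 1) * D₁ * Fintype.card S * l1 b) := by
          refine sum_le_sum fun i _ => ?_
          rw [← mul_sum, sum_add_distrib, ← mul_sum, sum_const, card_univ, nsmul_eq_mul]
          have h1 := hτsum i
          have h2 : (m : ℝ) * a₂ i ≤ m * (a₁ i + a₂ i) :=
            mul_le_mul_of_nonneg_left (le_add_of_nonneg_left (ha₁0 i)) (Nat.cast_nonneg m)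
          have h3 : (0 : ℝ) ≤ 3 * (m + 1) * B := by positivity
          have h4 := mul_le_mul_of_nonneg_left (h1.trans h2) h3
          linarith
      _ ≤ _ := by
          rw [sum_add_distrib, ← mul_sum, sum_const, card_range, nsmul_eq_mul]
          refine add_le_add le_rfl ?_
          have h5 : ((N - u : ℕ) : ℝ) ≤ N := by exact_mod_cast Nat.sub_le N u
          have h6 : 0 ≤ 3 * (m + 1) * D₁ * Fintype.card S * l1 b := by positivity
          have := mul_le_mul_of_nonneg_right h5 h6
          linarith
  rw [hwb]
  refine hdecomp.trans ((add_le_add hEu hlt).trans (le_of_eq ?_))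
  rw [hCw]; ring

end Stage
end
end LMDP

/-! ### Coverage of flows, and the case of a single context -/

namespace LMDP
noncomputable section
open Finset

section Cover

variable {S A O ι₁ ι₂ : Type*} [Fintype S] [Fintype A] [Fintype O] [DecidableEq S]
  [Fintype ι₁] [Fintype ι₂]

/-- On the second family, the flow of `π` from `y` to `s`, measured by `φ`, is controlled by the
flows of the words in `W`, up to an error. -/
def Covers (p : Ker S A O (ι₁ ⊕ ι₂)) (π : Pol S A) (u i : ℕ) (y s : S) (W : Finset (Pol S A))
    (B D : ℝ) (φ ψ : (ι₁ ⊕ ι₂ → ℝ) → ℝ) : Prop :=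
  ∀ v : ι₁ ⊕ ι₂ → ℝ, (∀ k, v (Sum.inl k) = 0) → runOp p π u i (ind s φ) y v ≤
    B * (∑ ω ∈ W, runOp p ω u i (ind s φ) y v) + D * ψ v

namespace Covers
variable {p : Ker S A O (ι₁ ⊕ ι₂)} {π : Pol S A} {u i : ℕ} {y s : S} {W : Finset (Pol S A)}
  {B D : ℝ}

theorem mul {φ ψ : (ι₁ ⊕ ι₂ → ℝ) → ℝ} (h : Covers p π u i y s W B D φ ψ) (z : ι₁ ⊕ ι₂ → ℝ) :
    Covers p π u i y s W B D (fun v => φ (v * z)) fun v => ψ (v * z) := by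
  intro v hv
  have e : ind s (fun v => φ (v * z)) = fun s' v => ind s φ s' (v * z) := rfl
  simp only [e, runOp_mul]
  exact h (v * z) fun k => by simp [hv k]

theorem sum {κ : Type*} {I : Finset κ} {φ ψ : κ → (ι₁ ⊕ ι₂ → ℝ) → ℝ}
    (h : ∀ x ∈ I, Covers p π u i y s W B D (φ x) (ψ x)) :
    Covers p π u i y s W B D (fun v => ∑ x ∈ I, φ x v) fun v => ∑ x ∈ I, ψ x v := by
  intro v hv
  have e : ind s (fun v => ∑ x ∈ I, φ x v) = fun s' v => ∑ x ∈ I, ind s (φ x) s' v := by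
    funext s' v; unfold ind; split_ifs <;> simp
  simp only [e, runOp_sum_fun]
  rw [sum_comm, mul_sum, mul_sum, ← sum_add_distrib]
  exact sum_le_sum fun x hx => h x hx v hv

theorem const_mul {φ ψ : (ι₁ ⊕ ι₂ → ℝ) → ℝ} (h : Covers p π u i y s W B D φ ψ) {c : ℝ}
    (hc : 0 ≤ c) : Covers p π u i y s W B D (fun v => c * φ v) fun v => c * ψ v := by
  intro v hv
  have e : ind s (fun v => c * φ v) = fun s' v => c * ind s φ s' v := by
    funext s' v; unfold ind; split_ifs <;> simp
  simp only [e, runOp_const_mul]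
  rw [← mul_sum]
  have := mul_le_mul_of_nonneg_left (h v hv) hc
  linarith

theorem stepOp {α : S → A → ℝ} (hα : ∀ s a, 0 ≤ α s a) {φ ψ : Fnl S (ι₁ ⊕ ι₂)} (t : ℕ)
    (h : ∀ s', Covers p π u i y s W B D (φ s') (ψ s')) (s' : S) :
    Covers p π u i y s W B D (stepOp p α t φ s') (LMDP.stepOp p α t ψ s') :=
  sum fun a _ => (sum fun _ _ => sum fun _ _ => (h _).mul _).const_mul (hα s' a)

theorem runOp {σ : Pol S A} (hσ : ∀ t s a, 0 ≤ σ t s a) {φ ψ : Fnl S (ι₁ ⊕ ι₂)} (t n : ℕ)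
    (h : ∀ s', Covers p π u i y s W B D (φ s') (ψ s')) (s' : S) :
    Covers p π u i y s W B D (runOp p σ t n φ s') (LMDP.runOp p σ t n ψ s') := by
  induction n generalizing t s' with
  | zero => exact h s'
  | succ n ih => exact stepOp (hσ t) t (fun s' => ih (t + 1) s') s'

theorem gap (hp : IsKer p) {σ : Pol S A} (hσ : IsPol σ)
    (h : Covers p π u i y s W B D (fun v => |∑ k, v k|) l1) (N l : ℕ) (s' : S) :
    Covers p π u i y s W B D (gap p N σ l s') l1 := by
  have := runOp hσ.nonneg (φ := absSum) (ψ := fun _ => l1) l (N - l) (fun _ => h) s'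
  rwa [show LMDP.runOp p σ l (N - l) (fun _ => l1) s' = l1 from
    funext fun v => runOp_l1 hp hσ l (N - l) s' v] at this

end Covers

variable [Nonempty A] {p : Ker S A O (ι₁ ⊕ ι₂)}

/-- Telescoping against the reference process `k₀`. -/
theorem gap_le_telescope (hp : IsKer p) {π : Pol S A} (hπ : IsPol π) (k₀ : ι₁ ⊕ ι₂) (n t : ℕ)
    (s : S) (v : ι₁ ⊕ ι₂ → ℝ) :
    runOp p π t n absSum s v ≤ |∑ k, v k| + ∑ i ∈ range n, runOp p π t i (fun s v =>
      ∑ a, π (t + i) s a * ∑ o, ∑ s', |∑ k, (v * fun k => p (t + i) s a o s' k -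
        p (t + i) s a o s' k₀) k|) s v := by
  induction n generalizing t s v with
  | zero => simp [absSum]
  | succ n ih =>
    rw [sum_range_succ', runOp_succ]
    refine (stepOp_mono (hπ.nonneg t) (fun s v => ih (t + 1) s v) s v).trans ?_
    rw [stepOp_add, stepOp_sum_fun]
    dsimp only
    have h1 : stepOp p (π t) t (fun _ v => |∑ k, v k|) s v ≤ |∑ k, v k| +
        ∑ a, π t s a * ∑ o, ∑ s', |∑ k, (v * fun k => p t s a o s' k - p t s a o s' k₀) k| := by
      have h2 : ∀ a, ∑ o, ∑ s', |∑ k, (v * p t s a o s') k| ≤ |∑ k, v k| +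
          ∑ o, ∑ s', |∑ k, (v * fun k => p t s a o s' k - p t s a o s' k₀) k| := by
        intro a
        have h3 : |∑ k, v k| = ∑ o, ∑ s', |∑ k, v k| * p t s a o s' k₀ := by
          simp_rw [← mul_sum, hp.sum_eq, mul_one]
        rw [h3, ← sum_add_distrib]
        refine sum_le_sum fun o _ => ?_
        rw [← sum_add_distrib]
        refine sum_le_sum fun s' _ => ?_
        have h4 : ∑ k, (v * p t s a o s') k = (∑ k, v k) * p t s a o s' k₀ +
            ∑ k, (v * fun k => p t s a o s' k - p t s a o s' k₀) k := by
          rw [sum_mul, ← sum_add_distrib]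
          exact sum_congr rfl fun k _ => by simp only [Pi.mul_apply]; ring
        rw [h4]
        refine (abs_add_le _ _).trans ?_
        rw [abs_mul, abs_of_nonneg (hp.nonneg _ _ _ _ _ _)]
      calc _ ≤ ∑ a, π t s a * (|∑ k, v k| +
            ∑ o, ∑ s', |∑ k, (v * fun k => p t s a o s' k - p t s a o s' k₀) k|) :=
          sum_le_sum fun a _ => mul_le_mul_of_nonneg_left (h2 a) (hπ.nonneg _ _ _)
        _ = _ := by simp only [mul_add, sum_add_distrib, ← sum_mul, hπ.sum_eq, one_mul]
    simp only [runOp_zero, add_zero]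
    have e : ∀ i, t + 1 + i = t + (i + 1) := fun i => by omega
    simp only [e, runOp_succ]
    linarith

/-- With a single positive weight in the first family, that process serves as a reference.
Telescoping bounds the gap by one-step deviations from it, in which the reference process itself
drops out. Hence only the second family enters and `π` may be replaced by the covering words up to
the deviating step; there `π` is replaced by a uniformly random action. -/
theorem base {N u : ℕ} {y : S} {π : Pol S A} (hp : IsKer p) (hπ : IsPol π) (huN : u < N)
    {B D₁ : ℝ} (hB : 1 ≤ B) (hD₁ : 0 ≤ D₁) [Nonempty ι₁]
    {W : ℕ → S → Finset (Pol S A)} {U : ℕ → Finset (Pol S A)}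
    (hWU : ∀ l s, W l s ⊆ U l) (hU : ∀ l, ∀ ω ∈ U l, IsPol ω) (hUu : (U u).Nonempty)
    (hcov : ∀ i s, u + i < N →
      Covers p π u i y s (W (u + i) s) B D₁ (fun v => |∑ k, v k|) l1)
    {Q : ℕ → Fnl S (ι₁ ⊕ ι₂)} (hQ : ∀ l s, Sn (Q l s)) (hQ0 : ∀ l s v, |∑ k, v k| ≤ Q l s v)
    {b : ι₁ ⊕ ι₂ → ℝ} (hb : PosType 1 b) :
    gap p N π u y b ≤ 2 * B * wordBound p Q U N u y b
      + 2 * D₁ * N * Fintype.card S * l1 b := by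
  classical
  obtain ⟨hb0, hb1⟩ := hb
  -- the reference process
  obtain ⟨k₀, hk₀⟩ : ∃ k₀ : ι₁, ∀ k, k ≠ k₀ → b (Sum.inl k) = 0 := by
    by_cases h : ∃ k, 0 < b (Sum.inl k)
    · obtain ⟨k₀, h0⟩ := h
      refine ⟨k₀, fun k hk => ?_⟩
      by_contra hne
      exact hk (card_le_one.1 hb1 k (by simp [(hb0 k).lt_of_ne (Ne.symm hne)]) k₀ (by simp [h0]))
    · push Not at h
      exact ⟨Classical.arbitrary _, fun k _ => le_antisymm (h k) (hb0 k)⟩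
  set z : ℕ → S → A → O → S → ι₁ ⊕ ι₂ → ℝ := fun t s a o s' k =>
    p t s a o s' k - p t s a o s' (Sum.inl k₀) with hz
  set Ξ : ℕ → Fnl S (ι₁ ⊕ ι₂) := fun t s v =>
    ∑ a, π t s a * ∑ o, ∑ s', |∑ k, (v * z t s a o s') k| with hΞ
  have htel : gap p N π u y b ≤ |∑ k, b k| + ∑ i ∈ range (N - u), runOp p π u i (Ξ (u + i)) y b :=
    gap_le_telescope hp hπ (Sum.inl k₀) (N - u) u y b
  -- The deviation vanishes at `k₀`, and the other weights of the first family are zero.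
  have hbz : ∀ t s a o s', inrPart b * z t s a o s' = b * z t s a o s' := by
    intro t s a o s'
    funext k
    rcases k with k | k
    · by_cases hk : k = k₀
      · simp [hz, hk]
      · simp [inrPart, hk₀ k hk]
    · simp [inrPart]
  have hΞb : ∀ (σ : Pol S A) i s,
      runOp p σ u i (ind s (Ξ (u + i) s)) y (inrPart b) = runOp p σ u i (ind s (Ξ (u + i) s)) y b := by
    intro σ i s
    have e : ind s (Ξ (u + i) s) = fun s' v => ∑ a, ∑ o, ∑ s'', π (u + i) s a *
        ind s (fun v => |∑ k, v k|) s' (v * z (u + i) s a o s'') := by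
      funext s' v; unfold ind; split_ifs <;> simp [hΞ, mul_sum]
    simp only [e, runOp_sum_fun, runOp_const_mul]
    refine sum_congr rfl fun a _ => sum_congr rfl fun o _ => sum_congr rfl fun s' _ => ?_
    rw [runOp_mul, runOp_mul, hbz]
  -- The deviation is the weight after the step minus the weight before it, redistributed by the
  -- reference kernel. Both parts are measurable by tests, the first after a uniformly random
  -- action.
  have hΞQ : ∀ i s v, Ξ (u + i) s v ≤ Fintype.card A *
      stepOp p (unifPol S A (u + i)) (u + i) (Q (u + i + 1)) s v + Q (u + i) s v := by
    intro i s v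
    have h1 : Ξ (u + i) s v ≤ stepOp p (π (u + i)) (u + i) absSum s v + |∑ k, v k| := by
      have h3 : |∑ k, v k| = ∑ a, π (u + i) s a *
          ∑ o, ∑ s', |∑ k, v k| * p (u + i) s a o s' (Sum.inl k₀) := by
        simp_rw [← mul_sum, hp.sum_eq, mul_one, ← sum_mul, hπ.sum_eq, one_mul]
      rw [h3]
      simp only [hΞ, stepOp]
      rw [← sum_add_distrib]
      refine sum_le_sum fun a _ => ?_
      rw [← mul_add, ← sum_add_distrib]
      refine mul_le_mul_of_nonneg_left (sum_le_sum fun o _ => ?_) (hπ.nonneg _ _ _)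
      rw [← sum_add_distrib]
      refine sum_le_sum fun s' _ => ?_
      have h4 : ∑ k, (v * z (u + i) s a o s') k = ∑ k, (v * p (u + i) s a o s') k -
          (∑ k, v k) * p (u + i) s a o s' (Sum.inl k₀) := by
        rw [sum_mul, ← sum_sub_distrib]
        exact sum_congr rfl fun k _ => by simp only [hz, Pi.mul_apply]; ring
      rw [h4]
      refine (abs_sub _ _).trans ?_
      rw [abs_mul, abs_of_nonneg (hp.nonneg (u + i) s a o s' (Sum.inl k₀))]
      exact le_rfl
    refine h1.trans (add_le_add ?_ (hQ0 _ _ _))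
    refine (stepOp_le_unif (fun s a => hπ.le_one _ s a) _ (fun s v => abs_nonneg _) s v).trans ?_
    exact mul_le_mul_of_nonneg_left (stepOp_mono (unifPol_isPol.nonneg _) (hQ0 _) s v)
      (Nat.cast_nonneg _)
  set g : ℕ → ℝ := fun i => ∑ ω ∈ U (u + i), (Fintype.card A *
    runOp p ω u i (stepOp p (unifPol S A (u + i)) (u + i) (Q (u + i + 1))) y b
      + runOp p ω u i (Q (u + i)) y b) with hg
  have hΞ0 : ∀ i s v, 0 ≤ Ξ (u + i) s v := fun i s v => sum_nonneg fun a _ =>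
    mul_nonneg (hπ.nonneg _ _ _) (sum_nonneg fun o _ => sum_nonneg fun s' _ => abs_nonneg _)
  have hU0 : ∀ i, ∀ ω ∈ U (u + i), ∀ t s a, 0 ≤ ω t s a := fun i ω hω => (hU _ ω hω).nonneg
  have hterm : ∀ i ∈ range (N - u), runOp p π u i (Ξ (u + i)) y b ≤
      B * g i + 2 * D₁ * Fintype.card S * l1 b := by
    intro i hi
    have hi := mem_range.1 hi
    rw [runOp_eq_sum_ind]
    have h1 : ∀ s, runOp p π u i (ind s (Ξ (u + i) s)) y b ≤
        B * (∑ ω ∈ W (u + i) s, runOp p ω u i (ind s (Ξ (u + i) s)) y b) + D₁ * (2 * l1 b) := by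
      intro s
      have hc : Covers p π u i y s (W (u + i) s) B D₁ (Ξ (u + i) s) (fun v =>
          ∑ a, π (u + i) s a * ∑ o, ∑ s', l1 (v * z (u + i) s a o s')) :=
        Covers.sum fun a _ => (Covers.sum fun _ _ => Covers.sum fun _ _ =>
          (hcov i s (by omega)).mul _).const_mul (hπ.nonneg _ s a)
      have h2 := hc (inrPart b) fun k => rfl
      simp only [hΞb] at h2
      refine h2.trans (add_le_add le_rfl (mul_le_mul_of_nonneg_left ?_ hD₁))
      have h3 : ∀ a, ∑ o, ∑ s', l1 (inrPart b * z (u + i) s a o s') ≤ 2 * l1 (inrPart b) := by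
        intro a
        calc _ ≤ ∑ o, ∑ s', ∑ k, |inrPart b k| * (p (u + i) s a o s' k + p (u + i) s a o s' (Sum.inl k₀)) := by
              refine sum_le_sum fun o _ => sum_le_sum fun s' _ => sum_le_sum fun k _ => ?_
              rw [Pi.mul_apply, abs_mul]
              refine mul_le_mul_of_nonneg_left ?_ (abs_nonneg _)
              refine (abs_sub _ _).trans ?_
              rw [abs_of_nonneg (hp.nonneg _ _ _ _ _ _), abs_of_nonneg (hp.nonneg _ _ _ _ _ _)]
          _ = 2 * l1 (inrPart b) := by
              simp_rw [sum_comm (s := (univ : Finset S)) (t := (univ : Finset (ι₁ ⊕ ι₂))),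
                sum_comm (s := (univ : Finset O)) (t := (univ : Finset (ι₁ ⊕ ι₂))), ← mul_sum,
                sum_add_distrib, hp.sum_eq, l1, mul_sum]
              exact sum_congr rfl fun k _ => by ring
      calc _ ≤ ∑ a, π (u + i) s a * (2 * l1 b) := sum_le_sum fun a _ => mul_le_mul_of_nonneg_left
            ((h3 a).trans (by linarith [l1_inrPart_le b])) (hπ.nonneg _ _ _)
        _ = 2 * l1 b := by rw [← sum_mul, hπ.sum_eq, one_mul]
    refine (sum_le_sum fun s _ => h1 s).trans ?_
    rw [sum_add_distrib, sum_const, card_univ, nsmul_eq_mul, ← mul_sum]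
    refine add_le_add (mul_le_mul_of_nonneg_left ?_ (by linarith)) (le_of_eq (by ring))
    calc _ ≤ ∑ s, ∑ ω ∈ U (u + i), runOp p ω u i (ind s (Ξ (u + i) s)) y b :=
          sum_le_sum fun s _ => sum_le_sum_of_subset_of_nonneg (hWU (u + i) s) fun ω hω _ =>
            runOp_nonneg (hU0 i ω hω) _ _ (ind_nonneg s (hΞ0 i s)) _ _
      _ = ∑ ω ∈ U (u + i), runOp p ω u i (Ξ (u + i)) y b := by
          rw [sum_comm]
          exact sum_congr rfl fun ω _ => (runOp_eq_sum_ind ω u i _ y b).symm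
      _ ≤ g i := sum_le_sum fun ω hω => by
          refine (runOp_mono (hU0 i ω hω) u i (hΞQ i) y b).trans (le_of_eq ?_)
          rw [runOp_add_fun (φ' := Q (u + i)), runOp_const_mul]
  have hg0 : ∀ i, 0 ≤ g i := fun i => sum_nonneg fun ω hω => add_nonneg
    (mul_nonneg (Nat.cast_nonneg _) (runOp_nonneg (hU0 i ω hω) _ _
      (fun s v => (stepOp_sn (unifPol_isPol.nonneg _) _ (hQ _) s).nonneg v) _ _))
    (runOp_nonneg (hU0 i ω hω) _ _ (fun s v => (hQ _ s).nonneg v) _ _)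
  have hwb : wordBound p Q U N u y b = ∑ i ∈ range (N - u), g i := rfl
  -- The initial term of the telescope is the term `i = 0` of the bound, the word being empty.
  have hstart : |∑ k, b k| ≤ wordBound p Q U N u y b := by
    obtain ⟨ω, hω⟩ := hUu
    rw [hwb]
    refine le_trans ?_ (single_le_sum (fun i _ => hg0 i) (mem_range.2 (show 0 < N - u by omega)))
    refine le_trans ?_ (single_le_sum (fun ω hω => add_nonneg
      (mul_nonneg (Nat.cast_nonneg _) (runOp_nonneg (hU0 0 ω hω) _ _
        (fun s v => (stepOp_sn (unifPol_isPol.nonneg _) _ (hQ _) s).nonneg v) _ _))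
      (runOp_nonneg (hU0 0 ω hω) _ _ (fun s v => (hQ _ s).nonneg v) _ _)) hω)
    refine le_add_of_nonneg_of_le (mul_nonneg (Nat.cast_nonneg _) (runOp_nonneg (hU0 0 ω hω) _ _
        (fun s v => (stepOp_sn (unifPol_isPol.nonneg _) _ (hQ _) s).nonneg v) _ _)) ?_
    exact hQ0 _ _ _
  have hwb0 : 0 ≤ wordBound p Q U N u y b := (abs_nonneg _).trans hstart
  have hsum := sum_le_sum hterm
  rw [sum_add_distrib, ← mul_sum, ← hwb, sum_const, card_range, nsmul_eq_mul] at hsum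
  have h5 : ((N - u : ℕ) : ℝ) ≤ N := by exact_mod_cast Nat.sub_le N u
  have h6 : 0 ≤ 2 * D₁ * Fintype.card S * l1 b := by have := l1_nonneg b; positivity
  have h7 := mul_le_mul_of_nonneg_right h5 h6
  nlinarith

end Cover
end
end LMDP

/-! ### Segmented policies, and the recursion over the contexts -/

namespace LMDP
noncomputable section
open Finset

section Words

variable {S A : Type*} [Fintype S] [Fintype A] [DecidableEq S]

/-- `σ` is, from time `u` on, a segmented policy over `Ψ` with at most `q` checkpoints. -/
inductive Tst (Ψ : Finset (Pol S A)) (N : ℕ) (σ : Pol S A) : ℕ → ℕ → Prop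
  | done (q u : ℕ) (h : ∀ t, u ≤ t → σ t = unifPol S A t) : Tst Ψ N σ q u
  | cons (q u τ : ℕ) (ψ : Pol S A) (hψ : ψ ∈ Ψ) (hu : u ≤ τ) (hN : τ < N)
      (h : ∀ t, u ≤ t → t < τ → σ t = ψ t) (hτ : σ τ = ψ τ ∨ σ τ = unifPol S A τ)
      (h' : Tst Ψ N σ q (τ + 1)) : Tst Ψ N σ (q + 1) u

theorem Tst.mono {Ψ : Finset (Pol S A)} {N q q' u : ℕ} {σ : Pol S A} (h : Tst Ψ N σ q u)
    (hq : q ≤ q') : Tst Ψ N σ q' u := by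
  induction h generalizing q' with
  | done q u h => exact Tst.done q' u h
  | cons q u τ ψ hψ hu hN h hτ _ ih =>
    obtain ⟨r, rfl⟩ : ∃ r, q' = r + 1 := ⟨q' - 1, by omega⟩
    exact Tst.cons r u τ ψ hψ hu hN h hτ (ih (by omega))

theorem Tst.congr {Ψ : Finset (Pol S A)} {N q u : ℕ} {σ σ' : Pol S A} (h : Tst Ψ N σ q u)
    (hσ : ∀ t, u ≤ t → σ' t = σ t) : Tst Ψ N σ' q u := by
  induction h with
  | done q u h => exact Tst.done q u fun t ht => (hσ t ht).trans (h t ht)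
  | cons q u τ ψ hψ hu hN h hτ _ ih =>
    refine Tst.cons q u τ ψ hψ hu hN (fun t h1 h2 => (hσ t h1).trans (h t h1 h2)) ?_
      (ih fun t ht => hσ t (by omega))
    rwa [hσ τ hu]

/-- `ω` is on `[u, l)` a concatenation of `r` policies of `Ψ`. -/
inductive Wrd (Ψ : Finset (Pol S A)) (ω : Pol S A) (l : ℕ) : ℕ → ℕ → Prop
  | nil : Wrd Ψ ω l 0 l
  | cons (r u t : ℕ) (ψ : Pol S A) (hψ : ψ ∈ Ψ) (hut : u < t) (h : ∀ i, u ≤ i → i < t → ω i = ψ i)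
      (h' : Wrd Ψ ω l r t) : Wrd Ψ ω l (r + 1) u

theorem Wrd.le {Ψ : Finset (Pol S A)} {ω : Pol S A} {l r u : ℕ} (h : Wrd Ψ ω l r u) : u ≤ l := by
  induction h with
  | nil => exact le_rfl
  | cons r u t ψ hψ hut h _ ih => omega

/-- Each segment costs one checkpoint, placed at its last time without intervention, where the old
policy is still played. -/
theorem Wrd.tst {Ψ : Finset (Pol S A)} {N q r u l : ℕ} {ω σ : Pol S A} (hw : Wrd Ψ ω l r u)
    (hl : l ≤ N) (hσ : ∀ t, u ≤ t → t < l → σ t = ω t) (h : Tst Ψ N σ q l) : Tst Ψ N σ (q + r) u := by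
  induction hw with
  | nil => exact h
  | cons r u t ψ hψ hut hag hw ih =>
    have htl := hw.le
    refine Tst.cons (q + r) u (t - 1) ψ hψ (by omega) (by omega)
      (fun i h1 h2 => (hσ i h1 (by omega)).trans (hag i h1 (by omega)))
      (Or.inl ((hσ _ (by omega) (by omega)).trans (hag _ (by omega) (by omega)))) ?_
    rw [show t - 1 + 1 = t by omega]
    exact ih fun i h1 h2 => hσ i (by omega) h2

/-- The random action after a nonempty word is free: it is an intervention at the checkpoint that
ends the last segment. Only after the empty word does it need a checkpoint of its own, behind an
empty segment of the uniform policy; hence `max r 1`. -/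
theorem Wrd.tst_unif {Ψ : Finset (Pol S A)} {N q r u l : ℕ} {ω σ : Pol S A} (hw : Wrd Ψ ω l r u)
    (hΨ : unifPol S A ∈ Ψ)
    (hl : l < N) (hσ : ∀ t, u ≤ t → t < l → σ t = ω t) (hσl : σ l = unifPol S A l)
    (h : Tst Ψ N σ q (l + 1)) : Tst Ψ N σ (q + max r 1) u := by
  induction hw with
  | nil => exact Tst.cons q l l _ hΨ le_rfl hl (fun t h1 h2 => by omega) (Or.inr hσl) h
  | cons r u t ψ hψ hut hag hw ih =>
    have htl := hw.le
    cases r with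
    | zero =>
      cases hw
      exact Tst.cons q u l ψ hψ hut.le hl
        (fun i h1 h2 => (hσ i h1 (by omega)).trans (hag i h1 (by omega))) (Or.inr hσl) h
    | succ r =>
      rw [show q + max (r + 1 + 1) 1 = (q + max (r + 1) 1) + 1 by omega]
      refine Tst.cons _ u (t - 1) ψ hψ (by omega) (by omega)
        (fun i h1 h2 => (hσ i h1 (by omega)).trans (hag i h1 (by omega)))
        (Or.inl ((hσ _ (by omega) (by omega)).trans (hag _ (by omega) (by omega)))) ?_
      rw [show t - 1 + 1 = t by omega]
      exact ih fun i h1 h2 => hσ i (by omega) h2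

/-- The properties of the test policies that start at time `u`. -/
structure IsTest (Ψ : Finset (Pol S A)) (N q u : ℕ) (σ : Pol S A) : Prop where
  isPol : IsPol σ
  before : ∀ t < u, σ t = unifPol S A t
  after : ∀ t, N ≤ t → σ t = unifPol S A t
  tst : Tst Ψ N σ q u

theorem isTest_unif [Nonempty A] (Ψ : Finset (Pol S A)) (N q u : ℕ) :
    IsTest Ψ N q u (unifPol S A) where
  isPol := unifPol_isPol
  before _ _ := rfl
  after _ _ := rfl
  tst := Tst.done _ _ fun _ _ => rfl

theorem IsTest.mono {Ψ : Finset (Pol S A)} {N q q' u : ℕ} {σ : Pol S A} (h : IsTest Ψ N q u σ)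
    (hq : q ≤ q') : IsTest Ψ N q' u σ := ⟨h.isPol, h.before, h.after, h.tst.mono hq⟩

end Words

section Recursion

variable {S A O ι₁ ι₂ : Type*} [Fintype S] [Fintype A] [Fintype O] [DecidableEq S] [Nonempty A]
  [Fintype ι₁] [Fintype ι₂]
variable {p : Ker S A O (ι₁ ⊕ ι₂)}

open Classical in
/-- A family of words from `y` at time `u` to the nodes `s` at time `l`, each a concatenation of at most
`R` policies of `Ψ`, that covers the flow of `π` on the second family. -/
structure WordFam (p : Ker S A O (ι₁ ⊕ ι₂)) (N : ℕ) (Ψ : Finset (Pol S A)) (π : Pol S A)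
    (u : ℕ) (y : S) (R w : ℕ) (B δ : ℝ) (W : ℕ → S → Finset (Pol S A)) : Prop where
  isPol : ∀ l s, ∀ ω ∈ W l s, IsPol ω
  word : ∀ l s, u ≤ l → ∀ ω ∈ W l s, ∃ r ≤ R, Wrd Ψ ω l r u
  canon : ∀ l s, ∀ ω ∈ W l s, ∀ t, t < u ∨ l ≤ t → ω t = unifPol S A t
  card : ∀ l, (univ.biUnion (W l)).card ≤ w
  start : ∀ s, W u s = {unifPol S A}
  covers : ∀ i s, 0 < i → u + i < N →
    Covers p π u i y s (W (u + i) s) B δ (fun v => |∑ k, v k|) l1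

/-- Node-wise domination of `π` by the policies in `D`, on the second family. -/
structure NodeFam (p : Ker S A O (ι₁ ⊕ ι₂)) (N : ℕ) (Ψ : Finset (Pol S A)) (π : Pol S A)
    (m : ℕ) (β δ : ℝ) (D : ℕ → S → Finset (Pol S A)) : Prop where
  subset : ∀ l s, D l s ⊆ Ψ
  card : ∀ l s, (D l s).card ≤ m
  gap_le : ∀ l s v, 0 < l → l < N → (∀ k, v (Sum.inl k) = 0) →
    gap p N π l s v ≤ β * (∑ ψ ∈ D l s, gap p N ψ l s v) + δ * l1 v

/-- The value of a family of tests, with an error term. -/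
def famBound (p : Ker S A O (ι₁ ⊕ ι₂)) (N : ℕ) (P E : ℝ) (F : ℕ → Finset (Pol S A)) (l : ℕ) :
    Fnl S (ι₁ ⊕ ι₂) := fun s v => P * (∑ σ ∈ F l, gap p N σ l s v) + E * l1 v

theorem famBound_sn {N : ℕ} {P E : ℝ} (hP : 0 ≤ P) (hE : 0 ≤ E) {F : ℕ → Finset (Pol S A)} {l : ℕ}
    (hF : ∀ σ ∈ F l, IsPol σ) (s : S) : Sn (famBound p N P E F l s) :=
  ((Sn.sum _ fun σ hσ => gap_sn (hF σ hσ).nonneg l s).const_mul hP).add (Sn.l1.const_mul hE)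

open Classical in
/-- Turning the bound by words into a bound by a set of test policies. -/
theorem wordBound_le_tests {N u q f R w : ℕ} {y : S} {Ψ : Finset (Pol S A)} (hp : IsKer p)
    (hΨ : unifPol S A ∈ Ψ) (hR : 1 ≤ R) {P E : ℝ} (hP : 0 ≤ P) (hE : 0 ≤ E)
    {F : ℕ → Finset (Pol S A)} (hF : ∀ l, ∀ σ ∈ F l, IsTest Ψ N q l σ)
    (hf : ∀ l, (F l).card ≤ f) {U : ℕ → Finset (Pol S A)} (hUpol : ∀ l, ∀ ω ∈ U l, IsPol ω)
    (hUw : ∀ l, u ≤ l → ∀ ω ∈ U l, ∃ r ≤ R, Wrd Ψ ω l r u)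
    (hUc : ∀ l, ∀ ω ∈ U l, ∀ t, t < u ∨ l ≤ t → ω t = unifPol S A t) (hU : ∀ l, (U l).card ≤ w) :
    ∃ G : Finset (Pol S A), G.card ≤ N * (w * (2 * f)) ∧ (∀ σ ∈ G, IsTest Ψ N (q + R) u σ) ∧
      ∀ b, wordBound p (famBound p N P E F) U N u y b ≤
        (Fintype.card A + 1) * P * N * (∑ σ ∈ G, gap p N σ u y b)
          + (Fintype.card A + 1) * E * N * w * l1 b := by
  set I : ℕ → Finset (Pol S A) := fun i =>
    (U (u + i) ×ˢ (F (u + i) ∪ F (u + i + 1))).image fun x => splice (u + i) x.1 x.2 with hI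
  refine ⟨(range (N - u)).biUnion I, ?_, ?_, ?_⟩
  · refine card_biUnion_le.trans ((sum_le_card_nsmul _ _ (w * (2 * f)) fun i _ => ?_).trans ?_)
    · refine card_image_le.trans ?_
      rw [card_product]
      refine Nat.mul_le_mul (hU _) ((card_union_le _ _).trans ?_)
      have := hf (u + i); have := hf (u + i + 1); omega
    · rw [card_range, smul_eq_mul]
      exact Nat.mul_le_mul_right _ (Nat.sub_le _ _)
  · intro σ hσ
    simp only [hI, mem_biUnion, mem_range, mem_image, mem_product, Prod.exists] at hσ
    obtain ⟨i, hi, ω, χ, ⟨hω, hχ⟩, rfl⟩ := hσ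
    obtain ⟨r, hr, hw⟩ := hUw (u + i) (by omega) ω hω
    have hχp : IsPol χ ∧ ∀ t, N ≤ t → χ t = unifPol S A t := by
      rcases mem_union.1 hχ with h | h
      exacts [⟨(hF _ _ h).isPol, (hF _ _ h).after⟩, ⟨(hF _ _ h).isPol, (hF _ _ h).after⟩]
    have hag : ∀ t, u ≤ t → t < u + i → splice (u + i) ω χ t = ω t := fun t _ h => splice_of_lt h _ _
    refine ⟨(hUpol _ ω hω).splice hχp.1 _, fun t ht => ?_, fun t ht => ?_, ?_⟩
    · rw [splice_of_lt (by omega)]; exact hUc _ ω hω t (Or.inl ht)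
    · rw [splice_of_le (by omega)]; exact hχp.2 t ht
    · have htail : ∀ u', u + i ≤ u' → Tst Ψ N χ q u' → Tst Ψ N (splice (u + i) ω χ) q u' :=
        fun u' hu' h => h.congr fun t ht => splice_of_le (by omega) _ _
      rcases mem_union.1 hχ with h | h
      · exact (hw.tst (by omega) hag (htail _ le_rfl (hF _ _ h).tst)).mono (by omega)
      · refine (hw.tst_unif hΨ (by omega) hag ?_ (htail _ (by omega) (hF _ _ h).tst)).mono (by omega)
        rw [splice_of_le le_rfl]
        exact (hF _ _ h).before _ (by omega)
  · intro b
    have hUn : ∀ i, ∀ ω ∈ U (u + i), ∀ t s a, 0 ≤ ω t s a := fun i ω hω => (hUpol _ ω hω).nonneg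
    set G := (range (N - u)).biUnion I with hG
    have hGpol : ∀ i ∈ range (N - u), ∀ σ ∈ I i, IsPol σ := by
      intro i _ σ hσ
      simp only [hI, mem_image, mem_product, Prod.exists] at hσ
      obtain ⟨ω, χ, ⟨hω, hχ⟩, rfl⟩ := hσ
      refine (hUpol _ ω hω).splice ?_ _
      rcases mem_union.1 hχ with h | h
      exacts [(hF _ _ h).isPol, (hF _ _ h).isPol]
    have hA : (0 : ℝ) ≤ Fintype.card A := Nat.cast_nonneg _
    have hl1 := l1_nonneg b
    have hterm : ∀ i ∈ range (N - u), (∑ ω ∈ U (u + i), (Fintype.card A *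
        runOp p ω u i (stepOp p (unifPol S A (u + i)) (u + i) (famBound p N P E F (u + i + 1))) y b
          + runOp p ω u i (famBound p N P E F (u + i)) y b)) ≤
        (Fintype.card A + 1) * P * (∑ σ ∈ G, gap p N σ u y b) + (Fintype.card A + 1) * E * w * l1 b := by
      intro i hi
      have hiN := mem_range.1 hi
      have hgs : ∀ ω σ, runOp p ω u i (gap p N σ (u + i)) = gap p N (splice (u + i) ω σ) u := by
        intro ω σ
        -- Running a word up to a node and continuing with a test is again a test, the spliced one.
        rw [gap_splice (by omega) (by omega), Nat.add_sub_cancel_left]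
      have h1 : ∀ ω ∈ U (u + i), runOp p ω u i (famBound p N P E F (u + i)) y b =
          P * (∑ σ ∈ F (u + i), gap p N (splice (u + i) ω σ) u y b) + E * l1 b := by
        intro ω hω
        unfold famBound
        rw [runOp_add_fun (φ' := fun _ v => E * l1 v), runOp_const_mul, runOp_const_mul, runOp_sum_fun]
        dsimp only
        rw [runOp_l1 hp (hUpol _ ω hω)]
        simp only [hgs]
      have h2 : ∀ ω ∈ U (u + i), runOp p ω u i
          (stepOp p (unifPol S A (u + i)) (u + i) (famBound p N P E F (u + i + 1))) y b =
          P * (∑ σ ∈ F (u + i + 1), gap p N (splice (u + i) ω σ) u y b) + E * l1 b := by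
        intro ω hω
        unfold famBound
        rw [stepOp_add (φ' := fun _ v => E * l1 v), stepOp_const_mul, stepOp_const_mul, stepOp_sum_fun]
        rw [runOp_add_fun, runOp_const_mul, runOp_const_mul, runOp_sum_fun]
        dsimp only
        have e1 : stepOp p (unifPol S A (u + i)) (u + i) (fun _ => l1) = fun _ => l1 :=
          funext fun s => funext fun v => stepOp_l1 hp unifPol_isPol _ s v
        rw [e1, runOp_l1 hp (hUpol _ ω hω)]
        congr 2
        refine sum_congr rfl fun σ hσ => ?_
        have e2 : stepOp p (unifPol S A (u + i)) (u + i) (fun s v => gap p N σ (u + i + 1) s v)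
            = gap p N σ (u + i) := by
          rw [gap_step σ (show u + i < N by omega), (hF _ σ hσ).before _ (by omega)]
        rw [e2, hgs]
      set T : Pol S A → ℝ := fun ω => ∑ σ ∈ F (u + i) ∪ F (u + i + 1),
        gap p N (splice (u + i) ω σ) u y b with hT
      have hg0 : ∀ ω ∈ U (u + i), ∀ σ ∈ F (u + i) ∪ F (u + i + 1),
          0 ≤ gap p N (splice (u + i) ω σ) u y b := fun ω hω σ hσ =>
        (gap_sn (hGpol i hi _ (mem_image.2 ⟨(ω, σ), mem_product.2 ⟨hω, hσ⟩, rfl⟩)).nonneg _ _).nonneg _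
      have h3 : ∀ ω ∈ U (u + i), Fintype.card A *
          runOp p ω u i (stepOp p (unifPol S A (u + i)) (u + i) (famBound p N P E F (u + i + 1))) y b
          + runOp p ω u i (famBound p N P E F (u + i)) y b ≤
          (Fintype.card A + 1) * P * T ω + (Fintype.card A + 1) * E * l1 b := by
        intro ω hω
        rw [h1 ω hω, h2 ω hω]
        have k1 : ∑ σ ∈ F (u + i), gap p N (splice (u + i) ω σ) u y b ≤ T ω :=
          sum_le_sum_of_subset_of_nonneg subset_union_left fun σ hσ _ => hg0 ω hω σ hσ
        have k2 : ∑ σ ∈ F (u + i + 1), gap p N (splice (u + i) ω σ) u y b ≤ T ω :=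
          sum_le_sum_of_subset_of_nonneg subset_union_right fun σ hσ _ => hg0 ω hω σ hσ
        have k3 := mul_le_mul_of_nonneg_left k1 hP
        have k4 := mul_le_mul_of_nonneg_left (mul_le_mul_of_nonneg_left k2 hP) hA
        linarith
      -- Words and tests are uniform outside their time window, so a spliced policy determines its
      -- two parts and no summand is lost when pairs are collected into a set of policies.
      have h4 : ∑ ω ∈ U (u + i), T ω ≤ ∑ σ ∈ G, gap p N σ u y b := by
        have e : ∑ ω ∈ U (u + i), T ω = ∑ σ ∈ I i, gap p N σ u y b := by
          rw [hI, sum_image, sum_product]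
          rintro ⟨ω, σ⟩ hx ⟨ω', σ'⟩ hx' he
          simp only [coe_product, Set.mem_prod, mem_coe] at hx hx'
          have hb : ∀ σ ∈ F (u + i) ∪ F (u + i + 1), ∀ t < u + i, σ t = unifPol S A t := by
            intro σ hσ t ht
            rcases mem_union.1 hσ with h | h
            exacts [(hF _ _ h).before t ht, (hF _ _ h).before t (by omega)]
          have he' := fun t => congrFun he t
          refine Prod.ext (funext fun t => ?_) (funext fun t => ?_)
          · rcases lt_or_ge t (u + i) with ht | ht
            · have := he' t
              dsimp only at this
              rwa [splice_of_lt ht, splice_of_lt ht] at this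
            · exact (hUc _ ω hx.1 t (Or.inr ht)).trans (hUc _ ω' hx'.1 t (Or.inr ht)).symm
          · rcases lt_or_ge t (u + i) with ht | ht
            · exact (hb σ hx.2 t ht).trans (hb σ' hx'.2 t ht).symm
            · have := he' t
              dsimp only at this
              rwa [splice_of_le ht, splice_of_le ht] at this
        rw [e]
        refine sum_le_sum_of_subset_of_nonneg (subset_biUnion_of_mem I hi) fun σ hσ _ => ?_
        obtain ⟨j, hj, hσ⟩ := mem_biUnion.1 hσ
        exact (gap_sn (hGpol j hj σ hσ).nonneg _ _).nonneg _
      refine (sum_le_sum h3).trans ?_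
      rw [sum_add_distrib, ← mul_sum, sum_const, nsmul_eq_mul]
      have k5 := mul_le_mul_of_nonneg_left h4 (show 0 ≤ (Fintype.card A + 1) * P by positivity)
      have k6 : ((U (u + i)).card : ℝ) ≤ w := by exact_mod_cast hU (u + i)
      have k7 := mul_le_mul_of_nonneg_right k6 (show 0 ≤ (Fintype.card A + 1) * E * l1 b by positivity)
      linarith
    unfold wordBound
    refine (sum_le_sum hterm).trans ?_
    rw [sum_const, card_range, nsmul_eq_mul]
    have h5 : ((N - u : ℕ) : ℝ) ≤ N := by exact_mod_cast Nat.sub_le N u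
    have h6 : 0 ≤ ∑ σ ∈ G, gap p N σ u y b := sum_nonneg fun σ hσ => by
      obtain ⟨j, hj, hσ⟩ := mem_biUnion.1 hσ
      exact (gap_sn (hGpol j hj σ hσ).nonneg _ _).nonneg _
    have h7 : 0 ≤ (Fintype.card A + 1) * P * (∑ σ ∈ G, gap p N σ u y b)
      + (Fintype.card A + 1) * E * w * l1 b := by positivity
    have := mul_le_mul_of_nonneg_right h5 h7
    linarith

/-- Combines node-wise domination with coverage of the flow into the hypothesis that `stage` needs.
Gaps inherit coverage from the absolute total weight, being built from it by nonnegative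
combinations and multiplication of the weights. -/
theorem covers_sum_gap {N u i m : ℕ} {y s : S} {π : Pol S A} (hp : IsKer p)
    (hπ : IsPol π) {D W : Finset (Pol S A)} (hD : ∀ ψ ∈ D, IsPol ψ) (hm : D.card ≤ m)
    {β B δ δ' : ℝ} (hβ : 0 ≤ β) (hδ : 0 ≤ δ) (hδ' : 0 ≤ δ')
    (h : Covers p π u i y s W B δ' (fun v => |∑ k, v k|) l1) (l : ℕ) (v : ι₁ ⊕ ι₂ → ℝ)
    (hv : ∀ k, v (Sum.inl k) = 0) :
    runOp p π u i (ind s fun v => β * (∑ ψ ∈ D, gap p N ψ l s v) + δ * l1 v) y v ≤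
      β * B * (∑ ω ∈ W, ∑ ψ ∈ D, runOp p ω u i (ind s (gap p N ψ l s)) y v)
        + (β * m * δ' + δ) * l1 v := by
  have e : ind s (fun v : ι₁ ⊕ ι₂ → ℝ => β * (∑ ψ ∈ D, gap p N ψ l s v) + δ * l1 v) = fun s' v =>
      β * (∑ ψ ∈ D, ind s (gap p N ψ l s) s' v) + δ * ind s l1 s' v := by
    funext s' v; unfold ind; split_ifs <;> simp
  rw [e, runOp_add_fun (φ' := fun s' v => δ * ind s l1 s' v), runOp_const_mul, runOp_const_mul, runOp_sum_fun]
  dsimp only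
  have h1 : ∑ ψ ∈ D, runOp p π u i (ind s (gap p N ψ l s)) y v ≤ ∑ ψ ∈ D,
      (B * (∑ ω ∈ W, runOp p ω u i (ind s (gap p N ψ l s)) y v) + δ' * l1 v) :=
    sum_le_sum fun ψ hψ => h.gap hp (hD ψ hψ) N l s v hv
  have h2 : runOp p π u i (ind s l1) y v ≤ l1 v := by
    rw [← runOp_l1 hp hπ u i y v]
    refine runOp_mono hπ.nonneg u i (fun s' v => ?_) y v
    unfold ind; split_ifs
    exacts [le_rfl, l1_nonneg v]
  rw [sum_add_distrib, ← mul_sum, sum_comm, sum_const, nsmul_eq_mul] at h1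
  have hl1 := l1_nonneg v
  have h3 : (D.card : ℝ) * (δ' * l1 v) ≤ m * (δ' * l1 v) :=
    mul_le_mul_of_nonneg_right (by exact_mod_cast hm) (by positivity)
  have h4 := mul_le_mul_of_nonneg_left h1 hβ
  have h5 := mul_le_mul_of_nonneg_left h2 hδ
  have h6 := mul_le_mul_of_nonneg_left h3 hβ
  linarith

open Classical in
/-- One level of the recursion: from the tests `F` for `j` positive weights to tests for `j + 1`. -/
theorem exists_tests_step {N u q f R w j m : ℕ} {y : S} {Ψ : Finset (Pol S A)} {π : Pol S A}
    (hp : IsKer p) (hπ : IsPol π) (huN : u < N) [Nonempty ι₁]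
    (hΨ : unifPol S A ∈ Ψ) (hΨpol : ∀ ψ ∈ Ψ, IsPol ψ) (hR : 1 ≤ R)
    {β B δ δ' : ℝ} (hβ : 1 ≤ β) (hB : 1 ≤ B) (hδ : 0 ≤ δ) (hδ' : 0 ≤ δ')
    {D W : ℕ → S → Finset (Pol S A)} (hD : NodeFam p N Ψ π m β δ D)
    (hW : WordFam p N Ψ π u y R w B δ' W)
    {P E : ℝ} (hP : 1 ≤ P) (hE : 0 ≤ E)
    {F : ℕ → Finset (Pol S A)} (hF : ∀ l, ∀ σ ∈ F l, IsTest Ψ N q l σ)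
    (hf : ∀ l, (F l).card ≤ f) (hFu : ∀ l, unifPol S A ∈ F l)
    (hFD : 0 < j → ∀ l s, 0 < l → l < N → ∀ ψ ∈ D l s, ∃ σ ∈ F l, gap p N σ l = gap p N ψ l)
    (hFπ : 0 < j → ∀ l s v, u < l → l < N → PosType j v → gap p N π l s v ≤ famBound p N P E F l s v) :
    ∃ G : Finset (Pol S A), G.card ≤ N * (w * (2 * f)) ∧ (∀ σ ∈ G, IsTest Ψ N (q + R) u σ) ∧
      ∀ b, PosType (j + 1) b → gap p N π u y b ≤
        3 * (β * B) * (m + 1) * (m + 2) * (Fintype.card A + 1) * N * P * (∑ σ ∈ G, gap p N σ u y b)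
          + 3 * (β * B) * (m + 1) * (m + 2) * (Fintype.card A + 1) * N * w *
            (E + (β * m * δ' + δ + δ') * Fintype.card S) * l1 b := by
  have hUpol : ∀ l, ∀ ω ∈ univ.biUnion (W l), IsPol ω := by
    intro l ω hω; obtain ⟨s, -, hs⟩ := mem_biUnion.1 hω; exact hW.isPol l s ω hs
  have hWU : ∀ l s, W l s ⊆ univ.biUnion (W l) := fun l s => subset_biUnion_of_mem (W l) (mem_univ s)
  obtain ⟨G, hG1, hG2, hG3⟩ := wordBound_le_tests (p := p) (y := y) hp hΨ hR (zero_le_one.trans hP) hE hF hf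
    (U := fun l => univ.biUnion (W l)) hUpol
    (fun l hl ω hω => by obtain ⟨s, -, hs⟩ := mem_biUnion.1 hω; exact hW.word l s hl ω hs)
    (fun l ω hω => by obtain ⟨s, -, hs⟩ := mem_biUnion.1 hω; exact hW.canon l s ω hs) hW.card
  refine ⟨G, hG1, hG2, fun b hb => ?_⟩
  have hQ : ∀ l s, Sn (famBound p N P E F l s) := fun l s =>
    famBound_sn (zero_le_one.trans hP) hE (fun σ hσ => (hF l σ hσ).isPol) s
  have hg0 : ∀ l s v, ∀ σ ∈ F l, 0 ≤ gap p N σ l s v := fun l s v σ hσ =>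
    (gap_sn (hF l σ hσ).isPol.nonneg l s).nonneg v
  have hQmem : ∀ l s v, ∀ σ ∈ F l, gap p N σ l s v ≤ famBound p N P E F l s v := by
    intro l s v σ hσ
    have h1 := single_le_sum (f := fun σ => gap p N σ l s v) (hg0 l s v) hσ
    have h2 : 0 ≤ ∑ σ ∈ F l, gap p N σ l s v := sum_nonneg (hg0 l s v)
    have h3 := l1_nonneg v
    have h4 : 0 ≤ E * l1 v := by positivity
    unfold famBound
    nlinarith
  have hQ0 : ∀ l s v, |∑ k, v k| ≤ famBound p N P E F l s v := fun l s v =>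
    (absSum_le_gap hp unifPol_isPol l s v).trans (hQmem l s v _ (hFu l))
  have hw1 : 1 ≤ w := by
    refine le_trans ?_ (hW.card u)
    rw [Nat.succ_le_iff, card_pos]
    exact ⟨unifPol S A, mem_biUnion.2 ⟨y, mem_univ y, by rw [hW.start]; exact mem_singleton_self _⟩⟩
  have hl1 := l1_nonneg b
  have hw : (1 : ℝ) ≤ w := by exact_mod_cast hw1
  have hA : (0 : ℝ) ≤ Fintype.card A := Nat.cast_nonneg _
  have hSc : (0 : ℝ) ≤ Fintype.card S := Nat.cast_nonneg _
  have hN : (0 : ℝ) ≤ N := Nat.cast_nonneg _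
  have hm0 : (0 : ℝ) ≤ m := Nat.cast_nonneg _
  have hβB : 1 ≤ β * B := one_le_mul_of_one_le_of_one_le hβ hB
  set c : ℝ := 3 * (β * B) * (m + 1) * (m + 2) with hc
  have hc0 : 0 ≤ c := by positivity
  set D₁ : ℝ := β * m * δ' + δ + δ' with hD₁
  have hD₁0 : 0 ≤ D₁ := by positivity
  have hcm : 3 * (m + 1) ≤ c := by
    have h1 : (1 : ℝ) ≤ β * B * (m + 2) := one_le_mul_of_one_le_of_one_le hβB (by linarith)
    have : c = 3 * (m + 1) * (β * B * (m + 2)) := by rw [hc]; ring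
    rw [this]
    exact le_mul_of_one_le_right (by positivity) h1
  have key : gap p N π u y b ≤ c * wordBound p (famBound p N P E F) (fun l => univ.biUnion (W l)) N u y b
      + c * D₁ * N * Fintype.card S * l1 b := by
    rcases Nat.eq_zero_or_pos j with rfl | hj
    · have hcov : ∀ i s, u + i < N →
          Covers p π u i y s (W (u + i) s) B δ' (fun v => |∑ k, v k|) l1 := by
        intro i s hi
        rcases Nat.eq_zero_or_pos i with rfl | hi0
        -- At the start the only word is empty and makes no step, so coverage is an identity, and `1
        -- ≤ B`.
        · intro v _
          rw [add_zero, hW.start, sum_singleton]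
          simp only [runOp_zero]
          have h1 := ind_nonneg (ι := ι₁ ⊕ ι₂) s (fun v => abs_nonneg (∑ k, v k)) y v
          have := l1_nonneg v
          nlinarith [mul_nonneg hδ' this]
        · exact hW.covers i s hi0 hi
      have hb' := base hp hπ huN hB hδ' hWU hUpol ⟨unifPol S A, mem_biUnion.2 ⟨y, mem_univ y, by
        rw [hW.start]; exact mem_singleton_self _⟩⟩ hcov hQ hQ0 hb
      have hwb0 : 0 ≤ wordBound p (famBound p N P E F) (fun l => univ.biUnion (W l)) N u y b :=
        sum_nonneg fun i _ => sum_nonneg fun ω hω => add_nonneg (mul_nonneg hA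
          (runOp_nonneg (hUpol _ ω hω).nonneg _ _ (fun s v =>
            (stepOp_sn (unifPol_isPol.nonneg _) _ (hQ _) s).nonneg v) _ _))
          (runOp_nonneg (hUpol _ ω hω).nonneg _ _ (fun s v => (hQ _ s).nonneg v) _ _)
      have k1 : 2 * B ≤ c := by
        have : c = 3 * B * (β * (m + 1) * (m + 2)) := by rw [hc]; ring
        have h2 : 1 ≤ β * (m + 1) * (m + 2) :=
          one_le_mul_of_one_le_of_one_le (one_le_mul_of_one_le_of_one_le hβ (by linarith)) (by linarith)
        rw [this]; nlinarith
      have k2 : 2 * δ' * N * Fintype.card S * l1 b ≤ c * D₁ * N * Fintype.card S * l1 b := by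
        have h3 : δ' ≤ D₁ := by rw [hD₁]; have : 0 ≤ β * m * δ' := by positivity
                                linarith
        gcongr
        linarith
      exact hb'.trans (add_le_add (mul_le_mul_of_nonneg_right k1 hwb0) k2)
    · have hDpol : ∀ l s, ∀ ψ ∈ (if 0 < l ∧ l < N then D l s else ∅), IsPol ψ := by
        intro l s ψ hψ
        split_ifs at hψ
        · exact hΨpol ψ (hD.subset l s hψ)
        · simp at hψ
      -- Domination is known strictly between the times 0 and `N` only; elsewhere the families are
      -- replaced by empty ones, which `stage` never consults for the gap of `π`.
      have hs := stage (y := y) (m := m) (D₁ := β * m * δ' + δ)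
        (D := fun l s => if 0 < l ∧ l < N then D l s else ∅)
        (ν := fun l s v => β * (∑ ψ ∈ (if 0 < l ∧ l < N then D l s else ∅), gap p N ψ l s v) + δ * l1 v)
        hp hπ huN hβB (by positivity) hWU hUpol hDpol
        (fun l s => by split_ifs; exacts [hD.card l s, by simp]) (by rw [hW.start]; simp)
        (fun l s => ((Sn.sum _ fun ψ hψ => gap_sn (hDpol l s ψ hψ).nonneg l s).const_mul
          (by linarith)).add (Sn.l1.const_mul hδ))
        (fun l s v h1 h2 hv => by
          have : 0 < l ∧ l < N := ⟨by omega, h2⟩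
          simp only [this, and_self, if_true]
          exact hD.gap_le l s v this.1 h2 hv)
        (fun i s hi hiN v hv => by
          have : 0 < u + i ∧ u + i < N := ⟨by omega, hiN⟩
          simp only [this, and_self, if_true]
          exact covers_sum_gap hp hπ (fun ψ hψ => hΨpol ψ (hD.subset _ _ hψ)) (hD.card _ _)
            (by linarith) hδ hδ' (hW.covers i s hi hiN) (u + i) v hv)
        hQ hQ0
        (fun l s ψ hψ v => by
          split_ifs at hψ with hl
          · obtain ⟨σ, hσ, he⟩ := hFD hj l s hl.1 hl.2 ψ hψ
            rw [← he]
            exact hQmem l s v σ hσ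
          · simp at hψ)
        (fun l s v h1 h2 hv => hFπ hj l s v h1 h2 hv) hb
      refine hs.trans (add_le_add le_rfl ?_)
      have h3 : β * m * δ' + δ ≤ D₁ := by rw [hD₁]; linarith
      gcongr
  refine key.trans ((add_le_add (mul_le_mul_of_nonneg_left (hG3 b) hc0) le_rfl).trans ?_)
  have h8 : c * D₁ * N * Fintype.card S * l1 b ≤
      c * (Fintype.card A + 1) * N * w * (D₁ * Fintype.card S) * l1 b := by
    have : (1 : ℝ) ≤ (Fintype.card A + 1) * w := one_le_mul_of_one_le_of_one_le (by linarith) hw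
    calc _ = (c * D₁ * N * Fintype.card S * l1 b) * 1 := by ring
      _ ≤ (c * D₁ * N * Fintype.card S * l1 b) * ((Fintype.card A + 1) * w) :=
          mul_le_mul_of_nonneg_left this (by positivity)
      _ = _ := by ring
  linarith

/-- Families of tests, for all nodes, that control `π` on mixtures with `j` positive weights. -/
structure TestFam (p : Ker S A O (ι₁ ⊕ ι₂)) (N : ℕ) (Ψ : Finset (Pol S A)) (π : Pol S A)
    (D : ℕ → S → Finset (Pol S A)) (j q f : ℕ) (P E : ℝ) (F : ℕ → Finset (Pol S A)) : Prop where
  isTest : ∀ l, ∀ σ ∈ F l, IsTest Ψ N q l σ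
  card : ∀ l, (F l).card ≤ f
  unif_mem : ∀ l, unifPol S A ∈ F l
  exists_gap_eq : 0 < j → ∀ l s, 0 < l → l < N → ∀ ψ ∈ D l s, ∃ σ ∈ F l, gap p N σ l = gap p N ψ l
  gap_le : 0 < j → ∀ l s v, 0 < l → l < N → PosType j v → gap p N π l s v ≤ famBound p N P E F l s v

open Classical in
-- Iterates `exists_tests_step` at all nodes simultaneously. One level multiplies the price by `X`,
-- the resolution error essentially by `X * w`, and adds two checkpoints.
theorem exists_testFam {N w m : ℕ} {Ψ : Finset (Pol S A)} {π : Pol S A}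
    (hp : IsKer p) (hπ : IsPol π) (hN : 0 < N) [Nonempty ι₁] [Nonempty S]
    (hΨ : unifPol S A ∈ Ψ) (hΨpol : ∀ ψ ∈ Ψ, IsPol ψ)
    (hΨN : ∀ ψ ∈ Ψ, ∀ t, N ≤ t → ψ t = unifPol S A t) (hw : 1 ≤ w)
    {β B δ δ' : ℝ} (hβ : 1 ≤ β) (hB : 1 ≤ B) (hδ : 0 ≤ δ) (hδ' : 0 ≤ δ')
    {D : ℕ → S → Finset (Pol S A)} (hD : NodeFam p N Ψ π m β δ D)
    (hW : ∀ u y, 0 < u → u < N → ∃ W, WordFam p N Ψ π u y 2 w B δ' W)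
    {X : ℝ} (hX : X = 3 * (β * B) * (m + 1) * (m + 2) * (Fintype.card A + 1) * N) (j : ℕ) :
    ∃ F, TestFam p N Ψ π D j (2 * j) ((Fintype.card S * (N * w * (m + 3))) ^ j) (X ^ j)
      (j * (X * w) ^ j * ((β * m * δ' + δ + δ') * Fintype.card S)) F := by
  have hA : (0 : ℝ) ≤ Fintype.card A := Nat.cast_nonneg _
  have hm0 : (0 : ℝ) ≤ m := Nat.cast_nonneg _
  have hN1 : (1 : ℝ) ≤ N := by exact_mod_cast hN
  have hw1 : (1 : ℝ) ≤ w := by exact_mod_cast hw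
  have hX1 : 1 ≤ X := by
    have h1 : 1 ≤ β * B := one_le_mul_of_one_le_of_one_le hβ hB
    have h2 : 1 ≤ 3 * (β * B) := by linarith
    rw [hX]
    exact one_le_mul_of_one_le_of_one_le (one_le_mul_of_one_le_of_one_le
      (one_le_mul_of_one_le_of_one_le (one_le_mul_of_one_le_of_one_le h2 (by linarith))
        (by linarith)) (by linarith)) hN1
  have hXw : 1 ≤ X * w := one_le_mul_of_one_le_of_one_le hX1 hw1
  have hD₁ : 0 ≤ (β * m * δ' + δ + δ') * Fintype.card S := by positivity
  induction j with
  | zero =>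
    exact ⟨fun _ => {unifPol S A}, fun l σ hσ => by
      rw [mem_singleton.1 hσ]; exact isTest_unif Ψ N _ l, fun l => by simp,
      fun l => mem_singleton_self _, fun h => absurd h (by omega), fun h => absurd h (by omega)⟩
  | succ j ih =>
    obtain ⟨F, hF⟩ := ih
    have hstep : ∀ (l : ℕ) (s : S), ∃ G : Finset (Pol S A), 0 < l → l < N →
        G.card ≤ N * (w * (2 * (Fintype.card S * (N * w * (m + 3))) ^ j)) ∧
        (∀ σ ∈ G, IsTest Ψ N (2 * j + 2) l σ) ∧
        ∀ b, PosType (j + 1) b → gap p N π l s b ≤ X * X ^ j * (∑ σ ∈ G, gap p N σ l s b) +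
          X * w * (j * (X * w) ^ j * ((β * m * δ' + δ + δ') * Fintype.card S) +
            (β * m * δ' + δ + δ') * Fintype.card S) * l1 b := by
      intro l s
      by_cases hl : 0 < l ∧ l < N
      · obtain ⟨W, hWW⟩ := hW l s hl.1 hl.2
        obtain ⟨G, h1, h2, h3⟩ := exists_tests_step (R := 2) hp hπ hl.2 hΨ hΨpol (by norm_num) hβ hB hδ hδ' hD hWW
          (P := X ^ j) (E := j * (X * w) ^ j * ((β * m * δ' + δ + δ') * Fintype.card S))
          (one_le_pow₀ hX1) (by positivity) hF.isTest hF.card hF.unif_mem hF.exists_gap_eq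
          (fun hj l' s' v h1 h2 => hF.gap_le hj l' s' v (by omega) h2)
        refine ⟨G, fun _ _ => ⟨h1, h2, fun b hb => ?_⟩⟩
        have := h3 b hb
        rwa [← hX] at this
      · exact ⟨∅, fun h1 h2 => absurd ⟨h1, h2⟩ hl⟩
    choose G hG using hstep
    -- The dominating policies must be tests themselves at the next level. Made uniform before time
    -- `l`, they are tests with one checkpoint, and their gap from `l` on does not change.
    set can : ℕ → Pol S A → Pol S A := fun l ψ => splice l (unifPol S A) ψ with hcan
    have hgcan : ∀ l ψ, gap p N (can l ψ) l = gap p N ψ l := fun l ψ =>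
      gap_congr fun i h1 _ => splice_of_le h1 _ _
    refine ⟨fun l => if 0 < l ∧ l < N then
      insert (unifPol S A) (univ.biUnion fun s => G l s ∪ (D l s).image (can l)) else {unifPol S A},
      ?_, ?_, ?_, ?_, ?_⟩
    · intro l σ hσ
      split_ifs at hσ with hl
      · rcases mem_insert.1 hσ with rfl | hσ
        · exact isTest_unif Ψ N _ l
        obtain ⟨s, -, hs⟩ := mem_biUnion.1 hσ
        rcases mem_union.1 hs with h | h
        · exact (hG l s hl.1 hl.2).2.1 σ h
        · obtain ⟨ψ, hψ, rfl⟩ := mem_image.1 h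
          have hψΨ := hD.subset l s hψ
          refine ⟨unifPol_isPol.splice (hΨpol ψ hψΨ) l, fun t ht => splice_of_lt ht _ _, fun t ht => ?_, ?_⟩
          · simp only [hcan]
            rw [splice_of_le (by omega)]
            exact hΨN ψ hψΨ t ht
          · refine Tst.mono (q := 1) ?_ (by omega)
            refine Tst.cons 0 l (N - 1) ψ hψΨ (by omega) (by omega)
              (fun t h1 h2 => splice_of_le h1 _ _) (Or.inl (splice_of_le (by omega) _ _)) ?_
            refine Tst.done _ _ fun t ht => ?_
            simp only [hcan]
            rw [splice_of_le (by omega)]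
            exact hΨN ψ hψΨ t (by omega)
      · rw [mem_singleton.1 hσ]; exact isTest_unif Ψ N _ l
    · intro l
      have hS1 : 1 ≤ Fintype.card S := Fintype.card_pos
      have hf1 : 1 ≤ (Fintype.card S * (N * w * (m + 3))) ^ j := Nat.one_le_pow _ _ (by positivity)
      split_ifs with hl
      · refine (card_insert_le _ _).trans ?_
        have h1 : (univ.biUnion fun s => G l s ∪ (D l s).image (can l)).card ≤
            Fintype.card S * (N * (w * (2 * (Fintype.card S * (N * w * (m + 3))) ^ j)) + m) := by
          refine card_biUnion_le.trans ((sum_le_card_nsmul _ _ _ fun s _ => ?_).trans_eq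
            (by rw [card_univ, smul_eq_mul]))
          exact (card_union_le _ _).trans (add_le_add (hG l s hl.1 hl.2).1
            (card_image_le.trans (hD.card l s)))
        refine (add_le_add_left h1 1).trans ?_
        rw [pow_succ]
        set y := (Fintype.card S * (N * w * (m + 3))) ^ j
        have h2 : 1 ≤ N * w * y := Nat.one_le_iff_ne_zero.2 (by positivity)
        -- Per node, `2` stands for the tests with and without random action, `m` for the dominating
        -- policies, and a further `1` absorbs the uniform policy.
        calc _ ≤ Fintype.card S * (N * (w * (2 * y)) + m * (N * w * y)) + Fintype.card S * (N * w * y) := by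
              gcongr
              · exact Nat.le_mul_of_pos_right m h2
              · exact Nat.one_le_iff_ne_zero.2 (by positivity)
          _ = _ := by ring
      · rw [card_singleton]
        exact Nat.one_le_pow _ _ (by positivity)
    · intro l
      split_ifs
      exacts [mem_insert_self _ _, mem_singleton_self _]
    · intro _ l s h1 h2 ψ hψ
      refine ⟨can l ψ, ?_, hgcan l ψ⟩
      rw [if_pos ⟨h1, h2⟩]
      exact mem_insert_of_mem (mem_biUnion.2 ⟨s, mem_univ s, mem_union_right _ (mem_image_of_mem _ hψ)⟩)
    · intro _ l s v h1 h2 hv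
      refine ((hG l s h1 h2).2.2 v hv).trans ?_
      unfold famBound
      dsimp only
      rw [if_pos ⟨h1, h2⟩, pow_succ' X j]
      have hl1 := l1_nonneg v
      refine add_le_add (mul_le_mul_of_nonneg_left ?_ (by positivity)) (mul_le_mul_of_nonneg_right ?_ hl1)
      · refine sum_le_sum_of_subset_of_nonneg (fun σ hσ => mem_insert_of_mem
          (mem_biUnion.2 ⟨s, mem_univ s, mem_union_left _ hσ⟩)) fun σ hσ _ => ?_
        have : IsPol σ := by
          rcases mem_insert.1 hσ with rfl | hσ
          · exact unifPol_isPol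
          obtain ⟨s, -, hs⟩ := mem_biUnion.1 hσ
          rcases mem_union.1 hs with h | h
          · exact ((hG l s h1 h2).2.1 σ h).isPol
          · obtain ⟨ψ, hψ, rfl⟩ := mem_image.1 h
            exact unifPol_isPol.splice (hΨpol ψ (hD.subset l s hψ)) l
        exact (gap_sn this.nonneg _ _).nonneg _
      · set d := (β * m * δ' + δ + δ') * Fintype.card S
        have h3 : 1 ≤ (X * w) ^ j := one_le_pow₀ hXw
        have h4 : d ≤ (X * w) ^ j * d := le_mul_of_one_le_left hD₁ h3
        rw [pow_succ']
        push_cast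
        have h5 := mul_le_mul_of_nonneg_left h4 (zero_le_one.trans hXw)
        nlinarith

/-- All mixtures with `M ≥ 1` positive weights are controlled by tests from the start. -/
theorem exists_tests_start {N w w₀ m M : ℕ} {Ψ : Finset (Pol S A)} {π : Pol S A} {y : S} (hM : 1 ≤ M)
    (hp : IsKer p) (hπ : IsPol π) (hN : 0 < N) [Nonempty ι₁]
    (hΨ : unifPol S A ∈ Ψ) (hΨpol : ∀ ψ ∈ Ψ, IsPol ψ)
    (hΨN : ∀ ψ ∈ Ψ, ∀ t, N ≤ t → ψ t = unifPol S A t) (hw : 1 ≤ w)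
    {β B B₀ δ δ' : ℝ} (hβ : 1 ≤ β) (hB : 1 ≤ B) (hB₀ : 1 ≤ B₀) (hδ : 0 ≤ δ) (hδ' : 0 ≤ δ')
    {D : ℕ → S → Finset (Pol S A)} (hD : NodeFam p N Ψ π m β δ D)
    (hW : ∀ u y, 0 < u → u < N → ∃ W, WordFam p N Ψ π u y 2 w B δ' W)
    {W₀ : ℕ → S → Finset (Pol S A)} (hW₀ : WordFam p N Ψ π 0 y 1 w₀ B₀ δ' W₀)
    {X X₀ d : ℝ} (hX : X = 3 * (β * B) * (m + 1) * (m + 2) * (Fintype.card A + 1) * N)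
    (hX₀ : X₀ = 3 * (β * B₀) * (m + 1) * (m + 2) * (Fintype.card A + 1) * N)
    (hd : d = (β * m * δ' + δ + δ') * Fintype.card S) :
    ∃ G : Finset (Pol S A),
      G.card ≤ N * (w₀ * (2 * (Fintype.card S * (N * w * (m + 3))) ^ (M - 1))) ∧
      (∀ σ ∈ G, IsTest Ψ N (2 * M - 1) 0 σ) ∧ ∀ b, PosType M b → gap p N π 0 y b ≤
        X₀ * X ^ (M - 1) * (∑ σ ∈ G, gap p N σ 0 y b) +
          X₀ * w₀ * ((M - 1 : ℕ) * (X * w) ^ (M - 1) * d + d) * l1 b := by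
  have : Nonempty S := ⟨y⟩
  obtain ⟨F, hF⟩ := exists_testFam hp hπ hN hΨ hΨpol hΨN hw hβ hB hδ hδ' hD hW hX (M - 1)
  have hA : (0 : ℝ) ≤ Fintype.card A := Nat.cast_nonneg _
  have hN1 : (1 : ℝ) ≤ N := by exact_mod_cast hN
  have hX1 : 1 ≤ X := by
    have h1 : 1 ≤ β * B := one_le_mul_of_one_le_of_one_le hβ hB
    have h2 : 1 ≤ 3 * (β * B) := by linarith
    have hm0 : (0 : ℝ) ≤ m := Nat.cast_nonneg _
    rw [hX]
    exact one_le_mul_of_one_le_of_one_le (one_le_mul_of_one_le_of_one_le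
      (one_le_mul_of_one_le_of_one_le (one_le_mul_of_one_le_of_one_le h2 (by linarith))
        (by linarith)) (by linarith)) hN1
  -- From the null state one-segment words suffice: the `M - 1` inner levels use `2 * (M - 1)`
  -- checkpoints and this one a single further one.
  obtain ⟨G, h1, h2, h3⟩ := exists_tests_step (R := 1) hp hπ hN hΨ hΨpol le_rfl hβ hB₀ hδ hδ' hD hW₀
    (one_le_pow₀ hX1) (by positivity) hF.isTest hF.card hF.unif_mem hF.exists_gap_eq
    (fun hj l s v h1 h2 => hF.gap_le hj l s v h1 h2)
  refine ⟨G, h1, fun σ hσ => (h2 σ hσ).mono (by omega), fun b hb => ?_⟩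
  have := h3 b (by rwa [Nat.sub_add_cancel hM])
  rw [hX₀, hd]
  exact this

end Recursion
end
end LMDP

/-! ### From memoryless to history-dependent policies -/

namespace LMDP
noncomputable section
open Finset

section Reach
variable {S A O ι : Type*} [Fintype S] [Fintype A] [Fintype O] [DecidableEq S]
variable {p : Ker S A O ι}

theorem rch_eq_runOp (σ : Pol S A) (t n : ℕ) (y s : S) (k : ι) :
    rch p σ t n y s k = runOp p σ t n (fun s' v => (if s' = s then 1 else 0) * v k) y 1 := by
  rw [runOp_coord]; simp

theorem rch_succ_first (σ : Pol S A) (t n : ℕ) (y s : S) (k : ι) : rch p σ t (n + 1) y s k =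
    ∑ a, σ t y a * ∑ o, ∑ s', p t y a o s' k * rch p σ (t + 1) n s' s k := by
  rw [rch_eq_runOp, runOp_succ, stepOp]
  refine sum_congr rfl fun a _ => congrArg _ (sum_congr rfl fun o _ => sum_congr rfl fun s' _ => ?_)
  rw [runOp_coord]; simp

variable [Nonempty A]

open Classical in
/-- The policy that always plays `f t s`. -/
def detPol (f : ℕ → S → A) : Pol S A := fun t s a => if a = f t s then 1 else 0

theorem detPol_isPol (f : ℕ → S → A) : IsPol (detPol f) where
  nonneg t s a := by unfold detPol; split_ifs <;> norm_num
  sum_eq t s := by rw [sum_eq_single (f t s)] <;> simp +contextual [detPol]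

theorem sum_detPol (f : ℕ → S → A) (t : ℕ) (s : S) (g : A → ℝ) :
    ∑ a, detPol f t s a * g a = g (f t s) := by
  rw [sum_eq_single (f t s)] <;> simp +contextual [detPol]

/-- A memoryless policy can maximize the probability to reach a node, from all starting points
simultaneously. -/
theorem exists_max_rch (hp : ∀ t s a o s' k, 0 ≤ p t s a o s' k) (l : ℕ) (s : S) (k : ι) :
    ∃ ψ : Pol S A, IsPol ψ ∧ ∀ σ, IsPol σ → ∀ u n, u + n = l → ∀ y,
      rch p σ u n y s k ≤ rch p ψ u n y s k := by
  classical
  -- Backward dynamic programming; the index counts the remaining steps, so the time is `l - n`.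
  let best : ℕ → S → ℝ := fun n => Nat.rec (fun y => if y = s then 1 else 0)
    (fun n b y => univ.sup' univ_nonempty fun a => ∑ o, ∑ s', p (l - (n + 1)) y a o s' k * b s') n
  have hb : ∀ n y, best (n + 1) y = univ.sup' univ_nonempty fun a =>
    ∑ o, ∑ s', p (l - (n + 1)) y a o s' k * best n s' := fun _ _ => rfl
  have hact : ∀ n y, ∃ a, best (n + 1) y = ∑ o, ∑ s', p (l - (n + 1)) y a o s' k * best n s' := by
    intro n y
    obtain ⟨a, -, ha⟩ := exists_mem_eq_sup' (univ_nonempty (α := A)) fun a =>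
      ∑ o, ∑ s', p (l - (n + 1)) y a o s' k * best n s'
    exact ⟨a, ha⟩
  choose f hf using hact
  refine ⟨detPol fun t y => f (l - t - 1) y, detPol_isPol _, fun σ hσ u n hun y => ?_⟩
  have h1 : ∀ n u, u + n = l → ∀ y, rch p σ u n y s k ≤ best n y := by
    intro n
    induction n with
    | zero => intro u _ y; exact le_rfl
    | succ n ih =>
      intro u hu y
      rw [rch_succ_first, hb]
      calc _ ≤ ∑ a, σ u y a * univ.sup' univ_nonempty fun a =>
              ∑ o, ∑ s', p (l - (n + 1)) y a o s' k * best n s' := by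
            refine sum_le_sum fun a _ => mul_le_mul_of_nonneg_left ?_ (hσ.nonneg _ _ _)
            refine le_trans ?_ (le_sup' _ (mem_univ a))
            rw [show l - (n + 1) = u by omega]
            exact sum_le_sum fun o _ => sum_le_sum fun s' _ =>
              mul_le_mul_of_nonneg_left (ih (u + 1) (by omega) s') (hp _ _ _ _ _ _)
        _ = _ := by rw [← sum_mul, hσ.sum_eq, one_mul]
  have h2 : ∀ n u, u + n = l → ∀ y, rch p (detPol fun t y => f (l - t - 1) y) u n y s k = best n y := by
    intro n
    induction n with
    | zero => intro u _ y; rfl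
    | succ n ih =>
      intro u hu y
      rw [rch_succ_first, sum_detPol, show l - u - 1 = n by omega, hf,
        show l - (n + 1) = u by omega]
      exact sum_congr rfl fun o _ => sum_congr rfl fun s' _ => by rw [ih (u + 1) (by omega)]
  rw [h2 n u hun]
  exact h1 n u hun y

end Reach

section MaxVal
variable {S A O ι : Type*} [Fintype S] [Fintype A] [Fintype O] [DecidableEq S] [Nonempty A]
  [Fintype ι]
variable {p : Ker S A O ι}

variable (p) in
/-- The largest total variation that history-dependent actions can achieve in `n` steps. -/
def maxVal : ℕ → ℕ → Fnl S ι
  | _, 0 => absSum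
  | t, n + 1 => fun s b => univ.sup' univ_nonempty fun a =>
    ∑ o, ∑ s', maxVal (t + 1) n s' (b * p t s a o s')

theorem maxVal_succ (t n : ℕ) (s : S) (b : ι → ℝ) : maxVal p t (n + 1) s b =
    univ.sup' univ_nonempty fun a => ∑ o, ∑ s', maxVal p (t + 1) n s' (b * p t s a o s') := rfl

theorem maxVal_sn (t n : ℕ) (s : S) : Sn (maxVal p t n s) := by
  induction n generalizing t s with
  | zero => exact absSum_sn s
  | succ n ih =>
    have h : ∀ a, Sn fun b => ∑ o, ∑ s', maxVal p (t + 1) n s' (b * p t s a o s') := fun a =>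
      Sn.sum _ fun _ _ => Sn.sum _ fun s' _ => (ih (t + 1) s').mul_left _
    constructor
    · intro v w
      simp only [maxVal_succ]
      refine sup'_le _ _ fun a ha => ((h a).add_le v w).trans (add_le_add ?_ ?_)
      · exact le_sup' (fun a => ∑ o, ∑ s', maxVal p (t + 1) n s' (v * p t s a o s')) ha
      · exact le_sup' (fun a => ∑ o, ∑ s', maxVal p (t + 1) n s' (w * p t s a o s')) ha
    · intro c v
      simp only [maxVal_succ]
      rw [mul₀_sup' (abs_nonneg c)]
      exact sup'_congr _ rfl fun a _ => (h a).smul c v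

theorem maxVal_le_l1 (hp : IsKer p) (t n : ℕ) (s : S) (b : ι → ℝ) : maxVal p t n s b ≤ l1 b := by
  induction n generalizing t s b with
  | zero => exact absSum_le_l1 b
  | succ n ih =>
    rw [maxVal_succ]
    refine sup'_le _ _ fun a _ => ?_
    calc _ ≤ ∑ o, ∑ s', l1 (b * p t s a o s') := sum_le_sum fun _ _ => sum_le_sum fun _ _ => ih _ _ _
      _ = ∑ a', detPol (fun (_ : ℕ) (_ : S) => a) t s a' * ∑ o, ∑ s', l1 (b * p t s a' o s') := by
          rw [sum_detPol]
      _ = l1 b := stepOp_l1 hp (detPol_isPol _) t s b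

theorem exists_maxVal_eq (t n : ℕ) (s : S) (b : ι → ℝ) :
    ∃ a, maxVal p t (n + 1) s b = ∑ o, ∑ s', maxVal p (t + 1) n s' (b * p t s a o s') := by
  obtain ⟨a, -, ha⟩ := exists_mem_eq_sup' (univ_nonempty (α := A)) fun a =>
    ∑ o, ∑ s', maxVal p (t + 1) n s' (b * p t s a o s')
  exact ⟨a, ha⟩

/-- `Φ u` is, as seen from the start, a combination of tests of total weight `C`. -/
def Combo (p : Ker S A O ι) (y₀ : S) (c : ι → ℝ) (e : ℝ) (u : ℕ) (C : ℝ) (Φ : Fnl S ι) : Prop :=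
  ∀ ω, IsPol ω → runOp p ω 0 u Φ y₀ c ≤ C * e

theorem Combo.runOp {y₀ : S} {c : ι → ℝ} {e C : ℝ} {u n : ℕ} {Φ : Fnl S ι} {ψ : Pol S A}
    (hψ : IsPol ψ) (h : Combo p y₀ c e (u + n) C Φ) : Combo p y₀ c e u C (runOp p ψ u n Φ) := by
  intro ω hω
  have := h _ (hω.splice hψ u)
  rw [runOp_add, zero_add, runOp_congr (σ' := ψ) p Φ fun i h1 _ => splice_of_le h1 _ _] at this
  rwa [runOp_congr (σ' := ω) p _ fun i _ h2 => splice_of_lt (by omega) _ _] at this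

theorem Combo.stepOp {y₀ : S} {c : ι → ℝ} {e C : ℝ} {u : ℕ} {Φ : Fnl S ι} {ψ : Pol S A}
    (hψ : IsPol ψ) (h : Combo p y₀ c e (u + 1) C Φ) : Combo p y₀ c e u C (stepOp p (ψ u) u Φ) :=
  Combo.runOp (n := 1) hψ h

theorem Combo.add {y₀ : S} {c : ι → ℝ} {e C C' : ℝ} {u : ℕ} {Φ Φ' : Fnl S ι}
    (h : Combo p y₀ c e u C Φ) (h' : Combo p y₀ c e u C' Φ') :
    Combo p y₀ c e u (C + C') fun s v => Φ s v + Φ' s v := by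
  intro ω hω
  rw [runOp_add_fun]
  linarith [h ω hω, h' ω hω]

theorem Combo.sum {κ : Type*} {I : Finset κ} {y₀ : S} {c : ι → ℝ} {e C : ℝ} {u : ℕ} {Φ : κ → Fnl S ι}
    (h : ∀ x ∈ I, Combo p y₀ c e u C (Φ x)) :
    Combo p y₀ c e u (I.card * C) fun s v => ∑ x ∈ I, Φ x s v := by
  intro ω hω
  rw [runOp_sum_fun]
  refine (sum_le_card_nsmul _ _ (C * e) fun x hx => h x hx ω hω).trans_eq ?_
  rw [nsmul_eq_mul, mul_assoc]

theorem Combo.const_mul {y₀ : S} {c : ι → ℝ} {e C a : ℝ} (ha : 0 ≤ a) {u : ℕ} {Φ : Fnl S ι}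
    (h : Combo p y₀ c e u C Φ) : Combo p y₀ c e u (a * C) fun s v => a * Φ s v := by
  intro ω hω
  rw [runOp_const_mul, mul_assoc]
  exact mul_le_mul_of_nonneg_left (h ω hω) ha

theorem Combo.mono {y₀ : S} {c : ι → ℝ} {e C C' : ℝ} (he : 0 ≤ e) {u : ℕ} {Φ : Fnl S ι}
    (h : Combo p y₀ c e u C Φ) (hC : C ≤ C') : Combo p y₀ c e u C' Φ := fun ω hω =>
  (h ω hω).trans (mul_le_mul_of_nonneg_right hC he)

end MaxVal

section HistStage
variable {S A O ι₁ ι₂ : Type*} [Fintype S] [Fintype A] [Fintype O] [DecidableEq S] [Nonempty A]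
  [Fintype ι₁] [Fintype ι₂]
variable {p : Ker S A O (ι₁ ⊕ ι₂)}

/-- Nonnegative on the first family, nonpositive on the second one, and supported on `J`. -/
structure SignType (J : Finset (ι₁ ⊕ ι₂)) (b : ι₁ ⊕ ι₂ → ℝ) : Prop where
  inl : ∀ i, 0 ≤ b (Sum.inl i)
  inr : ∀ i, b (Sum.inr i) ≤ 0
  supp : ∀ k, k ∉ J → b k = 0

open Classical in
-- Unrolling as in `stage`, but without stopping. The word to a node maximises the probability of
-- reaching it in the context `m`. Since no policy does better, the price inequality in this context
-- bounds the multiplicities by one. Every remainder loses an element of `J`, whichever is exhausted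
-- first, and is covered by `Φ`.
theorem hist_stage {N : ℕ} (hp : IsKer p) {J : Finset (ι₁ ⊕ ι₂)}
    {m : ι₁ ⊕ ι₂} (hm : m ∈ J) {Φ : ℕ → Fnl S (ι₁ ⊕ ι₂)} (hΦ : ∀ u s, Sn (Φ u s))
    (hΦ0 : ∀ u s v, |∑ k, v k| ≤ Φ u s v)
    (hΦV : ∀ k ∈ J, ∀ u s v, u ≤ N → SignType (J.erase k) v → maxVal p u (N - u) s v ≤ Φ u s v)
    {ψ : ℕ → S → Pol S A} (hψ : ∀ l s, IsPol (ψ l s))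
    (hψm : ∀ l s σ, IsPol σ → ∀ u n, u + n = l → ∀ y,
      rch p σ u n y s m ≤ rch p (ψ l s) u n y s m) {u : ℕ} (hu : u ≤ N) (y : S)
    {b : ι₁ ⊕ ι₂ → ℝ} (hb : SignType J b) :
    maxVal p u (N - u) y b ≤
      (∑ i ∈ range (N - u), ∑ s, Fintype.card A * runOp p (ψ (u + i) s) u i
        (stepOp p (unifPol S A (u + i)) (u + i) (Φ (u + i + 1))) y b)
      + ∑ i ∈ range (N - u + 1), ∑ s, 2 * runOp p (ψ (u + i) s) u i (Φ (u + i)) y b := by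
  classical
  set n := N - u with hn
  set wd : ℕ → S → ι₁ ⊕ ι₂ → ℝ := fun l s => rch p (ψ l s) u (l - u) y s with hwd
  have hwdi : ∀ i s, wd (u + i) s = rch p (ψ (u + i) s) u i y s := fun i s => by
    simp only [hwd, Nat.add_sub_cancel_left]
  have hwd0 : ∀ l s k, 0 ≤ wd l s k := fun l s k => rch_nonneg hp.nonneg (hψ l s).nonneg _ _ _ _ _
  have hwuy : wd u y = 1 := by funext k; simp [hwd, rch]
  have hwp : ∀ t s a o s' k, 0 ≤ (wd t s * p t s a o s') k := fun t s a o s' k =>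
    mul_nonneg (hwd0 _ _ _) (hp.nonneg _ _ _ _ _ _)
  -- Going to `s` along its word and then playing `a` is one of the competitors for reaching `s'`.
  have hmono : ∀ i s a o s', wd (u + i) s m * p (u + i) s a o s' m ≤ wd (u + i + 1) s' m := by
    intro i s a o s'
    have h1 := hψm (u + i + 1) s' (splice (u + i) (ψ (u + i) s) (detPol fun _ _ => a))
      ((hψ _ _).splice (detPol_isPol _) _) u (i + 1) (by omega) y
    rw [show wd (u + i + 1) s' m = rch p (ψ (u + i + 1) s') u (i + 1) y s' m by
      rw [show u + i + 1 = u + (i + 1) by omega, hwdi]]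
    refine le_trans ?_ h1
    rw [rch_succ, splice_of_le le_rfl]
    refine le_trans ?_ (single_le_sum (f := fun s₀ => rch p (splice (u + i) (ψ (u + i) s)
      (detPol fun _ _ => a)) u i y s₀ m * ∑ a', detPol (fun _ _ => a) (u + i) s₀ a' *
        ∑ o, p (u + i) s₀ a' o s' m) (fun s₀ _ => mul_nonneg (rch_nonneg hp.nonneg
          ((hψ _ _).splice (detPol_isPol _) _).nonneg _ _ _ _ _) (sum_nonneg fun a' _ =>
            mul_nonneg ((detPol_isPol _).nonneg _ _ _) (sum_nonneg fun o _ => hp.nonneg _ _ _ _ _ _)))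
        (mem_univ s))
    rw [sum_detPol, rch_congr (σ' := ψ (u + i) s) (fun j _ h2 => splice_of_lt h2 _ _), hwdi]
    exact mul_le_mul_of_nonneg_left (single_le_sum (f := fun o => p (u + i) s a o s' m)
      (fun o _ => hp.nonneg _ _ _ _ _ _) (mem_univ o)) (rch_nonneg hp.nonneg (hψ _ _).nonneg _ _ _ _ _)
  set κ : ℕ → S → A → O → S → ℝ := fun t s a o s' =>
    if 0 < wd (t + 1) s' m then kil J (wd t s * p t s a o s') (wd (t + 1) s') else 0 with hκ
  have hκ0 : ∀ t s a o s', 0 ≤ κ t s a o s' := fun t s a o s' => by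
    simp only [hκ]; split_ifs
    exacts [kil_nonneg (hwp t s a o s'), le_rfl]
  have hκle : ∀ k ∈ J, ∀ t s a o s', κ t s a o s' * wd (t + 1) s' k ≤ wd t s k * p t s a o s' k := by
    intro k hk t s a o s'
    simp only [hκ]
    split_ifs
    · exact kil_mul_le (hwp t s a o s') (hwd0 _ _) hk
    · rw [zero_mul]; exact hwp t s a o s' k
  set V : ℕ → Fnl S (ι₁ ⊕ ι₂) := fun t => maxVal p t (N - t) with hV
  -- After the exchange the weights at a node no longer depend on the history, hence neither does
  -- the maximising action: `α` is memoryless.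
  have hVs : ∀ t s, ∃ a, t < N → V t s (b * wd t s) =
      ∑ o, ∑ s', V (t + 1) s' (b * wd t s * p t s a o s') := by
    intro t s
    by_cases ht : t < N
    · obtain ⟨a, ha⟩ := exists_maxVal_eq (p := p) t (N - (t + 1)) s (b * wd t s)
      refine ⟨a, fun _ => ?_⟩
      simp only [hV]
      rw [← ha, show N - (t + 1) + 1 = N - t by omega]
    · exact ⟨Classical.arbitrary A, fun h => absurd h ht⟩
  choose f hf using hVs
  set α := detPol f with hα
  have hαp : IsPol α := detPol_isPol f
  have hflow0 := flow_nonneg (u := u) (y := y) hκ0 hαp.nonneg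
  have hflow1 : ∀ i s, flow κ α u i y s ≤ 1 := by
    intro i s
    have hprice := flow_mul_le (p := p) (u := u) (y := y) (w := wd) (k := m) hαp.nonneg hκ0 hp.nonneg
      (by rw [hwuy]; exact le_rfl) (hκle m hm) i s
    rcases (hwd0 (u + i) s m).eq_or_lt with h0 | h0
    · cases i with
      | zero => rw [flow_zero]; split_ifs <;> norm_num
      | succ i =>
        rw [flow_succ]
        refine le_of_eq_of_le (sum_eq_zero fun s₀ _ => ?_) zero_le_one
        have : ∀ a o, κ (u + i) s₀ a o s = 0 := fun a o => by
          simp only [hκ]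
          exact if_neg (by rw [show u + i + 1 = u + (i + 1) by omega, ← h0]; exact lt_irrefl _)
        simp [this]
    · refine le_of_mul_le_mul_right (a := wd (u + i) s m) ?_ h0
      rw [one_mul, hwdi] at *
      exact hprice.trans (hψm _ s α hαp u i rfl y)
  have hrem : ∀ i s a o s', i < n → V (u + i + 1) s' (b * wd (u + i) s * p (u + i) s a o s'
        - κ (u + i) s a o s' • (b * wd (u + i + 1) s')) ≤
      Φ (u + i + 1) s' (b * wd (u + i) s * p (u + i) s a o s') +
        κ (u + i) s a o s' * Φ (u + i + 1) s' (b * wd (u + i + 1) s') := by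
    intro i s a o s' hi
    rw [← (hΦ (u + i + 1) s').smul_nonneg (hκ0 _ _ _ _ _)]
    refine le_trans ?_ ((hΦ (u + i + 1) s').sub_le _ _)
    have hX : ∀ k, (b * wd (u + i) s * p (u + i) s a o s'
        - κ (u + i) s a o s' • (b * wd (u + i + 1) s')) k = b k *
          (wd (u + i) s k * p (u + i) s a o s' k - κ (u + i) s a o s' * wd (u + i + 1) s' k) := by
      intro k
      simp only [Pi.sub_apply, Pi.mul_apply, Pi.smul_apply, smul_eq_mul]; ring
    -- If the best word does not reach the new node in the context `m`, then nothing else does, and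
    -- the weight of `m` has vanished by itself.
    have hkill : ∃ k ∈ J, wd (u + i) s k * p (u + i) s a o s' k =
        κ (u + i) s a o s' * wd (u + i + 1) s' k := by
      by_cases h0 : 0 < wd (u + i + 1) s' m
      · obtain ⟨k, hk, -, he⟩ := exists_kil_mul_eq (J := J) (x := wd (u + i) s * p (u + i) s a o s')
          (y := wd (u + i + 1) s') ⟨m, hm, h0⟩
        refine ⟨k, hk, ?_⟩
        simp only [hκ]
        rw [if_pos h0, he]; rfl
      · refine ⟨m, hm, ?_⟩
        have h1 : wd (u + i + 1) s' m = 0 := le_antisymm (not_lt.1 h0) (hwd0 _ _ _)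
        have h2 := hmono i s a o s'
        rw [h1] at h2 ⊢
        rw [mul_zero]
        exact le_antisymm h2 (hwp _ _ _ _ _ _)
    obtain ⟨k, hk, he⟩ := hkill
    refine hΦV k hk _ _ _ (by omega) ⟨fun j => ?_, fun j => ?_, fun j hj => ?_⟩
    · rw [hX]
      by_cases hjJ : Sum.inl j ∈ J
      · exact mul_nonneg (hb.inl j) (sub_nonneg.2 (hκle _ hjJ _ _ _ _ _))
      · rw [hb.supp _ hjJ, zero_mul]
    · rw [hX]
      by_cases hjJ : Sum.inr j ∈ J
      · exact mul_nonpos_of_nonpos_of_nonneg (hb.inr j) (sub_nonneg.2 (hκle _ hjJ _ _ _ _ _))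
      · rw [hb.supp _ hjJ, zero_mul]
    · rw [hX]
      by_cases hjk : j = k
      · rw [hjk, he, sub_self, mul_zero]
      · rw [hb.supp j fun h => hj (mem_erase.2 ⟨hjk, h⟩), zero_mul]
  have hun := unroll (p := p) (fun t s => maxVal_sn t (N - t) s) hαp.nonneg wd hκ0 b u y n
    (fun i hi s _ => by
      have := hf (u + i) s (by omega)
      simp only [hV] at this
      rw [this, stepOp, hα, sum_detPol])
  rw [hwuy, mul_one] at hun
  refine hun.trans ?_
  have hword : ∀ i s {φ : Fnl S (ι₁ ⊕ ι₂)}, (∀ s, Sn (φ s)) →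
      φ s (b * wd (u + i) s) ≤ runOp p (ψ (u + i) s) u i φ y b := by
    intro i s φ hφ
    rw [hwdi]
    refine le_trans ?_ (sum_rch_le (hψ _ _).nonneg u i hφ y b)
    exact single_le_sum (f := fun s₀ => φ s₀ (b * rch p (ψ (u + i) s) u i y s₀))
      (fun s₀ _ => (hφ s₀).nonneg _) (mem_univ s)
  set g : ℕ → ℝ := fun i => ∑ s, runOp p (ψ (u + i) s) u i (Φ (u + i)) y b with hg
  have hflowΦ : ∀ i s, flow κ α u i y s * Φ (u + i) s (b * wd (u + i) s) ≤
      runOp p (ψ (u + i) s) u i (Φ (u + i)) y b := fun i s =>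
    (mul_le_of_le_one_left ((hΦ _ s).nonneg _) (hflow1 i s)).trans (hword i s (hΦ _))
  have hg0 : ∀ i, 0 ≤ g i := fun i => sum_nonneg fun s _ =>
    runOp_nonneg (hψ _ s).nonneg _ _ (fun s v => (hΦ _ s).nonneg v) _ _
  have hlast : ∑ s, flow κ α u n y s * maxVal p (u + n) (N - (u + n)) s (b * wd (u + n) s) ≤ g n := by
    refine sum_le_sum fun s _ => le_trans (mul_le_mul_of_nonneg_left ?_ (hflow0 n s)) (hflowΦ n s)
    rw [show N - (u + n) = 0 by omega]
    exact hΦ0 _ _ _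
  have hmain : ∀ i ∈ range n, (∑ s, flow κ α u i y s * ∑ a, α (u + i) s a * ∑ o, ∑ s',
      maxVal p (u + i + 1) (N - (u + i + 1)) s' (b * wd (u + i) s * p (u + i) s a o s'
        - κ (u + i) s a o s' • (b * wd (u + i + 1) s'))) ≤
      (∑ s, Fintype.card A * runOp p (ψ (u + i) s) u i
        (stepOp p (unifPol S A (u + i)) (u + i) (Φ (u + i + 1))) y b) + g (i + 1) := by
    intro i hi
    have hi := mem_range.1 hi
    have e1 : ∑ s', flow κ α u (i + 1) y s' * Φ (u + i + 1) s' (b * wd (u + i + 1) s')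
        = ∑ s, flow κ α u i y s * ∑ a, α (u + i) s a * ∑ o, ∑ s',
          κ (u + i) s a o s' * Φ (u + i + 1) s' (b * wd (u + i + 1) s') := by
      simp only [flow_succ, sum_mul, mul_sum]
      rw [sum_comm]
      refine sum_congr rfl fun s _ => ?_
      rw [sum_comm]
      refine sum_congr rfl fun a _ => ?_
      rw [sum_comm]
      exact sum_congr rfl fun o _ => sum_congr rfl fun s' _ => by ring
    have e2 : ∑ s, flow κ α u i y s * stepOp p (α (u + i)) (u + i) (Φ (u + i + 1)) s (b * wd (u + i) s) ≤
        ∑ s, Fintype.card A * runOp p (ψ (u + i) s) u i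
          (stepOp p (unifPol S A (u + i)) (u + i) (Φ (u + i + 1))) y b := by
      refine sum_le_sum fun s _ => ?_
      refine (mul_le_of_le_one_left ((stepOp_sn (hαp.nonneg _) _ (hΦ _) s).nonneg _) (hflow1 i s)).trans ?_
      refine (stepOp_le_unif (fun s a => hαp.le_one _ s a) _ (fun s v => (hΦ _ s).nonneg v) s _).trans ?_
      exact mul_le_mul_of_nonneg_left (hword i s (stepOp_sn (unifPol_isPol.nonneg _) _ (hΦ _)))
        (Nat.cast_nonneg _)
    have e3 : ∑ s', flow κ α u (i + 1) y s' * Φ (u + i + 1) s' (b * wd (u + i + 1) s') ≤ g (i + 1) :=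
      sum_le_sum fun s _ => hflowΦ (i + 1) s
    refine le_trans ?_ (add_le_add e2 e3)
    rw [e1, ← sum_add_distrib]
    refine sum_le_sum fun s _ => ?_
    rw [← mul_add, stepOp, ← sum_add_distrib]
    refine mul_le_mul_of_nonneg_left (sum_le_sum fun a _ => ?_) (hflow0 i s)
    rw [← mul_add, ← sum_add_distrib]
    refine mul_le_mul_of_nonneg_left (sum_le_sum fun o _ => ?_) (hαp.nonneg _ _ _)
    rw [← sum_add_distrib]
    exact sum_le_sum fun s' _ => hrem i s a o s' hi
  refine (add_le_add (sum_le_sum hmain) hlast).trans ?_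
  rw [sum_add_distrib, add_assoc]
  refine add_le_add le_rfl ?_
  have h1 : ∑ i ∈ range n, g (i + 1) ≤ ∑ i ∈ range (n + 1), g i := by
    rw [sum_range_succ' g]; linarith [hg0 0]
  have h2 : g n ≤ ∑ i ∈ range (n + 1), g i :=
    single_le_sum (fun i _ => hg0 i) (mem_range.2 (Nat.lt_succ_self n))
  simp only [← mul_sum]
  have : ∑ i ∈ range (n + 1), ∑ s, runOp p (ψ (u + i) s) u i (Φ (u + i)) y b
    = ∑ i ∈ range (n + 1), g i := rfl
  rw [this]
  linarith

/-- History-dependent actions gain at most a polynomial factor over memoryless policies. -/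
theorem exists_hist_bound {N : ℕ} (hp : IsKer p) {y₀ : S} {c : ι₁ ⊕ ι₂ → ℝ} {e : ℝ}
    (he : ∀ ω, IsPol ω → gap p N ω 0 y₀ c ≤ e) {Y : ℝ}
    (hY : Y = (N + 1) * Fintype.card S * (Fintype.card A + 2) * (Fintype.card (ι₁ ⊕ ι₂) + 1)) (j : ℕ)
    (J : Finset (ι₁ ⊕ ι₂)) (hJ : J.card ≤ j + 1) :
    ∃ Φ : ℕ → Fnl S (ι₁ ⊕ ι₂), (∀ u s, Sn (Φ u s)) ∧
      (∀ u s v, u ≤ N → SignType J v → maxVal p u (N - u) s v ≤ Φ u s v) ∧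
      ∀ u ≤ N, Combo p y₀ c e u (Y ^ j) (Φ u) := by
  have he0 : 0 ≤ e := ((gap_sn unifPol_isPol.nonneg _ _).nonneg _).trans (he _ unifPol_isPol)
  have hS1 : (1 : ℝ) ≤ Fintype.card S := by
    have : Nonempty S := ⟨y₀⟩
    exact_mod_cast Fintype.card_pos (α := S)
  have hA0 : (0 : ℝ) ≤ Fintype.card A := Nat.cast_nonneg _
  have hN0 : (0 : ℝ) ≤ N := Nat.cast_nonneg _
  have hι0 : (0 : ℝ) ≤ Fintype.card (ι₁ ⊕ ι₂) := Nat.cast_nonneg _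
  have hY1 : 1 ≤ Y := by
    rw [hY]
    exact one_le_mul_of_one_le_of_one_le (one_le_mul_of_one_le_of_one_le
      (one_le_mul_of_one_le_of_one_le (by linarith) hS1) (by linarith)) (by linarith)
  have habs : ∀ u ≤ N, Combo p y₀ c e u 1 absSum := by
    intro u hu ω hω
    rw [one_mul]
    refine le_trans ?_ (he ω hω)
    rw [← runOp_gap (t := 0) (n := u) ω (by omega)]
    exact runOp_mono hω.nonneg 0 u (fun s v => absSum_le_gap hp hω _ s v) _ _
  have hone : ∀ J : Finset (ι₁ ⊕ ι₂), (∀ i, Sum.inl i ∉ J) ∨ (∀ i, Sum.inr i ∉ J) →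
      ∀ u s v, u ≤ N → SignType J v → maxVal p u (N - u) s v ≤ absSum s v := by
    intro J h u s v _ hv
    refine (maxVal_le_l1 hp _ _ _ _).trans (le_of_eq ?_)
    unfold absSum l1
    rcases h with h | h
    · have : ∀ k, v k ≤ 0 := by
        rintro (k | k)
        exacts [(hv.supp _ (h k)).le, hv.inr k]
      rw [abs_of_nonpos (sum_nonpos fun k _ => this k), ← sum_neg_distrib]
      exact sum_congr rfl fun k _ => abs_of_nonpos (this k)
    · have : ∀ k, 0 ≤ v k := by
        rintro (k | k)
        exacts [hv.inl k, (hv.supp _ (h k)).ge]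
      rw [abs_of_nonneg (sum_nonneg fun k _ => this k)]
      exact sum_congr rfl fun k _ => abs_of_nonneg (this k)
  have htriv : ∀ (J : Finset (ι₁ ⊕ ι₂)) j, (∀ i, Sum.inl i ∉ J) ∨ (∀ i, Sum.inr i ∉ J) →
      ∃ Φ : ℕ → Fnl S (ι₁ ⊕ ι₂), (∀ u s, Sn (Φ u s)) ∧
      (∀ u s v, u ≤ N → SignType J v → maxVal p u (N - u) s v ≤ Φ u s v) ∧
      ∀ u ≤ N, Combo p y₀ c e u (Y ^ j) (Φ u) := fun J j h =>
    ⟨fun _ => absSum, fun _ s => absSum_sn s, hone J h, fun u hu =>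
      (habs u hu).mono he0 (one_le_pow₀ hY1)⟩
  induction j generalizing J with
  | zero =>
    refine htriv J 0 ?_
    by_contra h
    push Not at h
    obtain ⟨⟨i, hi⟩, ⟨i', hi'⟩⟩ := h
    exact absurd (card_le_one.1 hJ _ hi _ hi') (by simp)
  | succ j ih =>
    -- If only one of the two models is left there is no cancellation, and no policy can increase
    -- the variation. This is always so for a single context, hence `2 * M - 1` levels for `2 * M`
    -- contexts.
    by_cases h : (∀ i, Sum.inl i ∉ J) ∨ (∀ i, Sum.inr i ∉ J)
    · exact htriv J _ h
    push Not at h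
    obtain ⟨-, ⟨i, hi⟩⟩ := h
    classical
    have hih : ∀ k, ∃ Φ : ℕ → Fnl S (ι₁ ⊕ ι₂), k ∈ J → (∀ u s, Sn (Φ u s)) ∧
        (∀ u s v, u ≤ N → SignType (J.erase k) v → maxVal p u (N - u) s v ≤ Φ u s v) ∧
        ∀ u ≤ N, Combo p y₀ c e u (Y ^ j) (Φ u) := by
      intro k
      by_cases hk : k ∈ J
      · have hc : (J.erase k).card ≤ j + 1 := by rw [card_erase_of_mem hk]; omega
        obtain ⟨Φ, h⟩ := ih (J.erase k) hc
        exact ⟨Φ, fun _ => h⟩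
      · exact ⟨fun _ => absSum, fun h => absurd h hk⟩
    choose Φk hΦk using hih
    -- Which context is removed is not known in advance, so the bounds for all possibilities are
    -- added.
    set Φ : ℕ → Fnl S (ι₁ ⊕ ι₂) := fun u s v => absSum s v + ∑ k ∈ J, Φk k u s v with hΦdef
    have hΦ : ∀ u s, Sn (Φ u s) := fun u s => (absSum_sn s).add (Sn.sum _ fun k hk => (hΦk k hk).1 u s)
    have hk0 : ∀ u s v, ∀ k ∈ J, 0 ≤ Φk k u s v := fun u s v k hk => ((hΦk k hk).1 u s).nonneg v
    have hΦ0 : ∀ u s v, |∑ k, v k| ≤ Φ u s v := fun u s v =>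
      le_add_of_nonneg_right (sum_nonneg (hk0 u s v))
    have hΦV : ∀ k ∈ J, ∀ u s v, u ≤ N → SignType (J.erase k) v →
        maxVal p u (N - u) s v ≤ Φ u s v := by
      intro k hk u s v hu hv
      refine ((hΦk k hk).2.1 u s v hu hv).trans ?_
      exact (single_le_sum (hk0 u s v) hk).trans (le_add_of_nonneg_left (abs_nonneg _))
    set C' : ℝ := (Fintype.card (ι₁ ⊕ ι₂) + 1) * Y ^ j with hC'
    have hC'0 : 0 ≤ C' := by positivity
    have hΦC : ∀ u ≤ N, Combo p y₀ c e u C' (Φ u) := by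
      intro u hu
      refine ((habs u hu).add (Combo.sum fun k hk => (hΦk k hk).2.2 u hu)).mono he0 ?_
      have h1 : (J.card : ℝ) ≤ Fintype.card (ι₁ ⊕ ι₂) := by exact_mod_cast card_le_univ J
      have h2 : 1 ≤ Y ^ j := one_le_pow₀ hY1
      rw [hC']
      nlinarith
    have hψ : ∀ (l : ℕ) (s : S), ∃ ψ : Pol S A, IsPol ψ ∧ ∀ σ, IsPol σ → ∀ u n, u + n = l → ∀ y,
      rch p σ u n y s (Sum.inr i) ≤ rch p ψ u n y s (Sum.inr i) := fun l s =>
      exists_max_rch hp.nonneg l s (Sum.inr i)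
    choose ψ hψ1 hψ2 using hψ
    refine ⟨fun u s v => if u ≤ N then
      (∑ i ∈ range (N - u), ∑ s', Fintype.card A * runOp p (ψ (u + i) s') u i
        (stepOp p (unifPol S A (u + i)) (u + i) (Φ (u + i + 1))) s v)
      + ∑ i ∈ range (N - u + 1), ∑ s', 2 * runOp p (ψ (u + i) s') u i (Φ (u + i)) s v else 0,
      fun u s => ?_, fun u s v hu hv => ?_, fun u hu => ?_⟩
    · by_cases hu : u ≤ N
      · simp only [hu, if_true]
        exact (Sn.sum _ fun i _ => Sn.sum _ fun s' _ => (runOp_sn (hψ1 _ _).nonneg _ _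
          (stepOp_sn (unifPol_isPol.nonneg _) _ (hΦ _)) s).const_mul (Nat.cast_nonneg _)).add
          (Sn.sum _ fun i _ => Sn.sum _ fun s' _ => (runOp_sn (hψ1 _ _).nonneg _ _ (hΦ _) s).const_mul
            (by norm_num))
      · simp only [hu, if_false]
        exact Sn.zero_fun
    · simp only [hu, if_true]
      exact hist_stage hp hi hΦ hΦ0 hΦV hψ1 hψ2 hu s hv
    · simp only [hu, if_true]
      have k1 : Combo p y₀ c e u (((N - u : ℕ) : ℝ) * (Fintype.card S * (Fintype.card A * C'))) fun s v =>
          ∑ i ∈ range (N - u), ∑ s', (Fintype.card A : ℝ) * runOp p (ψ (u + i) s') u i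
            (stepOp p (unifPol S A (u + i)) (u + i) (Φ (u + i + 1))) s v := by
        have := Combo.sum (p := p) (y₀ := y₀) (c := c) (e := e) (u := u) (I := range (N - u))
          (Φ := fun i s v => ∑ s', (Fintype.card A : ℝ) * runOp p (ψ (u + i) s') u i
            (stepOp p (unifPol S A (u + i)) (u + i) (Φ (u + i + 1))) s v)
          (C := Fintype.card S * (Fintype.card A * C')) fun i hi => ?_
        · rwa [card_range] at this
        · exact Combo.sum (I := univ) fun s' _ => (Combo.runOp (hψ1 _ _) (Combo.stepOp unifPol_isPol
            (hΦC _ (by have := mem_range.1 hi; omega)))).const_mul hA0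
      have k2 : Combo p y₀ c e u (((N - u + 1 : ℕ) : ℝ) * (Fintype.card S * (2 * C'))) fun s v =>
          ∑ i ∈ range (N - u + 1), ∑ s', 2 * runOp p (ψ (u + i) s') u i (Φ (u + i)) s v := by
        have := Combo.sum (p := p) (y₀ := y₀) (c := c) (e := e) (u := u) (I := range (N - u + 1))
          (Φ := fun i s v => ∑ s', 2 * runOp p (ψ (u + i) s') u i (Φ (u + i)) s v)
          (C := Fintype.card S * (2 * C')) fun i hi => ?_
        · rwa [card_range] at this
        · exact Combo.sum (I := univ) fun s' _ => (Combo.runOp (hψ1 _ _)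
            (hΦC _ (by have := mem_range.1 hi; omega))).const_mul (by norm_num)
      refine (k1.add k2).mono he0 ?_
      have h3 : ((N - u : ℕ) : ℝ) ≤ N + 1 := by
        have : ((N - u : ℕ) : ℝ) ≤ N := by exact_mod_cast Nat.sub_le N u
        linarith
      have h4 : ((N - u + 1 : ℕ) : ℝ) ≤ N + 1 := by
        have : ((N - u : ℕ) : ℝ) ≤ N := by exact_mod_cast Nat.sub_le N u
        push_cast; linarith
      calc _ ≤ (N + 1 : ℝ) * (Fintype.card S * (Fintype.card A * C')) + (N + 1) * (Fintype.card S * (2 * C')) := by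
            gcongr
        _ = _ := by rw [hC', hY, pow_succ]; ring

end HistStage
end
end LMDP

/-! ### Spanners by maximal volume -/

namespace LMDP
noncomputable section
open Finset

section Spanner

variable {ι : Type*} [Fintype ι] [DecidableEq ι]

/-- Hahn–Banach: the functional `c • v ↦ c * φ v` on the line through `v` extends to a functional
below `φ`. -/
theorem Sn.exists_subgradient {φ : (ι → ℝ) → ℝ} (h : Sn φ) (v : ι → ℝ) :
    ∃ z : ι → ℝ, ∑ k, z k * v k = φ v ∧ ∀ w, ∑ k, z k * w k ≤ φ w := by
  have H : ∀ c : ℝ, c • v = 0 → (RingHom.id ℝ c) • φ v = 0 := by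
    intro c hc
    have := h.smul c v
    rw [hc, h.zero] at this
    rcases mul_eq_zero.1 this.symm with h0 | h0
    · simp [abs_eq_zero.1 h0]
    · simp [h0]
  obtain ⟨g, hg1, hg2⟩ := exists_extension_of_le_sublinear
    (LinearPMap.mkSpanSingleton' v (φ v) H) φ
    (fun c hc x => by rw [h.smul, abs_of_pos hc]) h.add_le (by
      rintro ⟨x, hx⟩
      obtain ⟨c, rfl⟩ := Submodule.mem_span_singleton.1 hx
      rw [LinearPMap.mkSpanSingleton'_apply]
      change c • φ v ≤ φ (c • v)
      rw [h.smul, smul_eq_mul]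
      exact mul_le_mul_of_nonneg_right (le_abs_self c) (h.nonneg v))
  have hz : ∀ w, ∑ k, g (Pi.single k 1) * w k = g w := by
    intro w
    conv_rhs => rw [← Finset.univ_sum_single w, map_sum]
    refine sum_congr rfl fun k _ => ?_
    rw [show (Pi.single k (w k) : ι → ℝ) = w k • Pi.single k 1 by
      rw [← Pi.single_smul]; simp, map_smul, smul_eq_mul, mul_comm]
  refine ⟨fun k => g (Pi.single k 1), ?_, fun w => by rw [hz]; exact hg2 w⟩
  rw [hz]
  have := hg1 ⟨v, Submodule.mem_span_singleton_self v⟩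
  exact this.trans (LinearPMap.mkSpanSingleton'_apply_self v (φ v) H _)

variable {Q : Type*} [DecidableEq Q]

/-- Vectors dominated by one of the seminorms `ν ψ`, `ψ ∈ Ψ`, or by a small multiple of `ℓ¹`. -/
def Adm (ν : Q → (ι → ℝ) → ℝ) (δ : ℝ) (Ψ : Finset Q) (z : ι → ℝ) : Prop :=
  (∃ ψ ∈ Ψ, ∀ w, ∑ k, z k * w k ≤ ν ψ w) ∨ ∀ w, ∑ k, z k * w k ≤ δ * l1 w

/-- The largest volume spanned by admissible vectors. -/
def Vol (ν : Q → (ι → ℝ) → ℝ) (δ : ℝ) (Ψ : Finset Q) : ℝ :=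
  sSup {x | ∃ Z : Matrix ι ι ℝ, (∀ i, Adm ν δ Ψ (Z i)) ∧ x = |Z.det|}

variable {ν : Q → (ι → ℝ) → ℝ} {δ : ℝ} {Ψ : Finset Q}

theorem Adm.abs_le_one (hν : ∀ ψ v, ν ψ v ≤ l1 v) (hδ : δ ≤ 1) {z : ι → ℝ} (h : Adm ν δ Ψ z) (k : ι) :
    |z k| ≤ 1 := by
  have h1 : ∀ w, ∑ k, z k * w k ≤ l1 w := by
    intro w
    rcases h with ⟨ψ, -, h⟩ | h
    · exact (h w).trans (hν ψ w)
    · exact (h w).trans (mul_le_of_le_one_left (l1_nonneg w) hδ)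
  have h2 : ∀ c : ℝ, l1 (Pi.single k c : ι → ℝ) = |c| := by
    intro c
    unfold l1
    rw [sum_eq_single k] <;> simp +contextual
  rw [abs_le]
  have h3 := h1 (Pi.single k 1)
  have h4 := h1 (Pi.single k (-1))
  rw [h2] at h3 h4
  simp only [Pi.single_apply, mul_ite, mul_one, mul_zero, mul_neg, sum_ite_eq', mem_univ, if_true,
    abs_neg, abs_one] at h3 h4
  constructor <;> linarith

theorem vol_bdd (hν : ∀ ψ v, ν ψ v ≤ l1 v) (hδ : δ ≤ 1) :
    ∀ x ∈ {x | ∃ Z : Matrix ι ι ℝ, (∀ i, Adm ν δ Ψ (Z i)) ∧ x = |Z.det|},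
      x ≤ (Fintype.card ι).factorial := by
  rintro x ⟨Z, hZ, rfl⟩
  have := Matrix.det_le (A := Z) (abv := AbsoluteValue.abs) (x := 1) fun i j => (hZ i).abs_le_one hν hδ j
  simpa using this

theorem le_vol (hν : ∀ ψ v, ν ψ v ≤ l1 v) (hδ : δ ≤ 1) {Z : Matrix ι ι ℝ}
    (hZ : ∀ i, Adm ν δ Ψ (Z i)) : |Z.det| ≤ Vol ν δ Ψ :=
  le_csSup ⟨_, vol_bdd hν hδ⟩ ⟨Z, hZ, rfl⟩

/-- The `δ`-multiples of the unit vectors are always admissible. They keep the volume away from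
zero, at the price of the `ℓ¹` error. -/
theorem adm_diag (hδ0 : 0 ≤ δ) (i : ι) : Adm ν δ Ψ ((Matrix.diagonal fun _ : ι => δ) i) := by
  right
  intro w
  rw [sum_eq_single i (fun k _ hk => by rw [Matrix.diagonal_apply_ne' _ hk, zero_mul]) (by simp),
    Matrix.diagonal_apply_eq]
  refine mul_le_mul_of_nonneg_left ((le_abs_self _).trans ?_) hδ0
  exact single_le_sum (f := fun k => |w k|) (fun k _ => abs_nonneg _) (mem_univ i)

theorem pow_le_vol (hν : ∀ ψ v, ν ψ v ≤ l1 v) (hδ0 : 0 ≤ δ) (hδ : δ ≤ 1) :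
    δ ^ Fintype.card ι ≤ Vol ν δ Ψ := by
  have := le_vol (Ψ := Ψ) hν hδ (adm_diag hδ0)
  rwa [Matrix.det_diagonal, prod_const, card_univ, abs_of_nonneg (pow_nonneg hδ0 _)] at this

theorem vol_le (hν : ∀ ψ v, ν ψ v ≤ l1 v) (hδ0 : 0 ≤ δ) (hδ : δ ≤ 1) :
    Vol ν δ Ψ ≤ (Fintype.card ι).factorial :=
  csSup_le ⟨_, Matrix.diagonal fun _ => δ, adm_diag hδ0, rfl⟩ (vol_bdd hν hδ)

theorem vol_mono (hν : ∀ ψ v, ν ψ v ≤ l1 v) (hδ0 : 0 ≤ δ) (hδ : δ ≤ 1) {Ψ' : Finset Q} (h : Ψ ⊆ Ψ') :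
    Vol ν δ Ψ ≤ Vol ν δ Ψ' := by
  refine csSup_le ⟨_, Matrix.diagonal fun _ => δ, adm_diag hδ0, rfl⟩ ?_
  rintro x ⟨Z, hZ, rfl⟩
  refine le_vol hν hδ fun i => ?_
  rcases hZ i with ⟨ψ, hψ, hz⟩ | hz
  exacts [Or.inl ⟨ψ, h hψ, hz⟩, Or.inr hz]

/-- Either the new seminorm is controlled by few old ones, or the volume grows by a factor. -/
theorem spanner (hsn : ∀ ψ, Sn (ν ψ)) (hν : ∀ ψ v, ν ψ v ≤ l1 v) (hδ0 : 0 < δ) (hδ : δ ≤ 1)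
    {β : ℝ} (hβ : 0 ≤ β) (Ψ : Finset Q) (π : Q) (hgrow : Vol ν δ (insert π Ψ) < β / 2 * Vol ν δ Ψ) :
    ∃ D ⊆ Ψ, D.card ≤ Fintype.card ι ∧ ∀ v, ν π v ≤
      β * Fintype.card ι * (∑ ψ ∈ D, ν ψ v) + β * Fintype.card ι * δ * l1 v := by
  classical
  have hV0 : 0 < Vol ν δ Ψ := (pow_pos hδ0 _).trans_le (pow_le_vol hν hδ0.le hδ)
  -- A system of at least half the maximal volume suffices; the maximum need not be attained. This
  -- is the factor `1 / 2` in the growth condition.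
  obtain ⟨x, ⟨Z, hZ, rfl⟩, hx⟩ := exists_lt_of_lt_csSup
    (⟨_, Matrix.diagonal fun _ => δ, adm_diag hδ0.le, rfl⟩ :
      {x | ∃ Z : Matrix ι ι ℝ, (∀ i, Adm ν δ Ψ (Z i)) ∧ x = |Z.det|}.Nonempty)
    (show Vol ν δ Ψ / 2 < Vol ν δ Ψ by linarith)
  have hdet : 0 < |Z.det| := by linarith
  -- the coefficients of a dominated vector are bounded
  have hcoef : ∀ z, (∀ w, ∑ k, z k * w k ≤ ν π w) → ∀ i, |(Z.updateRow i z).det| ≤ β * |Z.det| := by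
    intro z hz i
    have h1 : |(Z.updateRow i z).det| ≤ Vol ν δ (insert π Ψ) := by
      refine le_vol hν hδ fun j => ?_
      by_cases hj : j = i
      · subst hj
        rw [Matrix.updateRow_self]
        exact Or.inl ⟨π, mem_insert_self _ _, hz⟩
      · rw [Matrix.updateRow_ne hj]
        rcases hZ j with ⟨ψ, hψ, h⟩ | h
        exacts [Or.inl ⟨ψ, mem_insert_of_mem hψ, h⟩, Or.inr h]
    have h2 : β / 2 * Vol ν δ Ψ ≤ β * |Z.det| := by
      have := mul_le_mul_of_nonneg_left hx.le hβ
      linarith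
    linarith
  have hpick : ∀ i, ∃ o : Option Q, (∀ ψ ∈ o, ψ ∈ Ψ) ∧
      ∀ w, |∑ k, Z i k * w k| ≤ (o.elim 0 fun ψ => ν ψ w) + δ * l1 w := by
    intro i
    rcases hZ i with ⟨ψ, hψ, h⟩ | h
    · refine ⟨some ψ, by simpa using hψ, fun w => ?_⟩
      have h1 := h w
      have h2 := h (-w)
      rw [(hsn ψ).neg] at h2
      simp only [Pi.neg_apply, mul_neg, sum_neg_distrib] at h2
      have h3 := l1_nonneg w
      rw [abs_le]
      simp only [Option.elim]
      constructor <;> nlinarith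
    · refine ⟨none, by simp, fun w => ?_⟩
      have h1 := h w
      have h2 := h (-w)
      rw [Sn.l1.neg] at h2
      simp only [Pi.neg_apply, mul_neg, sum_neg_distrib] at h2
      rw [abs_le]
      simp only [Option.elim]
      constructor <;> linarith
  choose o ho1 ho2 using hpick
  refine ⟨univ.biUnion fun i => (o i).toFinset, ?_, ?_, fun v => ?_⟩
  · intro ψ hψ
    obtain ⟨i, -, hi⟩ := mem_biUnion.1 hψ
    exact ho1 i ψ (by simpa using hi)
  · refine card_biUnion_le.trans ((sum_le_card_nsmul _ _ 1 fun i _ => ?_).trans (by simp))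
    cases o i <;> simp
  · set D := univ.biUnion fun i => (o i).toFinset with hD
    obtain ⟨z, hz1, hz2⟩ := (hsn π).exists_subgradient v
    -- Cramer's rule expands the subgradient in the rows of `Z`. The coefficients are quotients of
    -- volumes, bounded by `β` because replacing a row by `z` yields an admissible system for the
    -- enlarged set.
    have hcr : ∀ k, ∑ i, Z i k * (Z.updateRow i z).det = Z.det * z k := by
      intro k
      have := congrFun (Matrix.mulVec_cramer Z.transpose z) k
      rw [Matrix.det_transpose] at this
      simpa [Matrix.mulVec, dotProduct, Matrix.cramer_transpose_apply] using this
    have h1 : Z.det * ν π v = ∑ i, (Z.updateRow i z).det * ∑ k, Z i k * v k := by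
      rw [← hz1, mul_sum]
      simp_rw [mul_sum]
      rw [sum_comm]
      refine sum_congr rfl fun k _ => ?_
      rw [← mul_assoc, ← hcr, sum_mul]
      exact sum_congr rfl fun i _ => by ring
    have h2 : |Z.det| * ν π v ≤ ∑ i, β * |Z.det| * |∑ k, Z i k * v k| := by
      rw [← abs_of_nonneg ((hsn π).nonneg v), ← abs_mul, h1]
      refine (abs_sum_le_sum_abs _ _).trans (sum_le_sum fun i _ => ?_)
      rw [abs_mul]
      exact mul_le_mul_of_nonneg_right (hcoef z hz2 i) (abs_nonneg _)
    have h3 : ν π v ≤ β * ∑ i, |∑ k, Z i k * v k| := by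
      refine le_of_mul_le_mul_left (h2.trans (le_of_eq ?_)) hdet
      rw [← mul_sum]; ring
    have h4 : ∀ i, |∑ k, Z i k * v k| ≤ (∑ ψ ∈ D, ν ψ v) + δ * l1 v := by
      intro i
      refine (ho2 i v).trans (add_le_add ?_ le_rfl)
      rcases hoi : o i with _ | ψ
      · simp only [Option.elim]
        exact sum_nonneg fun ψ _ => (hsn ψ).nonneg v
      · simp only [Option.elim]
        refine single_le_sum (f := fun ψ => ν ψ v) (fun ψ _ => (hsn ψ).nonneg v) ?_
        rw [hD]
        exact mem_biUnion.2 ⟨i, mem_univ i, by simp [hoi]⟩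
    have h5 : ∑ i, |∑ k, Z i k * v k| ≤ Fintype.card ι * ((∑ ψ ∈ D, ν ψ v) + δ * l1 v) := by
      refine (sum_le_card_nsmul _ _ _ fun i _ => h4 i).trans_eq ?_
      rw [card_univ, nsmul_eq_mul]
    refine h3.trans ((mul_le_mul_of_nonneg_left h5 hβ).trans (le_of_eq (by ring)))

/-- Along an increasing sequence, the volume grows by a factor only a bounded number of times. -/
theorem card_vol_growth (hν : ∀ ψ v, ν ψ v ≤ l1 v) (hδ0 : 0 < δ) (hδ : δ ≤ 1) {c : ℝ} (hc : 1 < c)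
    (Ψ : ℕ → Finset Q) (hΨ : ∀ k, Ψ k ⊆ Ψ (k + 1)) (K : ℕ) (I : Finset ℕ) (hI : ∀ k ∈ I, k < K)
    (h : ∀ k ∈ I, c * Vol ν δ (Ψ k) ≤ Vol ν δ (Ψ (k + 1))) :
    (I.card : ℝ) ≤ (Real.log (Fintype.card ι).factorial - Fintype.card ι * Real.log δ) / Real.log c := by
  have hV0 : ∀ Ψ : Finset Q, 0 < Vol ν δ Ψ := fun Ψ =>
    (pow_pos hδ0 _).trans_le (pow_le_vol hν hδ0.le hδ)
  have hlc : 0 < Real.log c := Real.log_pos hc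
  -- The logarithm of the volume is nondecreasing and gains at least `log c` at every step in `I`.
  have key : ∀ K, ((I.filter (· < K)).card : ℝ) * Real.log c ≤
      Real.log (Vol ν δ (Ψ K)) - Real.log (Vol ν δ (Ψ 0)) := by
    intro K
    induction K with
    | zero => simp
    | succ K ih =>
      by_cases hK : K ∈ I
      · have e : I.filter (· < K + 1) = insert K (I.filter (· < K)) := by
          ext j; simp only [mem_filter, mem_insert]
          constructor
          · rintro ⟨h1, h2⟩; by_cases hj : j = K; exacts [Or.inl hj, Or.inr ⟨h1, by omega⟩]
          · rintro (rfl | ⟨h1, h2⟩); exacts [⟨hK, by omega⟩, ⟨h1, by omega⟩]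
        rw [e, card_insert_of_notMem (by simp)]
        have h1 := Real.log_le_log (mul_pos (by linarith) (hV0 _)) (h K hK)
        rw [Real.log_mul (by linarith) (hV0 _).ne'] at h1
        push_cast
        linarith
      · have e : I.filter (· < K + 1) = I.filter (· < K) := by
          ext j; simp only [mem_filter]
          constructor
          · rintro ⟨h1, h2⟩; exact ⟨h1, lt_of_le_of_ne (by omega) fun h => hK (h ▸ h1)⟩
          · rintro ⟨h1, h2⟩; exact ⟨h1, by omega⟩
        rw [e]
        have h1 := Real.log_le_log (hV0 _) (vol_mono hν hδ0.le hδ (hΨ K))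
        linarith
  rw [le_div_iff₀ hlc]
  have h1 := key K
  rw [filter_true_of_mem hI] at h1
  have h2 := Real.log_le_log (hV0 (Ψ K)) (vol_le hν hδ0.le hδ)
  have h3 := Real.log_le_log (pow_pos hδ0 _) (pow_le_vol (Ψ := Ψ 0) hν hδ0.le hδ)
  rw [Real.log_pow] at h3
  linarith

end Spanner
end
end LMDP

/-! ### Coverage where volumes do not grow -/

namespace LMDP
noncomputable section
open Finset

section Embed

variable {S A O ι₁ ι₂ : Type*} [Fintype S] [Fintype A] [Fintype O] [DecidableEq S]
  [Fintype ι₁] [Fintype ι₂]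

/-- Weights on the second family, extended by zero. -/
def emb (ι₁ : Type*) {ι₂ : Type*} (v : ι₂ → ℝ) : ι₁ ⊕ ι₂ → ℝ := Sum.elim 0 v

theorem emb_comp_inr {v : ι₁ ⊕ ι₂ → ℝ} (hv : ∀ k, v (Sum.inl k) = 0) :
    emb ι₁ (fun k => v (Sum.inr k)) = v := by
  funext k; cases k <;> simp [emb, hv]

theorem sum_emb (v : ι₂ → ℝ) : ∑ k, emb ι₁ v k = ∑ k, v k := by
  simp [emb, Fintype.sum_sum_type]

theorem l1_emb (v : ι₂ → ℝ) : l1 (emb ι₁ v) = l1 v := by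
  simp [emb, l1, Fintype.sum_sum_type]

variable {p' : Ker S A O (ι₁ ⊕ ι₂)} {p : Ker S A O ι₂}

theorem runOp_emb (hpp : ∀ t s a o s' k, p' t s a o s' (Sum.inr k) = p t s a o s' k) (σ : Pol S A)
    (t n : ℕ) (φ : Fnl S (ι₁ ⊕ ι₂)) (y : S) (v : ι₂ → ℝ) :
    runOp p' σ t n φ y (emb ι₁ v) = runOp p σ t n (fun s v => φ s (emb ι₁ v)) y v := by
  induction n generalizing t y v with
  | zero => rfl
  | succ n ih =>
    simp only [runOp_succ, stepOp]
    refine sum_congr rfl fun a _ => congrArg _ (sum_congr rfl fun o _ => sum_congr rfl fun s' _ => ?_)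
    rw [← ih]
    congr 1
    funext k
    cases k <;> simp [emb, hpp]

theorem gap_emb (hpp : ∀ t s a o s' k, p' t s a o s' (Sum.inr k) = p t s a o s' k) (N : ℕ)
    (σ : Pol S A) (l : ℕ) (y : S) (v : ι₂ → ℝ) : gap p' N σ l y (emb ι₁ v) = gap p N σ l y v := by
  rw [gap, runOp_emb hpp]
  simp only [absSum, sum_emb]
  rfl

theorem runOp_ind_emb (hpp : ∀ t s a o s' k, p' t s a o s' (Sum.inr k) = p t s a o s' k)
    (σ : Pol S A) (t n : ℕ) (y s : S) (v : ι₂ → ℝ) :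
    runOp p' σ t n (ind s fun v => |∑ k, v k|) y (emb ι₁ v)
      = runOp p σ t n (ind s fun v => |∑ k, v k|) y v := by
  rw [runOp_emb hpp]
  simp only [ind, sum_emb]
  rfl

end Embed

section Coverage

variable {S A O ι₁ ι₂ : Type*} [Fintype S] [Fintype A] [Fintype O] [DecidableEq S] [Nonempty A]
  [Fintype ι₁] [Fintype ι₂] [DecidableEq ι₂]

/-- `ψ` on `[u, l)`, uniformly random actions outside. -/
def window (u l : ℕ) (ψ : Pol S A) : Pol S A := fun t => if u ≤ t ∧ t < l then ψ t else unifPol S A t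

theorem window_of {u l t : ℕ} (h : u ≤ t ∧ t < l) (ψ : Pol S A) : window u l ψ t = ψ t := if_pos h

theorem window_of_not {u l t : ℕ} (h : t < u ∨ l ≤ t) (ψ : Pol S A) :
    window u l ψ t = unifPol S A t := if_neg (by omega)

theorem IsPol.window {ψ : Pol S A} (h : IsPol ψ) (u l : ℕ) : IsPol (window u l ψ) where
  nonneg t s a := by unfold LMDP.window; split_ifs; exacts [h.nonneg _ _ _, unifPol_isPol.nonneg _ _ _]
  sum_eq t s := by unfold LMDP.window; split_ifs; exacts [h.sum_eq _ _, unifPol_isPol.sum_eq _ _]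

theorem runOp_window {ι : Type*} {p : Ker S A O ι} (u n : ℕ) (ψ : Pol S A) (φ : Fnl S ι) :
    runOp p (window u (u + n) ψ) u n φ = runOp p ψ u n φ :=
  runOp_congr p φ fun i h1 h2 => window_of ⟨h1, by omega⟩ ψ

/-- The flow from `y` at time `u` to `s`, `n` steps later, as a seminorm of the weights. -/
def pairSn {ι : Type*} [Fintype ι] (p : Ker S A O ι) (u n : ℕ) (y s : S) (σ : Pol S A) :
    (ι → ℝ) → ℝ := runOp p σ u n (ind s fun v => |∑ k, v k|) y

theorem pairSn_sn {ι : Type*} [Fintype ι] {p : Ker S A O ι} (u n : ℕ) (y s : S) {σ : Pol S A}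
    (hσ : IsPol σ) : Sn (pairSn p u n y s σ) := runOp_sn hσ.nonneg u n (ind_sn s Sn.absSum) y

theorem runOp_ind_l1_le {ι : Type*} [Fintype ι] {p : Ker S A O ι} (hp : IsKer p) (u n : ℕ) (y s : S)
    {σ : Pol S A} (hσ : IsPol σ) (v : ι → ℝ) : runOp p σ u n (ind s l1) y v ≤ l1 v := by
  rw [← runOp_l1 hp hσ u n y v]
  refine runOp_mono hσ.nonneg u n (fun s' v => ?_) y v
  unfold ind; split_ifs
  exacts [le_rfl, l1_nonneg v]

theorem pairSn_le_l1 {ι : Type*} [Fintype ι] {p : Ker S A O ι} (hp : IsKer p) (u n : ℕ) (y s : S)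
    {σ : Pol S A} (hσ : IsPol σ) (v : ι → ℝ) : pairSn p u n y s σ v ≤ l1 v :=
  (runOp_mono hσ.nonneg u n (ind_mono s absSum_le_l1) y v).trans (runOp_ind_l1_le hp u n y s hσ v)

variable {p' : Ker S A O (ι₁ ⊕ ι₂)} {p : Ker S A O ι₂}
variable {Q : Type*} [DecidableEq Q] {e : Q → Pol S A}

open Classical in
/-- Without growth at a pair of nodes, few old policies cover the flow between them. -/
theorem exists_pair_cover (hp : IsKer p)
    (hpp : ∀ t s a o s' k, p' t s a o s' (Sum.inr k) = p t s a o s' k) (he : ∀ q, IsPol (e q))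
    {δ β : ℝ} (hδ0 : 0 < δ) (hδ : δ ≤ 1) (hβ : 0 ≤ β) {Ψ : Finset Q} {π : Q} (u n : ℕ) (y s : S)
    (h : Vol (fun q => pairSn p u n y s (e q)) δ (insert π Ψ) <
      β / 2 * Vol (fun q => pairSn p u n y s (e q)) δ Ψ) :
    ∃ X : Finset (Pol S A), X.card ≤ Fintype.card ι₂ ∧
      (∀ χ ∈ X, ∃ ψ ∈ Ψ, χ = window u (u + n) (e ψ)) ∧
      Covers p' (e π) u n y s X (β * Fintype.card ι₂ ^ 2) (β * Fintype.card ι₂ * δ)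
        (fun v => |∑ k, v k|) l1 := by
  obtain ⟨D, hD1, hD2, hD3⟩ := spanner (fun q => pairSn_sn u n y s (he q))
    (fun q v => pairSn_le_l1 hp u n y s (he q) v) hδ0 hδ hβ Ψ π h
  refine ⟨D.image fun q => window u (u + n) (e q), card_image_le.trans hD2, ?_, ?_⟩
  · intro χ hχ
    obtain ⟨ψ, hψ, rfl⟩ := mem_image.1 hχ
    exact ⟨ψ, hD1 hψ, rfl⟩
  · intro v hv
    rw [← emb_comp_inr hv]
    set v' : ι₂ → ℝ := fun k => v (Sum.inr k)
    simp only [runOp_ind_emb hpp, l1_emb]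
    refine (hD3 v').trans (add_le_add ?_ le_rfl)
    -- Different policies may coincide on the window, so passing to the set of their restrictions
    -- can merge terms; the cardinality factor accounts for this and makes the constant quadratic.
    have h1 : ∑ q ∈ D, pairSn p u n y s (e q) v' ≤ Fintype.card ι₂ *
        ∑ χ ∈ D.image fun q => window u (u + n) (e q), pairSn p u n y s χ v' := by
      have hnn : ∀ χ ∈ D.image (fun q => window u (u + n) (e q)), 0 ≤ pairSn p u n y s χ v' := by
        intro χ hχ
        obtain ⟨ψ, hψ, rfl⟩ := mem_image.1 hχ
        exact (pairSn_sn u n y s ((he ψ).window _ _)).nonneg _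
      refine (sum_le_card_nsmul _ _ (∑ χ ∈ D.image fun q => window u (u + n) (e q),
        pairSn p u n y s χ v') fun q hq => ?_).trans ?_
      · rw [show pairSn p u n y s (e q) v' = pairSn p u n y s (window u (u + n) (e q)) v' by
          unfold pairSn; rw [runOp_window]]
        exact single_le_sum hnn (mem_image_of_mem _ hq)
      · rw [nsmul_eq_mul]
        exact mul_le_mul_of_nonneg_right (by exact_mod_cast hD2) (sum_nonneg hnn)
    refine (mul_le_mul_of_nonneg_left h1 (by positivity)).trans (le_of_eq ?_)
    unfold pairSn
    ring

open Classical in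
theorem exists_node_cover (hp : IsKer p)
    (hpp : ∀ t s a o s' k, p' t s a o s' (Sum.inr k) = p t s a o s' k) (he : ∀ q, IsPol (e q))
    (hinj : Function.Injective e)
    {δ β : ℝ} (hδ0 : 0 < δ) (hδ : δ ≤ 1) (hβ : 0 ≤ β) {Ψ : Finset Q} {π : Q} (N l : ℕ) (s : S)
    (h : Vol (fun q => gap p N (e q) l s) δ (insert π Ψ) <
      β / 2 * Vol (fun q => gap p N (e q) l s) δ Ψ) :
    ∃ X ⊆ Ψ.image e, X.card ≤ Fintype.card ι₂ ∧ ∀ v, (∀ k, v (Sum.inl k) = 0) →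
      gap p' N (e π) l s v ≤ β * Fintype.card ι₂ * (∑ ψ ∈ X, gap p' N ψ l s v)
        + β * Fintype.card ι₂ * δ * l1 v := by
  obtain ⟨D, hD1, hD2, hD3⟩ := spanner (fun q => gap_sn (he q).nonneg l s)
    (fun q v => gap_le_l1 hp (he q) l s v) hδ0 hδ hβ Ψ π h
  refine ⟨D.image e, image_subset_image hD1, card_image_le.trans hD2, fun v hv => ?_⟩
  rw [← emb_comp_inr hv, sum_image fun a _ b _ h => hinj h]
  simp only [gap_emb hpp, l1_emb]
  exact hD3 _

/-- Composition of coverings through the nodes `w` at an intermediate time. -/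
theorem covers_comp (hp' : IsKer p') {π : Pol S A} (hπ : IsPol π) {u i j m : ℕ} {y s : S}
    {X Y : S → Finset (Pol S A)} {b d : ℝ} (hb : 0 ≤ b) (hd : 0 ≤ d)
    (hXp : ∀ w, ∀ χ ∈ X w, IsPol χ) (hYp : ∀ w, ∀ χ ∈ Y w, IsPol χ)
    (hXc : ∀ w, ∀ χ ∈ X w, ∀ t, t < u ∨ u + i ≤ t → χ t = unifPol S A t)
    (hYc : ∀ w, ∀ χ ∈ Y w, ∀ t, t < u + i ∨ u + i + j ≤ t → χ t = unifPol S A t)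
    (hm : ∀ w, (Y w).card ≤ m)
    (hX : ∀ w, Covers p' π u i y w (X w) b d (fun v => |∑ k, v k|) l1)
    (hY : ∀ w, Covers p' π (u + i) j w s (Y w) b d (fun v => |∑ k, v k|) l1)
    {W : Finset (Pol S A)} (hW : ∀ w, ∀ χ₁ ∈ X w, ∀ χ₂ ∈ Y w, splice (u + i) χ₁ χ₂ ∈ W)
    (hWp : ∀ ω ∈ W, IsPol ω) :
    Covers p' π u (i + j) y s W (b ^ 2) (b * m * Fintype.card S * d + d) (fun v => |∑ k, v k|) l1 := by
  classical
  intro v hv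
  set φ : Fnl S (ι₁ ⊕ ι₂) := ind s fun v => |∑ k, v k| with hφ
  have hφ0 : ∀ s v, 0 ≤ φ s v := ind_nonneg s fun v => abs_nonneg _
  rw [runOp_add, runOp_eq_sum_ind]
  have hl1 := l1_nonneg v
  -- the second leg
  have h1 : ∀ w, runOp p' π u i (ind w (runOp p' π (u + i) j φ w)) y v ≤
      b * (∑ χ₂ ∈ Y w, runOp p' π u i (ind w (runOp p' χ₂ (u + i) j φ w)) y v)
        + d * runOp p' π u i (ind w l1) y v := by
    intro w
    have e : ∀ v, b * (∑ χ₂ ∈ Y w, runOp p' π u i (ind w (runOp p' χ₂ (u + i) j φ w)) y v)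
        + d * runOp p' π u i (ind w l1) y v = runOp p' π u i (fun s' v =>
          b * (∑ χ₂ ∈ Y w, ind w (runOp p' χ₂ (u + i) j φ w) s' v) + d * ind w l1 s' v) y v := by
      intro v
      rw [runOp_add_fun (φ' := fun s' v => d * ind w l1 s' v), runOp_const_mul, runOp_const_mul, runOp_sum_fun]
    rw [e]
    refine runOp_mono_inr hπ.nonneg (fun s' v hv => ?_) u i y hv
    by_cases hs : s' = w
    · simp only [ind, hs, if_true]
      exact hY w v hv
    · simp [ind, hs]
  -- the first leg
  have h2 : ∀ w, ∀ χ₂ ∈ Y w, runOp p' π u i (ind w (runOp p' χ₂ (u + i) j φ w)) y v ≤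
      b * (∑ χ₁ ∈ X w, runOp p' χ₁ u i (ind w (runOp p' χ₂ (u + i) j φ w)) y v) + d * l1 v := by
    intro w χ₂ hχ₂
    have hc : ∀ s', Covers p' π u i y w (X w) b d (φ s') l1 := by
      intro s'
      by_cases hs : s' = s
      · rw [show φ s' = fun v => |∑ k, v k| by funext v; simp [hφ, ind, hs]]
        exact hX w
      · intro v _
        have e : ind w (φ s') = fun _ _ => 0 := by
          funext s' v; simp [hφ, ind, hs]
        simp only [e, runOp_zero_fun, sum_const_zero, mul_zero, zero_add]
        exact mul_nonneg hd (l1_nonneg v)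
    have := Covers.runOp (hYp w χ₂ hχ₂).nonneg (ψ := fun _ => l1) (u + i) j hc w v hv
    rwa [show LMDP.runOp p' χ₂ (u + i) j (fun _ => l1) w = l1 from
      funext fun v => runOp_l1 hp' (hYp w χ₂ hχ₂) (u + i) j w v] at this
  have hT0 : ∀ w w', ∀ χ₁ ∈ X w', ∀ χ₂ ∈ Y w',
      0 ≤ runOp p' χ₁ u i (ind w (runOp p' χ₂ (u + i) j φ w)) y v := fun w w' χ₁ h₁ χ₂ h₂ =>
    runOp_nonneg (hXp w' χ₁ h₁).nonneg _ _ (ind_nonneg w fun v =>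
      runOp_nonneg (hYp w' χ₂ h₂).nonneg _ _ hφ0 _ _) _ _
  set P : Finset (Pol S A × Pol S A) := univ.biUnion fun w => X w ×ˢ Y w with hP
  have h3 : ∑ w, ∑ χ₂ ∈ Y w, ∑ χ₁ ∈ X w, runOp p' χ₁ u i (ind w (runOp p' χ₂ (u + i) j φ w)) y v ≤
      ∑ ω ∈ W, runOp p' ω u (i + j) φ y v := by
    calc _ = ∑ w, ∑ x ∈ X w ×ˢ Y w, runOp p' x.1 u i (ind w (runOp p' x.2 (u + i) j φ w)) y v := by
          refine sum_congr rfl fun w _ => ?_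
          rw [sum_product, sum_comm]
      _ ≤ ∑ w, ∑ x ∈ P, runOp p' x.1 u i (ind w (runOp p' x.2 (u + i) j φ w)) y v := by
          refine sum_le_sum fun w _ => sum_le_sum_of_subset_of_nonneg
            (subset_biUnion_of_mem (fun w => X w ×ˢ Y w) (mem_univ w)) fun x hx _ => ?_
          obtain ⟨w', -, hx⟩ := mem_biUnion.1 hx
          obtain ⟨hx1, hx2⟩ := mem_product.1 hx
          exact hT0 w w' _ hx1 _ hx2
      _ = ∑ x ∈ P, runOp p' (splice (u + i) x.1 x.2) u (i + j) φ y v := by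
          rw [sum_comm]
          refine sum_congr rfl fun x _ => ?_
          rw [← runOp_eq_sum_ind x.1 u i (runOp p' x.2 (u + i) j φ) y v, runOp_add,
            runOp_congr (σ' := x.2) p' φ fun t h1 _ => splice_of_le h1 _ _,
            runOp_congr (σ' := x.1) p' _ fun t _ h2 => splice_of_lt h2 _ _]
      _ = ∑ ω ∈ P.image fun x => splice (u + i) x.1 x.2, runOp p' ω u (i + j) φ y v := by
          rw [sum_image]
          rintro ⟨χ₁, χ₂⟩ hx ⟨χ₁', χ₂'⟩ hx' he
          obtain ⟨w, -, hx⟩ := mem_biUnion.1 hx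
          obtain ⟨w', -, hx'⟩ := mem_biUnion.1 hx'
          obtain ⟨ha, hb⟩ := mem_product.1 hx
          obtain ⟨ha', hb'⟩ := mem_product.1 hx'
          have he' := fun t => congrFun he t
          dsimp only at ha hb ha' hb' he'
          refine Prod.ext (funext fun t => ?_) (funext fun t => ?_)
          · rcases lt_or_ge t (u + i) with ht | ht
            · have := he' t
              rwa [splice_of_lt ht, splice_of_lt ht] at this
            · exact (hXc w _ ha t (Or.inr ht)).trans (hXc w' _ ha' t (Or.inr ht)).symm
          · rcases lt_or_ge t (u + i) with ht | ht
            · exact (hYc w _ hb t (Or.inl ht)).trans (hYc w' _ hb' t (Or.inl ht)).symm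
            · have := he' t
              rwa [splice_of_le ht, splice_of_le ht] at this
      _ ≤ _ := by
          refine sum_le_sum_of_subset_of_nonneg (fun ω hω => ?_) fun ω hω _ =>
            runOp_nonneg (hWp ω hω).nonneg _ _ hφ0 _ _
          obtain ⟨x, hx, rfl⟩ := mem_image.1 hω
          obtain ⟨w, -, hx⟩ := mem_biUnion.1 hx
          obtain ⟨hx1, hx2⟩ := mem_product.1 hx
          exact hW w _ hx1 _ hx2
  have h4 : ∑ w, runOp p' π u i (ind w l1) y v = l1 v := by
    rw [← runOp_l1 hp' hπ u i y v, runOp_eq_sum_ind π u i (fun _ => l1) y v]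
  calc _ ≤ ∑ w, (b * (∑ χ₂ ∈ Y w, (b * (∑ χ₁ ∈ X w,
            runOp p' χ₁ u i (ind w (runOp p' χ₂ (u + i) j φ w)) y v) + d * l1 v))
          + d * runOp p' π u i (ind w l1) y v) :=
        sum_le_sum fun w _ => (h1 w).trans (add_le_add (mul_le_mul_of_nonneg_left
          (sum_le_sum fun χ₂ hχ₂ => h2 w χ₂ hχ₂) hb) le_rfl)
    _ = b ^ 2 * (∑ w, ∑ χ₂ ∈ Y w, ∑ χ₁ ∈ X w,
            runOp p' χ₁ u i (ind w (runOp p' χ₂ (u + i) j φ w)) y v) +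
          (∑ w, b * ((Y w).card * (d * l1 v))) + d * l1 v := by
        rw [sum_add_distrib, ← mul_sum (s := univ) (a := d), h4]
        congr 1
        rw [mul_sum, ← sum_add_distrib]
        refine sum_congr rfl fun w _ => ?_
        rw [sum_add_distrib, ← mul_sum, sum_const, nsmul_eq_mul]
        ring
    _ ≤ _ := by
        have k1 : ∑ w, b * ((Y w).card * (d * l1 v)) ≤ Fintype.card S * (b * (m * (d * l1 v))) := by
          refine (sum_le_card_nsmul _ _ (b * (m * (d * l1 v))) fun w _ => ?_).trans_eq
            (by rw [card_univ, nsmul_eq_mul])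
          have : ((Y w).card : ℝ) ≤ m := by exact_mod_cast hm w
          gcongr
        have k2 := mul_le_mul_of_nonneg_left h3 (sq_nonneg b)
        linarith

end Coverage
end
end LMDP

/-! ### Families of words and nodes; counting the iterations without coverage -/

namespace LMDP
noncomputable section
open Finset

section Families

variable {S A O ι₁ ι₂ : Type*} [Fintype S] [Fintype A] [Fintype O] [DecidableEq S] [Nonempty A]
  [Fintype ι₁] [Fintype ι₂] [DecidableEq ι₂]
variable {p' : Ker S A O (ι₁ ⊕ ι₂)} {p : Ker S A O ι₂}
variable {Q : Type*} [DecidableEq Q] {e : Q → Pol S A}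

open Classical in
theorem exists_wordFam_of {N u R c : ℕ} {y : S} {B δ : ℝ} {Ψ : Finset (Pol S A)} {π : Pol S A} (hc : 1 ≤ c)
    (h : ∀ i s, 0 < i → u + i < N → ∃ X : Finset (Pol S A), X.card ≤ c ∧ (∀ ω ∈ X, IsPol ω ∧
      (∃ r ≤ R, Wrd Ψ ω (u + i) r u) ∧ ∀ t, t < u ∨ u + i ≤ t → ω t = unifPol S A t) ∧
      Covers p' π u i y s X B δ (fun v => |∑ k, v k|) l1) :
    ∃ W, WordFam p' N Ψ π u y R (Fintype.card S * c) B δ W := by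
  choose! X hX1 hX2 hX3 using h
  let W : ℕ → S → Finset (Pol S A) := fun l s =>
    if l = u then {unifPol S A} else if u < l ∧ l < N then X (l - u) s else ∅
  have hu : ∀ s, W u s = {unifPol S A} := fun s => if_pos rfl
  have hlt : ∀ l s, u < l → l < N → W l s = X (l - u) s := fun l s h1 h2 => by
    simp only [W]; rw [if_neg (by omega), if_pos ⟨h1, h2⟩]
  have hcase : ∀ l s, ∀ ω ∈ W l s, (l = u ∧ ω = unifPol S A) ∨ (u < l ∧ l < N ∧ ω ∈ X (l - u) s) := by
    intro l s ω hω
    simp only [W] at hω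
    split_ifs at hω with h1 h2
    · exact Or.inl ⟨h1, mem_singleton.1 hω⟩
    · exact Or.inr ⟨h2.1, h2.2, hω⟩
    · exact absurd hω (notMem_empty _)
  have hX : ∀ l s, u < l → l < N → ∀ ω ∈ X (l - u) s, IsPol ω ∧
      (∃ r ≤ R, Wrd Ψ ω l r u) ∧ ∀ t, t < u ∨ l ≤ t → ω t = unifPol S A t := by
    intro l s h1 h2 ω hω
    have := hX2 (l - u) s (by omega) (by omega) ω hω
    rwa [show u + (l - u) = l by omega] at this
  refine ⟨W, ⟨fun l s ω hω => ?_, fun l s _ ω hω => ?_, fun l s ω hω => ?_, fun l => ?_, hu,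
    fun i s h1 h2 => ?_⟩⟩
  · rcases hcase l s ω hω with ⟨-, rfl⟩ | ⟨h1, h2, h⟩
    exacts [unifPol_isPol, (hX l s h1 h2 ω h).1]
  · rcases hcase l s ω hω with ⟨rfl, rfl⟩ | ⟨h1, h2, h⟩
    exacts [⟨0, Nat.zero_le _, Wrd.nil⟩, (hX l s h1 h2 ω h).2.1]
  · rcases hcase l s ω hω with ⟨rfl, rfl⟩ | ⟨h1, h2, h⟩
    exacts [fun _ _ => rfl, (hX l s h1 h2 ω h).2.2]
  · refine card_biUnion_le.trans ((sum_le_card_nsmul _ _ c fun s _ => ?_).trans_eq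
      (by rw [card_univ, smul_eq_mul]))
    simp only [W]
    split_ifs with h1 h2
    · simpa using hc
    · exact hX1 _ _ (by omega) (by omega)
    · simp
  · rw [hlt _ _ (by omega) h2, show u + i - u = i by omega]
    exact hX3 i s h1 h2

theorem Covers.weaken {π : Pol S A} {u i : ℕ} {y s : S} {W : Finset (Pol S A)} {B B' D D' : ℝ}
    (h : Covers p' π u i y s W B D (fun v => |∑ k, v k|) l1) (hW : ∀ ω ∈ W, IsPol ω) (hB : B ≤ B')
    (hD : D ≤ D') : Covers p' π u i y s W B' D' (fun v => |∑ k, v k|) l1 := fun v hv =>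
  (h v hv).trans (add_le_add (mul_le_mul_of_nonneg_right hB (sum_nonneg fun ω hω =>
    runOp_nonneg (hW ω hω).nonneg _ _ (ind_nonneg s fun _ => abs_nonneg _) _ _))
    (mul_le_mul_of_nonneg_right hD (l1_nonneg v)))

/-- No seminorm attached to a node or to a pair of nodes grows much when `π` is added to `Ψ`; between
two nodes after the start, it is enough that this holds on both sides of some intermediate time. -/
structure Covered (p : Ker S A O ι₂) (e : Q → Pol S A) (N : ℕ) (y₀ : S) (δ β : ℝ) (Ψ : Finset Q)
    (π : Q) : Prop where
  node : ∀ l s, 0 < l → l < N → Vol (fun q => gap p N (e q) l s) δ (insert π Ψ) <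
    4 / 2 * Vol (fun q => gap p N (e q) l s) δ Ψ
  start : ∀ i s, 0 < i → i < N → Vol (fun q => pairSn p 0 i y₀ s (e q)) δ (insert π Ψ) <
    4 / 2 * Vol (fun q => pairSn p 0 i y₀ s (e q)) δ Ψ
  pair : ∀ u i y s, 0 < u → 0 < i → u + i < N →
    Vol (fun q => pairSn p u i y s (e q)) δ (insert π Ψ) <
      β / 2 * Vol (fun q => pairSn p u i y s (e q)) δ Ψ ∨
    ∃ i₁ i₂, 0 < i₁ ∧ 0 < i₂ ∧ i₁ + i₂ = i ∧ ∀ w,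
      Vol (fun q => pairSn p u i₁ y w (e q)) δ (insert π Ψ) <
        β / 2 * Vol (fun q => pairSn p u i₁ y w (e q)) δ Ψ ∧
      Vol (fun q => pairSn p (u + i₁) i₂ w s (e q)) δ (insert π Ψ) <
        β / 2 * Vol (fun q => pairSn p (u + i₁) i₂ w s (e q)) δ Ψ

open Classical in
theorem Covered.exists_nodeFam (hp : IsKer p)
    (hpp : ∀ t s a o s' k, p' t s a o s' (Sum.inr k) = p t s a o s' k) (he : ∀ q, IsPol (e q))
    (hinj : Function.Injective e) {N : ℕ} {y₀ : S} {δ β : ℝ} (hδ0 : 0 < δ) (hδ : δ ≤ 1)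
    {Ψ : Finset Q} {π : Q} (h : Covered p e N y₀ δ β Ψ π) :
    ∃ D, NodeFam p' N (Ψ.image e) (e π) (Fintype.card ι₂) (4 * Fintype.card ι₂)
      (4 * Fintype.card ι₂ * δ) D := by
  have := fun l s (h1 : 0 < l) (h2 : l < N) =>
    exists_node_cover hp hpp he hinj hδ0 hδ (by norm_num) N l s (h.node l s h1 h2)
  choose! X hX1 hX2 hX3 using this
  refine ⟨fun l s => if 0 < l ∧ l < N then X l s else ∅, ⟨fun l s => ?_, fun l s => ?_,
    fun l s v h1 h2 hv => ?_⟩⟩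
  · split_ifs with h
    exacts [hX1 l s h.1 h.2, empty_subset _]
  · split_ifs with h
    exacts [hX2 l s h.1 h.2, by simp]
  · rw [if_pos ⟨h1, h2⟩]
    exact hX3 l s h1 h2 v hv

theorem wrd_window {Ψ : Finset (Pol S A)} {ψ : Pol S A} (hψ : ψ ∈ Ψ) {u n : ℕ} (hn : 0 < n) :
    Wrd Ψ (window u (u + n) ψ) (u + n) 1 u :=
  Wrd.cons 0 u (u + n) ψ hψ (by omega) (fun _ h1 h2 => window_of ⟨h1, h2⟩ ψ) Wrd.nil

open Classical in
theorem Covered.exists_wordFam_start (hp : IsKer p)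
    (hpp : ∀ t s a o s' k, p' t s a o s' (Sum.inr k) = p t s a o s' k) (he : ∀ q, IsPol (e q))
    {N : ℕ} {y₀ : S} {δ β δ' : ℝ} (hδ0 : 0 < δ) (hδ : δ ≤ 1) [Nonempty ι₂]
    {Ψ : Finset Q} {π : Q} (h : Covered p e N y₀ δ β Ψ π) (hδ' : 4 * Fintype.card ι₂ * δ ≤ δ') :
    ∃ W, WordFam p' N (Ψ.image e) (e π) 0 y₀ 1 (Fintype.card S * Fintype.card ι₂)
      (4 * Fintype.card ι₂ ^ 2) δ' W := by
  refine exists_wordFam_of Fintype.card_pos fun i s h1 h2 => ?_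
  obtain ⟨X, hX1, hX2, hX3⟩ := exists_pair_cover hp hpp he hδ0 hδ (by norm_num) 0 i y₀ s
    (h.start i s h1 (by omega))
  have hX : ∀ ω ∈ X, IsPol ω := fun ω hω => by
    obtain ⟨ψ, hψ, rfl⟩ := hX2 ω hω
    exact (he ψ).window _ _
  refine ⟨X, hX1, fun ω hω => ⟨hX ω hω, ?_⟩, hX3.weaken hX le_rfl hδ'⟩
  obtain ⟨ψ, hψ, rfl⟩ := hX2 ω hω
  exact ⟨⟨1, le_rfl, wrd_window (mem_image_of_mem _ hψ) h1⟩, fun t ht => window_of_not ht _⟩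

open Classical in
-- Either the pair of nodes itself does not grow, and windows of old policies cover it, or both
-- sides of some cut do not grow, whatever the state in between, and the covers are composed through
-- all these states. The composition squares the constant and yields words of two segments.
theorem Covered.exists_wordFam (hp : IsKer p) (hp' : IsKer p')
    (hpp : ∀ t s a o s' k, p' t s a o s' (Sum.inr k) = p t s a o s' k) (he : ∀ q, IsPol (e q))
    {N : ℕ} {y₀ : S} {δ β δ' : ℝ} (hδ0 : 0 < δ) (hδ : δ ≤ 1) (hβ : 1 ≤ β) [Nonempty ι₂]
    {Ψ : Finset Q} {π : Q} (h : Covered p e N y₀ δ β Ψ π)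
    (hδ' : β * Fintype.card ι₂ ^ 2 * Fintype.card ι₂ * Fintype.card S * (β * Fintype.card ι₂ * δ)
      + β * Fintype.card ι₂ * δ ≤ δ') {u : ℕ} (hu : 0 < u) (y : S) :
    ∃ W, WordFam p' N (Ψ.image e) (e π) u y 2 (Fintype.card S * (Fintype.card S * Fintype.card ι₂ ^ 2))
      ((β * Fintype.card ι₂ ^ 2) ^ 2) δ' W := by
  have hS1 : 1 ≤ Fintype.card S := Fintype.card_pos_iff.2 ⟨y⟩
  have hι1 : 1 ≤ Fintype.card ι₂ := Fintype.card_pos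
  have hι1' : (1 : ℝ) ≤ Fintype.card ι₂ := by exact_mod_cast hι1
  have hβι : 1 ≤ β * (Fintype.card ι₂ : ℝ) ^ 2 :=
    one_le_mul_of_one_le_of_one_le hβ (one_le_pow₀ hι1')
  refine exists_wordFam_of (Nat.mul_pos hS1 (by positivity)) fun i s h1 h2 => ?_
  rcases h.pair u i y s hu h1 h2 with h3 | ⟨i₁, i₂, hi₁, hi₂, rfl, h3⟩
  · obtain ⟨X, hX1, hX2, hX3⟩ := exists_pair_cover hp hpp he hδ0 hδ (by linarith) u i y s h3
    have hX : ∀ ω ∈ X, IsPol ω := fun ω hω => by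
      obtain ⟨ψ, hψ, rfl⟩ := hX2 ω hω
      exact (he ψ).window _ _
    refine ⟨X, hX1.trans ?_, fun ω hω => ⟨hX ω hω, ?_⟩, hX3.weaken hX ?_ ?_⟩
    · calc Fintype.card ι₂ = 1 * Fintype.card ι₂ ^ 1 := by ring
        _ ≤ _ := Nat.mul_le_mul hS1 (Nat.pow_le_pow_right hι1 (by norm_num))
    · obtain ⟨ψ, hψ, rfl⟩ := hX2 ω hω
      exact ⟨⟨1, by norm_num, wrd_window (mem_image_of_mem _ hψ) h1⟩, fun t ht => window_of_not ht _⟩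
    · exact le_self_pow₀ hβι two_ne_zero
    · refine le_trans (le_add_of_nonneg_left ?_) hδ'
      positivity
  · have hc1 := fun w => exists_pair_cover hp hpp he hδ0 hδ (by linarith) u i₁ y w (h3 w).1
    have hc2 := fun w => exists_pair_cover hp hpp he hδ0 hδ (by linarith) (u + i₁) i₂ w s (h3 w).2
    choose X hX1 hX2 hX3 using hc1
    choose Y hY1 hY2 hY3 using hc2
    have hmem : ∀ ω ∈ (univ : Finset S).biUnion fun w => image₂ (splice (u + i₁)) (X w) (Y w),
        ∃ ψ₁ ∈ Ψ, ∃ ψ₂ ∈ Ψ, ω = splice (u + i₁) (window u (u + i₁) (e ψ₁))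
          (window (u + i₁) (u + i₁ + i₂) (e ψ₂)) := by
      intro ω hω
      obtain ⟨w, -, hω⟩ := mem_biUnion.1 hω
      obtain ⟨χ₁, h₁, χ₂, h₂, rfl⟩ := mem_image₂.1 hω
      obtain ⟨ψ₁, hψ₁, rfl⟩ := hX2 w χ₁ h₁
      obtain ⟨ψ₂, hψ₂, rfl⟩ := hY2 w χ₂ h₂
      exact ⟨ψ₁, hψ₁, ψ₂, hψ₂, rfl⟩
    have hpol : ∀ ω ∈ (univ : Finset S).biUnion fun w => image₂ (splice (u + i₁)) (X w) (Y w),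
        IsPol ω := by
      intro ω hω
      obtain ⟨ψ₁, -, ψ₂, -, rfl⟩ := hmem ω hω
      exact IsPol.splice ((he ψ₁).window _ _) ((he ψ₂).window _ _) _
    refine ⟨(univ : Finset S).biUnion fun w => image₂ (splice (u + i₁)) (X w) (Y w), ?_,
      fun ω hω => ⟨hpol ω hω, ?_⟩, (covers_comp (b := β * Fintype.card ι₂ ^ 2)
        (d := β * Fintype.card ι₂ * δ) (X := X) (Y := Y)
        hp' (he π) (by positivity) (by positivity) ?_ ?_ ?_ ?_
        hY1 hX3 hY3 (fun w χ₁ h₁ χ₂ h₂ => mem_biUnion.2 ⟨w, mem_univ w, mem_image₂_of_mem h₁ h₂⟩)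
        hpol).weaken hpol le_rfl hδ'⟩
    · refine card_biUnion_le.trans ((sum_le_card_nsmul _ _ (Fintype.card ι₂ ^ 2) fun w _ => ?_).trans_eq
        (by rw [card_univ, smul_eq_mul]))
      rw [pow_two]
      exact (card_image₂_le _ _ _).trans (Nat.mul_le_mul (hX1 w) (hY1 w))
    · obtain ⟨ψ₁, hψ₁, ψ₂, hψ₂, rfl⟩ := hmem ω hω
      refine ⟨⟨2, le_rfl, Wrd.cons 1 u (u + i₁) _ (mem_image_of_mem e hψ₁) (by omega) ?_
        (Wrd.cons 0 (u + i₁) (u + (i₁ + i₂)) _ (mem_image_of_mem e hψ₂) (by omega) ?_ Wrd.nil)⟩, ?_⟩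
      · intro t h1 h2
        rw [splice_of_lt h2, window_of ⟨h1, h2⟩]
      · intro t h1 h2
        rw [splice_of_le h1, window_of ⟨h1, by omega⟩]
      · intro t ht
        rcases lt_or_ge t (u + i₁) with h | h
        · rw [splice_of_lt h, window_of_not (by omega)]
        · rw [splice_of_le h, window_of_not (by omega)]
    · intro w χ hχ
      obtain ⟨ψ, -, rfl⟩ := hX2 w χ hχ
      exact (he ψ).window _ _
    · intro w χ hχ
      obtain ⟨ψ, -, rfl⟩ := hY2 w χ hχ
      exact (he ψ).window _ _
    · intro w χ hχ t ht
      obtain ⟨ψ, -, rfl⟩ := hX2 w χ hχ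
      exact window_of_not ht _
    · intro w χ hχ t ht
      obtain ⟨ψ, -, rfl⟩ := hY2 w χ hχ
      exact window_of_not ht _

end Families

section Count

variable {S A O ι₂ : Type*} [Fintype S] [Fintype A] [Fintype O] [DecidableEq S] [Nonempty A]
  [Fintype ι₂] [DecidableEq ι₂]
variable {p : Ker S A O ι₂}
variable {Q : Type*} [DecidableEq Q] {e : Q → Pol S A}

/-- If `g` holds at `(u, i)` and, for every way to cut `[u, u + i]` in two, on one of the sides, then
it holds for at least `i` intervals of length at most `i`. -/
theorem one_le_sum_inv_of_split {N : ℕ} {g : ℕ → ℕ → Prop} [∀ u i, Decidable (g u i)] {u i : ℕ} (hi : 0 < i)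
    (hN : u + i < N) (h : g u i) (hs : ∀ i₁ i₂, 0 < i₁ → 0 < i₂ → i₁ + i₂ = i → g u i₁ ∨ g (u + i₁) i₂) :
    1 ≤ ∑ u ∈ range N, ∑ i ∈ Icc 1 N, if g u i then (i : ℝ)⁻¹ else 0 := by
  classical
  have key : ∀ j ∈ Icc 1 i, g u j ∨ (j < i ∧ g (u + j) (i - j)) := by
    intro j hj
    obtain ⟨h1, h2⟩ := mem_Icc.1 hj
    rcases h2.lt_or_eq with h2 | rfl
    · rcases hs j (i - j) h1 (by omega) (by omega) with h | h
      exacts [Or.inl h, Or.inr ⟨h2, h⟩]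
    · exact Or.inl h
  -- The cut at distance `j` is charged to its left part, if this is growing, and to its right part
  -- otherwise. The intervals are different: left parts differ in length, right parts in the
  -- starting point, and right parts start after `u`.
  let f : ℕ → ℕ × ℕ := fun j => if g u j then (u, j) else (u + j, i - j)
  have hf : ∀ j ∈ Icc 1 i, f j ∈ (range N ×ˢ Icc 1 N).filter (fun x => g x.1 x.2) ∧ (f j).2 ≤ i := by
    intro j hj
    have h1 := mem_Icc.1 hj
    by_cases hg : g u j
    · simp only [f, if_pos hg, mem_filter, mem_product, mem_range, mem_Icc]
      exact ⟨⟨⟨by omega, by omega, by omega⟩, hg⟩, h1.2⟩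
    · obtain ⟨h2, h3⟩ := (key j hj).resolve_left hg
      simp only [f, if_neg hg, mem_filter, mem_product, mem_range, mem_Icc]
      exact ⟨⟨⟨by omega, by omega, by omega⟩, h3⟩, by omega⟩
  have hinj : Set.InjOn f (Icc 1 i : Finset ℕ) := by
    intro j hj j' hj' hjj
    have h1 := mem_Icc.1 (mem_coe.1 hj)
    have h1' := mem_Icc.1 (mem_coe.1 hj')
    simp only [f] at hjj
    split_ifs at hjj <;> simp only [Prod.mk.injEq] at hjj <;> omega
  rw [← sum_product' (range N) (Icc 1 N) fun u i => if g u i then (i : ℝ)⁻¹ else 0, ← sum_filter]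
  calc (1 : ℝ) = ∑ x ∈ (Icc 1 i).image f, (i : ℝ)⁻¹ := by
        rw [sum_const, card_image_of_injOn hinj, Nat.card_Icc, nsmul_eq_mul, Nat.add_sub_cancel,
          mul_inv_cancel₀ (by exact_mod_cast hi.ne')]
    _ ≤ ∑ x ∈ (Icc 1 i).image f, (x.2 : ℝ)⁻¹ := by
        refine sum_le_sum fun x hx => ?_
        obtain ⟨j, hj, rfl⟩ := mem_image.1 hx
        have h1 := (hf j hj).2
        have h2 := (mem_Icc.1 (mem_product.1 (mem_filter.1 (hf j hj).1).1).2).1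
        exact inv_anti₀ (by exact_mod_cast h2) (by exact_mod_cast h1)
    _ ≤ _ := by
        refine sum_le_sum_of_subset_of_nonneg (fun x hx => ?_) fun x _ _ => by positivity
        obtain ⟨j, hj, rfl⟩ := mem_image.1 hx
        exact (hf j hj).1

theorem sum_inv_le_log (N : ℕ) : ∑ i ∈ Icc 1 N, (i : ℝ)⁻¹ ≤ 1 + Real.log N := by
  have := harmonic_le_one_add_log N
  rw [harmonic_eq_sum_Icc] at this
  push_cast at this
  exact this

/-- Along an increasing sequence of sets of policies, coverage fails a bounded number of times. -/
theorem exists_covered (hp : IsKer p) (he : ∀ q, IsPol (e q)) {N : ℕ} (hN : 1 ≤ N) (y₀ : S) {δ β : ℝ}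
    (hδ0 : 0 < δ) (hδ : δ ≤ 1) (hβ : β = 4 * √N) (Ψ : ℕ → Finset Q) (hΨ : ∀ k, Ψ k ⊆ Ψ (k + 1))
    (π : ℕ → Q) {K : ℕ} (hins : ∀ k < K, Ψ (k + 1) = insert (π k) (Ψ k))
    (hK : 6 * N * Fintype.card S ^ 2 *
      (Real.log (Fintype.card ι₂).factorial - Fintype.card ι₂ * Real.log δ) < K) :
    ∃ k < K, Covered p e N y₀ δ β (Ψ k) (π k) := by
  classical
  by_contra! hcon
  set L := Real.log (Fintype.card ι₂).factorial - Fintype.card ι₂ * Real.log δ with hL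
  have hN1 : (1 : ℝ) ≤ N := by exact_mod_cast hN
  have hL0 : 0 ≤ L := by
    have h1 : 0 ≤ Real.log (Fintype.card ι₂).factorial :=
      Real.log_nonneg (by exact_mod_cast Nat.succ_le_of_lt (Nat.factorial_pos _))
    have h2 := mul_nonneg (Nat.cast_nonneg (α := ℝ) (Fintype.card ι₂))
      (neg_nonneg.2 (Real.log_nonpos hδ0.le hδ))
    rw [hL]; linarith
  have hlog2 : 1 / 2 ≤ Real.log 2 := by have := Real.log_two_gt_d9; linarith
  have hS1 : (1 : ℝ) ≤ Fintype.card S := by exact_mod_cast Fintype.card_pos_iff.2 ⟨y₀⟩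
  let GN : ℕ → S → ℕ → Prop := fun l s k => 4 / 2 * Vol (fun q => gap p N (e q) l s) δ (Ψ k) ≤
    Vol (fun q => gap p N (e q) l s) δ (Ψ (k + 1))
  let GS : ℕ → S → ℕ → Prop := fun i s k => 4 / 2 * Vol (fun q => pairSn p 0 i y₀ s (e q)) δ (Ψ k) ≤
    Vol (fun q => pairSn p 0 i y₀ s (e q)) δ (Ψ (k + 1))
  let GP : ℕ → ℕ → S → S → ℕ → Prop := fun u i y s k =>
    β / 2 * Vol (fun q => pairSn p u i y s (e q)) δ (Ψ k) ≤
    Vol (fun q => pairSn p u i y s (e q)) δ (Ψ (k + 1))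
  have hsqrt : 1 ≤ √(N : ℝ) := by rw [Real.one_le_sqrt]; exact hN1
  have hcount : ∀ {g : ℕ → Prop} {c : ℝ}, (((range K).filter g).card : ℝ) ≤ L / Real.log c →
      0 < c → ∀ c', 0 < c' → c' ≤ Real.log c → (((range K).filter g).card : ℝ) ≤ L / c' := by
    intro g c h _ c' h1 h2
    exact h.trans (div_le_div_of_nonneg_left hL0 h1 h2)
  have cN : ∀ l s, (((range K).filter (GN l s)).card : ℝ) ≤ 2 * L := by
    intro l s
    have := card_vol_growth (fun q v => gap_le_l1 hp (he q) l s v) hδ0 hδ (c := 4 / 2) (by norm_num)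
      Ψ hΨ K ((range K).filter (GN l s)) (fun k hk => mem_range.1 (mem_filter.1 hk).1)
      (fun k hk => (mem_filter.1 hk).2)
    have := hcount this (by norm_num) (1 / 2) (by norm_num) (by norm_num at hlog2 ⊢; linarith)
    linarith
  have cS : ∀ i s, (((range K).filter (GS i s)).card : ℝ) ≤ 2 * L := by
    intro i s
    have := card_vol_growth (fun q v => pairSn_le_l1 hp 0 i y₀ s (he q) v) hδ0 hδ (c := 4 / 2)
      (by norm_num) Ψ hΨ K ((range K).filter (GS i s)) (fun k hk => mem_range.1 (mem_filter.1 hk).1)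
      (fun k hk => (mem_filter.1 hk).2)
    have := hcount this (by norm_num) (1 / 2) (by norm_num) (by norm_num at hlog2 ⊢; linarith)
    linarith
  have hlN : 0 ≤ Real.log N := Real.log_nonneg hN1
  -- The reason for `β = 4 * √N`: a growth by the factor `2 * √N` uses up order `log N` of the
  -- logarithmic volume, which pays for the harmonic sum over the interval lengths. The square of
  -- `β`, by which the composed words are worse, is only linear in `N`.
  have hlβ : (1 + Real.log N) / 2 ≤ Real.log (β / 2) := by
    rw [hβ, show 4 * √(N : ℝ) / 2 = 2 * √(N : ℝ) by ring, Real.log_mul (by norm_num) (by positivity),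
      Real.log_sqrt (by linarith)]
    linarith
  have cP : ∀ u i y s, (((range K).filter (GP u i y s)).card : ℝ) ≤ 2 * L / (1 + Real.log N) := by
    intro u i y s
    have := card_vol_growth (fun q v => pairSn_le_l1 hp u i y s (he q) v) hδ0 hδ (c := β / 2)
      (by rw [hβ]; linarith) Ψ hΨ K ((range K).filter (GP u i y s))
      (fun k hk => mem_range.1 (mem_filter.1 hk).1) (fun k hk => (mem_filter.1 hk).2)
    refine (hcount this (by rw [hβ]; positivity) _ (by positivity) hlβ).trans (le_of_eq ?_)
    field_simp
  -- every step is charged to a growing seminorm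
  have key : ∀ k ∈ range K, (1 : ℝ) ≤ (∑ l ∈ range N, ∑ s, if GN l s k then 1 else 0) +
      (∑ l ∈ range N, ∑ s, if GS l s k then 1 else 0) +
      ∑ u ∈ range N, ∑ i ∈ Icc 1 N, (i : ℝ)⁻¹ * ∑ y, ∑ s, if GP u i y s k then 1 else 0 := by
    intro k hk
    have hk := mem_range.1 hk
    have n1 : (0 : ℝ) ≤ ∑ l ∈ range N, ∑ s, if GN l s k then (1 : ℝ) else 0 := by positivity
    have n2 : (0 : ℝ) ≤ ∑ l ∈ range N, ∑ s, if GS l s k then (1 : ℝ) else 0 := by positivity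
    have n3 : (0 : ℝ) ≤ ∑ u ∈ range N, ∑ i ∈ Icc 1 N, (i : ℝ)⁻¹ * ∑ y, ∑ s,
      if GP u i y s k then (1 : ℝ) else 0 := by positivity
    by_cases h1 : ∃ l s, 0 < l ∧ l < N ∧ GN l s k
    · obtain ⟨l, s, -, hl, h⟩ := h1
      have a1 : (1 : ℝ) ≤ ∑ s, if GN l s k then (1 : ℝ) else 0 := by
        refine le_trans ?_ (single_le_sum (f := fun s => if GN l s k then (1 : ℝ) else 0)
          (fun _ _ => by positivity) (mem_univ s))
        simp [h]
      have a2 := single_le_sum (f := fun l => ∑ s, if GN l s k then (1 : ℝ) else 0)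
          (fun _ _ => by positivity) (mem_range.2 hl)
      linarith
    by_cases h2 : ∃ l s, 0 < l ∧ l < N ∧ GS l s k
    · obtain ⟨l, s, -, hl, h⟩ := h2
      have a1 : (1 : ℝ) ≤ ∑ s, if GS l s k then (1 : ℝ) else 0 := by
        refine le_trans ?_ (single_le_sum (f := fun s => if GS l s k then (1 : ℝ) else 0)
          (fun _ _ => by positivity) (mem_univ s))
        simp [h]
      have a2 := single_le_sum (f := fun l => ∑ s, if GS l s k then (1 : ℝ) else 0)
          (fun _ _ => by positivity) (mem_range.2 hl)
      linarith
    -- If neither node nor start seminorms grow, failure of coverage means that some pair grows and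
    -- that every cut of its interval has a growing side, for some state in between.
    have h3 : ∃ u i y s, 0 < u ∧ 0 < i ∧ u + i < N ∧ GP u i y s k ∧ ∀ i₁ i₂, 0 < i₁ → 0 < i₂ →
        i₁ + i₂ = i → ∃ w, GP u i₁ y w k ∨ GP (u + i₁) i₂ w s k := by
      by_contra! hc
      refine hcon k hk ⟨fun l s h h' => ?_, fun i s h h' => ?_, fun u i y s hu hi hN => ?_⟩
      · push Not at h1
        have := h1 l s h h'
        simp only [GN, hins k hk] at this
        exact not_le.1 this
      · push Not at h2
        have := h2 i s h h'
        simp only [GS, hins k hk] at this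
        exact not_le.1 this
      · by_cases hg : GP u i y s k
        · obtain ⟨i₁, i₂, a1, a2, a3, a4⟩ := hc u i y s hu hi hN hg
          refine Or.inr ⟨i₁, i₂, a1, a2, a3, fun w => ?_⟩
          have := a4 w
          simp only [GP, hins k hk] at this
          exact ⟨not_le.1 this.1, not_le.1 this.2⟩
        · simp only [GP, hins k hk] at hg
          exact Or.inl (not_le.1 hg)
    obtain ⟨u, i, y, s, -, hi, hN, hg, hs⟩ := h3
    have a1 := one_le_sum_inv_of_split (g := fun u i => ∃ y s, GP u i y s k) hi hN ⟨y, s, hg⟩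
      fun i₁ i₂ b1 b2 b3 => by
        obtain ⟨w, h | h⟩ := hs i₁ i₂ b1 b2 b3
        exacts [Or.inl ⟨y, w, h⟩, Or.inr ⟨w, s, h⟩]
    have a2 : ∑ u ∈ range N, ∑ i ∈ Icc 1 N, (if ∃ y s, GP u i y s k then (i : ℝ)⁻¹ else 0) ≤
        ∑ u ∈ range N, ∑ i ∈ Icc 1 N, (i : ℝ)⁻¹ * ∑ y, ∑ s, if GP u i y s k then (1 : ℝ) else 0 := by
      refine sum_le_sum fun u _ => sum_le_sum fun i _ => ?_
      split_ifs with h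
      · obtain ⟨y, s, h⟩ := h
        refine le_mul_of_one_le_right (by positivity) ?_
        have b1 := single_le_sum (f := fun s => if GP u i y s k then (1 : ℝ) else 0)
          (fun _ _ => by positivity) (mem_univ s)
        have b2 := single_le_sum (f := fun y => ∑ s, if GP u i y s k then (1 : ℝ) else 0)
          (fun _ _ => by positivity) (mem_univ y)
        simp only [h, if_true] at b1 b2
        linarith
      · positivity
    linarith
  have tot := sum_le_sum key
  have hcard : ∀ g : ℕ → Prop, ∑ k ∈ range K, (if g k then (1 : ℝ) else 0) = ((range K).filter g).card := by
    intro g; rw [sum_boole]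
  have hkN : ∑ k ∈ range K, ∑ l ∈ range N, ∑ s, (if GN l s k then (1 : ℝ) else 0) ≤
      N * (Fintype.card S * (2 * L)) := by
    rw [sum_comm]
    refine (sum_le_card_nsmul _ _ (Fintype.card S * (2 * L)) fun l _ => ?_).trans_eq
      (by rw [card_range, nsmul_eq_mul])
    rw [sum_comm]
    refine (sum_le_card_nsmul _ _ (2 * L) fun s _ => ?_).trans_eq (by rw [card_univ, nsmul_eq_mul])
    rw [hcard]; exact cN l s
  have hkS : ∑ k ∈ range K, ∑ l ∈ range N, ∑ s, (if GS l s k then (1 : ℝ) else 0) ≤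
      N * (Fintype.card S * (2 * L)) := by
    rw [sum_comm]
    refine (sum_le_card_nsmul _ _ (Fintype.card S * (2 * L)) fun l _ => ?_).trans_eq
      (by rw [card_range, nsmul_eq_mul])
    rw [sum_comm]
    refine (sum_le_card_nsmul _ _ (2 * L) fun s _ => ?_).trans_eq (by rw [card_univ, nsmul_eq_mul])
    rw [hcard]; exact cS l s
  have hkP : ∑ k ∈ range K, ∑ u ∈ range N, ∑ i ∈ Icc 1 N, (i : ℝ)⁻¹ * ∑ y, ∑ s,
      (if GP u i y s k then (1 : ℝ) else 0) ≤ N * (Fintype.card S ^ 2 * (2 * L)) := by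
    rw [sum_comm]
    refine (sum_le_card_nsmul _ _ (Fintype.card S ^ 2 * (2 * L)) fun u _ => ?_).trans_eq
      (by rw [card_range, nsmul_eq_mul])
    rw [sum_comm]
    calc _ ≤ ∑ i ∈ Icc 1 N, (i : ℝ)⁻¹ * (Fintype.card S ^ 2 * (2 * L / (1 + Real.log N))) := by
          refine sum_le_sum fun i _ => ?_
          rw [← mul_sum]
          refine mul_le_mul_of_nonneg_left ?_ (by positivity)
          rw [sum_comm]
          refine (sum_le_card_nsmul _ _ (Fintype.card S * (2 * L / (1 + Real.log N))) fun y _ => ?_).trans_eq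
            (by rw [card_univ, nsmul_eq_mul]; ring)
          rw [sum_comm]
          refine (sum_le_card_nsmul _ _ (2 * L / (1 + Real.log N)) fun s _ => ?_).trans_eq
            (by rw [card_univ, nsmul_eq_mul])
          rw [hcard]; exact cP u i y s
      _ ≤ (1 + Real.log N) * (Fintype.card S ^ 2 * (2 * L / (1 + Real.log N))) := by
          rw [← sum_mul]
          exact mul_le_mul_of_nonneg_right (sum_inv_le_log N) (by positivity)
      _ = _ := by field_simp
  simp only [sum_add_distrib, sum_const, card_range, nsmul_eq_mul, mul_one] at tot
  -- Nodes, starts and pairs contribute at most `2 * N * S ^ 2 * L` each, which makes the constant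
  -- `6`.
  have hS2 : (Fintype.card S : ℝ) ≤ Fintype.card S ^ 2 := by nlinarith
  have h9 : (N : ℝ) * (Fintype.card S * (2 * L)) ≤ N * (Fintype.card S ^ 2 * (2 * L)) := by gcongr
  linarith

end Count
end
end LMDP

/-! ### Episodes as runs of kernels -/

namespace LMDP
noncomputable section
open Finset

/-- Sums over paths of a function that decreases along extensions, on average. -/
theorem sum_path_le {X ι : Type*} [Fintype X] (n : ℕ) (f : (t : Fin n) → (Fin t → X) → X → ι → ℝ)
    (G : (t : ℕ) → (Fin t → X) → (ι → ℝ) → ℝ)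
    (hG : ∀ (t : Fin n) (T : Fin t → X) (v : ι → ℝ),
      ∑ x, G (t + 1) (Fin.snoc (α := fun _ => X) T x) (v * f t T x) ≤ G t T v) (v : ι → ℝ) :
    ∑ T : Fin n → X, G n T (v * ∏ t, f t (pre T t) (T t)) ≤ G 0 (fun i => i.elim0) v := by
  induction n with
  | zero =>
    simp only [univ_eq_empty, prod_empty, mul_one]
    rw [Fintype.sum_unique]
    exact le_of_eq (congrArg (fun T => G 0 T v) (Subsingleton.elim _ _))
  | succ n ih =>
    rw [← (Fin.snocEquiv (fun _ : Fin (n + 1) => X)).sum_comp, Fintype.sum_prod_type_right]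
    refine le_trans (sum_le_sum fun T _ => ?_)
      (ih (fun t => f t.castSucc) fun t T v => hG t.castSucc T v)
    have key : ∀ x : X, ∏ t, f t (pre (Fin.snocEquiv (fun _ : Fin (n + 1) => X) (x, T)) t)
          (Fin.snocEquiv (fun _ : Fin (n + 1) => X) (x, T) t)
        = (∏ t : Fin n, f t.castSucc (pre T t) (T t)) * f (Fin.last n) T x := by
      intro x
      rw [Fin.prod_univ_castSucc]
      congr 1
      · refine Finset.prod_congr rfl fun t _ => ?_
        congr 1
        · funext i
          exact Fin.snoc_castSucc (α := fun _ => X) x T (Fin.castLE t.isLt.le i)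
        · exact Fin.snoc_castSucc (α := fun _ => X) x T t
      · congr 1
        · funext i
          exact Fin.snoc_castSucc (α := fun _ => X) x T i
        · exact Fin.snoc_last (α := fun _ => X) x T
    simp_rw [key, ← mul_assoc]
    exact hG (Fin.last n) T (v * ∏ t : Fin n, f t.castSucc (pre T t) (T t))

section Bridge

variable {H : ℕ} {𝒮 𝒜 : Type*} [Fintype 𝒮] [Fintype 𝒜] [Nonempty 𝒜] [DecidableEq 𝒮] {ℛ : Finset ℝ}
variable {ι : Type*} [Fintype ι]

/-- The distribution of the next state after a history of `t` steps. -/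
def nextDist (initDist : ι → Dist 𝒮) (trans : ι → 𝒮 → 𝒜 → Dist 𝒮) (k : ι) :
    (t : ℕ) → (Fin t → Step 𝒮 𝒜 ℛ) → Dist 𝒮
  | 0, _ => initDist k
  | (t + 1), h => trans k (h (Fin.last t)).1 (h (Fin.last t)).2.1

/-- The kernels of a family of episodic processes: an episode starts in the null state, the state
and the reward of step `t + 1` are those of time `t + 1`, and nothing moves after the horizon. -/
def envKer (H : ℕ) (initDist : ι → Dist 𝒮) (trans : ι → 𝒮 → 𝒜 → Dist 𝒮) (reward : ι → 𝒮 → 𝒜 → Dist ℛ) :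
    Ker (Option 𝒮) 𝒜 (Option ℛ) ι := fun t s a o s' k =>
  match s, o, s' with
  | none, none, some x => initDist k x
  | some s, some r, some x => reward k s a r * if t < H then trans k s a x else if x = s then 1 else 0
  | _, _, _ => 0

variable {initDist : ι → Dist 𝒮} {trans : ι → 𝒮 → 𝒜 → Dist 𝒮} {reward : ι → 𝒮 → 𝒜 → Dist ℛ}

theorem sum_dist {α : Type*} [Fintype α] (q : Dist α) : ∑ a, q a = 1 := q.2.2

theorem dist_nonneg' {α : Type*} [Fintype α] (q : Dist α) (a : α) : 0 ≤ q a := q.2.1 a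

theorem envKer_isKer : IsKer (envKer H initDist trans reward) where
  nonneg t s a o s' k := by
    cases s <;> cases o <;> cases s' <;> simp only [envKer, le_refl]
    · exact dist_nonneg' _ _
    · refine mul_nonneg (dist_nonneg' _ _) ?_
      split_ifs
      exacts [dist_nonneg' _ _, zero_le_one, le_rfl]
  sum_eq t s a k := by
    cases s with
    | none => simp [Fintype.sum_option, envKer]
    | some s =>
      simp only [Fintype.sum_option, envKer, sum_const_zero, zero_add, ← mul_sum]
      have : ∑ x, (if t < H then (trans k s a) x else if x = s then (1 : ℝ) else 0) = 1 := by
        split_ifs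
        · exact sum_dist _
        · simp
      rw [this]
      simp only [mul_one]; exact sum_dist (reward k s a)

/-- Comparison of the law of the episodes with a value function on the nodes. -/
theorem sum_traj_le (π : HistPolicy H 𝒮 𝒜 ℛ) (c : ι → ℝ) (φ : (ι → ℝ) → ℝ)
    (V : ℕ → Option 𝒮 → (ι → ℝ) → ℝ) (hV : ∀ t s (a : ℝ) v, 0 ≤ a → V t s (a • v) = a * V t s v)
    (hstep : ∀ (t : Fin H) (T : Fin t → Step 𝒮 𝒜 ℛ) s v, ∑ a, π t T s a * ∑ o, ∑ s',
      V (t + 2) s' (v * envKer H initDist trans reward (t + 1) (some s) a o s') ≤ V (t + 1) (some s) v)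
    (hstart : ∀ v a, ∑ o, ∑ s', V 1 s' (v * envKer H initDist trans reward 0 none a o s') ≤ V 0 none v)
    (hend : ∀ s v, V (H + 1) s v = φ v) (hH : 0 < H) :
    ∑ T : Traj H 𝒮 𝒜 ℛ, φ (fun k => c k * ∏ t : Fin H, (nextDist initDist trans k t (pre T t) (T t).1
      * π t (pre T t) (T t).1 (T t).2.1 * reward k (T t).1 (T t).2.1 (T t).2.2)) ≤ V 0 none c := by
  have h0 : ∀ t s, V t s 0 = 0 := fun t s => by simpa using hV t s 0 0 le_rfl
  let f : (t : Fin H) → (Fin t → Step 𝒮 𝒜 ℛ) → Step 𝒮 𝒜 ℛ → ι → ℝ := fun t h x k =>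
    nextDist initDist trans k t h x.1 * π t h x.1 x.2.1 * reward k x.1 x.2.1 x.2.2
  -- An episode step comprises state, action and reward, while a kernel step goes from an action to
  -- the next state. The potential after `t` steps therefore averages over the state of the coming
  -- one, and this shifts the time by one.
  let G : (t : ℕ) → (Fin t → Step 𝒮 𝒜 ℛ) → (ι → ℝ) → ℝ := fun t h v =>
    if t < H then ∑ s, V (t + 1) (some s) (v * fun k => nextDist initDist trans k t h s) else φ v
  have key := sum_path_le H f G (fun t T v => ?_) c
  · refine le_trans (le_of_eq ?_) (key.trans ?_)
    · refine sum_congr rfl fun T _ => ?_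
      simp only [G, lt_irrefl, if_false]
      congr 1
      funext k
      simp [f, Finset.prod_apply]
    · simp only [G, hH, if_true]
      refine le_trans (le_of_eq ?_) (hstart c (Classical.arbitrary 𝒜))
      simp only [Fintype.sum_option]
      have e1 : ∀ s', (envKer H initDist trans reward 0 none (Classical.arbitrary 𝒜) none (some s'))
          = fun k => initDist k s' := fun s' => rfl
      have e2 : (envKer H initDist trans reward 0 none (Classical.arbitrary 𝒜) none none) = 0 := rfl
      have e3 : ∀ r s', (envKer H initDist trans reward 0 none (Classical.arbitrary 𝒜) (some r) s')
          = 0 := fun r s' => rfl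
      simp only [e1, e2, e3, mul_zero, h0, sum_const_zero, zero_add, add_zero]
      rfl
  · have hG : ∀ s a r, G (t + 1) (Fin.snoc (α := fun _ => Step 𝒮 𝒜 ℛ) T (s, a, r)) (v * f t T (s, a, r))
        = π t T s a * ∑ s', V (t + 2) (some s') (v * (fun k => nextDist initDist trans k t T s) *
          envKer H initDist trans reward (t + 1) (some s) a (some r) (some s')) := by
      intro s a r
      have hπ : 0 ≤ π t T s a := dist_nonneg' _ _
      by_cases ht : (t : ℕ) + 1 < H
      · simp only [G, ht, if_true]
        rw [mul_sum]
        refine sum_congr rfl fun s' _ => ?_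
        rw [← hV _ _ _ _ hπ]
        congr 1
        funext k
        simp only [Pi.mul_apply, Pi.smul_apply, smul_eq_mul, f, envKer, ht, if_true, nextDist, Fin.snoc_last]
        ring
      -- The last step: the kernel only emits the reward and stays in `s`, so a single term survives
      -- and `V` is the terminal `φ`.
      · have hte : (t : ℕ) + 1 = H := by have := t.2; omega
        have htv : (t : ℕ) + 2 = H + 1 := by omega
        simp only [G, ht, if_false]
        rw [sum_eq_single s]
        · rw [← hV _ _ _ _ hπ, htv, hend]
          congr 1
          funext k
          simp only [Pi.mul_apply, Pi.smul_apply, smul_eq_mul, f, envKer, ht, if_true, if_false]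
          ring
        · intro s' _ hs
          convert h0 _ _
          funext k
          simp [envKer, ht, hs]
        · simp
    have e3 : ∀ s a s', envKer H initDist trans reward (t + 1) (some s) a none s' = 0 := by
      intro s a s'; cases s' <;> rfl
    have e4 : ∀ s a r, envKer H initDist trans reward (t + 1) (some s) a (some r) none = 0 := by
      intro s a r; rfl
    rw [Fintype.sum_prod_type]
    simp only [Fintype.sum_prod_type, hG]
    simp only [G, t.2, if_true]
    refine sum_le_sum fun s _ => ?_
    refine le_trans (le_of_eq ?_) (hstep t T s _)
    refine sum_congr rfl fun a _ => ?_
    rw [← mul_sum]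
    simp only [Fintype.sum_option, e3, e4, mul_zero, h0, sum_const_zero, zero_add, add_zero]

/-- A memoryless policy on the time axis of the kernels, with uniformly random actions at irrelevant
times. -/
def MlsPolicy.ext (π : MlsPolicy H 𝒮 𝒜) : Pol (Option 𝒮) 𝒜 := fun t s a =>
  match t, s with
  | i + 1, some s => if h : i < H then π ⟨i, h⟩ s a else 1 / (Fintype.card 𝒜 : ℝ)
  | _, _ => 1 / (Fintype.card 𝒜 : ℝ)

theorem ext_succ (π : MlsPolicy H 𝒮 𝒜) (t : Fin H) (s : 𝒮) (a : 𝒜) :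
    π.ext (t + 1) (some s) a = π t s a := by
  simp [MlsPolicy.ext]

theorem ext_none (π : MlsPolicy H 𝒮 𝒜) (t : ℕ) (a : 𝒜) : π.ext t none a = 1 / (Fintype.card 𝒜 : ℝ) := by
  cases t <;> rfl

theorem ext_zero (π : MlsPolicy H 𝒮 𝒜) : π.ext 0 = unifPol (Option 𝒮) 𝒜 0 := by
  funext s a; cases s <;> rfl

theorem ext_of_le (π : MlsPolicy H 𝒮 𝒜) {t : ℕ} (ht : H < t) : π.ext t = unifPol (Option 𝒮) 𝒜 t := by
  funext s a
  obtain ⟨i, rfl⟩ : ∃ i, t = i + 1 := ⟨t - 1, by omega⟩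
  cases s
  · rfl
  · simp [MlsPolicy.ext, unifPol, show ¬ i < H by omega]

theorem ext_isPol (π : MlsPolicy H 𝒮 𝒜) : IsPol π.ext where
  nonneg t s a := by
    unfold MlsPolicy.ext
    split
    · split_ifs
      exacts [dist_nonneg' _ _, by positivity]
    · positivity
  sum_eq t s := by
    have : (Fintype.card 𝒜 : ℝ) ≠ 0 := by positivity
    unfold MlsPolicy.ext
    split
    · split_ifs
      exacts [sum_dist _, by simp [this]]
    · simp [this]

theorem ext_injective : Function.Injective (MlsPolicy.ext : MlsPolicy H 𝒮 𝒜 → Pol (Option 𝒮) 𝒜) := by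
  intro π π' h
  funext t s
  refine Subtype.ext (funext fun a => ?_)
  have := congrFun (congrFun (congrFun h (t + 1)) (some s)) a
  rwa [ext_succ, ext_succ] at this

theorem ext_unif : (unif : MlsPolicy H 𝒮 𝒜).ext = unifPol (Option 𝒮) 𝒜 := by
  funext t s a
  unfold MlsPolicy.ext unifPol
  split
  · split_ifs
    · simp [unif, stdSimplex.barycenter]
      rfl
    · rfl
  · rfl

/-- The memoryless policy that a policy on the time axis of the kernels induces. -/
def IsPol.toMls {ω : Pol (Option 𝒮) 𝒜} (hω : IsPol ω) : MlsPolicy H 𝒮 𝒜 := fun t s =>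
  ⟨fun a => ω (t + 1) (some s) a, fun a => hω.nonneg _ _ a, hω.sum_eq _ _⟩

/-- The comparison `sum_traj_le` needs only positive homogeneity and a one-step inequality. For
`gap` these are equalities, so it applies to `gap` and to its negative. -/
theorem gap_eq_sum_traj {ω : Pol (Option 𝒮) 𝒜} (hω : IsPol ω) (π : MlsPolicy H 𝒮 𝒜)
    (hπ : ∀ (t : Fin H) s a, ω (t + 1) (some s) a = π t s a) (c : ι → ℝ) (hH : 0 < H) :
    gap (envKer H initDist trans reward) (H + 1) ω 0 none c =
    ∑ T : Traj H 𝒮 𝒜 ℛ, |∑ k, c k * ∏ t : Fin H, (nextDist initDist trans k t (pre T t) (T t).1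
      * π t (T t).1 (T t).2.1 * reward k (T t).1 (T t).2.1 (T t).2.2)| := by
  have hst : ∀ (t : Fin H) (T : Fin t → Step 𝒮 𝒜 ℛ) s v, ∑ a, (π.toHist : HistPolicy H 𝒮 𝒜 ℛ) t T s a *
      ∑ o, ∑ s', gap (envKer H initDist trans reward) (H + 1) ω (t + 2) s'
        (v * envKer H initDist trans reward (t + 1) (some s) a o s') =
      gap (envKer H initDist trans reward) (H + 1) ω (t + 1) (some s) v := by
    intro t T s v
    rw [gap_step (t := t + 1) ω (by have := t.2; omega)]
    simp only [stepOp, hπ]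
    rfl
  have hin : ∀ v a, ∑ o, ∑ s', gap (envKer H initDist trans reward) (H + 1) ω 1 s'
      (v * envKer H initDist trans reward 0 none a o s') =
      gap (envKer H initDist trans reward) (H + 1) ω 0 none v := by
    intro v a
    rw [gap_step (t := 0) ω (by omega)]
    simp only [stepOp]
    rw [show (∑ o, ∑ s', gap (envKer H initDist trans reward) (H + 1) ω 1 s'
      (v * envKer H initDist trans reward 0 none a o s')) = ∑ a', ω 0 none a' *
        ∑ o, ∑ s', gap (envKer H initDist trans reward) (H + 1) ω 1 s'
          (v * envKer H initDist trans reward 0 none a o s') by rw [← sum_mul, hω.sum_eq, one_mul]]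
    refine sum_congr rfl fun a' _ => ?_
    refine congrArg _ (sum_congr rfl fun o _ => sum_congr rfl fun s' _ => ?_)
    cases o <;> cases s' <;> rfl
  refine le_antisymm ?_ ?_
  · have := sum_traj_le (initDist := initDist) (trans := trans) (reward := reward) π.toHist c (fun v => -|∑ k, v k|)
      (fun t s v => - gap (envKer H initDist trans reward) (H + 1) ω t s v)
      (fun t s a v ha => by rw [(gap_sn hω.nonneg t s).smul_nonneg ha]; ring)
      (fun t T s v => by
        simp only [sum_neg_distrib, mul_neg]
        rw [hst t T s v])
      (fun v a => by
        simp only [sum_neg_distrib]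
        rw [hin])
      (fun s v => by rw [gap_end]; rfl) hH
    rw [sum_neg_distrib] at this
    exact neg_le_neg_iff.1 this
  · exact sum_traj_le (initDist := initDist) (trans := trans) (reward := reward) π.toHist c (fun v => |∑ k, v k|)
      (fun t s v => gap (envKer H initDist trans reward) (H + 1) ω t s v)
      (fun t s a v ha => (gap_sn hω.nonneg t s).smul_nonneg ha v)
      (fun t T s v => (hst t T s v).le) (fun v a => (hin v a).le)
      (fun s v => by rw [gap_end]; rfl) hH

/-- Whatever the history, an average over actions is at most the maximum over actions. -/
theorem sum_traj_le_maxVal (π : HistPolicy H 𝒮 𝒜 ℛ) (c : ι → ℝ) (hH : 0 < H) :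
    ∑ T : Traj H 𝒮 𝒜 ℛ, |∑ k, c k * ∏ t : Fin H, (nextDist initDist trans k t (pre T t) (T t).1
      * π t (pre T t) (T t).1 (T t).2.1 * reward k (T t).1 (T t).2.1 (T t).2.2)| ≤
    maxVal (envKer H initDist trans reward) 0 (H + 1) none c := by
  refine sum_traj_le (initDist := initDist) (trans := trans) (reward := reward) π c (fun v => |∑ k, v k|)
    (fun t s v => maxVal (envKer H initDist trans reward) t (H + 1 - t) s v)
    (fun t s a v ha => (maxVal_sn _ _ s).smul_nonneg ha v) (fun t T s v => ?_) (fun v a => ?_)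
    (fun s v => by simp [maxVal, absSum]) hH
  · rw [show H + 1 - (t + 1) = (H + 1 - (t + 2)) + 1 by have := t.2; omega, maxVal_succ]
    calc _ ≤ ∑ a, π t T s a * univ.sup' univ_nonempty fun a => ∑ o, ∑ s',
          maxVal (envKer H initDist trans reward) (t + 1 + 1) (H + 1 - (t + 2)) s'
            (v * envKer H initDist trans reward (t + 1) (some s) a o s') :=
          sum_le_sum fun a _ => mul_le_mul_of_nonneg_left
            (le_sup' (fun a => ∑ o, ∑ s', maxVal (envKer H initDist trans reward) (t + 1 + 1)
              (H + 1 - (t + 2)) s' (v * envKer H initDist trans reward (t + 1) (some s) a o s')) (mem_univ a))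
            (dist_nonneg' _ _)
      _ = _ := by rw [← sum_mul, sum_dist, one_mul]
  · rw [show H + 1 - 0 = (H + 1 - 1) + 1 by omega, maxVal_succ]
    exact le_sup' (fun a => ∑ o, ∑ s', maxVal (envKer H initDist trans reward) (0 + 1) (H + 1 - 1) s'
      (v * envKer H initDist trans reward 0 none a o s')) (mem_univ a)

end Bridge

section Pair

variable {M H : ℕ} {𝒮 𝒜 : Type*} [Fintype 𝒮] [Fintype 𝒜] [Nonempty 𝒜] [DecidableEq 𝒮] {ℛ : Finset ℝ}

/-- The kernels of a model. -/
def Model.ker (H : ℕ) (θ : Model M 𝒮 𝒜 ℛ) : Ker (Option 𝒮) 𝒜 (Option ℛ) (Fin M) :=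
  envKer H θ.init θ.trans θ.reward

/-- The kernels of two models, side by side. -/
def pairKer (H : ℕ) (θ θs : Model M 𝒮 𝒜 ℛ) : Ker (Option 𝒮) 𝒜 (Option ℛ) (Fin M ⊕ Fin M) :=
  envKer H (Sum.elim θ.init θs.init) (Sum.elim θ.trans θs.trans) (Sum.elim θ.reward θs.reward)

theorem ker_isKer (θ : Model M 𝒮 𝒜 ℛ) : IsKer (θ.ker H) := envKer_isKer

theorem pairKer_isKer (θ θs : Model M 𝒮 𝒜 ℛ) : IsKer (pairKer H θ θs) := envKer_isKer

theorem pairKer_inr (θ θs : Model M 𝒮 𝒜 ℛ) (t s a o s' k) :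
    pairKer H θ θs t s a o s' (Sum.inr k) = θs.ker H t s a o s' k := by
  cases s <;> cases o <;> cases s' <;> rfl

/-- The weights of the difference of two models. -/
def pairWt (θ θs : Model M 𝒮 𝒜 ℛ) : Fin M ⊕ Fin M → ℝ := Sum.elim (fun m => θ.w m) fun m => -θs.w m

theorem nextDist_inl (θ θs : Model M 𝒮 𝒜 ℛ) (m : Fin M) (t : ℕ) (h : Fin t → Step 𝒮 𝒜 ℛ) :
    nextDist (Sum.elim θ.init θs.init) (Sum.elim θ.trans θs.trans) (Sum.inl m) t h
      = θ.nextState m t h := by cases t <;> rfl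

theorem nextDist_inr (θ θs : Model M 𝒮 𝒜 ℛ) (m : Fin M) (t : ℕ) (h : Fin t → Step 𝒮 𝒜 ℛ) :
    nextDist (Sum.elim θ.init θs.init) (Sum.elim θ.trans θs.trans) (Sum.inr m) t h
      = θs.nextState m t h := by cases t <;> rfl

theorem tv_eq_sum (θ θs : Model M 𝒮 𝒜 ℛ) (π : HistPolicy H 𝒮 𝒜 ℛ) : tv θ θs π =
    ∑ T : Traj H 𝒮 𝒜 ℛ, |∑ k, pairWt θ θs k * ∏ t : Fin H,
      (nextDist (Sum.elim θ.init θs.init) (Sum.elim θ.trans θs.trans) k t (pre T t) (T t).1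
      * π t (pre T t) (T t).1 (T t).2.1 *
        (Sum.elim θ.reward θs.reward) k (T t).1 (T t).2.1 (T t).2.2)| := by
  unfold tv
  refine sum_congr rfl fun T _ => ?_
  rw [Fintype.sum_sum_type]
  simp only [nextDist_inl, nextDist_inr, pairWt, Sum.elim_inl, Sum.elim_inr, neg_mul, sum_neg_distrib,
    ← sub_eq_add_neg]
  rfl

theorem gap_eq_tv (θ θs : Model M 𝒮 𝒜 ℛ) {ω : Pol (Option 𝒮) 𝒜} (hω : IsPol ω) (π : MlsPolicy H 𝒮 𝒜)
    (hπ : ∀ (t : Fin H) s a, ω (t + 1) (some s) a = π t s a) (hH : 0 < H) :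
    gap (pairKer H θ θs) (H + 1) ω 0 none (pairWt θ θs) = tv θ θs π.toHist := by
  rw [tv_eq_sum]
  exact gap_eq_sum_traj hω π hπ _ hH

theorem tv_eq_gap (θ θs : Model M 𝒮 𝒜 ℛ) (π : MlsPolicy H 𝒮 𝒜) (hH : 0 < H) :
    tv θ θs π.toHist = gap (pairKer H θ θs) (H + 1) π.ext 0 none (pairWt θ θs) :=
  (gap_eq_tv θ θs (ext_isPol π) π (ext_succ π) hH).symm

/-- If all memoryless policies nearly agree, then so do all history-dependent ones. -/
theorem tv_hist_le (θ θs : Model M 𝒮 𝒜 ℛ) (hM : 1 ≤ M) (hH : 0 < H) {e : ℝ}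
    (he : ∀ π : MlsPolicy H 𝒮 𝒜, tv θ θs π.toHist ≤ e) (π : HistPolicy H 𝒮 𝒜 ℛ) :
    tv θ θs π ≤ ((H + 2) * (Fintype.card 𝒮 + 1) * (Fintype.card 𝒜 + 2) * (2 * M + 1)) ^ (2 * M - 1) * e := by
  -- `Φ` belongs to the set of all `2 * M` contexts, reached after `2 * M - 1` levels. It is
  -- evaluated in the null state at time 0, where no prefix is left.
  obtain ⟨Φ, -, h2, h3⟩ := exists_hist_bound (p := pairKer H θ θs) (N := H + 1) (pairKer_isKer θ θs)
    (y₀ := none) (c := pairWt θ θs) (e := e)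
    (fun ω hω => by
      rw [gap_eq_tv θ θs hω hω.toMls (fun _ _ _ => rfl) hH]
      exact he _) rfl (2 * M - 1) univ (by
        rw [card_univ, Fintype.card_sum, Fintype.card_fin]; omega)
  rw [tv_eq_sum]
  refine (sum_traj_le_maxVal π _ hH).trans ((h2 0 none _ (Nat.zero_le _) ⟨fun i => ?_, fun i => ?_,
    fun k hk => absurd (mem_univ k) hk⟩).trans ((h3 0 (Nat.zero_le _) _ unifPol_isPol).trans
      (le_of_eq ?_)))
  · exact dist_nonneg' _ _
  · exact neg_nonpos.2 (dist_nonneg' _ _)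
  · congr 2
    rw [Fintype.card_option, Fintype.card_sum, Fintype.card_fin]
    push_cast
    ring

end Pair
end
end LMDP

/-! ### Tests are data collection policies -/

namespace LMDP
noncomputable section
open Finset

section Design

variable {H : ℕ} {𝒮 𝒜 : Type*} [Fintype 𝒮] [Fintype 𝒜] [Nonempty 𝒜] [DecidableEq 𝒮]

theorem Tst.cases_at {S A : Type*} [Fintype S] [Fintype A] [DecidableEq S] {Ψ : Finset (Pol S A)}
    {N q u : ℕ} {σ : Pol S A} (h : Tst Ψ N σ q u) {t : ℕ} (ht : u ≤ t) :
    σ t = unifPol S A t ∨ ∃ ψ ∈ Ψ, σ t = ψ t := by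
  induction h with
  | done q u h => exact Or.inl (h t ht)
  | cons q u τ ψ hψ hu hN h hτ _ ih =>
    rcases lt_trichotomy t τ with h1 | rfl | h1
    · exact Or.inr ⟨ψ, hψ, h t ht h1⟩
    · rcases hτ with h2 | h2
      exacts [Or.inr ⟨ψ, hψ, h2⟩, Or.inl h2]
    · exact ih h1

open Classical in
-- By induction along the test: a new first checkpoint is added in front and all indices of segments
-- move up by one.
theorem Tst.exists_segments {Ψ : Finset (MlsPolicy H 𝒮 𝒜)} (hΨ : unif ∈ Ψ) {q u : ℕ}
    {σ : Pol (Option 𝒮) 𝒜} (h : Tst (Ψ.image MlsPolicy.ext) (H + 1) σ q u) :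
    ∃ (ψ : ℕ → MlsPolicy H 𝒮 𝒜) (τ Z : Finset (Fin H)), (∀ i, ψ i ∈ Ψ) ∧ (∀ i, q ≤ i → ψ i = unif) ∧
      (∀ t ∈ τ, u ≤ (t : ℕ) + 1) ∧ τ.card ≤ q ∧ Z ⊆ τ ∧ ∀ (t : Fin H) s a, u ≤ (t : ℕ) + 1 →
        σ (t + 1) (some s) a = if t ∈ Z then unif t s a else ψ (τ.filter (· < t)).card t s a := by
  have hun : ∀ (t : Fin H) (s : 𝒮) (a : 𝒜), unifPol (Option 𝒮) 𝒜 (t + 1) (some s) a = unif t s a :=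
    fun t s a => by rw [← ext_succ, ext_unif]
  induction h with
  | done q u h =>
    refine ⟨fun _ => unif, ∅, ∅, fun _ => hΨ, fun _ _ => rfl, by simp, by simp, by simp,
      fun t s a ht => ?_⟩
    rw [h _ ht, hun]
    simp
  | cons q u τ₀ χ hχ hu hN h hτ _ ih =>
    obtain ⟨ψ, τ, Z, h1, h2, h3, h4, h5, h6⟩ := ih
    -- A checkpoint at time 0 lies in the null state, where actions have no effect, and is dropped.
    rcases Nat.eq_zero_or_pos τ₀ with rfl | hpos
    · exact ⟨ψ, τ, Z, h1, fun i hi => h2 i (by omega), fun t ht => by have := h3 t ht; omega,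
        by omega, h5, fun t s a _ => h6 t s a (by omega)⟩
    obtain ⟨ψ₀, hψ₀, rfl⟩ := mem_image.1 hχ
    set t₀ : Fin H := ⟨τ₀ - 1, by omega⟩ with ht₀
    have hval : (t₀ : ℕ) + 1 = τ₀ := by simp only [ht₀]; omega
    have hgt : ∀ t ∈ τ, t₀ < t := fun t ht => by
      have := h3 t ht
      exact Fin.lt_def.2 (by omega)
    have hnot : t₀ ∉ τ := fun h => lt_irrefl _ (hgt _ h)
    -- At the checkpoint the test plays the policy of the segment or uniformly; an intervention is
    -- recorded only if it does not play the former.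
    let Z' : Finset (Fin H) := if σ τ₀ = MlsPolicy.ext ψ₀ τ₀ then Z else insert t₀ Z
    have hZ' : ∀ t, t ≠ t₀ → (t ∈ Z' ↔ t ∈ Z) := by
      intro t ht
      simp only [Z']
      split_ifs
      · rfl
      · simp [ht]
    refine ⟨fun i => if i = 0 then ψ₀ else ψ (i - 1), insert t₀ τ, Z', fun i => ?_, fun i hi => ?_,
      fun t ht => ?_, ?_, ?_, fun t s a ht => ?_⟩
    · dsimp only
      split_ifs
      exacts [hψ₀, h1 _]
    · dsimp only
      rw [if_neg (by omega)]
      exact h2 _ (by omega)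
    · rcases mem_insert.1 ht with rfl | ht
      · omega
      · have := h3 t ht; omega
    · rw [card_insert_of_notMem hnot]; omega
    · simp only [Z']
      split_ifs
      exacts [h5.trans (subset_insert _ _), insert_subset_insert _ h5]
    · dsimp only
      rcases lt_trichotomy t t₀ with hlt | rfl | hlt
      · have hl := Fin.lt_def.1 hlt
        have hZ : t ∉ Z' := fun hz => by
          have := hgt _ (h5 ((hZ' t hlt.ne).1 hz))
          exact lt_asymm hlt this
        have hf : (insert t₀ τ).filter (· < t) = ∅ := by
          rw [filter_eq_empty_iff]
          intro x hx
          rcases mem_insert.1 hx with rfl | hx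
          · exact not_lt.2 hlt.le
          · exact not_lt.2 (hlt.trans (hgt x hx)).le
        rw [if_neg hZ, hf, card_empty, if_pos rfl, h _ ht (by omega), ext_succ]
      · have hf : (insert t₀ τ).filter (· < t₀) = ∅ := by
          rw [filter_eq_empty_iff]
          intro x hx
          rcases mem_insert.1 hx with rfl | hx
          · exact lt_irrefl _
          · exact not_lt.2 (hgt x hx).le
        rw [hf, card_empty, if_pos rfl]
        have hZ0 : t₀ ∉ Z := fun hz => hnot (h5 hz)
        by_cases hc : σ τ₀ = MlsPolicy.ext ψ₀ τ₀
        · have : t₀ ∉ Z' := by simp only [Z', if_pos hc]; exact hZ0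
          rw [if_neg this, hval, hc, ← hval, ext_succ]
        · have : t₀ ∈ Z' := by simp only [Z', if_neg hc]; exact mem_insert_self _ _
          rw [if_pos this, hval, hτ.resolve_left hc, ← hval, hun]
      · have hl := Fin.lt_def.1 hlt
        have hf : (insert t₀ τ).filter (· < t) = insert t₀ (τ.filter (· < t)) := by
          rw [filter_insert, if_pos hlt]
        rw [hf, card_insert_of_notMem (fun hm => hnot (mem_filter.1 hm).1), h6 t s a (by omega)]
        simp only [hZ' t hlt.ne', Nat.succ_ne_zero, if_false, Nat.add_sub_cancel]

open Classical in
/-- Tests over `Ψ` are the segmented policies over `Ψ`. -/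
theorem IsTest.exists_design {Ψ : Finset (MlsPolicy H 𝒮 𝒜)} (hΨ : unif ∈ Ψ) {d : ℕ} (hd : 1 ≤ d)
    (hH : 0 < H) {σ : Pol (Option 𝒮) 𝒜} (h : IsTest (Ψ.image MlsPolicy.ext) (H + 1) d 0 σ) :
    ∃ (ψ : Fin d → MlsPolicy H 𝒮 𝒜) (τ Z : Finset (Fin H)), (∀ i, ψ i ∈ Ψ) ∧ τ.Nonempty ∧ τ.card ≤ d ∧
      Z ⊆ τ ∧ (segmented ψ τ Z).ext = σ := by
  obtain ⟨ψ, τ, Z, h1, h2, -, h4, h5, h6⟩ := h.tst.exists_segments hΨ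
  have key : ∀ τ' : Finset (Fin H), (∀ t : Fin H, (τ'.filter (· < t)).card = (τ.filter (· < t)).card) →
      (segmented (fun i : Fin d => ψ i) τ' Z).ext = σ := by
    intro τ' hτ'
    funext t s a
    rcases Nat.eq_zero_or_pos t with rfl | hpos
    · rw [ext_zero]
      rcases h.tst.cases_at le_rfl with h | ⟨χ, hχ, h⟩
      · rw [h]
      · obtain ⟨ψ₀, -, rfl⟩ := mem_image.1 hχ
        rw [h, ext_zero]
    rcases lt_or_ge H t with hHt | hHt
    · rw [ext_of_le _ hHt, h.after t hHt]
    cases s with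
    | none =>
      rw [ext_none]
      rcases h.tst.cases_at (Nat.zero_le t) with h | ⟨χ, hχ, h⟩
      · rw [h]; rfl
      · obtain ⟨ψ₀, -, rfl⟩ := mem_image.1 hχ
        rw [h, ext_none]
    | some s =>
      obtain ⟨i, rfl⟩ : ∃ i, t = i + 1 := ⟨t - 1, by omega⟩
      have e1 := ext_succ (segmented (fun i : Fin d => ψ i) τ' Z) ⟨i, by omega⟩ s a
      have e2 := h6 ⟨i, by omega⟩ s a (Nat.zero_le _)
      dsimp only at e1 e2
      rw [e1, e2]
      simp only [segmented, hτ']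
      split_ifs with h7 h8
      · rfl
      · rfl
      · rw [h2 _ (not_lt.1 h8)]
  by_cases hτ : τ.Nonempty
  · exact ⟨fun i => ψ i, τ, Z, fun i => h1 i, hτ, h4, h5, key τ fun _ => rfl⟩
  -- Designs need at least one checkpoint. One at the last step changes nothing, as no time comes
  -- strictly after it.
  · rw [not_nonempty_iff_eq_empty] at hτ
    refine ⟨fun i => ψ i, {⟨H - 1, by omega⟩}, Z, fun i => h1 i, singleton_nonempty _, by simpa using hd,
      ?_, key _ fun t => ?_⟩
    · rw [hτ, subset_empty] at h5
      rw [h5]; exact empty_subset _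
    · have : ({⟨H - 1, by omega⟩} : Finset (Fin H)).filter (· < t) = ∅ := by
        rw [filter_eq_empty_iff]
        intro x hx
        rw [mem_singleton.1 hx, Fin.lt_def]
        have := t.2
        dsimp only
        omega
      rw [this, hτ]
      simp

end Design
end
end LMDP

/-! ### Concentration of likelihood ratios along adaptive data -/

namespace LMDP
noncomputable section
open Finset
open scoped ENNReal

section Expect

variable {α γ : Type*}

/-- The expectation of a nonnegative function. -/
def expect (p : PMF α) (f : α → ℝ≥0∞) : ℝ≥0∞ := ∑' a, p a * f a

theorem expect_bind (p : PMF α) (g : α → PMF γ) (f : γ → ℝ≥0∞) :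
    expect (p.bind g) f = expect p fun a => expect (g a) f := by
  simp only [expect, PMF.bind_apply, ← ENNReal.tsum_mul_right, ← ENNReal.tsum_mul_left]
  rw [ENNReal.tsum_comm]
  simp only [mul_assoc]

theorem expect_pure (a : α) (f : α → ℝ≥0∞) : expect (PMF.pure a) f = f a := by
  classical
  unfold expect
  rw [tsum_eq_single a]
  · simp
  · intro b hb
    simp [PMF.pure_apply, hb]

theorem expect_map (p : PMF α) (g : α → γ) (f : γ → ℝ≥0∞) :
    expect (p.map g) f = expect p fun a => f (g a) := by
  rw [PMF.map, expect_bind]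
  simp only [Function.comp, expect_pure]

theorem expect_mono {p : PMF α} {f g : α → ℝ≥0∞} (h : ∀ a, f a ≤ g a) : expect p f ≤ expect p g :=
  ENNReal.tsum_le_tsum fun a => by gcongr; exact h a

theorem expect_const_mul (p : PMF α) (c : ℝ≥0∞) (f : α → ℝ≥0∞) :
    (expect p fun a => c * f a) = c * expect p f := by
  simp only [expect, ← ENNReal.tsum_mul_left]
  exact tsum_congr fun a => by ring

theorem toOuterMeasure_le_expect (p : PMF α) (f : α → ℝ≥0∞) {c : ℝ≥0∞} (hc0 : c ≠ 0) (hc : c ≠ ∞) :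
    p.toOuterMeasure {a | c ≤ f a} ≤ expect p f * c⁻¹ := by
  rw [← div_eq_mul_inv, ENNReal.le_div_iff_mul_le (Or.inl hc0) (Or.inl hc), PMF.toOuterMeasure_apply,
    ← ENNReal.tsum_mul_right]
  refine ENNReal.tsum_le_tsum fun a => ?_
  by_cases h : c ≤ f a
  · rw [Set.indicator_of_mem (by exact h)]
    gcongr
  · rw [Set.indicator_of_notMem (by exact h), zero_mul]
    exact zero_le

end Expect

section Supermartingale

variable {M H : ℕ} {𝒮 𝒜 : Type*} [Fintype 𝒮] [Fintype 𝒜] [Nonempty 𝒜] {ℛ : Finset ℝ}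
variable {p : Params} {Θ : Finset (Model M 𝒮 𝒜 ℛ)} {pick : State H 𝒮 𝒜 ℛ → MlsPolicy H 𝒮 𝒜}
variable {θs : Model M 𝒮 𝒜 ℛ}

theorem expect_execute_le {z : MlsPolicy H 𝒮 𝒜 → Traj H 𝒮 𝒜 ℛ → ℝ≥0∞}
    (hz : ∀ π, expect (θs.episode π.toHist) (z π) ≤ 1) (l : List (MlsPolicy H 𝒮 𝒜)) :
    expect (execute θs l) (fun D => (D.map fun e => z e.1 e.2).prod) ≤ 1 := by
  induction l with
  | nil => rw [execute, expect_pure]; simp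
  | cons π l ih =>
    rw [execute, expect_bind]
    simp only [expect_map, List.map_cons, List.prod_cons, expect_const_mul]
    refine le_trans (expect_mono fun T => mul_le_of_le_one_right' ih) (hz π)

/-- The state fixes the policies of the coming iteration, so given the past the new factors have
expected product at most one: the product is a supermartingale. -/
theorem expect_iter_le {z : MlsPolicy H 𝒮 𝒜 → Traj H 𝒮 𝒜 ℛ → ℝ≥0∞}
    (hz : ∀ π, expect (θs.episode π.toHist) (z π) ≤ 1) (σ : State H 𝒮 𝒜 ℛ) :
    expect (iter p Θ pick θs σ) (fun σ => (σ.D.map fun e => z e.1 e.2).prod) ≤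
      (σ.D.map fun e => z e.1 e.2).prod := by
  unfold iter
  split_ifs
  · rw [expect_map]
    simp only [List.map_append, List.prod_append, expect_const_mul]
    exact mul_le_of_le_one_right' (expect_execute_le hz _)
  · rw [expect_pure]

theorem expect_run_le {z : MlsPolicy H 𝒮 𝒜 → Traj H 𝒮 𝒜 ℛ → ℝ≥0∞}
    (hz : ∀ π, expect (θs.episode π.toHist) (z π) ≤ 1) (k : ℕ) :
    expect (run p Θ pick θs k) (fun σ => (σ.D.map fun e => z e.1 e.2).prod) ≤ 1 := by
  induction k with
  | zero => rw [run, expect_map]; exact expect_execute_le hz _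
  | succ k ih =>
    rw [run, expect_bind]
    exact (expect_mono fun σ => expect_iter_le hz σ).trans ih

theorem likelihood_pos_of_execute {l : List (MlsPolicy H 𝒮 𝒜)} {D : Dataset H 𝒮 𝒜 ℛ}
    (h : D ∈ (execute θs l).support) : 0 < θs.likelihood D := by
  induction l generalizing D with
  | nil =>
    rw [execute, PMF.mem_support_pure_iff] at h
    simp [h, Model.likelihood]
  | cons π l ih =>
    rw [execute, PMF.mem_support_bind_iff] at h
    obtain ⟨T, hT, h⟩ := h
    rw [PMF.mem_support_map_iff] at h
    obtain ⟨D', hD', rfl⟩ := h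
    have h1 := ih hD'
    have h2 : 0 < θs.prob π.toHist T := by
      rw [PMF.mem_support_iff] at hT
      simpa [Model.episode] using hT
    unfold Model.likelihood at h1 ⊢
    rw [List.map_cons, List.prod_cons]
    exact mul_pos h2 h1

theorem likelihood_append (θ : Model M 𝒮 𝒜 ℛ) (D D' : Dataset H 𝒮 𝒜 ℛ) :
    θ.likelihood (D ++ D') = θ.likelihood D * θ.likelihood D' := by
  simp [Model.likelihood]

theorem likelihood_pos_of_run {k : ℕ} {σ : State H 𝒮 𝒜 ℛ} (h : σ ∈ (run p Θ pick θs k).support) :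
    0 < θs.likelihood σ.D := by
  induction k generalizing σ with
  | zero =>
    rw [run, PMF.mem_support_map_iff] at h
    obtain ⟨D, hD, rfl⟩ := h
    exact likelihood_pos_of_execute hD
  | succ k ih =>
    rw [run, PMF.mem_support_bind_iff] at h
    obtain ⟨σ', hσ', h⟩ := h
    unfold iter at h
    split_ifs at h
    · rw [PMF.mem_support_map_iff] at h
      obtain ⟨D, hD, rfl⟩ := h
      rw [likelihood_append]
      exact mul_pos (ih hσ') (likelihood_pos_of_execute hD)
    · rw [PMF.mem_support_pure_iff] at h
      rw [h]; exact ih hσ'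

/-- The affinity of the laws of the episodes under two models. -/
def affinity (θ θs : Model M 𝒮 𝒜 ℛ) (π : MlsPolicy H 𝒮 𝒜) : ℝ :=
  ∑ T, √(θ.prob π.toHist T * θs.prob π.toHist T)

theorem affinity_nonneg (θ : Model M 𝒮 𝒜 ℛ) (π : MlsPolicy H 𝒮 𝒜) : 0 ≤ affinity θ θs π :=
  sum_nonneg fun _ _ => Real.sqrt_nonneg _

/-- Cauchy–Schwarz for `|P - R| = |√P - √R| * (√P + √R)`. The two square sums are `2 - 2 * affinity`
and `2 + 2 * affinity`, and the latter is at most `4`. -/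
theorem tv_sq_le (θ : Model M 𝒮 𝒜 ℛ) (π : MlsPolicy H 𝒮 𝒜) :
    tv θ θs π.toHist ^ 2 ≤ 8 * (1 - affinity θ θs π) := by
  set P := θ.prob π.toHist
  set R := θs.prob π.toHist
  have hP : ∀ T, 0 ≤ P T := θ.prob_nonneg _
  have hR : ∀ T, 0 ≤ R T := θs.prob_nonneg _
  have e1 : ∑ T, (√(P T) - √(R T)) ^ 2 = 2 - 2 * affinity θ θs π := by
    have : ∀ T, (√(P T) - √(R T)) ^ 2 = P T + R T - 2 * √(P T * R T) := fun T => by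
      rw [sub_sq, Real.sq_sqrt (hP T), Real.sq_sqrt (hR T), Real.sqrt_mul (hP T)]; ring
    simp only [this, sum_sub_distrib, sum_add_distrib, ← mul_sum]
    rw [θ.sum_prob, θs.sum_prob, affinity]; ring
  have e2 : ∑ T, (√(P T) + √(R T)) ^ 2 = 2 + 2 * affinity θ θs π := by
    have : ∀ T, (√(P T) + √(R T)) ^ 2 = P T + R T + 2 * √(P T * R T) := fun T => by
      rw [add_sq, Real.sq_sqrt (hP T), Real.sq_sqrt (hR T), Real.sqrt_mul (hP T)]; ring
    simp only [this, sum_add_distrib, ← mul_sum]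
    rw [θ.sum_prob, θs.sum_prob, affinity]; ring
  have h0 := affinity_nonneg (θs := θs) θ π
  have h1 : affinity θ θs π ≤ 1 := by
    have : 0 ≤ ∑ T, (√(P T) - √(R T)) ^ 2 := sum_nonneg fun _ _ => sq_nonneg _
    linarith
  have e3 : tv θ θs π.toHist = ∑ T, |√(P T) - √(R T)| * (√(P T) + √(R T)) := by
    unfold tv
    refine sum_congr rfl fun T _ => ?_
    rw [← abs_of_nonneg (add_nonneg (Real.sqrt_nonneg (P T)) (Real.sqrt_nonneg (R T))), ← abs_mul]
    congr 1
    have a1 := Real.sq_sqrt (hP T)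
    have a2 := Real.sq_sqrt (hR T)
    linear_combination -a1 + a2
  have h2 := sum_mul_sq_le_sq_mul_sq univ (fun T => |√(P T) - √(R T)|) fun T => √(P T) + √(R T)
  simp only [sq_abs] at h2
  rw [e1, e2, ← e3] at h2
  nlinarith

theorem expect_episode_ofReal (π : MlsPolicy H 𝒮 𝒜) {g : Traj H 𝒮 𝒜 ℛ → ℝ} (hg : ∀ T, 0 ≤ g T)
    (h : ∑ T, θs.prob π.toHist T * g T ≤ 1) :
    expect (θs.episode π.toHist) (fun T => ENNReal.ofReal (g T)) ≤ 1 := by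
  unfold expect
  rw [tsum_fintype, ← ENNReal.ofReal_one]
  refine le_trans (le_of_eq ?_) (ENNReal.ofReal_le_ofReal h)
  rw [ENNReal.ofReal_sum_of_nonneg fun T _ => mul_nonneg (θs.prob_nonneg _ _) (hg T)]
  refine sum_congr rfl fun T _ => ?_
  rw [ENNReal.ofReal_mul (θs.prob_nonneg _ _)]
  rfl

theorem prod_ofReal {α : Type*} (l : List α) {g : α → ℝ} (hg : ∀ a, 0 ≤ g a) :
    (l.map fun a => ENNReal.ofReal (g a)).prod = ENNReal.ofReal (l.map g).prod := by
  induction l with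
  | nil => simp
  | cons a l ih => rw [List.map_cons, List.prod_cons, ih, List.map_cons, List.prod_cons,
      ENNReal.ofReal_mul (hg a)]

theorem toOuterMeasure_run_le {z : MlsPolicy H 𝒮 𝒜 → Traj H 𝒮 𝒜 ℛ → ℝ} (hz0 : ∀ π T, 0 ≤ z π T)
    (hz : ∀ π, ∑ T, θs.prob π.toHist T * z π T ≤ 1) (k : ℕ) (x : ℝ) :
    (run p Θ pick θs k).toOuterMeasure {σ | Real.exp x ≤ (σ.D.map fun e => z e.1 e.2).prod} ≤
      ENNReal.ofReal (Real.exp (-x)) := by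
  have h1 := toOuterMeasure_le_expect (run p Θ pick θs k)
    (fun σ => (σ.D.map fun e => ENNReal.ofReal (z e.1 e.2)).prod) (c := ENNReal.ofReal (Real.exp x))
    (by simpa using Real.exp_pos x) ENNReal.ofReal_ne_top
  have h2 := expect_run_le (p := p) (Θ := Θ) (pick := pick) (θs := θs)
    (z := fun π T => ENNReal.ofReal (z π T)) (fun π => expect_episode_ofReal π (hz0 π) (hz π)) k
  refine le_trans ((run p Θ pick θs k).toOuterMeasure.mono fun σ hσ => ?_) (h1.trans
    ((mul_le_mul_left h2 _).trans (le_of_eq ?_)))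
  · have := prod_ofReal σ.D (g := fun e => z e.1 e.2) fun e => hz0 _ _
    simp only [Set.mem_ofPred_eq] at hσ ⊢
    rw [this]
    exact ENNReal.ofReal_le_ofReal hσ
  · rw [one_mul, Real.exp_neg, ENNReal.ofReal_inv_of_pos (Real.exp_pos x)]

/-- Models that are about as likely as the true one have nearly the same laws on the data. -/
def Concentrated (Θ : Finset (Model M 𝒮 𝒜 ℛ)) (β : ℝ) (θs : Model M 𝒮 𝒜 ℛ) (D : Dataset H 𝒮 𝒜 ℛ) : Prop :=
  ∀ θ ∈ Θ, Real.exp (-β) * θs.likelihood D ≤ θ.likelihood D →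
    (D.map fun e => 1 - affinity θ θs e.1).sum ≤ 5 / 2 * β

theorem prod_sqrt_ratio (θ : Model M 𝒮 𝒜 ℛ) (D : Dataset H 𝒮 𝒜 ℛ) :
    (D.map fun e => √(θ.prob e.1.toHist e.2 / θs.prob e.1.toHist e.2) *
      Real.exp (1 - affinity θ θs e.1)).prod =
    √(θ.likelihood D / θs.likelihood D) * Real.exp (D.map fun e => 1 - affinity θ θs e.1).sum := by
  induction D with
  | nil => simp [Model.likelihood]
  | cons e D ih =>
    rw [List.map_cons, List.prod_cons, ih]
    simp only [Model.likelihood, List.map_cons, List.prod_cons, List.sum_cons, Real.exp_add]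
    rw [mul_div_mul_comm, Real.sqrt_mul (div_nonneg (θ.prob_nonneg _ _) (θs.prob_nonneg _ _))]
    ring

/-- Under `θs`, the expected root of the likelihood ratio is the affinity, which is at most `exp
(affinity - 1)`. After multiplication by `exp (1 - affinity)` the product over the data is a
supermartingale, and Markov's inequality with a union bound over the models applies. -/
theorem toOuterMeasure_not_concentrated_le (k : ℕ) (β : ℝ) :
    (run p Θ pick θs k).toOuterMeasure {σ | ¬ Concentrated Θ β θs σ.D} ≤
      Θ.card * ENNReal.ofReal (Real.exp (-(2 * β))) := by
  let z : Model M 𝒮 𝒜 ℛ → MlsPolicy H 𝒮 𝒜 → Traj H 𝒮 𝒜 ℛ → ℝ := fun θ π T =>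
    √(θ.prob π.toHist T / θs.prob π.toHist T) * Real.exp (1 - affinity θ θs π)
  have hz : ∀ θ π, ∑ T, θs.prob π.toHist T * z θ π T ≤ 1 := by
    intro θ π
    have e : ∀ T, θs.prob π.toHist T * z θ π T =
        √(θ.prob π.toHist T * θs.prob π.toHist T) * Real.exp (1 - affinity θ θs π) := by
      intro T
      simp only [z]
      rw [← mul_assoc]
      congr 1
      have h0 := θs.prob_nonneg π.toHist T
      nth_rewrite 1 [← Real.sqrt_sq h0]
      rw [← Real.sqrt_mul (sq_nonneg _)]
      congr 1
      rcases h0.eq_or_lt with h | h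
      · rw [← h]; simp
      · field_simp
    simp only [e, ← sum_mul]
    change affinity θ θs π * _ ≤ 1
    have h1 : affinity θ θs π ≤ Real.exp (affinity θ θs π - 1) := by
      have := Real.add_one_le_exp (affinity θ θs π - 1)
      linarith
    calc _ ≤ Real.exp (affinity θ θs π - 1) * Real.exp (1 - affinity θ θs π) := by gcongr
      _ = 1 := by rw [← Real.exp_add]; simp
  have hsub : (run p Θ pick θs k).toOuterMeasure {σ | ¬ Concentrated Θ β θs σ.D} ≤
      (run p Θ pick θs k).toOuterMeasure
        (⋃ θ ∈ Θ, {σ | Real.exp (2 * β) ≤ (σ.D.map fun e => z θ e.1 e.2).prod}) := by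
    refine PMF.toOuterMeasure_mono _ fun σ hσ => ?_
    obtain ⟨h1, h2⟩ := hσ
    have hpos := likelihood_pos_of_run h2
    simp only [Concentrated, Set.mem_ofPred_eq, not_forall, not_le] at h1
    obtain ⟨θ, hθ, h3, h4⟩ := h1
    refine Set.mem_biUnion hθ ?_
    simp only [Set.mem_ofPred_eq, z]
    rw [prod_sqrt_ratio]
    -- A competitive model has root likelihood ratio at least `exp (-β / 2)`, so a deficit above `5
    -- / 2 * β` pushes the product beyond `exp (2 * β)`.
    have h5 : Real.exp (-β / 2) ≤ √(θ.likelihood σ.D / θs.likelihood σ.D) := by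
      refine Real.le_sqrt_of_sq_le ?_
      rw [← Real.exp_nat_mul, le_div_iff₀ hpos]
      refine le_trans (le_of_eq ?_) h3
      congr 2
      push_cast; ring
    calc Real.exp (2 * β) = Real.exp (-β / 2) * Real.exp (5 / 2 * β) := by
          rw [← Real.exp_add]; congr 1; ring
      _ ≤ _ := by gcongr
  refine hsub.trans ((MeasureTheory.measure_biUnion_finset_le _ _).trans ?_)
  refine (sum_le_card_nsmul _ _ (ENNReal.ofReal (Real.exp (-(2 * β)))) fun θ _ =>
    toOuterMeasure_run_le (fun π T => by positivity) (hz θ) k (2 * β)).trans_eq ?_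
  rw [nsmul_eq_mul]

theorem prod_ratio (θ : Model M 𝒮 𝒜 ℛ) (D : Dataset H 𝒮 𝒜 ℛ) :
    (D.map fun e => θ.prob e.1.toHist e.2 / θs.prob e.1.toHist e.2).prod =
    θ.likelihood D / θs.likelihood D := by
  induction D with
  | nil => simp [Model.likelihood]
  | cons e D ih =>
    rw [List.map_cons, List.prod_cons, ih]
    simp only [Model.likelihood, List.map_cons, List.prod_cons]
    rw [mul_div_mul_comm]

/-- If `θs` is excluded, some model has likelihood ratio at least `exp β`, and likelihood ratios
have expectation at most one. -/
theorem toOuterMeasure_not_mem_confidenceSet_le (hθs : θs ∈ Θ) (k : ℕ) (β : ℝ) :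
    (run p Θ pick θs k).toOuterMeasure {σ | θs ∉ confidenceSet Θ β σ.D} ≤
      Θ.card * ENNReal.ofReal (Real.exp (-β)) := by
  let z : Model M 𝒮 𝒜 ℛ → MlsPolicy H 𝒮 𝒜 → Traj H 𝒮 𝒜 ℛ → ℝ := fun θ π T =>
    θ.prob π.toHist T / θs.prob π.toHist T
  have hz : ∀ θ π, ∑ T, θs.prob π.toHist T * z θ π T ≤ 1 := by
    intro θ π
    rw [← θ.sum_prob π.toHist]
    refine sum_le_sum fun T _ => ?_
    simp only [z]
    rcases (θs.prob_nonneg π.toHist T).eq_or_lt with h | h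
    · rw [← h]; simpa using θ.prob_nonneg _ _
    · rw [mul_div_cancel₀ _ h.ne']
  have hsub : (run p Θ pick θs k).toOuterMeasure {σ | θs ∉ confidenceSet Θ β σ.D} ≤
      (run p Θ pick θs k).toOuterMeasure
        (⋃ θ ∈ Θ, {σ | Real.exp β ≤ (σ.D.map fun e => z θ e.1 e.2).prod}) := by
    refine PMF.toOuterMeasure_mono _ fun σ hσ => ?_
    obtain ⟨h1, h2⟩ := hσ
    have hpos := likelihood_pos_of_run h2
    simp only [confidenceSet, Set.mem_ofPred_eq, not_and, not_forall, not_le] at h1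
    obtain ⟨θ, hθ, h3⟩ := h1 hθs
    refine Set.mem_biUnion hθ ?_
    simp only [Set.mem_ofPred_eq, z]
    rw [prod_ratio, le_div_iff₀ hpos]
    rw [Real.exp_neg, inv_mul_eq_div, lt_div_iff₀ (Real.exp_pos β)] at h3
    linarith
  refine hsub.trans ((MeasureTheory.measure_biUnion_finset_le _ _).trans ?_)
  refine (sum_le_card_nsmul _ _ (ENNReal.ofReal (Real.exp (-β))) fun θ _ =>
    toOuterMeasure_run_le (fun π T => div_nonneg (θ.prob_nonneg _ _) (θs.prob_nonneg _ _))
      (hz θ) k β).trans_eq ?_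
  rw [nsmul_eq_mul]

end Supermartingale
end
end LMDP

/-! ### Paths of the algorithm -/

namespace LMDP
noncomputable section
open Finset
open scoped ENNReal

section Count

variable {H : ℕ} {𝒮 𝒜 : Type*} [Fintype 𝒮] [Fintype 𝒜] [Nonempty 𝒜]

/-- A nonempty set of at most `d` checkpoints is the image of a map from `Fin d`, and the
interventions are the image of a set of indices. -/
theorem card_checkpoints_le (H d : ℕ) :
    (univ.filter fun τZ : Finset (Fin H) × Finset (Fin H) =>
      τZ.1.Nonempty ∧ τZ.1.card ≤ d ∧ τZ.2 ⊆ τZ.1).card ≤ H ^ d * 2 ^ d := by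
  classical
  have hsub : (univ.filter fun τZ : Finset (Fin H) × Finset (Fin H) =>
      τZ.1.Nonempty ∧ τZ.1.card ≤ d ∧ τZ.2 ⊆ τZ.1) ⊆
      (univ : Finset ((Fin d → Fin H) × Finset (Fin d))).image
        fun x => (univ.image x.1, x.2.image x.1) := by
    rintro ⟨τ, Z⟩ h
    obtain ⟨-, ⟨t₀, ht₀⟩, hc, hZ⟩ := mem_filter.1 h
    dsimp only at ht₀ hc hZ
    have : Nonempty τ := ⟨⟨t₀, ht₀⟩⟩
    obtain ⟨e⟩ := Function.Embedding.nonempty_of_card_le (α := τ) (β := Fin d) (by simpa using hc)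
    have hs := Function.invFun_surjective e.injective
    set f := Function.invFun e
    refine mem_image.2 ⟨(fun i => (f i : Fin H), univ.filter fun i => (f i : Fin H) ∈ Z), mem_univ _, ?_⟩
    refine Prod.ext ?_ ?_
    · ext t
      simp only [mem_image, mem_univ, true_and]
      constructor
      · rintro ⟨i, rfl⟩; exact (f i).2
      · intro ht
        obtain ⟨i, hi⟩ := hs ⟨t, ht⟩
        exact ⟨i, by rw [hi]⟩
    · ext t
      simp only [mem_image, mem_filter, mem_univ, true_and]
      constructor
      · rintro ⟨i, hi, rfl⟩; exact hi
      · intro ht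
        obtain ⟨i, hi⟩ := hs ⟨t, hZ ht⟩
        exact ⟨i, by rw [hi]; exact ht, by rw [hi]⟩
  refine (card_le_card hsub).trans (card_image_le.trans_eq ?_)
  rw [card_univ, Fintype.card_prod]
  simp

open Classical in
-- A union bound over the position that holds the new policy; the other `d - 1` positions are free.
theorem card_designs_le (H d : ℕ) (Ψ : Finset (MlsPolicy H 𝒮 𝒜)) (π : MlsPolicy H 𝒮 𝒜) :
    (designs H d Ψ π).card ≤ d * Ψ.card ^ (d - 1) * (H ^ d * 2 ^ d) := by
  unfold designs
  rw [card_product]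
  refine Nat.mul_le_mul ?_ (card_checkpoints_le H d)
  have hsub : (Fintype.piFinset fun _ : Fin d => Ψ).filter (fun ψ => ∃ i, ψ i = π) ⊆
      univ.biUnion fun i : Fin d => Fintype.piFinset (Function.update (fun _ => Ψ) i {π}) := by
    intro ψ hψ
    obtain ⟨h1, i, hi⟩ := mem_filter.1 hψ
    refine mem_biUnion.2 ⟨i, mem_univ i, Fintype.mem_piFinset.2 fun j => ?_⟩
    by_cases hj : j = i
    · subst hj; simp [hi]
    · rw [Function.update_of_ne hj]
      exact Fintype.mem_piFinset.1 h1 j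
  refine (card_le_card hsub).trans (card_biUnion_le.trans
    ((sum_le_card_nsmul _ _ (Ψ.card ^ (d - 1)) fun i _ => ?_).trans_eq (by simp)))
  rw [Fintype.card_piFinset, ← Finset.mul_prod_erase univ _ (mem_univ i)]
  rw [Function.update_self, card_singleton, one_mul, prod_congr rfl (g := fun _ => Ψ.card)
    fun j hj => by rw [Function.update_of_ne (ne_of_mem_erase hj)], prod_const, card_erase_of_mem (mem_univ i)]
  simp

end Count

section Path

variable {M H : ℕ} {𝒮 𝒜 : Type*} [Fintype 𝒮] [Fintype 𝒜] [Nonempty 𝒜] {ℛ : Finset ℝ}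
variable {p : Params} {Θ : Finset (Model M 𝒮 𝒜 ℛ)} {pick : State H 𝒮 𝒜 ℛ → MlsPolicy H 𝒮 𝒜}
variable {θs : Model M 𝒮 𝒜 ℛ}

theorem map_fst_of_execute {l : List (MlsPolicy H 𝒮 𝒜)} {D : Dataset H 𝒮 𝒜 ℛ}
    (h : D ∈ (execute θs l).support) : D.map Prod.fst = l := by
  induction l generalizing D with
  | nil =>
    rw [execute, PMF.mem_support_pure_iff] at h
    simp [h]
  | cons π l ih =>
    rw [execute, PMF.mem_support_bind_iff] at h
    obtain ⟨T, -, h⟩ := h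
    rw [PMF.mem_support_map_iff] at h
    obtain ⟨D', hD', rfl⟩ := h
    simp [ih hD']

open Classical in
/-- What is known about the states after `k` iterations: every segmented policy over the current
test policies has been executed `nTest` times. -/
structure Invariant (p : Params) (k : ℕ) (σ : State H 𝒮 𝒜 ℛ) : Prop where
  unif_mem : unif ∈ σ.Ψ
  card_le : σ.Ψ.card ≤ k + 1
  length_le : σ.D.length ≤ p.nTest * (1 + k * (p.d * (k + 1) ^ (p.d - 1) * (H ^ p.d * 2 ^ p.d)))
  le_count : ∀ (ψ : Fin p.d → MlsPolicy H 𝒮 𝒜) (τ Z : Finset (Fin H)), (∀ i, ψ i ∈ σ.Ψ) → τ.Nonempty →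
    τ.card ≤ p.d → Z ⊆ τ → p.nTest ≤ (σ.D.map Prod.fst).count (segmented ψ τ Z)

theorem segmented_unif {d : ℕ} {ψ : Fin d → MlsPolicy H 𝒮 𝒜} (hψ : ∀ i, ψ i = unif)
    (τ Z : Finset (Fin H)) : segmented ψ τ Z = unif := by
  funext t s
  unfold segmented
  split_ifs
  · rfl
  · rw [hψ]
  · rfl

theorem Invariant.zero {σ : State H 𝒮 𝒜 ℛ} (h : σ ∈ (run p Θ pick θs 0).support) : Invariant p 0 σ := by
  classical
  rw [run, PMF.mem_support_map_iff] at h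
  obtain ⟨D, hD, rfl⟩ := h
  have hD := map_fst_of_execute hD
  refine ⟨by simp, by simp, ?_, fun ψ τ Z h1 h2 h3 h4 => ?_⟩
  · have := congrArg List.length hD
    simp only [List.length_map, List.length_replicate] at this
    simp [this]
  · dsimp only
    rw [hD, segmented_unif (fun i => mem_singleton.1 (h1 i))]
    simp

theorem Invariant.succ {k : ℕ} {σ σ' : State H 𝒮 𝒜 ℛ} (h : Invariant p k σ)
    (hσ : σ' ∈ (iter p Θ pick θs σ).support) : Invariant p (k + 1) σ' := by
  classical
  have hmono : p.d * (k + 1) ^ (p.d - 1) * (H ^ p.d * 2 ^ p.d) ≤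
      p.d * (k + 1 + 1) ^ (p.d - 1) * (H ^ p.d * 2 ^ p.d) := by
    gcongr; omega
  unfold iter at hσ
  split_ifs at hσ
  · rw [PMF.mem_support_map_iff] at hσ
    obtain ⟨D, hD, rfl⟩ := hσ
    have hD := map_fst_of_execute hD
    have hc : (insert (pick σ) σ.Ψ).card ≤ k + 1 + 1 := (card_insert_le _ _).trans (by have := h.card_le; omega)
    refine ⟨mem_insert_of_mem h.unif_mem, by convert hc, ?_, fun ψ τ Z h1 h2 h3 h4 => ?_⟩
    · have h1 := congrArg List.length hD
      rw [List.length_map, List.length_flatMap] at h1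
      simp only [List.length_replicate, List.map_const', List.sum_replicate, length_toList,
        smul_eq_mul] at h1
      have h2 := card_designs_le H p.d (insert (pick σ) σ.Ψ) (pick σ)
      have h3 : (designs H p.d (insert (pick σ) σ.Ψ) (pick σ)).card ≤
          p.d * (k + 1 + 1) ^ (p.d - 1) * (H ^ p.d * 2 ^ p.d) := h2.trans (by gcongr)
      have h4 := h.length_le
      dsimp only
      rw [List.length_append]
      calc _ ≤ p.nTest * (1 + k * (p.d * (k + 1) ^ (p.d - 1) * (H ^ p.d * 2 ^ p.d))) +
            (p.d * (k + 1 + 1) ^ (p.d - 1) * (H ^ p.d * 2 ^ p.d)) * p.nTest := by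
            refine Nat.add_le_add h4 ?_
            refine le_trans (le_of_eq ?_) (Nat.mul_le_mul_right _ h3)
            rw [h1]
        _ ≤ p.nTest * (1 + k * (p.d * (k + 1 + 1) ^ (p.d - 1) * (H ^ p.d * 2 ^ p.d))) +
            (p.d * (k + 1 + 1) ^ (p.d - 1) * (H ^ p.d * 2 ^ p.d)) * p.nTest := by gcongr
        _ = _ := by ring
    · dsimp only
      rw [List.map_append, List.count_append, hD]
      -- Tuples with the new policy are designs of this iteration; the others are tuples over the
      -- old set and were executed before.
      by_cases hπ : ∃ i, ψ i = pick σ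
      · refine le_trans ?_ (Nat.le_add_left _ _)
        rw [List.count_flatMap]
        have hmem : (ψ, τ, Z) ∈ (designs H p.d (insert (pick σ) σ.Ψ) (pick σ)).toList := by
          rw [mem_toList, designs]
          refine mem_product.2 ⟨mem_filter.2 ⟨Fintype.mem_piFinset.2 fun i => by convert h1 i, hπ⟩,
            mem_filter.2 ⟨mem_univ _, h2, h3, h4⟩⟩
        refine le_trans (le_of_eq ?_) (List.le_sum_of_mem (List.mem_map_of_mem hmem))
        simp
      · push Not at hπ
        refine le_trans (h.le_count ψ τ Z (fun i => ?_) h2 h3 h4) (Nat.le_add_right _ _)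
        exact (mem_insert.1 (h1 i)).resolve_left (hπ i)
  · rw [PMF.mem_support_pure_iff] at hσ
    subst hσ
    refine ⟨h.unif_mem, h.card_le.trans (by omega), h.length_le.trans ?_, h.le_count⟩
    gcongr; omega

/-- The states that are reached after `k` iterations through concentrated data sets. -/
def GoodAt (p : Params) (Θ : Finset (Model M 𝒮 𝒜 ℛ)) (pick : State H 𝒮 𝒜 ℛ → MlsPolicy H 𝒮 𝒜)
    (θs : Model M 𝒮 𝒜 ℛ) (β : ℝ) : ℕ → State H 𝒮 𝒜 ℛ → Prop
  | 0, σ => σ ∈ (run p Θ pick θs 0).support ∧ Concentrated Θ β θs σ.D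
  | k + 1, σ' => ∃ σ, GoodAt p Θ pick θs β k σ ∧ σ' ∈ (iter p Θ pick θs σ).support ∧
      Concentrated Θ β θs σ'.D

theorem GoodAt.invariant {β : ℝ} {k : ℕ} {σ : State H 𝒮 𝒜 ℛ} (h : GoodAt p Θ pick θs β k σ) :
    Invariant p k σ := by
  induction k generalizing σ with
  | zero => exact Invariant.zero h.1
  | succ k ih =>
    obtain ⟨σ₀, h1, h2, -⟩ := h
    exact (ih h1).succ h2

/-- A union bound over the iterations, carried along the Markov chain: a path first turns bad when
its data set is not concentrated. -/
theorem toOuterMeasure_not_goodAt_le (β : ℝ) (k : ℕ) :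
    (run p Θ pick θs k).toOuterMeasure {σ | ¬ GoodAt p Θ pick θs β k σ} ≤
      (k + 1 : ℕ) * (Θ.card * ENNReal.ofReal (Real.exp (-(2 * β)))) := by
  induction k with
  | zero =>
    refine le_trans (PMF.toOuterMeasure_mono _ (t := {σ | ¬ Concentrated Θ β θs σ.D}) fun σ hσ hc =>
      hσ.1 ⟨hσ.2, hc⟩) ?_
    simpa using toOuterMeasure_not_concentrated_le 0 β
  | succ k ih =>
    set q := (Θ.card * ENNReal.ofReal (Real.exp (-(2 * β))) : ℝ≥0∞)
    have hsub : {σ | ¬ GoodAt p Θ pick θs β (k + 1) σ} ⊆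
        {σ | ¬ Concentrated Θ β θs σ.D} ∪
          {σ | ¬ GoodAt p Θ pick θs β (k + 1) σ ∧ Concentrated Θ β θs σ.D} := by
      intro σ hσ
      by_cases h : Concentrated Θ β θs σ.D
      exacts [Or.inr ⟨hσ, h⟩, Or.inl h]
    have h2 : (run p Θ pick θs (k + 1)).toOuterMeasure
        {σ | ¬ GoodAt p Θ pick θs β (k + 1) σ ∧ Concentrated Θ β θs σ.D} ≤
        (run p Θ pick θs k).toOuterMeasure {σ | ¬ GoodAt p Θ pick θs β k σ} := by
      rw [run, PMF.toOuterMeasure_bind_apply, PMF.toOuterMeasure_apply]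
      refine ENNReal.tsum_le_tsum fun σ => ?_
      by_cases h : GoodAt p Θ pick θs β k σ
      · have : (iter p Θ pick θs σ).toOuterMeasure
            {σ | ¬ GoodAt p Θ pick θs β (k + 1) σ ∧ Concentrated Θ β θs σ.D} = 0 := by
          rw [PMF.toOuterMeasure_apply_eq_zero_iff, Set.disjoint_left]
          exact fun σ' h1 h2 => h2.1 ⟨σ, h, h1, h2.2⟩
        rw [this, mul_zero]
        exact zero_le
      · rw [Set.indicator_of_mem (by exact h)]
        refine mul_le_of_le_one_right' ?_
        refine le_trans (MeasureTheory.measure_mono (Set.subset_univ _)) ?_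
        exact ((PMF.toOuterMeasure_apply_eq_one_iff _ _).2 (Set.subset_univ _)).le
    calc _ ≤ _ := MeasureTheory.measure_mono hsub
      _ ≤ _ := MeasureTheory.measure_union_le _ _
      _ ≤ q + (k + 1 : ℕ) * q := add_le_add (toOuterMeasure_not_concentrated_le _ _) (h2.trans ih)
      _ = _ := by push_cast; ring

/-- The history of a state in which the algorithm has not terminated. -/
theorem GoodAt.exists_path {β : ℝ} {k : ℕ} {σ : State H 𝒮 𝒜 ℛ} (h : GoodAt p Θ pick θs β k σ)
    (hL : σ.LoopCond p Θ) : ∃ f : ℕ → State H 𝒮 𝒜 ℛ, f k = σ ∧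
      (∀ j ≤ k, Concentrated Θ β θs (f j).D ∧ Invariant p j (f j) ∧ (f j).LoopCond p Θ) ∧
      ∀ j < k, ∀ π, π ∈ (f (j + 1)).Ψ ↔ π = pick (f j) ∨ π ∈ (f j).Ψ := by
  induction k generalizing σ with
  | zero =>
    refine ⟨fun _ => σ, rfl, fun j hj => ?_, fun j hj => absurd hj (Nat.not_lt_zero _)⟩
    rw [Nat.le_zero.1 hj]
    exact ⟨h.2, h.invariant, hL⟩
  | succ k ih =>
    have hinv := h.invariant
    obtain ⟨σ₀, h1, h2, h3⟩ := h
    have hL0 : σ₀.LoopCond p Θ := by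
      by_contra hn
      rw [iter, if_neg hn, PMF.mem_support_pure_iff] at h2
      exact hn (h2 ▸ hL)
    obtain ⟨f, hf1, hf2, hf3⟩ := ih h1 hL0
    refine ⟨fun j => if j ≤ k then f j else σ, by simp, fun j hj => ?_, fun j hj => ?_⟩
    · dsimp only
      split_ifs with h
      · exact hf2 j h
      · obtain rfl : j = k + 1 := by omega
        exact ⟨h3, hinv, hL⟩
    · dsimp only
      rw [if_pos (by omega : j ≤ k)]
      rcases (Nat.lt_succ_iff.1 hj).lt_or_eq with h | rfl
      · rw [if_pos (by omega)]
        exact hf3 j h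
      · rw [if_neg (by omega), hf1]
        rw [iter, if_pos hL0, PMF.mem_support_map_iff] at h2
        obtain ⟨D, -, rfl⟩ := h2
        intro π
        simp

theorem affinity_le_one (θ : Model M 𝒮 𝒜 ℛ) (π : MlsPolicy H 𝒮 𝒜) : affinity θ θs π ≤ 1 := by
  have := (sq_nonneg _).trans (tv_sq_le (θs := θs) θ π)
  linarith

open Classical in
-- Each policy in `G` occurs at least `n` times among the data, so its affinity deficit is counted
-- `n` times in the sum bounded by concentration; the constant is `8 * (5 / 2)`. Membership of `θs`
-- in the confidence set is not needed, only in `Θ`.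
theorem sum_tv_sq_le {β : ℝ} {D : Dataset H 𝒮 𝒜 ℛ} (hD : Concentrated Θ β θs D) {θ : Model M 𝒮 𝒜 ℛ}
    (hθ : θ ∈ confidenceSet Θ β D) (hθs : θs ∈ Θ) {n : ℕ} (G : Finset (MlsPolicy H 𝒮 𝒜))
    (hG : ∀ π ∈ G, n ≤ (D.map Prod.fst).count π) :
    n * ∑ π ∈ G, tv θ θs π.toHist ^ 2 ≤ 20 * β := by
  have h1 := hD θ hθ.1 (hθ.2 θs hθs)
  have h2 : (D.map fun e => 1 - affinity θ θs e.1) =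
      (D.map Prod.fst).map fun π => 1 - affinity θ θs π := by simp [Function.comp_def]
  rw [h2, Finset.sum_list_map_count] at h1
  have h0 : ∀ π : MlsPolicy H 𝒮 𝒜, 0 ≤ 1 - affinity θ θs π := fun π => by
    have := affinity_le_one (θs := θs) θ π; linarith
  have h3 : ∑ π ∈ G, (n : ℝ) * (1 - affinity θ θs π) ≤ 5 / 2 * β := by
    rcases Nat.eq_zero_or_pos n with rfl | hn
    · refine le_trans ?_ h1
      simp only [Nat.cast_zero, zero_mul, sum_const_zero]
      exact sum_nonneg fun π _ => nsmul_nonneg (h0 π) _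
    refine le_trans ?_ h1
    calc _ ≤ ∑ π ∈ G, (D.map Prod.fst).count π • (1 - affinity θ θs π) := by
          refine sum_le_sum fun π hπ => ?_
          rw [nsmul_eq_mul]
          have : (n : ℝ) ≤ (D.map Prod.fst).count π := by exact_mod_cast hG π hπ
          exact mul_le_mul_of_nonneg_right this (h0 π)
      _ ≤ _ := by
          refine sum_le_sum_of_subset_of_nonneg (fun π hπ => ?_) fun π _ _ => nsmul_nonneg (h0 π) _
          rw [List.mem_toFinset]
          exact List.count_pos_iff.1 (hn.trans_le (hG π hπ))
  rw [mul_sum]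
  calc _ ≤ ∑ π ∈ G, 8 * ((n : ℝ) * (1 - affinity θ θs π)) := by
        refine sum_le_sum fun π _ => ?_
        have := mul_le_mul_of_nonneg_left (tv_sq_le (θs := θs) θ π) (Nat.cast_nonneg (α := ℝ) n)
        linarith
    _ ≤ _ := by rw [← mul_sum]; linarith

end Path
end
end LMDP

/-! ### Values of policies -/

namespace LMDP
noncomputable section
open Finset

section Value

variable {M H : ℕ} {𝒮 𝒜 : Type*} [Fintype 𝒮] [Fintype 𝒜] [Nonempty 𝒜] {ℛ : Finset ℝ}

theorem abs_sum_reward_le (hℛ : ∀ r ∈ ℛ, |r| ≤ 1) (T : Traj H 𝒮 𝒜 ℛ) : |∑ t, ((T t).2.2 : ℝ)| ≤ H := by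
  refine (abs_sum_le_sum_abs _ _).trans ((sum_le_card_nsmul _ _ 1 fun t _ => hℛ _ (T t).2.2.2).trans_eq ?_)
  simp

theorem abs_histValue_le (hℛ : ∀ r ∈ ℛ, |r| ≤ 1) (θ : Model M 𝒮 𝒜 ℛ) (π : HistPolicy H 𝒮 𝒜 ℛ) :
    |θ.histValue π| ≤ H := by
  refine (abs_sum_le_sum_abs _ _).trans ?_
  calc _ ≤ ∑ T, θ.prob π T * (H : ℝ) := by
        refine sum_le_sum fun T _ => ?_
        rw [abs_mul, abs_of_nonneg (θ.prob_nonneg π T)]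
        exact mul_le_mul_of_nonneg_left (abs_sum_reward_le hℛ T) (θ.prob_nonneg π T)
    _ = H := by rw [← sum_mul, θ.sum_prob, one_mul]

theorem abs_histValue_sub_le (hℛ : ∀ r ∈ ℛ, |r| ≤ 1) (θ θ' : Model M 𝒮 𝒜 ℛ) (π : HistPolicy H 𝒮 𝒜 ℛ) :
    |θ.histValue π - θ'.histValue π| ≤ H * tv θ θ' π := by
  unfold Model.histValue tv
  rw [← sum_sub_distrib, mul_sum]
  refine (abs_sum_le_sum_abs _ _).trans (sum_le_sum fun T _ => ?_)
  rw [← sub_mul, abs_mul, mul_comm]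
  exact mul_le_mul_of_nonneg_right (abs_sum_reward_le hℛ T) (abs_nonneg _)

theorem measurable_histValue (θ : Model M 𝒮 𝒜 ℛ) (π : Policy H 𝒮 𝒜 ℛ) :
    @Measurable _ _ π.mΞ _ fun ξ => θ.histValue (π.act ξ) := by
  let _ := π.mΞ
  unfold Model.histValue Model.prob Model.stepProb
  refine Finset.measurable_sum _ fun T _ => Measurable.mul_const (Finset.measurable_sum _ fun m _ =>
    Measurable.const_mul (Finset.measurable_prod _ fun t _ => Measurable.mul_const
      (Measurable.const_mul (π.measurable_act _ _ _ _) _) _) _) _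

theorem integrable_histValue (hℛ : ∀ r ∈ ℛ, |r| ≤ 1) (θ : Model M 𝒮 𝒜 ℛ) (π : Policy H 𝒮 𝒜 ℛ) :
    @MeasureTheory.Integrable _ _ _ _ π.mΞ (fun ξ => θ.histValue (π.act ξ)) π.law := by
  let _ := π.mΞ
  have := π.isProb
  exact MeasureTheory.Integrable.of_bound (measurable_histValue θ π).aestronglyMeasurable (H : ℝ)
    (Filter.Eventually.of_forall fun ξ => abs_histValue_le hℛ θ _)

theorem value_le_add (hℛ : ∀ r ∈ ℛ, |r| ≤ 1) (θ θ' : Model M 𝒮 𝒜 ℛ) {e : ℝ}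
    (he : ∀ π : HistPolicy H 𝒮 𝒜 ℛ, tv θ θ' π ≤ e) (π : Policy H 𝒮 𝒜 ℛ) :
    |θ.value π - θ'.value π| ≤ H * e := by
  let _ := π.mΞ
  have := π.isProb
  unfold Model.value
  rw [← MeasureTheory.integral_sub (integrable_histValue hℛ θ π) (integrable_histValue hℛ θ' π)]
  have := MeasureTheory.norm_integral_le_of_norm_le_const (μ := π.law) (C := H * e)
    (f := fun ξ => θ.histValue (π.act ξ) - θ'.histValue (π.act ξ))
    (Filter.Eventually.of_forall fun ξ => (abs_histValue_sub_le hℛ θ θ' _).trans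
      (mul_le_mul_of_nonneg_left (he _) (Nat.cast_nonneg _)))
  simpa using this

theorem isEpsOptimal_of_tv_le (hℛ : ∀ r ∈ ℛ, |r| ≤ 1) {θ θs : Model M 𝒮 𝒜 ℛ} {e : ℝ}
    (he : ∀ π : HistPolicy H 𝒮 𝒜 ℛ, tv θ θs π ≤ e) {π : Policy H 𝒮 𝒜 ℛ} (hπ : θ.IsOptimal π) :
    θs.IsEpsOptimal (2 * (H * e)) π := by
  intro π'
  have h1 := abs_le.1 (value_le_add hℛ θ θs he π)
  have h2 := abs_le.1 (value_le_add hℛ θ θs he π')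
  have h3 := hπ π'
  linarith [h1.1, h1.2, h2.1, h2.2]

theorem continuous_histValue (θ : Model M 𝒮 𝒜 ℛ) :
    Continuous fun π : HistPolicy H 𝒮 𝒜 ℛ => θ.histValue π := by
  unfold Model.histValue Model.prob Model.stepProb
  refine continuous_finsetSum _ fun T _ => Continuous.mul (continuous_finsetSum _ fun m _ =>
    Continuous.mul continuous_const (continuous_finsetProd _ fun t _ => Continuous.mul
      (Continuous.mul continuous_const ?_) continuous_const)) continuous_const
  have h1 : Continuous fun π : HistPolicy H 𝒮 𝒜 ℛ => π t (pre T t) (T t).1 :=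
    (continuous_apply _).comp ((continuous_apply _).comp (continuous_apply t))
  exact (continuous_apply (T t).2.1).comp (continuous_subtype_val.comp h1)

/-- The value is continuous on the compact space of history-dependent behaviours, and averaging over
a seed cannot exceed the maximum. -/
theorem exists_isOptimal (hℛ : ∀ r ∈ ℛ, |r| ≤ 1) (θ : Model M 𝒮 𝒜 ℛ) :
    ∃ π : Policy H 𝒮 𝒜 ℛ, θ.IsOptimal π := by
  have : CompactSpace (Dist 𝒜) := isCompact_iff_compactSpace.1 (isCompact_stdSimplex ℝ 𝒜)
  have : Nonempty (Dist 𝒜) := ⟨stdSimplex.barycenter⟩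
  obtain ⟨π, -, hπ⟩ := isCompact_univ.exists_isMaxOn (s := (Set.univ : Set (HistPolicy H 𝒮 𝒜 ℛ)))
    Set.univ_nonempty (continuous_histValue θ).continuousOn
  refine ⟨{ Ξ := Unit, law := MeasureTheory.Measure.dirac (), act := fun _ => π,
            measurable_act := fun _ _ _ _ => measurable_const }, fun π' => ?_⟩
  let _ := π'.mΞ
  have := π'.isProb
  unfold Model.value
  simp only [MeasureTheory.integral_const, MeasureTheory.probReal_univ, smul_eq_mul, one_mul, sub_zero]
  calc _ ≤ ∫ _, θ.histValue π ∂π'.law := MeasureTheory.integral_mono (integrable_histValue hℛ θ π')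
        (MeasureTheory.integrable_const _) fun ξ => hπ (Set.mem_univ _)
    _ = θ.histValue π := by simp

end Value
end
end LMDP

/-! ### The comparison for a covered policy, with explicit constants -/

namespace LMDP
noncomputable section
open Finset

/-- How much smaller than the discrepancy of a covered policy that of all tests together can be. -/
def priceBound (M : ℕ) (a h : ℝ) : ℝ :=
  192 * M ^ 3 * (M + 1) * (M + 2) * (a * h) * (1536 * M ^ 5 * (M + 1) * (M + 2) * (a * h ^ 2)) ^ (M - 1)

/-- The number of tests that are needed for a covered policy. -/
def testBound (M : ℕ) (s h : ℝ) : ℝ := 8 * M * (h * s) * (16 * M ^ 2 * (M + 3) * (s ^ 3 * h)) ^ (M - 1)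

/-- The sensitivity to the resolution of the coverage. -/
def errBound (M : ℕ) (s a h : ℝ) : ℝ :=
  192 * M ^ 3 * (M + 1) * (M + 2) * (a * h) * (2 * s * M) *
    (M * (1536 * M ^ 5 * (M + 1) * (M + 2) * (a * h ^ 2) * (4 * s ^ 2 * M ^ 2)) ^ (M - 1) *
      ((4 * M ^ 2 + 2) * (128 * M ^ 4 * h * s) * (2 * s))) * 2

section Combine

variable {M H : ℕ} {𝒮 𝒜 : Type*} [Fintype 𝒮] [Fintype 𝒜] [Nonempty 𝒜] [DecidableEq 𝒮] {ℛ : Finset ℝ}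

theorem l1_pairWt (θ θs : Model M 𝒮 𝒜 ℛ) : l1 (pairWt θ θs) = 2 := by
  have h1 : ∑ m, |θ.w m| = 1 := by
    rw [← sum_dist θ.w]; exact sum_congr rfl fun m _ => abs_of_nonneg (dist_nonneg' _ _)
  have h2 : ∑ m, |-θs.w m| = 1 := by
    rw [← sum_dist θs.w]
    exact sum_congr rfl fun m _ => by rw [abs_neg, abs_of_nonneg (dist_nonneg' _ _)]
  rw [l1, Fintype.sum_sum_type]
  simp only [pairWt, Sum.elim_inl, Sum.elim_inr]
  rw [h1, h2]; norm_num

open Classical in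
-- Assembles coverage, the recursion over contexts and the translation of tests into segmented
-- policies. The null state and the time before the first step account for `S + 1` and `H + 1`,
-- which are then bounded by `2 * S` and `2 * H`.
theorem exists_tests_of_covered (hM : 1 ≤ M) (hH : 0 < H) (hS : 1 ≤ Fintype.card 𝒮) (θ θs : Model M 𝒮 𝒜 ℛ)
    {Ψ : Finset (MlsPolicy H 𝒮 𝒜)} (hΨ : unif ∈ Ψ) {π : MlsPolicy H 𝒮 𝒜} {δ : ℝ} (hδ0 : 0 < δ)
    (hδ : δ ≤ 1) (h : Covered (θs.ker H) MlsPolicy.ext (H + 1) none δ (4 * √(H + 1 : ℕ)) Ψ π) :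
    ∃ G : Finset (MlsPolicy H 𝒮 𝒜), (G.card : ℝ) ≤ testBound M (Fintype.card 𝒮) H ∧
      (∀ π' ∈ G, ∃ (ψ : Fin (2 * M - 1) → MlsPolicy H 𝒮 𝒜) (τ Z : Finset (Fin H)), (∀ i, ψ i ∈ Ψ) ∧
        τ.Nonempty ∧ τ.card ≤ 2 * M - 1 ∧ Z ⊆ τ ∧ segmented ψ τ Z = π') ∧
      tv θ θs π.toHist ≤ priceBound M (Fintype.card 𝒜) H * ∑ π' ∈ G, tv θ θs π'.toHist +
        errBound M (Fintype.card 𝒮) (Fintype.card 𝒜) H * δ := by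
  have : Nonempty (Fin M) := ⟨⟨0, hM⟩⟩
  set β : ℝ := 4 * √(H + 1 : ℕ) with hβ
  have hm : (1 : ℝ) ≤ M := by exact_mod_cast hM
  have hh : (1 : ℝ) ≤ H := by exact_mod_cast hH
  have hs : (1 : ℝ) ≤ Fintype.card 𝒮 := by exact_mod_cast hS
  have ha : (1 : ℝ) ≤ Fintype.card 𝒜 := by exact_mod_cast Fintype.card_pos (α := 𝒜)
  have hβ4 : 4 ≤ β := by
    have : 1 ≤ √((H + 1 : ℕ) : ℝ) := by
      rw [Real.one_le_sqrt]; push_cast; linarith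
    linarith
  have hβ2 : β ^ 2 ≤ 32 * H := by
    rw [hβ, mul_pow, Real.sq_sqrt (by positivity)]; push_cast; linarith
  set δ' : ℝ := β * (M : ℝ) ^ 2 * M * (Fintype.card 𝒮 + 1) * (β * M * δ) + β * M * δ with hδ'
  have hδ'1 : 4 * M * δ ≤ δ' := by
    have h1 : 4 * M * δ ≤ β * M * δ := by gcongr
    have h2 : 0 ≤ β * (M : ℝ) ^ 2 * M * (Fintype.card 𝒮 + 1) * (β * M * δ) := by positivity
    linarith
  have hcard : Fintype.card (Option 𝒮) = Fintype.card 𝒮 + 1 := Fintype.card_option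
  have hker : IsKer (θs.ker H) := ker_isKer θs
  obtain ⟨D, hD⟩ := h.exists_nodeFam (p' := pairKer H θ θs) hker (pairKer_inr θ θs) ext_isPol ext_injective
    hδ0 hδ
  obtain ⟨W₀, hW₀⟩ := h.exists_wordFam_start (p' := pairKer H θ θs) (δ' := δ') hker (pairKer_inr θ θs)
    ext_isPol hδ0 hδ (by rw [Fintype.card_fin]; exact hδ'1)
  have hW := fun (u : ℕ) (y : Option 𝒮) (hu : 0 < u) (_ : u < H + 1) =>
    h.exists_wordFam (p' := pairKer H θ θs) (δ' := δ') hker (pairKer_isKer θ θs) (pairKer_inr θ θs) ext_isPol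
      hδ0 hδ (by linarith) (by rw [Fintype.card_fin, hcard]; push_cast; exact le_rfl) hu y
  rw [Fintype.card_fin] at hD hW₀
  simp only [Fintype.card_fin, hcard] at hW hW₀
  obtain ⟨G, hG1, hG2, hG3⟩ := exists_tests_start hM (pairKer_isKer θ θs) (ext_isPol π) (Nat.succ_pos H)
    (mem_image.2 ⟨unif, hΨ, ext_unif⟩)
    (fun ψ hψ => by obtain ⟨ψ, -, rfl⟩ := mem_image.1 hψ; exact ext_isPol ψ)
    (fun ψ hψ t ht => by obtain ⟨ψ, -, rfl⟩ := mem_image.1 hψ; exact ext_of_le ψ ht)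
    (Nat.mul_pos (Nat.succ_pos _) (Nat.mul_pos (Nat.succ_pos _) (by positivity)))
    (by nlinarith) (one_le_pow₀ (one_le_mul_of_one_le_of_one_le (by linarith) (one_le_pow₀ hm)))
    (by nlinarith) (by positivity) ((by positivity : 0 ≤ 4 * M * δ).trans hδ'1) hD hW hW₀ rfl rfl rfl
  have hdes := fun σ (hσ : σ ∈ G) => (hG2 σ hσ).exists_design hΨ (by omega) hH
  choose! ψ τ Z h1 h2 h3 h4 h5 using hdes
  set f : Pol (Option 𝒮) 𝒜 → MlsPolicy H 𝒮 𝒜 := fun σ => segmented (ψ σ) (τ σ) (Z σ)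
  -- A test is recovered from its segmented policy, so the sum over policies is the sum over tests.
  have hinj : Set.InjOn f G := fun σ hσ σ' hσ' he => by
    rw [← h5 σ hσ, ← h5 σ' hσ']; exact congrArg MlsPolicy.ext he
  refine ⟨G.image f, ?_, fun π' hπ' => ?_, ?_⟩
  · have h6 : ((G.image f).card : ℝ) ≤ _ := Nat.cast_le.2 (card_image_le.trans hG1)
    refine h6.trans ?_
    push_cast [hcard]
    unfold testBound
    have k1 : (Fintype.card 𝒮 : ℝ) + 1 ≤ 2 * Fintype.card 𝒮 := by linarith
    have k2 : (H : ℝ) + 1 ≤ 2 * H := by linarith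
    calc _ ≤ (2 * H) * ((2 * Fintype.card 𝒮) * M * (2 * ((2 * Fintype.card 𝒮) * ((2 * H) *
          ((2 * Fintype.card 𝒮) * ((2 * Fintype.card 𝒮) * (M : ℝ) ^ 2)) * (M + 3))) ^ (M - 1))) := by
          gcongr
      _ = _ := by
          rw [show (2 * (Fintype.card 𝒮 : ℝ)) * ((2 * H) *
            ((2 * Fintype.card 𝒮) * ((2 * Fintype.card 𝒮) * (M : ℝ) ^ 2)) * (M + 3)) =
            16 * M ^ 2 * (M + 3) * ((Fintype.card 𝒮 : ℝ) ^ 3 * H) by ring]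
          ring
  · obtain ⟨σ, hσ, rfl⟩ := mem_image.1 hπ'
    exact ⟨ψ σ, τ σ, Z σ, h1 σ hσ, h2 σ hσ, h3 σ hσ, h4 σ hσ, rfl⟩
  · have hb : PosType M (pairWt θ θs) :=
      ⟨fun i => dist_nonneg' _ _, (card_filter_le _ _).trans (by simp)⟩
    have h6 := hG3 _ hb
    rw [← tv_eq_gap θ θs π hH, l1_pairWt] at h6
    have h7 : ∑ σ ∈ G, gap (pairKer H θ θs) (H + 1) σ 0 none (pairWt θ θs) =
        ∑ π' ∈ G.image f, tv θ θs π'.toHist := by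
      rw [sum_image hinj]
      refine sum_congr rfl fun σ hσ => ?_
      rw [tv_eq_gap θ θs _ hH, h5 σ hσ]
    rw [h7] at h6
    have k1 : (Fintype.card 𝒮 : ℝ) + 1 ≤ 2 * Fintype.card 𝒮 := by linarith
    have k2 : (H : ℝ) + 1 ≤ 2 * H := by linarith
    have k3 : (Fintype.card 𝒜 : ℝ) + 1 ≤ 2 * Fintype.card 𝒜 := by linarith
    push_cast [hcard] at h6
    set s : ℝ := (Fintype.card 𝒮 : ℝ)
    set a : ℝ := (Fintype.card 𝒜 : ℝ)
    set m : ℝ := (M : ℝ)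
    set h : ℝ := (H : ℝ)
    set X : ℝ := 3 * (4 * m * (β * m ^ 2) ^ 2) * (m + 1) * (m + 2) * (a + 1) * (h + 1) with hX
    set X₀ : ℝ := 3 * (4 * m * (4 * m ^ 2)) * (m + 1) * (m + 2) * (a + 1) * (h + 1) with hX₀
    set d : ℝ := (4 * m * m * δ' + 4 * m * δ + δ') * (s + 1) with hd
    have hXle : X ≤ 1536 * m ^ 5 * (m + 1) * (m + 2) * (a * h ^ 2) := by
      calc X = 3 * (4 * m * (β ^ 2 * m ^ 4)) * (m + 1) * (m + 2) * (a + 1) * (h + 1) := by rw [hX]; ring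
        _ ≤ 3 * (4 * m * (32 * h * m ^ 4)) * (m + 1) * (m + 2) * (2 * a) * (2 * h) := by gcongr
        _ = _ := by ring
    have hX₀le : X₀ ≤ 192 * m ^ 3 * (m + 1) * (m + 2) * (a * h) := by
      calc X₀ ≤ 3 * (4 * m * (4 * m ^ 2)) * (m + 1) * (m + 2) * (2 * a) * (2 * h) := by rw [hX₀]; gcongr
        _ = _ := by ring
    have hX0 : 0 ≤ X := by positivity
    have hX₀0 : 0 ≤ X₀ := by positivity
    have hδ'le : δ' ≤ 128 * m ^ 4 * h * s * δ := by
      have e1 : β * m * δ ≤ β ^ 2 * m ^ 4 * (s + 1) * δ := by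
        have e2 : β ≤ β ^ 2 := le_self_pow₀ (by linarith) two_ne_zero
        have e3 : m ≤ m ^ 4 := le_self_pow₀ hm (by norm_num)
        calc β * m * δ = β * m * 1 * δ := by ring
          _ ≤ _ := by gcongr; linarith
      calc δ' ≤ β ^ 2 * m ^ 4 * (s + 1) * δ + β ^ 2 * m ^ 4 * (s + 1) * δ := by
            rw [hδ']; refine add_le_add (le_of_eq (by ring)) e1
        _ = 2 * (β ^ 2 * m ^ 4 * (s + 1) * δ) := by ring
        _ ≤ 2 * (32 * h * m ^ 4 * (2 * s) * δ) := by gcongr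
        _ = _ := by ring
    have hδ'0 : 0 ≤ δ' := (by positivity : 0 ≤ 4 * m * δ).trans hδ'1
    have hdle : d ≤ (4 * m ^ 2 + 2) * (128 * m ^ 4 * h * s) * (2 * s) * δ := by
      calc d ≤ (4 * m * m * δ' + δ' + δ') * (2 * s) := by rw [hd]; gcongr
        _ = (4 * m ^ 2 + 2) * δ' * (2 * s) := by ring
        _ ≤ (4 * m ^ 2 + 2) * (128 * m ^ 4 * h * s * δ) * (2 * s) := by gcongr
        _ = _ := by ring
    have hd0 : 0 ≤ d := by positivity
    refine h6.trans (add_le_add (mul_le_mul_of_nonneg_right ?_ (sum_nonneg fun π' _ =>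
      sum_nonneg fun _ _ => abs_nonneg _)) ?_)
    · unfold priceBound
      gcongr
    · set Z := (1536 * m ^ 5 * (m + 1) * (m + 2) * (a * h ^ 2) * (4 * s ^ 2 * m ^ 2)) ^ (M - 1) with hZ
      have hZ1 : 1 ≤ Z := by
        refine one_le_pow₀ ?_
        have e1 : 1 ≤ m ^ 5 := one_le_pow₀ hm
        have e2 : 1 ≤ s ^ 2 := one_le_pow₀ hs
        have e3 : 1 ≤ m ^ 2 := one_le_pow₀ hm
        have e4 : 1 ≤ a * h ^ 2 := one_le_mul_of_one_le_of_one_le ha (one_le_pow₀ hh)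
        refine one_le_mul_of_one_le_of_one_le (one_le_mul_of_one_le_of_one_le
          (one_le_mul_of_one_le_of_one_le (one_le_mul_of_one_le_of_one_le ?_ ?_) ?_) e4)
          (one_le_mul_of_one_le_of_one_le ?_ e3) <;> linarith
      have hZle : (X * ((s + 1) * ((s + 1) * m ^ 2))) ^ (M - 1) ≤ Z := by
        rw [hZ]
        refine pow_le_pow_left₀ (by positivity) ?_ _
        calc _ ≤ (1536 * m ^ 5 * (m + 1) * (m + 2) * (a * h ^ 2)) * ((2 * s) * ((2 * s) * m ^ 2)) := by gcongr
          _ = _ := by ring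
      have hM1 : ((M - 1 : ℕ) : ℝ) = m - 1 := by rw [Nat.cast_sub hM]; simp [m]
      have hin : ((M - 1 : ℕ) : ℝ) * (X * ((s + 1) * ((s + 1) * m ^ 2))) ^ (M - 1) * d + d ≤
          m * Z * ((4 * m ^ 2 + 2) * (128 * m ^ 4 * h * s) * (2 * s) * δ) := by
        calc _ ≤ ((M - 1 : ℕ) : ℝ) * Z * d + Z * d := by
              refine add_le_add ?_ (le_mul_of_one_le_left hd0 hZ1)
              gcongr
          _ = m * Z * d := by rw [hM1]; ring
          _ ≤ _ := by gcongr
      calc _ ≤ (192 * m ^ 3 * (m + 1) * (m + 2) * (a * h)) * (2 * s * m) *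
            (m * Z * ((4 * m ^ 2 + 2) * (128 * m ^ 4 * h * s) * (2 * s) * δ)) * 2 := by gcongr
        _ = _ := by rw [errBound]; ring

end Combine
end
end LMDP

/-! ### Termination and success -/

namespace LMDP
noncomputable section
open Finset
open scoped ENNReal

section Success

variable {M H : ℕ} {𝒮 𝒜 : Type*} [Fintype 𝒮] [Fintype 𝒜] [Nonempty 𝒜] {ℛ : Finset ℝ}
variable {Θ : Finset (Model M 𝒮 𝒜 ℛ)} {pick : State H 𝒮 𝒜 ℛ → MlsPolicy H 𝒮 𝒜} {θs : Model M 𝒮 𝒜 ℛ}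
variable {K nTest : ℕ} {εTest η : ℝ}

theorem tv_triangle (θ₁ θ₂ θ₃ : Model M 𝒮 𝒜 ℛ) (π : HistPolicy H 𝒮 𝒜 ℛ) :
    tv θ₁ θ₂ π ≤ tv θ₁ θ₃ π + tv θ₂ θ₃ π := by
  unfold tv
  rw [← sum_add_distrib]
  refine sum_le_sum fun T _ => ?_
  rw [abs_sub_comm (θ₂.prob π T)]
  exact abs_sub_le _ _ _

theorem priceBound_nonneg (M : ℕ) {a h : ℝ} (ha : 0 ≤ a) (hh : 0 ≤ h) : 0 ≤ priceBound M a h := by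
  unfold priceBound; positivity

/-- If the loop were still running after `K` iterations, some iteration would have chosen a covered
policy. Every model of the confidence set is then within `2 * εTest` of `θs` under it, so no two
models differ by more than `4 * εTest`. -/
theorem GoodAt.not_loopCond (hM : 1 ≤ M) (hH : 0 < H) (hS : 1 ≤ Fintype.card 𝒮) (hθs : θs ∈ Θ)
    (hsel : IsSelector ⟨K, 2 * M - 1, nTest, εTest, η⟩ Θ pick) (hn : 0 < nTest) (hε : 0 < εTest) {δ : ℝ}
    (hδ0 : 0 < δ) (hδ : δ ≤ 1)
    (hK : 6 * ((H + 1 : ℕ) : ℝ) * ((Fintype.card 𝒮 + 1 : ℕ) : ℝ) ^ 2 *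
      (Real.log M.factorial - M * Real.log δ) < K)
    (herr : errBound M (Fintype.card 𝒮) (Fintype.card 𝒜) H * δ ≤ εTest) {β : ℝ}
    (hβ : β = (⟨K, 2 * M - 1, nTest, εTest, η⟩ : Params).β Θ)
    (hnt : 20 * β * priceBound M (Fintype.card 𝒜) H ^ 2 * testBound M (Fintype.card 𝒮) H ≤
      nTest * εTest ^ 2) {σ : State H 𝒮 𝒜 ℛ}
    (hσ : GoodAt ⟨K, 2 * M - 1, nTest, εTest, η⟩ Θ pick θs β K σ) :
    ¬ σ.LoopCond ⟨K, 2 * M - 1, nTest, εTest, η⟩ Θ := by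
  classical
  intro hL
  obtain ⟨f, -, hf2, hf3⟩ := hσ.exists_path hL
  -- The counting argument expects an infinite increasing sequence; the sets are frozen after
  -- iteration `K`.
  obtain ⟨k, hk, hcov⟩ := exists_covered (p := θs.ker H) (e := MlsPolicy.ext) (ker_isKer θs) ext_isPol
    (Nat.succ_pos H) none hδ0 hδ rfl (fun k => (f (min k K)).Ψ)
    (fun k => by
      rcases lt_or_ge k K with h | h
      · rw [min_eq_left h.le, min_eq_left (by omega)]
        exact fun π hπ => (hf3 k h π).2 (Or.inr hπ)
      · rw [min_eq_right h, min_eq_right (by omega)])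
    (fun k => pick (f k)) (K := K)
    (fun k h => by
      rw [min_eq_left h.le, min_eq_left (by omega)]
      ext π
      rw [hf3 k h π, mem_insert])
    (by rw [Fintype.card_option, Fintype.card_fin]; exact hK)
  rw [min_eq_left hk.le] at hcov
  obtain ⟨hc, hinv, hLk⟩ := hf2 k hk.le
  obtain ⟨θ₁, hθ₁, θ₂, hθ₂, hlt⟩ := hsel (f k) hLk
  have key : ∀ θ ∈ (f k).C ⟨K, 2 * M - 1, nTest, εTest, η⟩ Θ, tv θ θs (pick (f k)).toHist ≤ 2 * εTest := by
    intro θ hθ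
    obtain ⟨G, hG1, hG2, hG3⟩ := exists_tests_of_covered hM hH hS θ θs hinv.unif_mem hδ0 hδ hcov
    have h1 := sum_tv_sq_le (n := nTest) hc (by rw [hβ]; exact hθ) hθs G fun π hπ => by
      obtain ⟨ψ, τ, Z, a1, a2, a3, a4, rfl⟩ := hG2 π hπ
      exact hinv.le_count ψ τ Z a1 a2 a3 a4
    set P := priceBound M (Fintype.card 𝒜) H
    have hP : 0 ≤ P := priceBound_nonneg M (Nat.cast_nonneg _) (Nat.cast_nonneg _)
    set x := ∑ π ∈ G, tv θ θs π.toHist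
    set y := ∑ π ∈ G, tv θ θs π.toHist ^ 2
    have hy : 0 ≤ y := sum_nonneg fun _ _ => sq_nonneg _
    have h2 : x ^ 2 ≤ G.card * y := sq_sum_le_card_mul_sum_sq
    have hn' : (0 : ℝ) < nTest := by exact_mod_cast hn
    -- The price times the sum of test values is at most `εTest` by Cauchy–Schwarz over at most
    -- `testBound` tests and the choice of `nTest`; the error term is at most `εTest` as well.
    have h3 : (P * x) ^ 2 ≤ εTest ^ 2 := by
      refine le_of_mul_le_mul_left ?_ hn'
      calc (nTest : ℝ) * (P * x) ^ 2 = P ^ 2 * (nTest * x ^ 2) := by ring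
        _ ≤ P ^ 2 * (nTest * (testBound M (Fintype.card 𝒮) H * y)) := by
            gcongr
            exact h2.trans (mul_le_mul_of_nonneg_right hG1 hy)
        _ = P ^ 2 * (testBound M (Fintype.card 𝒮) H * (nTest * y)) := by ring
        _ ≤ P ^ 2 * (testBound M (Fintype.card 𝒮) H * (20 * β)) := by
            have : 0 ≤ testBound M (Fintype.card 𝒮) H := (Nat.cast_nonneg _).trans hG1
            gcongr
        _ = 20 * β * P ^ 2 * testBound M (Fintype.card 𝒮) H := by ring
        _ ≤ _ := hnt
    have h4 : P * x ≤ εTest := le_of_sq_le_sq h3 hε.le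
    linarith
  have h1 := tv_triangle θ₁ θ₂ θs (pick (f k)).toHist
  have h2 := key θ₁ hθ₁
  have h3 := key θ₂ hθ₂
  dsimp only at hlt
  linarith

theorem GoodAt.success (hM : 1 ≤ M) (hH : 0 < H) (hℛ : ∀ r ∈ ℛ, |r| ≤ 1) {p : Params} {β N ε : ℝ}
    {σ : State H 𝒮 𝒜 ℛ} (hσ : GoodAt p Θ pick θs β K σ) (hL : ¬ σ.LoopCond p Θ) (hC : θs ∈ σ.C p Θ)
    (hε : 2 * (H * (((H + 2) * (Fintype.card 𝒮 + 1) * (Fintype.card 𝒜 + 2) * (2 * M + 1)) ^ (2 * M - 1) *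
      (4 * p.εTest))) ≤ ε)
    (hN : ((p.nTest * (1 + K * (p.d * (K + 1) ^ (p.d - 1) * (H ^ p.d * 2 ^ p.d))) : ℕ) : ℝ) ≤ N) :
    σ.Success p Θ θs N ε := by
  classical
  refine ⟨hL, le_trans (by exact_mod_cast hσ.invariant.length_le) hN, ?_, ?_⟩
  · obtain ⟨π, hπ⟩ := exists_isOptimal (H := H) hℛ θs
    exact ⟨π, θs, hC, hπ⟩
  · rintro π ⟨θ, hθ, hπ⟩
    have h1 : ∀ ψ : MlsPolicy H 𝒮 𝒜, tv θ θs ψ.toHist ≤ 4 * p.εTest := by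
      intro ψ
      by_contra hlt
      exact hL ⟨ψ, θ, hθ, θs, hC, not_le.1 hlt⟩
    have h2 := isEpsOptimal_of_tv_le hℛ (tv_hist_le θ θs hM hH h1) hπ
    exact fun π' => le_trans (by linarith [h2 π']) (h2 π')

/-- The concentration event is needed at all `K + 1` times but fails with the squared probability
scale `exp (-2 * β)`; membership of `θs` in the confidence set is needed at the final time only and
may fail at the scale `exp (-β)`. With `3 ≤ K` the two cost at most `2 / 3` and `1 / 3` of `η`. -/
theorem prob_success_ge {p : Params} (hK : 3 ≤ p.K) (hη0 : 0 < p.η) (hη : p.η < 1) (hθs : θs ∈ Θ) {N ε : ℝ}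
    (h : ∀ σ, GoodAt p Θ pick θs (p.β Θ) p.K σ → θs ∈ σ.C p Θ → σ.Success p Θ θs N ε) :
    ENNReal.ofReal (1 - p.η) ≤ (run p Θ pick θs p.K).toOuterMeasure {σ | σ.Success p Θ θs N ε} := by
  set μ := (run p Θ pick θs p.K).toOuterMeasure
  set β := p.β Θ with hβ
  have hK0 : (3 : ℝ) ≤ p.K := by exact_mod_cast hK
  have hn0 : (1 : ℝ) ≤ Θ.card := by exact_mod_cast card_pos.2 ⟨θs, hθs⟩
  have hexp : Real.exp (-β) = p.η / (p.K * Θ.card) := by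
    rw [hβ, Params.β, Real.exp_neg, Real.exp_log (by positivity), inv_div]
  have hexp2 : Real.exp (-(2 * β)) = (p.η / (p.K * Θ.card)) ^ 2 := by
    rw [← hexp, ← Real.exp_nat_mul]; congr 1; push_cast; ring
  have h1 : (1 : ℝ≥0∞) ≤ μ {σ | σ.Success p Θ θs N ε} + μ {σ | σ.Success p Θ θs N ε}ᶜ := by
    rw [← (PMF.toOuterMeasure_apply_eq_one_iff (run p Θ pick θs p.K) (s := Set.univ)).2 (Set.subset_univ _),
      ← Set.union_compl_self {σ | σ.Success p Θ θs N ε}]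
    exact MeasureTheory.measure_union_le _ _
  have h2 : μ {σ | σ.Success p Θ θs N ε}ᶜ ≤ ENNReal.ofReal p.η := by
    have hsub : {σ | σ.Success p Θ θs N ε}ᶜ ⊆ {σ | ¬ GoodAt p Θ pick θs β p.K σ} ∪
        {σ | θs ∉ confidenceSet Θ β σ.D} := by
      intro σ hσ
      by_contra hcon
      simp only [Set.mem_union, Set.mem_ofPred_eq, not_or, not_not] at hcon
      exact hσ (h σ hcon.1 hcon.2)
    refine (MeasureTheory.measure_mono hsub).trans ((MeasureTheory.measure_union_le _ _).trans
      ((add_le_add (toOuterMeasure_not_goodAt_le β p.K)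
        (toOuterMeasure_not_mem_confidenceSet_le hθs p.K β)).trans ?_))
    rw [hexp, hexp2, ← ENNReal.ofReal_natCast, ← ENNReal.ofReal_natCast (Θ.card),
      ← ENNReal.ofReal_mul (by positivity), ← ENNReal.ofReal_mul (by positivity),
      ← ENNReal.ofReal_mul (by positivity), ← ENNReal.ofReal_add (by positivity) (by positivity)]
    refine ENNReal.ofReal_le_ofReal ?_
    push_cast
    set k : ℝ := (p.K : ℝ)
    set n : ℝ := (Θ.card : ℝ)
    have e1 : (k + 1) * (n * (p.η / (k * n)) ^ 2) + n * (p.η / (k * n)) =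
        p.η * (p.η * (k + 1) / (k ^ 2 * n) + 1 / k) := by field_simp
    rw [e1]
    have e2 : p.η * (k + 1) / (k ^ 2 * n) ≤ 2 / 3 := by
      rw [div_le_iff₀ (by positivity)]
      have : p.η * (k + 1) ≤ 1 * (k + 1) := by gcongr
      nlinarith
    have e3 : 1 / k ≤ 1 / 3 := one_div_le_one_div_of_le (by norm_num) hK0
    nlinarith
  rw [ENNReal.ofReal_sub _ hη0.le, ENNReal.ofReal_one, tsub_le_iff_right]
  exact h1.trans (by gcongr)

end Success
end
end LMDP

/-! ### Numerical estimates -/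

namespace LMDP
noncomputable section
open Finset

section Numerics

/-- The loss in passing from memoryless to history-dependent policies. -/
def histLoss (M : ℕ) (s a h : ℝ) : ℝ := ((h + 2) * (s + 1) * (a + 2) * (2 * M + 1)) ^ (2 * M - 1)

theorem one_le_histLoss (M : ℕ) {s a h : ℝ} (hs : 1 ≤ s) (ha : 1 ≤ a) (hh : 1 ≤ h) : 1 ≤ histLoss M s a h := by
  have hm : (0 : ℝ) ≤ M := Nat.cast_nonneg _
  refine one_le_pow₀ (one_le_mul_of_one_le_of_one_le (one_le_mul_of_one_le_of_one_le
    (one_le_mul_of_one_le_of_one_le ?_ ?_) ?_) ?_) <;> linarith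

theorem histLoss_le {M : ℕ} (hM : 1 ≤ M) {s a h : ℝ} (hs : 1 ≤ s) (ha : 1 ≤ a) (hh : 3 ≤ h) :
    histLoss M s a h ≤ (36 * M) ^ (2 * M - 1) * (s * a * h) ^ (2 * M - 1) := by
  have hm : (1 : ℝ) ≤ M := by exact_mod_cast hM
  unfold histLoss
  rw [← mul_pow]
  refine pow_le_pow_left₀ (by positivity) ?_ _
  calc _ ≤ (2 * h) * (2 * s) * (3 * a) * (3 * M) := by
        gcongr <;> linarith
    _ = _ := by ring

theorem one_le_errBound {M : ℕ} (hM : 1 ≤ M) {s a h : ℝ} (hs : 1 ≤ s) (ha : 1 ≤ a) (hh : 1 ≤ h) :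
    1 ≤ errBound M s a h := by
  have hm : (1 : ℝ) ≤ M := by exact_mod_cast hM
  have hp : ∀ {x : ℝ} (k : ℕ), 1 ≤ x → 1 ≤ x ^ k := fun k hx => one_le_pow₀ hx
  have hmul : ∀ {x y : ℝ}, 1 ≤ x → 1 ≤ y → 1 ≤ x * y := fun hx hy => one_le_mul_of_one_le_of_one_le hx hy
  have h1 : (1 : ℝ) ≤ M + 1 := by linarith
  have h2 : (1 : ℝ) ≤ M + 2 := by linarith
  have h3 : (1 : ℝ) ≤ 4 * M ^ 2 + 2 := by have := sq_nonneg (M : ℝ); linarith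
  unfold errBound
  refine hmul (hmul (hmul (hmul (hmul (hmul (hmul (by norm_num) (hp 3 hm)) h1) h2) (hmul ha hh))
    (hmul (hmul (by norm_num) hs) hm)) (hmul (hmul hm (hp _ (hmul (hmul (hmul (hmul (hmul (by norm_num)
      (hp 5 hm)) h1) h2) (hmul ha (hp 2 hh))) (hmul (hmul (by norm_num) (hp 2 hs)) (hp 2 hm)))))
        (hmul (hmul h3 (hmul (hmul (hmul (by norm_num) (hp 4 hm)) hh) hs)) (hmul (by norm_num) hs)))) (by norm_num)

theorem exists_errBound_le (M : ℕ) : ∃ c : ℝ, 1 ≤ c ∧ ∀ s a h : ℝ, 1 ≤ s → 1 ≤ a → 1 ≤ h →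
    errBound M s a h ≤ c * (s * a * h) ^ (2 * (M - 1) + 3) := by
  set c : ℝ := 192 * M ^ 3 * (M + 1) * (M + 2) * (2 * M) * (M * (1536 * M ^ 5 * (M + 1) * (M + 2) *
    (4 * M ^ 2)) ^ (M - 1) * ((4 * M ^ 2 + 2) * (128 * M ^ 4) * 2)) * 2 with hc
  have hc0 : 0 ≤ c := by positivity
  refine ⟨c + 1, by linarith, fun s a h hs ha hh => ?_⟩
  have e : errBound M s a h = c * ((s * a * h) * (a * h ^ 2 * s ^ 2) ^ (M - 1) * (h * s ^ 2)) := by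
    unfold errBound
    rw [show 1536 * (M : ℝ) ^ 5 * (M + 1) * (M + 2) * (a * h ^ 2) * (4 * s ^ 2 * M ^ 2) =
      (1536 * M ^ 5 * (M + 1) * (M + 2) * (4 * M ^ 2)) * (a * h ^ 2 * s ^ 2) by ring, mul_pow, hc]
    ring
  have h1 : a * h ^ 2 * s ^ 2 ≤ (s * a * h) ^ 2 := by
    calc a * h ^ 2 * s ^ 2 ≤ a ^ 2 * h ^ 2 * s ^ 2 := by gcongr; exact le_self_pow₀ ha two_ne_zero
      _ = _ := by ring
  have h2 : h * s ^ 2 ≤ (s * a * h) ^ 2 := by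
    calc h * s ^ 2 = 1 * h * s ^ 2 := by ring
      _ ≤ a ^ 2 * h ^ 2 * s ^ 2 := by
        gcongr
        · exact one_le_pow₀ ha
        · exact le_self_pow₀ hh two_ne_zero
      _ = _ := by ring
  rw [e]
  calc _ ≤ c * ((s * a * h) * ((s * a * h) ^ 2) ^ (M - 1) * (s * a * h) ^ 2) := by gcongr
    _ = c * (s * a * h) ^ (2 * (M - 1) + 3) := by rw [← pow_mul, pow_add]; ring
    _ ≤ _ := by gcongr; linarith

/-- The resolution of the coverage. -/
def resolution (M : ℕ) (s a h ε : ℝ) : ℝ := ε / (8 * h * histLoss M s a h) / errBound M s a h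

/-- The inverse resolution is polynomial in `s * a * h / ε` for fixed `M`. As this quotient is at
least `3`, its logarithm is at least one and absorbs all constants. -/
theorem exists_log_resolution_le {M : ℕ} (hM : 1 ≤ M) : ∃ c : ℝ, 1 ≤ c ∧ ∀ s a h ε : ℝ, 1 ≤ s → 1 ≤ a → 3 ≤ h →
    0 < ε → ε ≤ 1 → 1 ≤ Real.log (M * s * a * h / ε) ∧
      Real.log M.factorial - M * Real.log (resolution M s a h ε) ≤ c * Real.log (M * s * a * h / ε) := by
  obtain ⟨cE, hcE, hE⟩ := exists_errBound_le M
  have hm : (1 : ℝ) ≤ M := by exact_mod_cast hM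
  set c₁ : ℝ := cE * (8 * (36 * M) ^ (2 * M - 1)) with hc₁
  have hc₁1 : 1 ≤ c₁ := one_le_mul_of_one_le_of_one_le hcE
    (one_le_mul_of_one_le_of_one_le (by norm_num) (one_le_pow₀ (by linarith)))
  set q : ℕ := 2 * (M - 1) + 3 + (2 * M - 1) + 1 with hq
  have hf : 0 ≤ Real.log M.factorial :=
    Real.log_nonneg (by exact_mod_cast Nat.succ_le_of_lt (Nat.factorial_pos _))
  have hlc : 0 ≤ Real.log c₁ := Real.log_nonneg hc₁1
  refine ⟨Real.log M.factorial + M * (Real.log c₁ + q) + 1, ?_, fun s a h ε hs ha hh hε0 hε => ?_⟩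
  · have : 0 ≤ M * (Real.log c₁ + q) := by positivity
    linarith
  set x := s * a * h with hx
  have hx3 : 3 ≤ x := by
    have : 1 ≤ s * a := one_le_mul_of_one_le_of_one_le hs ha
    rw [hx]; nlinarith
  have hxε : 3 ≤ x / ε := by rw [le_div_iff₀ hε0]; nlinarith
  have hlog : 1 ≤ Real.log (x / ε) := by
    rw [Real.le_log_iff_exp_le (by linarith)]
    have := Real.exp_one_lt_d9
    linarith
  have hL : Real.log (x / ε) ≤ Real.log (M * s * a * h / ε) := by
    refine Real.log_le_log (by linarith) ?_
    rw [show (M : ℝ) * s * a * h = M * x by rw [hx]; ring]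
    gcongr
    exact le_mul_of_one_le_left (by linarith) hm
  have hE1 := one_le_errBound hM hs ha (by linarith : 1 ≤ h)
  have hY1 := one_le_histLoss M hs ha (by linarith : 1 ≤ h)
  have hres : Real.log (resolution M s a h ε) = - Real.log (errBound M s a h * (8 * h * histLoss M s a h) / ε) := by
    rw [← Real.log_inv]
    congr 1
    unfold resolution
    rw [inv_div]
    field_simp
  have hle : errBound M s a h * (8 * h * histLoss M s a h) / ε ≤ c₁ * (x / ε) ^ q := by
    have h1 : h ≤ x := by
      have : 1 ≤ s * a := one_le_mul_of_one_le_of_one_le hs ha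
      rw [hx]; nlinarith
    calc _ ≤ (cE * x ^ (2 * (M - 1) + 3)) * (8 * x * ((36 * M) ^ (2 * M - 1) * x ^ (2 * M - 1))) / ε := by
          gcongr
          · exact hE s a h hs ha (by linarith)
          · exact histLoss_le hM hs ha hh
      _ = c₁ * (x ^ q / ε) := by rw [hq, pow_add, pow_add, hc₁]; ring
      _ ≤ c₁ * (x ^ q / ε ^ q) := by
          gcongr
          exact pow_le_of_le_one hε0.le hε (by omega)
      _ = _ := by rw [div_pow]
  have hlog2 : Real.log (errBound M s a h * (8 * h * histLoss M s a h) / ε) ≤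
      (Real.log c₁ + q) * Real.log (M * s * a * h / ε) := by
    have h1 := Real.log_le_log (by positivity) hle
    rw [Real.log_mul (by positivity) (by positivity), Real.log_pow] at h1
    have h2 : Real.log c₁ ≤ Real.log c₁ * Real.log (M * s * a * h / ε) :=
      le_mul_of_one_le_right hlc (hlog.trans hL)
    have h3 : (q : ℝ) * Real.log (x / ε) ≤ q * Real.log (M * s * a * h / ε) := by gcongr
    linarith
  refine ⟨hlog.trans hL, ?_⟩
  rw [hres]
  have h1 := mul_le_mul_of_nonneg_left hlog2 (by linarith : (0 : ℝ) ≤ M)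
  have h2 := le_mul_of_one_le_right hf (hlog.trans hL)
  nlinarith [hlog.trans hL]

theorem priceBound_eq (M : ℕ) (a h : ℝ) : priceBound M a h =
    192 * M ^ 3 * (M + 1) * (M + 2) * (1536 * M ^ 5 * (M + 1) * (M + 2)) ^ (M - 1) *
      (a * h * (a * h ^ 2) ^ (M - 1)) := by
  unfold priceBound; rw [mul_pow (1536 * (M : ℝ) ^ 5 * (M + 1) * (M + 2))]; ring

theorem testBound_eq (M : ℕ) (s h : ℝ) : testBound M s h =
    8 * M * (16 * M ^ 2 * (M + 3)) ^ (M - 1) * (h * s * (s ^ 3 * h) ^ (M - 1)) := by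
  unfold testBound; rw [mul_pow (16 * (M : ℝ) ^ 2 * (M + 3))]; ring

theorem one_le_priceBound {M : ℕ} (hM : 1 ≤ M) {a h : ℝ} (ha : 1 ≤ a) (hh : 1 ≤ h) : 1 ≤ priceBound M a h := by
  have hm : (1 : ℝ) ≤ M := by exact_mod_cast hM
  have hp : ∀ {x : ℝ} (k : ℕ), 1 ≤ x → 1 ≤ x ^ k := fun k hx => one_le_pow₀ hx
  have hmul : ∀ {x y : ℝ}, 1 ≤ x → 1 ≤ y → 1 ≤ x * y := fun hx hy => one_le_mul_of_one_le_of_one_le hx hy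
  have h1 : (1 : ℝ) ≤ M + 1 := by linarith
  have h2 : (1 : ℝ) ≤ M + 2 := by linarith
  unfold priceBound
  exact hmul (hmul (hmul (hmul (hmul (by norm_num) (hp 3 hm)) h1) h2) (hmul ha hh))
    (hp _ (hmul (hmul (hmul (hmul (by norm_num) (hp 5 hm)) h1) h2) (hmul ha (hp 2 hh))))

theorem one_le_testBound {M : ℕ} (hM : 1 ≤ M) {s h : ℝ} (hs : 1 ≤ s) (hh : 1 ≤ h) : 1 ≤ testBound M s h := by
  have hm : (1 : ℝ) ≤ M := by exact_mod_cast hM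
  have hp : ∀ {x : ℝ} (k : ℕ), 1 ≤ x → 1 ≤ x ^ k := fun k hx => one_le_pow₀ hx
  have hmul : ∀ {x y : ℝ}, 1 ≤ x → 1 ≤ y → 1 ≤ x * y := fun hx hy => one_le_mul_of_one_le_of_one_le hx hy
  have h2 : (1 : ℝ) ≤ M + 3 := by linarith
  unfold testBound
  exact hmul (hmul (hmul (by norm_num) hm) (hmul hh hs))
    (hp _ (hmul (hmul (hmul (by norm_num) (hp 2 hm)) h2) (hmul (hp 3 hs) hh)))

/-- Comparison of exponents with `j = M - 1`. The factors on the left come from the squared price,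
the number of tests, the squared loss of history dependence, and the number of designs. -/
theorem monomial_le (j : ℕ) {s a h : ℝ} (hs : 1 ≤ s) (ha : 1 ≤ a) (hh : 1 ≤ h) :
    (a * h * (a * h ^ 2) ^ j) ^ 2 * (h * s * (s ^ 3 * h) ^ j) * ((s * a * h) ^ (2 * j + 1)) ^ 2 *
      (s ^ 2 * h ^ 2) ^ (2 * j + 1) ≤ (s ^ 6 * a ^ 4 * h ^ 7) ^ (2 * j + 1) := by
  have e1 : (a * h * (a * h ^ 2) ^ j) ^ 2 * (h * s * (s ^ 3 * h) ^ j) * ((s * a * h) ^ (2 * j + 1)) ^ 2 *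
      (s ^ 2 * h ^ 2) ^ (2 * j + 1) = s ^ (11 * j + 5) * a ^ (6 * j + 4) * h ^ (13 * j + 7) := by ring
  have e2 : (s ^ 6 * a ^ 4 * h ^ 7) ^ (2 * j + 1) = s ^ (12 * j + 6) * a ^ (8 * j + 4) * h ^ (14 * j + 7) := by
    ring
  rw [e1, e2]
  gcongr <;> first | assumption | omega

theorem exists_episodes_le {M : ℕ} (hM : 1 ≤ M) (c : ℝ) (hc : 0 ≤ c) : ∃ C : ℝ, 0 < C ∧
    ∀ s a h ε L β k : ℝ, 1 ≤ s → 1 ≤ a → 3 ≤ h → 0 < ε → 0 ≤ L → 0 ≤ β → 0 ≤ k → k ≤ c * (s ^ 2 * h * L) →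
      2 * (20 * β * priceBound M a h ^ 2 * testBound M s h / (ε / (8 * h * histLoss M s a h)) ^ 2) *
        (2 * (2 * M - 1 : ℕ) * (4 * k * h) ^ (2 * M - 1)) ≤
      C * ((M : ℝ) ^ 4 * s ^ 6 * a ^ 4 * h ^ 7 * L) ^ (2 * M - 1) * (M ^ 4 * h ^ 2) * β / ε ^ 2 := by
  have hm : (1 : ℝ) ≤ M := by exact_mod_cast hM
  set cP : ℝ := 192 * M ^ 3 * (M + 1) * (M + 2) * (1536 * M ^ 5 * (M + 1) * (M + 2)) ^ (M - 1) with hcP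
  set cT : ℝ := 8 * M * (16 * M ^ 2 * (M + 3)) ^ (M - 1) with hcT
  set D : ℝ := 2 * (2 * M - 1 : ℕ) with hD
  have hD0 : 0 ≤ D := by positivity
  set C : ℝ := 40 * cP ^ 2 * cT * (8 * (36 * M) ^ (2 * M - 1)) ^ 2 * D * (4 * c) ^ (2 * M - 1) with hC
  have hC0 : 0 ≤ C := by positivity
  refine ⟨C + 1, by linarith, fun s a h ε L β k hs ha hh hε hL hβ hk hkle => ?_⟩
  obtain ⟨j, rfl⟩ : ∃ j, M = j + 1 := ⟨M - 1, by omega⟩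
  have hd : 2 * (j + 1) - 1 = 2 * j + 1 := by omega
  have hj : j + 1 - 1 = j := by omega
  have hY := histLoss_le hM hs ha hh
  have hY1 := one_le_histLoss (j + 1) hs ha (by linarith : 1 ≤ h)
  set m : ℝ := ((j + 1 : ℕ) : ℝ)
  calc _ = 40 * β * priceBound (j + 1) a h ^ 2 * testBound (j + 1) s h *
        (8 * h * histLoss (j + 1) s a h) ^ 2 * (D * (4 * k * h) ^ (2 * (j + 1) - 1)) / ε ^ 2 := by
        rw [div_pow]; field_simp; ring
    _ ≤ 40 * β * priceBound (j + 1) a h ^ 2 * testBound (j + 1) s h *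
        (8 * h * ((36 * m) ^ (2 * (j + 1) - 1) * (s * a * h) ^ (2 * (j + 1) - 1))) ^ 2 *
          (D * (4 * (c * (s ^ 2 * h * L)) * h) ^ (2 * (j + 1) - 1)) / ε ^ 2 := by
        have := one_le_testBound hM hs (by linarith : 1 ≤ h)
        gcongr
    _ = C * ((a * h * (a * h ^ 2) ^ j) ^ 2 * (h * s * (s ^ 3 * h) ^ j) * ((s * a * h) ^ (2 * j + 1)) ^ 2 *
          (s ^ 2 * h ^ 2) ^ (2 * j + 1)) * L ^ (2 * j + 1) * h ^ 2 * β / ε ^ 2 := by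
        rw [priceBound_eq, testBound_eq, ← hcP, ← hcT, hC, hj, hd,
          show 4 * (c * (s ^ 2 * h * L)) * h = (4 * c) * (s ^ 2 * h ^ 2) * L by ring,
          mul_pow _ L, mul_pow (4 * c)]
        ring
    _ ≤ C * (s ^ 6 * a ^ 4 * h ^ 7) ^ (2 * j + 1) * L ^ (2 * j + 1) * h ^ 2 * β / ε ^ 2 := by
        have := monomial_le j hs ha (by linarith : 1 ≤ h)
        gcongr
    _ = C * (1 * s ^ 6 * a ^ 4 * h ^ 7 * L) ^ (2 * j + 1) * (1 * h ^ 2) * β / ε ^ 2 := by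
        rw [mul_pow _ L]; ring
    _ ≤ _ := by
        rw [hd]
        have hm4 : 1 ≤ m ^ 4 := one_le_pow₀ hm
        gcongr
        linarith

end Numerics
end
end LMDP

/-! ### Choice of the inputs -/

namespace LMDP

theorem one_add_episodes_le {K H d : ℕ} (hK : 1 ≤ K) (hH : 1 ≤ H) (hd : 1 ≤ d) :
    1 + K * (d * (K + 1) ^ (d - 1) * (H ^ d * 2 ^ d)) ≤ 2 * d * (4 * K * H) ^ d := by
  have h1 : K * (K + 1) ^ (d - 1) ≤ (2 * K) ^ d := by
    obtain ⟨e, rfl⟩ : ∃ e, d = e + 1 := ⟨d - 1, by omega⟩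
    rw [Nat.add_sub_cancel, pow_succ, mul_comm]
    exact Nat.mul_le_mul (Nat.pow_le_pow_left (by omega) e) (by omega)
  have h2 : 1 ≤ d * (4 * K * H) ^ d := Nat.mul_pos hd (by positivity)
  calc _ = 1 + d * (K * (K + 1) ^ (d - 1)) * (H ^ d * 2 ^ d) := by ring
    _ ≤ d * (4 * K * H) ^ d + d * (2 * K) ^ d * (H ^ d * 2 ^ d) := by gcongr
    _ = d * (4 * K * H) ^ d + d * (4 * K * H) ^ d := by
        rw [mul_assoc d ((2 * K) ^ d), ← mul_pow, ← mul_pow]; ring_nf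
    _ = _ := by ring

end LMDP


theorem theorem2 (M : ℕ) (hM : 1 ≤ M) :
    ∃ C : ℝ, 0 < C ∧
      ∀ (S A H n : ℕ) (ε η : ℝ), 1 ≤ S → 1 ≤ A → 2 * M < H → 1 ≤ n →
        0 < ε → ε ≤ 1 → 0 < η → η < 1 →
      ∃ (K nTest : ℕ) (εTest : ℝ), 1 ≤ K ∧ 0 < εTest ∧
        (K : ℝ) ≤ C * (M * S ^ 2 * H) * Real.log (M * S * A * H / ε) ∧
        ∀ (𝒮 𝒜 : Type*) [Fintype 𝒮] [Fintype 𝒜] [Nonempty 𝒜] (ℛ : Finset ℝ)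
          (Θ : Finset (LMDP.Model M 𝒮 𝒜 ℛ)) (θs : LMDP.Model M 𝒮 𝒜 ℛ)
          (pick : LMDP.State H 𝒮 𝒜 ℛ → LMDP.MlsPolicy H 𝒮 𝒜),
          Fintype.card 𝒮 = S → Fintype.card 𝒜 = A → (∀ r ∈ ℛ, |r| ≤ 1) →
          Θ.card = n → θs ∈ Θ →
          LMDP.IsSelector ⟨K, 2 * M - 1, nTest, εTest, η⟩ Θ pick →
          ENNReal.ofReal (1 - η) ≤
            (LMDP.run ⟨K, 2 * M - 1, nTest, εTest, η⟩ Θ pick θs K).toOuterMeasure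
              {σ | σ.Success ⟨K, 2 * M - 1, nTest, εTest, η⟩ Θ θs
                (C * ((M : ℝ) ^ 4 * S ^ 6 * A ^ 4 * H ^ 7 * Real.log (M * S * A * H / ε))
                    ^ (2 * M - 1) * (M ^ 4 * H ^ 2) * Real.log (K * n / η) / ε ^ 2) ε} := by
  obtain ⟨cQ, hcQ, hQ⟩ := LMDP.exists_log_resolution_le hM
  obtain ⟨cN, hcN, hN⟩ := LMDP.exists_episodes_le hM (48 * cQ + 3) (by linarith)
  refine ⟨48 * cQ + 3 + cN, by linarith, fun S A H n ε η hS hA hH hn hε0 hε hη0 hη => ?_⟩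
  have hm : (1 : ℝ) ≤ M := by exact_mod_cast hM
  have hs : (1 : ℝ) ≤ S := by exact_mod_cast hS
  have ha : (1 : ℝ) ≤ A := by exact_mod_cast hA
  have hh : (3 : ℝ) ≤ H := by exact_mod_cast (by omega : 3 ≤ H)
  have hh1 : (1 : ℝ) ≤ H := by linarith
  have hn1 : (1 : ℝ) ≤ n := by exact_mod_cast hn
  obtain ⟨hL1, hQle⟩ := hQ S A H ε hs ha hh hε0 hε
  set L := Real.log (M * S * A * H / ε)
  have hY1 := LMDP.one_le_histLoss M hs ha hh1
  have hE1 := LMDP.one_le_errBound hM hs ha hh1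
  have hP1 := LMDP.one_le_priceBound hM ha hh1
  have hT1 := LMDP.one_le_testBound hM hs hh1
  -- Chosen so that `2 * H * histLoss * (4 * εTest) = ε`: disagreement `4 * εTest` over memoryless
  -- policies, the loss for history dependence, rewards up to `H`, and two comparisons of values.
  set εTest : ℝ := ε / (8 * H * LMDP.histLoss M S A H) with hεT
  have hεT0 : 0 < εTest := by positivity
  have hεT1 : εTest ≤ 1 := by
    rw [hεT, div_le_one (by positivity)]
    exact hε.trans (one_le_mul_of_one_le_of_one_le (by linarith) hY1)
  have hδ : LMDP.resolution M S A H ε = εTest / LMDP.errBound M S A H := rfl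
  set δ := LMDP.resolution M S A H ε
  have hδ0 : 0 < δ := by rw [hδ]; positivity
  have hδ1 : δ ≤ 1 := by rw [hδ, div_le_one (by positivity)]; linarith
  set Q := Real.log M.factorial - M * Real.log δ
  -- Strictly more than the possible number of uncovered iterations, and at least `3` as the
  -- probability estimate requires.
  set K : ℕ := ⌊6 * ((H + 1 : ℕ) : ℝ) * ((S + 1 : ℕ) : ℝ) ^ 2 * Q⌋₊ + 3 with hK
  have hK3 : 3 ≤ K := by omega
  have hK3' : (3 : ℝ) ≤ K := by exact_mod_cast hK3
  have hKlt : 6 * ((H + 1 : ℕ) : ℝ) * ((S + 1 : ℕ) : ℝ) ^ 2 * Q < K := by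
    refine (Nat.lt_floor_add_one _).trans_le ?_
    rw [hK]; push_cast; linarith
  have hKle : (K : ℝ) ≤ (48 * cQ + 3) * (S ^ 2 * H * L) := by
    have h1 : 6 * ((H + 1 : ℕ) : ℝ) * ((S + 1 : ℕ) : ℝ) ^ 2 * Q ≤
        6 * (2 * H) * (2 * S) ^ 2 * (cQ * L) := by
      have : (H : ℝ) + 1 ≤ 2 * H := by linarith
      have : (S : ℝ) + 1 ≤ 2 * S := by linarith
      refine (mul_le_mul_of_nonneg_left hQle (by positivity)).trans ?_
      push_cast
      gcongr
    have h2 : (0 : ℝ) ≤ 6 * (2 * H) * (2 * S) ^ 2 * (cQ * L) := by positivity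
    have h3 : (K : ℝ) ≤ 6 * (2 * H) * (2 * S) ^ 2 * (cQ * L) + 3 := by
      have := (Nat.cast_le (α := ℝ)).2 (Nat.floor_le_floor h1)
      rw [hK, Nat.cast_add]
      exact add_le_add (this.trans (Nat.floor_le h2)) (by norm_num)
    have h4 : (1 : ℝ) ≤ S ^ 2 * H * L := one_le_mul_of_one_le_of_one_le
      (one_le_mul_of_one_le_of_one_le (one_le_pow₀ hs) hh1) hL1
    calc (K : ℝ) ≤ _ := h3
      _ = 48 * cQ * (S ^ 2 * H * L) + 3 := by ring
      _ ≤ _ := by linarith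
  set β := Real.log (K * n / η) with hβ
  have hβ1 : 1 ≤ β := by
    rw [hβ, Real.le_log_iff_exp_le (by positivity)]
    have h1 := Real.exp_one_lt_d9
    have h2 : (3 : ℝ) ≤ K * n / η := by
      rw [le_div_iff₀ hη0]; nlinarith
    linarith
  -- The number of repetitions that makes the estimated test values, multiplied by the price, at
  -- most `εTest`. Since `1 ≤ z`, rounding up costs at most a factor `2`.
  set z := 20 * β * LMDP.priceBound M A H ^ 2 * LMDP.testBound M S H / εTest ^ 2 with hz
  have hz1 : 1 ≤ z := by
    rw [hz, le_div_iff₀ (by positivity), one_mul]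
    have h1 : εTest ^ 2 ≤ 1 := pow_le_one₀ hεT0.le hεT1
    refine h1.trans (one_le_mul_of_one_le_of_one_le (one_le_mul_of_one_le_of_one_le (by linarith)
      (one_le_pow₀ hP1)) hT1)
  have hzle : (⌈z⌉₊ : ℝ) ≤ 2 * z := by
    have := (Nat.ceil_lt_add_one (by linarith : 0 ≤ z)).le
    linarith
  refine ⟨K, ⌈z⌉₊, εTest, by omega, hεT0, ?_, ?_⟩
  · calc (K : ℝ) ≤ (48 * cQ + 3) * (1 * S ^ 2 * H) * L := hKle.trans (le_of_eq (by ring))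
      _ ≤ _ := mul_le_mul_of_nonneg_right (mul_le_mul (by linarith) (by gcongr) (by positivity)
          (by linarith)) (by linarith)
  intro 𝒮 𝒜 _ _ _ ℛ Θ θs pick hcS hcA hℛ hcΘ hθs hsel
  refine LMDP.prob_success_ge (p := ⟨K, 2 * M - 1, ⌈z⌉₊, εTest, η⟩) hK3 hη0 hη hθs fun σ hσ hC => ?_
  have hβp : (LMDP.Params.mk K (2 * M - 1) ⌈z⌉₊ εTest η).β Θ = β := by
    simp only [LMDP.Params.β, hcΘ, hβ]
  have hloop := LMDP.GoodAt.not_loopCond hM (by omega) (by omega) hθs hsel (Nat.ceil_pos.2 (by linarith))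
    hεT0 hδ0 hδ1 (by rw [hcS]; exact hKlt)
    (by
      rw [hcS, hcA, hδ, mul_div_cancel₀ _ (by positivity)])
    rfl (by
      rw [hcS, hcA, hβp]
      have := Nat.le_ceil z
      rw [hz, div_le_iff₀ (by positivity)] at this
      rw [hz]
      exact this) hσ
  refine hσ.success hM (by omega) hℛ hloop hC ?_ ?_
  · rw [hcS, hcA]
    refine le_of_eq ?_
    change 2 * ((H : ℝ) * (LMDP.histLoss M S A H * (4 * εTest))) = ε
    rw [hεT]
    field_simp
    norm_num
  · dsimp only
    have h1 := LMDP.one_add_episodes_le (K := K) (H := H) (d := 2 * M - 1) (by omega) (by omega) (by omega)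
    have h2 : ((1 + K * ((2 * M - 1) * (K + 1) ^ (2 * M - 1 - 1) * (H ^ (2 * M - 1) * 2 ^ (2 * M - 1))) : ℕ) : ℝ) ≤
        2 * (2 * M - 1 : ℕ) * (4 * K * H) ^ (2 * M - 1) := by exact_mod_cast h1
    rw [Nat.cast_mul]
    refine (mul_le_mul hzle h2 (Nat.cast_nonneg _) (by linarith)).trans
      ((hN S A H ε L β K hs ha hh hε0 (by linarith) (by linarith) (Nat.cast_nonneg _) hKle).trans ?_)
    gcongr
    linarith
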